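/- Let $J\subseteq[n]=\{1,\dots,n\}$, $J=\{j_1<\dots<j_k\}$, $[n]\setminus J=\{h_1<\dots<h_{n-k}\}$. Let $\pi(J)\in S_n$ be given by $\pi(J)(h_i)=i$, $\pi(J)(j_i)=n-k+i$, let $S_J$ be the set of $\pi\in S_n$ with $\pi(j)\ge j$ for $j\in J$ and $\pi(j)\le j$ for $j\notin J$, and let the bridge polytope $\mathsf{Br}_J\subset\mathbb R^n$ be the convex hull of the points $(\pi(1),\dots,\pi(n))$, $\pi\in S_J$. An edge of $\mathsf{Br}_J$ between $\pi$ and $\hat\pi=(i\,\ell)\pi$, $i<\ell$, is labeled by the transposition $(i\,\ell)$. To a path in the one-skeleton of $\mathsf{Br}_J$ from $\pi(J)$ to the identity $e$ with labels $\tau_1,\tau_2,\dots,\tau_m$ we associate a bicolored graph with boundary vertices $1,\dots,n$ as follows. Hang a vertical wire from each boundary vertex, the boundary vertices being placed from left to right on top; from top to bottom, for each $\tau_t=(i\,\ell)$ with $i<\ell$, add a horizontal edge (bridge) from a new white vertex on wire $i$ to a new black vertex on wire $\ell$; cut each wire below its last bridge, and let a wire $a$ without bridges end in a boundary leaf, which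 is white if $a\in J$ and black otherwise. Graphs are considered up to homotopy in the disk. Consider the following local moves for plabic graphs (planar bicolored graphs in a disk, without internal leaves other than those attached to the boundary, and without isolated components). (M1): switch the colors of the vertices of a square face formed by four trivalent vertices of alternating colors. (M2): contract an edge joining two distinct vertices of the same color, or the inverse. (M3): remove a vertex of degree two and glue its two edges together, or the inverse. Theorem. Let $p$ be a shortest path from $\pi(J)$ to $e$ in the one-skeleton of $\mathsf{Br}_J$, let $F$ be a two-dimensional face of $\mathsf{Br}_J$ such that $p$ traverses half of the sides of $F$, and let $p'$ be the path obtained from $p$ by going around the other sides of $F$. Then the graphs associated to $p$ and $p'$ are planar (drawn in the disk), and one of the following holds: 1. $F$ is a rectangle, and the two plabic graphs are homotopic; 2. $F$ is a trapezoid, and the two plabic graphs are related by homotopy and moves (M2) and (M3); 3. $F$ is a hexagon, and the two plabic graphs are related by homotopy, moves (M2) and (M3), and exactly one square move (M1). -/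

import Mathlib

namespace BridgePolytope

/-! ## Bridge polytopes and their one-skeleta

The ground set is `Fin n`; the letter `i` of `{1, …, n}` is `i - 1 : Fin n`. -/

/-- The permutations with weak excedances exactly allowed at the positions in `J`:
`π j ≥ j` for `j ∈ J` and `π j ≤ j` for `j ∉ J`. -/
def permSet {n : ℕ} (J : Finset (Fin n)) : Set (Equiv.Perm (Fin n)) :=
  {z | ∀ j, (j ∈ J → j ≤ z j) ∧ (j ∉ J → z j ≤ j)}

/-- The point `(z(1), …, z(n))` of `ℝⁿ`. -/
def permPoint {n : ℕ} (z : Equiv.Perm (Fin n)) : Fin n → ℝ :=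
  fun j => ((z j : ℕ) : ℝ) + 1

/-- The bridge polytope. -/
def bridgePolytope {n : ℕ} (J : Finset (Fin n)) : Set (Fin n → ℝ) :=
  convexHull ℝ (permPoint '' permSet J)

/-- The one-skeleton of the bridge polytope: two permutations of `permSet J` are adjacent when the
segment between the corresponding points is a (one-dimensional) face. -/
def skeleton {n : ℕ} (J : Finset (Fin n)) : SimpleGraph (Equiv.Perm (Fin n)) where
  Adj u v := u ≠ v ∧ u ∈ permSet J ∧ v ∈ permSet J ∧
    IsExposed ℝ (bridgePolytope J) (segment ℝ (permPoint u) (permPoint v))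
  symm := ⟨fun u v h => ⟨h.1.symm, h.2.2.1, h.2.1, by rw [segment_symm]; exact h.2.2.2⟩⟩
  loopless := ⟨fun _ h => h.1 rfl⟩

/-- `F` is a two-dimensional face of the bridge polytope (faces of a polytope are the sets where a
linear functional attains its maximum; the polytope itself is one of them). -/
def IsTwoFace {n : ℕ} (J : Finset (Fin n)) (F : Set (Fin n → ℝ)) : Prop :=
  IsExposed ℝ (bridgePolytope J) F ∧ Module.finrank ℝ (vectorSpan ℝ F) = 2

/-- The sides of a face `F`: the edges of the one-skeleton with both ends in `F`. -/
def sides {n : ℕ} (J : Finset (Fin n)) (F : Set (Fin n → ℝ)) : Set (Sym2 (Equiv.Perm (Fin n))) :=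
  {e | e ∈ (skeleton J).edgeSet ∧ ∀ z ∈ e, permPoint z ∈ F}

/-- The values of the permutation `π(J)`, counted from `0`: with `J = {j₁ < ⋯ < j_k}` and
complement `{h₁ < ⋯ < h_{n-k}}`, `π(h_i) = i` and `π(j_i) = n - k + i`. -/
def schubertVal {n : ℕ} (J : Finset (Fin n)) (a : Fin n) : ℕ :=
  if a ∈ J then (Jᶜ).card + (J.filter (· < a)).card else ((Jᶜ).filter (· < a)).card

theorem schubertVal_lt {n : ℕ} (J : Finset (Fin n)) (a : Fin n) : schubertVal J a < n := by
  have hc : J.card + (Jᶜ).card = n := by simp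
  unfold schubertVal
  split_ifs with h
  · have : (J.filter (· < a)).card < J.card :=
      Finset.card_lt_card (Finset.filter_ssubset.2 ⟨a, h, lt_irrefl _⟩)
    omega
  · have : ((Jᶜ).filter (· < a)).card < (Jᶜ).card :=
      Finset.card_lt_card (Finset.filter_ssubset.2 ⟨a, by simpa using h, lt_irrefl _⟩)
    omega

theorem schubertVal_injective {n : ℕ} (J : Finset (Fin n)) :
    Function.Injective (schubertVal J) := by
  have key : ∀ (S : Finset (Fin n)) (a b : Fin n), a ∈ S → a < b →
      (S.filter (· < a)).card < (S.filter (· < b)).card := by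
    intro S a b ha hab
    apply Finset.card_lt_card
    refine Finset.ssubset_iff_subset_ne.2 ⟨?_, ?_⟩
    · intro x hx
      simp only [Finset.mem_filter] at hx ⊢
      exact ⟨hx.1, hx.2.trans hab⟩
    · intro h
      have : a ∈ S.filter (· < b) := Finset.mem_filter.2 ⟨ha, hab⟩
      rw [← h] at this
      exact lt_irrefl _ (Finset.mem_filter.1 this).2
  have low : ∀ a : Fin n, a ∉ J → ((Jᶜ).filter (· < a)).card < (Jᶜ).card := fun a h =>
    Finset.card_lt_card (Finset.filter_ssubset.2 ⟨a, by simpa using h, lt_irrefl _⟩)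
  intro a b hab
  unfold schubertVal at hab
  by_cases ha : a ∈ J <;> by_cases hb : b ∈ J <;> simp only [ha, hb, if_true, if_false] at hab
  · rcases lt_trichotomy a b with h | h | h
    · have := key J a b ha h; omega
    · exact h
    · have := key J b a hb h; omega
  · have := low b hb; omega
  · have := low a ha; omega
  · rcases lt_trichotomy a b with h | h | h
    · have := key Jᶜ a b (by simpa using ha) h; omega
    · exact h
    · have := key Jᶜ b a (by simpa using hb) h; omega

/-- The permutation `π(J)`, with `π(h_i) = i` and `π(j_i) = n - k + i`, where
`J = {j₁ < ⋯ < j_k}` and `{h₁ < ⋯ < h_{n-k}}` is its complement. -/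
noncomputable def schubertPerm {n : ℕ} (J : Finset (Fin n)) : Equiv.Perm (Fin n) :=
  Equiv.ofBijective (fun a => (⟨schubertVal J a, schubertVal_lt J a⟩ : Fin n))
    (Finite.injective_iff_bijective.1 fun _ _ h =>
      schubertVal_injective J (congrArg Fin.val h))

/-- `p'` arises from `p` by rerouting along the face `F`: `p = q₁ r q₂` and `p' = q₁ r' q₂`, where
`r` traverses half of the sides of `F` and `r'` goes around the other sides. -/
def IsReroute {n : ℕ} (J : Finset (Fin n)) (F : Set (Fin n → ℝ))
    {x y : Equiv.Perm (Fin n)} (p p' : (skeleton J).Walk x y) : Prop :=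
  ∃ (u v : Equiv.Perm (Fin n)) (q₁ : (skeleton J).Walk x u) (r r' : (skeleton J).Walk u v)
    (q₂ : (skeleton J).Walk v y),
    p = q₁.append (r.append q₂) ∧ p' = q₁.append (r'.append q₂) ∧
    r.IsPath ∧ r'.IsPath ∧ List.Disjoint r.edges r'.edges ∧
    {e | e ∈ r.edges ∨ e ∈ r'.edges} = sides J F ∧
    2 * r.length = (sides J F).ncard

/-! ### Shapes of polygons -/

/-- `F` is a (nondegenerate) rectangle. -/
def IsRectangle {n : ℕ} (F : Set (Fin n → ℝ)) : Prop :=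
  ∃ a b c d : Fin n → ℝ, F = convexHull ℝ {a, b, c, d} ∧ a ≠ b ∧ a ≠ d ∧
    b - a = c - d ∧ (b - a) ⬝ᵥ (d - a) = 0

/-- `F` is a (nondegenerate) trapezoid, not a parallelogram: the sides `ab` and `dc` are parallel
and of different length. -/
def IsTrapezoid {n : ℕ} (F : Set (Fin n → ℝ)) : Prop :=
  ∃ (a b c d : Fin n → ℝ) (t : ℝ), F = convexHull ℝ {a, b, c, d} ∧
    LinearIndependent ℝ ![b - a, d - a] ∧ 0 < t ∧ t ≠ 1 ∧ c - d = t • (b - a)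

/-- The polygon `F` is a hexagon, i.e. it has six vertices. -/
def IsHexagon {n : ℕ} (F : Set (Fin n → ℝ)) : Prop :=
  (F.extremePoints ℝ).ncard = 6

/-! ## Plabic graphs as rotation systems -/

inductive Color where
  | white
  | black

/-- The opposite color. -/
def Color.flip : Color → Color
  | .white => .black
  | .black => .white

/-- A leafless bicolored graph without isolated components and with `n` boundary
vertices, given up to homotopy by its rotation system.  A dart is a half-edge; `edge` sends a
half-edge to the other half of its edge, and `rot` to the clockwise next half-edge at the same
vertex, so that vertices are the cycles of `rot`.  `bdry i` is the half-edge at the boundary vertex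
`i`.  A half-edge has the color of its vertex; boundary vertices have no color.  Planarity is the
predicate `PlabicMap.IsPlanar`.  Since every component meets the boundary circle, the embedding of
a planar graph in the disk is determined up to homotopy by this data. -/
structure PlabicMap (n : ℕ) where
  Dart : Type
  finite : Finite Dart
  edge : Equiv.Perm Dart
  edge_edge : ∀ d, edge (edge d) = d
  edge_ne : ∀ d, edge d ≠ d
  rot : Equiv.Perm Dart
  bdry : Fin n → Dart
  bdry_injective : Function.Injective bdry
  /-- each boundary vertex is incident to a single edge -/
  rot_bdry : ∀ i, rot (bdry i) = bdry i
  color : Dart → Option Color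
  color_rot : ∀ d, color (rot d) = color d
  color_eq_none : ∀ d, color d = none ↔ d ∈ Set.range bdry
  /-- an internal vertex of degree one is a leaf attached to a boundary vertex -/
  leafless : ∀ d, rot d = d → d ∉ Set.range bdry → edge d ∈ Set.range bdry
  /-- no isolated components -/
  connected : ∀ d, ∃ i, Relation.ReflTransGen (fun x y => y = edge x ∨ y = rot x) (bdry i) d

namespace PlabicMap

variable {n : ℕ}

/-- The number of cycles of a permutation, fixed points included. -/
noncomputable def numCycles {α : Type} (f : Equiv.Perm α) : ℕ :=
  Nat.card (Quotient (Equiv.Perm.SameCycle.setoid f))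

/-- The rotation system on the sphere obtained by shrinking the complement of the open disk to one
vertex.  The boundary labels run clockwise around the disk, hence `n, …, 2, 1` is the clockwise
order around that new vertex. -/
noncomputable def sphereRot (G : PlabicMap n) : Equiv.Perm G.Dart :=
  G.rot * Equiv.Perm.viaEmbedding (finRotate n)⁻¹ ⟨G.bdry, G.bdry_injective⟩

/-- The graph can be drawn in the disk with the given rotations and boundary order: Euler's
formula `V + F = E + 2` holds for the associated map on the sphere. -/
def IsPlanar (G : PlabicMap n) : Prop :=
  numCycles G.sphereRot + numCycles (G.sphereRot * G.edge) = numCycles G.edge + 2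

/-- Homotopic plabic graphs: isomorphic rotation systems with equal colors and boundary labels. -/
def Homotopic (G H : PlabicMap n) : Prop :=
  ∃ f : G.Dart ≃ H.Dart, (∀ d, f (G.edge d) = H.edge (f d)) ∧ (∀ d, f (G.rot d) = H.rot (f d)) ∧
    (∀ i, f (G.bdry i) = H.bdry i) ∧ ∀ d, H.color (f d) = G.color d

/-- The corners of the face on one side of the half-edge `x`. -/
def corner (G : PlabicMap n) (x : G.Dart) (k : ℕ) : G.Dart := (fun d => G.rot (G.edge d))^[k] x

/-- Two half-edges at the same vertex. -/
def SameVertex (G : PlabicMap n) (d e : G.Dart) : Prop := G.rot.SameCycle d e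

/-- The square move (M1): `x` lies on a face with four corners, at four distinct trivalent internal
vertices whose colors alternate, and `H` is `G` with the colors of these four vertices switched. -/
def SquareMove (G H : PlabicMap n) : Prop :=
  ∃ (x : G.Dart) (f : G.Dart ≃ H.Dart),
    G.corner x 4 = x ∧
    (∀ k < 4, ∀ l < 4, k ≠ l → ¬ G.SameVertex (G.corner x k) (G.corner x l)) ∧
    (∀ k < 4, G.rot (G.corner x k) ≠ G.corner x k ∧
      G.rot (G.rot (G.rot (G.corner x k))) = G.corner x k) ∧
    (∃ c : Color, G.color (G.corner x 0) = some c ∧ G.color (G.corner x 1) = some c.flip ∧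
      G.color (G.corner x 2) = some c ∧ G.color (G.corner x 3) = some c.flip) ∧
    (∀ d, f (G.edge d) = H.edge (f d)) ∧ (∀ d, f (G.rot d) = H.rot (f d)) ∧
    (∀ i, f (G.bdry i) = H.bdry i) ∧
    (∀ d, (∃ k < 4, G.SameVertex d (G.corner x k)) →
      H.color (f d) = (G.color d).map Color.flip) ∧
    (∀ d, (¬ ∃ k < 4, G.SameVertex d (G.corner x k)) → H.color (f d) = G.color d)

open Classical in
/-- The contraction in (M2): `H` is obtained from `G` by contracting the edge `{d, edge d}` between
two distinct internal vertices of the same color. -/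
def Contraction (G H : PlabicMap n) : Prop :=
  ∃ (d : G.Dart) (f : H.Dart ↪ G.Dart),
    G.color d ≠ none ∧ G.color (G.edge d) = G.color d ∧ ¬ G.SameVertex d (G.edge d) ∧
    Set.range f = {d, G.edge d}ᶜ ∧
    (∀ x, f (H.edge x) = G.edge (f x)) ∧
    (∀ x, f (H.rot x) =
      if G.rot (f x) = d then G.rot (G.edge d)
      else if G.rot (f x) = G.edge d then G.rot d
      else G.rot (f x)) ∧
    (∀ i, f (H.bdry i) = G.bdry i) ∧ ∀ x, H.color x = G.color (f x)

open Classical in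
/-- The removal in (M3): `H` is obtained from `G` by removing an internal vertex of degree two,
whose half-edges are `d` and `rot d`, and gluing the two incident edges together. -/
def MiddleVertexRemoval (G H : PlabicMap n) : Prop :=
  ∃ (d : G.Dart) (f : H.Dart ↪ G.Dart),
    G.color d ≠ none ∧ G.rot d ≠ d ∧ G.rot (G.rot d) = d ∧
    Set.range f = {d, G.rot d}ᶜ ∧
    (∀ x, f (H.edge x) =
      if G.edge (f x) = d then G.edge (G.rot d)
      else if G.edge (f x) = G.rot d then G.edge d
      else G.edge (f x)) ∧
    (∀ x, f (H.rot x) = G.rot (f x)) ∧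
    (∀ i, f (H.bdry i) = G.bdry i) ∧ ∀ x, H.color x = G.color (f x)

/-- `G` and `H` are related by homotopy and a finite sequence of moves (M2), that is unicolored
edge contractions and uncontractions, and (M3), that is middle vertex insertions and removals. -/
def EquivM2M3 (G H : PlabicMap n) : Prop :=
  Relation.EqvGen
    (fun A B => Homotopic A B ∨ Contraction A B ∨ MiddleVertexRemoval A B) G H

/-- `G` and `H` are related by homotopy, moves (M2) and (M3), and exactly one square move (M1). -/
def EquivWithOneM1 (G H : PlabicMap n) : Prop :=
  ∃ G' H' : PlabicMap n, EquivM2M3 G G' ∧ SquareMove G' H' ∧ EquivM2M3 H' H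

end PlabicMap

/-! ## The plabic graph of a bridge decomposition

The boundary vertices `1, …, n` are on top, from left to right, and a vertical wire hangs from each
of them.  The bridges are placed from top to bottom; the bridge `(i j)` with `i < j` joins a new
white vertex on the wire `i` to a new black vertex on the wire `j`.  A wire ends at the last bridge
on it; a wire without bridges ends in a boundary leaf. -/

/-- A bridge between the wires `left < right`. -/
structure Bridge (n : ℕ) where
  left : Fin n
  right : Fin n
  lt : left < right

section BridgeGraph

variable {n : ℕ} (w : List (Bridge n))

/-- The vertices on the bridges: the bridge `w[t]` has a left end `(t, false)` and a right end
`(t, true)`. -/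
abbrev Foot : Type := Fin w.length × Bool

/-- The wire on which a vertex lies. -/
def wire (v : Foot w) : Fin n := bif v.2 then (w.get v.1).right else (w.get v.1).left

/-- `v'` is the next vertex below `v` on the same wire. -/
def IsNext (v v' : Foot w) : Prop :=
  wire w v = wire w v' ∧ v.1 < v'.1 ∧ ∀ u, wire w u = wire w v → ¬ (v.1 < u.1 ∧ u.1 < v'.1)

variable {w}

theorem foot_ext {v v' : Foot w} (h : v.1 = v'.1) (hw : wire w v = wire w v') : v = v' := by
  obtain ⟨t, s⟩ := v
  obtain ⟨t', s'⟩ := v'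
  obtain rfl : t = t' := h
  have := (w.get t).lt
  cases s <;> cases s' <;> simp only [wire, cond_true, cond_false] at hw <;>
    first | rfl | (rw [hw] at this; exact absurd this (lt_irrefl _))

theorem IsNext.right_unique {v a b : Foot w} (ha : IsNext w v a) (hb : IsNext w v b) : a = b := by
  rcases lt_trichotomy a.1 b.1 with h | h | h
  · exact absurd ⟨ha.2.1, h⟩ (hb.2.2 a ha.1.symm)
  · exact foot_ext h (ha.1.symm.trans hb.1)
  · exact absurd ⟨hb.2.1, h⟩ (ha.2.2 b hb.1.symm)

theorem IsNext.left_unique {v a b : Foot w} (ha : IsNext w a v) (hb : IsNext w b v) : a = b := by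
  rcases lt_trichotomy a.1 b.1 with h | h | h
  · exact absurd ⟨h, hb.2.1⟩ (ha.2.2 b (hb.1.trans ha.1.symm))
  · exact foot_ext h (ha.1.trans hb.1.symm)
  · exact absurd ⟨h, ha.2.1⟩ (hb.2.2 a (ha.1.trans hb.1.symm))

variable (w)

open Classical in
/-- The next vertex below `v` on its wire, if any. -/
noncomputable def below (v : Foot w) : Option (Foot w) :=
  if h : ∃ v', IsNext w v v' then some h.choose else none

open Classical in
/-- The next vertex above `v` on its wire, if any (otherwise the boundary vertex is next). -/
noncomputable def above (v : Foot w) : Option (Foot w) :=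
  if h : ∃ v', IsNext w v' v then some h.choose else none

variable {w}

theorem below_eq_some {v v' : Foot w} : below w v = some v' ↔ IsNext w v v' := by
  unfold below
  constructor
  · intro h
    split_ifs at h with hx
    cases h
    exact hx.choose_spec
  · intro h
    have hx : ∃ v', IsNext w v v' := ⟨v', h⟩
    rw [dif_pos hx, hx.choose_spec.right_unique h]

theorem above_eq_some {v v' : Foot w} : above w v = some v' ↔ IsNext w v' v := by
  unfold above
  constructor
  · intro h
    split_ifs at h with hx
    cases h
    exact hx.choose_spec
  · intro h
    have hx : ∃ v', IsNext w v' v := ⟨v', h⟩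
    rw [dif_pos hx, hx.choose_spec.left_unique h]

theorem above_of_below {v v' : Foot w} (h : below w v = some v') : above w v' = some v :=
  above_eq_some.2 (below_eq_some.1 h)

theorem below_of_above {v v' : Foot w} (h : above w v = some v') : below w v' = some v :=
  below_eq_some.2 (above_eq_some.1 h)

/-- On a wire that carries a vertex there is a topmost one. -/
theorem exists_top {a : Fin n} (h : ∃ v, wire w v = a) :
    ∃ v, wire w v = a ∧ above w v = none := by
  obtain ⟨v, hv, hmin⟩ := Set.exists_min_image {v | wire w v = a} Prod.fst (Set.toFinite _) h
  refine ⟨v, hv, ?_⟩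
  by_contra hne
  obtain ⟨u, hu⟩ := Option.ne_none_iff_exists'.1 hne
  have hn := above_eq_some.1 hu
  exact absurd (hmin u (hn.1.trans hv)) (not_le.2 hn.2.1)

theorem top_unique {u v : Foot w} (h : wire w u = wire w v) (hu : above w u = none)
    (hv : above w v = none) : u = v := by
  have key : ∀ u v : Foot w, wire w u = wire w v → above w v = none → ¬ u.1 < v.1 := by
    intro u v h hv hlt
    obtain ⟨x, ⟨hx, hxv⟩, hmax⟩ := Set.exists_max_image {x | wire w x = wire w v ∧ x.1 < v.1}
      Prod.fst (Set.toFinite _) ⟨u, h, hlt⟩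
    have : above w v = some x := above_eq_some.2 ⟨hx, hxv, fun y hy hlt' =>
      absurd (hmax y ⟨hy.trans hx, hlt'.2⟩) (not_le.2 hlt'.1)⟩
    simp [this] at hv
  exact foot_ext (le_antisymm (not_lt.1 (key v u h.symm hu)) (not_lt.1 (key u v h hv))) h

variable (w)

/-- The half-edges of the bridge graph. -/
inductive BridgeDart where
  /-- the half at `v` of the wire segment from `v` upwards -/
  | up (v : Foot w)
  /-- the other half of that segment, at the next vertex above `v` or at the boundary -/
  | down (v : Foot w)
  /-- the half at `v` of the bridge -/
  | cross (v : Foot w)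
  /-- the half at the boundary vertex of an edge from the boundary to a boundary leaf -/
  | stub (a : {a : Fin n // ¬ ∃ v, wire w v = a})
  /-- the half at the leaf of that edge -/
  | leaf (a : {a : Fin n // ¬ ∃ v, wire w v = a})

variable {w}

theorem BridgeDart.finite : Finite (BridgeDart w) := by
  let S := {a : Fin n // ¬ ∃ v, wire w v = a}
  let g : Foot w ⊕ Foot w ⊕ Foot w ⊕ S ⊕ S → BridgeDart w := fun x =>
    match x with
    | .inl v => .up v
    | .inr (.inl v) => .down v
    | .inr (.inr (.inl v)) => .cross v
    | .inr (.inr (.inr (.inl a))) => .stub a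
    | .inr (.inr (.inr (.inr a))) => .leaf a
  refine Finite.of_surjective g ?_
  rintro (v | v | v | a | a)
  · exact ⟨.inl v, rfl⟩
  · exact ⟨.inr (.inl v), rfl⟩
  · exact ⟨.inr (.inr (.inl v)), rfl⟩
  · exact ⟨.inr (.inr (.inr (.inl a))), rfl⟩
  · exact ⟨.inr (.inr (.inr (.inr a))), rfl⟩

/-- The other half of an edge. -/
def BridgeDart.opp : BridgeDart w → BridgeDart w
  | .up v => .down v
  | .down v => .up v
  | .cross v => .cross (v.1, !v.2)
  | .stub a => .leaf a
  | .leaf a => .stub a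

/-- The half-edge that leaves `v` downwards, or `d` if the wire ends at `v`. -/
noncomputable def BridgeDart.downFrom (v : Foot w) (d : BridgeDart w) : BridgeDart w :=
  match below w v with
  | some v' => .down v'
  | none => d

/-- Clockwise rotation: at a left end of a bridge the order is up, cross, down, at a right end it
is up, down, cross. -/
noncomputable def BridgeDart.cw : BridgeDart w → BridgeDart w
  | .up v => bif v.2 then downFrom v (.cross v) else .cross v
  | .cross v => bif v.2 then .up v else downFrom v (.up v)
  | .down v =>
    match above w v with
    | some u => bif u.2 then .cross u else .up u
    | none => .down v
  | .stub a => .stub a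
  | .leaf a => .leaf a

/-- Counterclockwise rotation. -/
noncomputable def BridgeDart.ccw : BridgeDart w → BridgeDart w
  | .up v => bif v.2 then .cross v else downFrom v (.cross v)
  | .cross v => bif v.2 then downFrom v (.up v) else .up v
  | .down v =>
    match above w v with
    | some u => bif u.2 then .up u else .cross u
    | none => .down v
  | .stub a => .stub a
  | .leaf a => .leaf a

theorem BridgeDart.ccw_cw (d : BridgeDart w) : d.cw.ccw = d := by
  rcases d with v | v | v | a | a
  · obtain ⟨t, s⟩ := v
    cases s
    · simp [cw, ccw]
    · rcases h : below w (t, true) with _ | v'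
      · simp [cw, ccw, downFrom, h]
      · simp [cw, ccw, downFrom, h, above_of_below h]
  · rcases h : above w v with _ | u
    · simp [cw, ccw, h]
    · have h' := below_of_above h
      obtain ⟨t, s⟩ := u
      cases s <;> simp [cw, ccw, downFrom, h, h']
  · obtain ⟨t, s⟩ := v
    cases s
    · rcases h : below w (t, false) with _ | v'
      · simp [cw, ccw, downFrom, h]
      · simp [cw, ccw, downFrom, h, above_of_below h]
    · simp [cw, ccw]
  · rfl
  · rfl

theorem BridgeDart.cw_ccw (d : BridgeDart w) : d.ccw.cw = d := by
  rcases d with v | v | v | a | a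
  · obtain ⟨t, s⟩ := v
    cases s
    · rcases h : below w (t, false) with _ | v'
      · simp [cw, ccw, downFrom, h]
      · simp [cw, ccw, downFrom, h, above_of_below h]
    · simp [cw, ccw]
  · rcases h : above w v with _ | u
    · simp [cw, ccw, h]
    · have h' := below_of_above h
      obtain ⟨t, s⟩ := u
      cases s <;> simp [cw, ccw, downFrom, h, h']
  · obtain ⟨t, s⟩ := v
    cases s
    · simp [cw, ccw]
    · rcases h : below w (t, true) with _ | v'
      · simp [cw, ccw, downFrom, h]
      · simp [cw, ccw, downFrom, h, above_of_below h]
  · rfl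
  · rfl

variable (w)

open Classical in
/-- The half-edge at a boundary vertex. -/
noncomputable def boundaryDart (a : Fin n) : BridgeDart w :=
  if h : ∃ v, wire w v = a then .down (exists_top h).choose else .stub ⟨a, h⟩

/-- The colors: left ends of bridges are white, right ends are black; the boundary leaf of an
untouched wire `a` is white for `a ∈ J` (a counterclockwise fixed point) and black for `a ∉ J` (a
clockwise fixed point). -/
noncomputable def dartColor (J : Finset (Fin n)) : BridgeDart w → Option Color
  | .up v => some (bif v.2 then .black else .white)
  | .cross v => some (bif v.2 then .black else .white)
  | .down v => (above w v).map fun u => bif u.2 then .black else .white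
  | .stub _ => none
  | .leaf a => some (if (a : Fin n) ∈ J then .white else .black)

variable {w}

theorem boundaryDart_of_top {v : Foot w} (h : above w v = none) :
    boundaryDart w (wire w v) = .down v := by
  have hx : ∃ u, wire w u = wire w v := ⟨v, rfl⟩
  have hs := (exists_top hx).choose_spec
  rw [boundaryDart, dif_pos hx, top_unique hs.1 hs.2 h]

theorem boundaryDart_of_untouched (a : {a : Fin n // ¬ ∃ v, wire w v = a}) :
    boundaryDart w a = .stub a := by
  rw [boundaryDart, dif_neg a.2]

theorem boundaryDart_cases (a : Fin n) :
    (∃ v, wire w v = a ∧ above w v = none ∧ boundaryDart w a = .down v) ∨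
      ∃ h : ¬ ∃ v, wire w v = a, boundaryDart w a = .stub ⟨a, h⟩ := by
  by_cases h : ∃ v, wire w v = a
  · obtain ⟨v, rfl, hv⟩ := exists_top h
    exact .inl ⟨v, rfl, hv, boundaryDart_of_top hv⟩
  · exact .inr ⟨h, boundaryDart_of_untouched ⟨a, h⟩⟩

theorem dartColor_eq_none (J : Finset (Fin n)) (d : BridgeDart w) :
    dartColor w J d = none ↔ d ∈ Set.range (boundaryDart w) := by
  constructor
  · intro h
    rcases d with v | v | v | a | a
    · simp [dartColor] at h
    · exact ⟨wire w v, boundaryDart_of_top (by simpa [dartColor] using h)⟩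
    · simp [dartColor] at h
    · exact ⟨a, boundaryDart_of_untouched a⟩
    · simp [dartColor] at h
  · rintro ⟨a, rfl⟩
    rcases boundaryDart_cases (w := w) a with ⟨v, -, hv, h⟩ | ⟨h', h⟩ <;> rw [h]
    · simp [dartColor, hv]
    · simp [dartColor]

theorem dartColor_cw (J : Finset (Fin n)) (d : BridgeDart w) :
    dartColor w J d.cw = dartColor w J d := by
  rcases d with v | v | v | a | a
  · obtain ⟨t, s⟩ := v
    cases s
    · simp [BridgeDart.cw, dartColor]
    · rcases h : below w (t, true) with _ | v'
      · simp [BridgeDart.cw, BridgeDart.downFrom, dartColor, h]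
      · simp [BridgeDart.cw, BridgeDart.downFrom, dartColor, h, above_of_below h]
  · rcases h : above w v with _ | u
    · simp [BridgeDart.cw, h]
    · obtain ⟨t, s⟩ := u
      cases s <;> simp [BridgeDart.cw, dartColor, h]
  · obtain ⟨t, s⟩ := v
    cases s
    · rcases h : below w (t, false) with _ | v'
      · simp [BridgeDart.cw, BridgeDart.downFrom, dartColor, h]
      · simp [BridgeDart.cw, BridgeDart.downFrom, dartColor, h, above_of_below h]
    · simp [BridgeDart.cw, dartColor]
  · rfl
  · rfl

theorem reach_down (v : Foot w) :
    ∃ a, Relation.ReflTransGen (fun x y : BridgeDart w => y = x.opp ∨ y = x.cw)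
      (boundaryDart w a) (.down v) := by
  suffices H : ∀ (m : ℕ) (v : Foot w), (v.1 : ℕ) < m →
      ∃ a, Relation.ReflTransGen (fun x y : BridgeDart w => y = x.opp ∨ y = x.cw)
        (boundaryDart w a) (.down v) from H _ v (Nat.lt_succ_self _)
  intro m
  induction m with
  | zero => intro v h; omega
  | succ m ih =>
    intro v hv
    rcases h : above w v with _ | u
    · exact ⟨wire w v, by rw [boundaryDart_of_top h]⟩
    · have hlt : (u.1 : ℕ) < v.1 := (above_eq_some.1 h).2.1
      have hb := below_of_above h
      obtain ⟨a, ha⟩ := ih u (by omega)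
      refine ⟨a, ?_⟩
      have hup := ha.tail (c := .up u) (.inl rfl)
      obtain ⟨t, s⟩ := u
      cases s
      · have hcr := hup.tail (c := .cross (t, false)) (.inr rfl)
        exact hcr.tail (.inr (by simp [BridgeDart.cw, BridgeDart.downFrom, hb]))
      · exact hup.tail (.inr (by simp [BridgeDart.cw, BridgeDart.downFrom, hb]))

theorem reach (d : BridgeDart w) :
    ∃ a, Relation.ReflTransGen (fun x y : BridgeDart w => y = x.opp ∨ y = x.cw)
      (boundaryDart w a) d := by
  have hup : ∀ v : Foot w, ∃ a, Relation.ReflTransGen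
      (fun x y : BridgeDart w => y = x.opp ∨ y = x.cw) (boundaryDart w a) (.up v) := fun v => by
    obtain ⟨a, ha⟩ := reach_down v
    exact ⟨a, ha.tail (.inl rfl)⟩
  have hleft : ∀ t, ∃ a, Relation.ReflTransGen
      (fun x y : BridgeDart w => y = x.opp ∨ y = x.cw) (boundaryDart w a)
      (.cross (t, false)) := fun t => by
    obtain ⟨a, ha⟩ := hup (t, false)
    exact ⟨a, ha.tail (.inr rfl)⟩
  rcases d with v | v | v | a | a
  · exact hup v
  · exact reach_down v
  · obtain ⟨t, s⟩ := v
    cases s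
    · exact hleft t
    · obtain ⟨a, ha⟩ := hleft t
      exact ⟨a, ha.tail (.inl rfl)⟩
  · exact ⟨a, by rw [boundaryDart_of_untouched]⟩
  · refine ⟨a, ?_⟩
    rw [boundaryDart_of_untouched]
    exact Relation.ReflTransGen.single (.inl rfl)

/-- The plabic graph built from a sequence of bridges, the first of which is the one closest to the
boundary; `J` decides the colors of the boundary leaves. -/
noncomputable def bridgeGraph (J : Finset (Fin n)) (w : List (Bridge n)) : PlabicMap n where
  Dart := BridgeDart w
  finite := BridgeDart.finite
  edge := ⟨BridgeDart.opp, BridgeDart.opp,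
    by rintro (v | v | v | a | a) <;> simp [BridgeDart.opp],
    by rintro (v | v | v | a | a) <;> simp [BridgeDart.opp]⟩
  edge_edge := by rintro (v | v | v | a | a) <;> simp [BridgeDart.opp]
  edge_ne := by
    rintro (v | v | v | a | a)
    · simp [BridgeDart.opp]
    · simp [BridgeDart.opp]
    · obtain ⟨t, s⟩ := v
      cases s <;> simp [BridgeDart.opp]
    · simp [BridgeDart.opp]
    · simp [BridgeDart.opp]
  rot := ⟨BridgeDart.cw, BridgeDart.ccw, BridgeDart.ccw_cw, BridgeDart.cw_ccw⟩
  bdry := boundaryDart w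
  bdry_injective := by
    intro a b hab
    rcases boundaryDart_cases (w := w) a with ⟨v, hv, -, h⟩ | ⟨ha, h⟩ <;>
      rcases boundaryDart_cases (w := w) b with ⟨v', hv', -, h'⟩ | ⟨hb, h'⟩ <;>
      rw [h, h'] at hab
    · rw [← hv, ← hv', BridgeDart.down.inj hab]
    · cases hab
    · cases hab
    · exact congrArg Subtype.val (BridgeDart.stub.inj hab)
  rot_bdry := by
    intro a
    rcases boundaryDart_cases (w := w) a with ⟨v, -, hv, h⟩ | ⟨h', h⟩ <;> rw [h]
    · simp [BridgeDart.cw, hv]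
    · simp [BridgeDart.cw]
  color := dartColor w J
  color_rot := dartColor_cw J
  color_eq_none := dartColor_eq_none J
  leafless := by
    rintro (v | v | v | a | a) hd hb
    · obtain ⟨t, s⟩ := v
      cases s
      · simp [BridgeDart.cw] at hd
      · rcases h : below w (t, true) with _ | v' <;>
          simp [BridgeDart.cw, BridgeDart.downFrom, h] at hd
    · rcases h : above w v with _ | u
      · exact absurd ⟨_, boundaryDart_of_top h⟩ hb
      · obtain ⟨t, s⟩ := u
        cases s <;> simp [BridgeDart.cw, h] at hd
    · obtain ⟨t, s⟩ := v
      cases s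
      · rcases h : below w (t, false) with _ | v' <;>
          simp [BridgeDart.cw, BridgeDart.downFrom, h] at hd
      · simp [BridgeDart.cw] at hd
    · exact absurd ⟨_, boundaryDart_of_untouched a⟩ hb
    · exact ⟨a, boundaryDart_of_untouched a⟩
  connected := reach

end BridgeGraph

/-! ## From paths to plabic graphs -/

section Paths

variable {n : ℕ} {J : Finset (Fin n)}

/-- The values moved when passing from one end of a step to the other. -/
noncomputable def swapped (d : (skeleton J).Dart) : Finset (Fin n) :=
  (d.snd * d.fst⁻¹).support

theorem one_lt_card_swapped (d : (skeleton J).Dart) : 1 < (swapped d).card := by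
  refine Equiv.Perm.two_le_card_support_of_ne_one fun h => d.adj.1 ?_
  exact (mul_inv_eq_one.1 h).symm

/-- The label `(i ℓ)`, `i < ℓ`, of a step from `z` to `(i ℓ) z`: the least and the greatest of the
values that are moved. -/
noncomputable def edgeLabel (d : (skeleton J).Dart) : Bridge n where
  left := (swapped d).min' (Finset.card_pos.1 (zero_lt_one.trans (one_lt_card_swapped d)))
  right := (swapped d).max' (Finset.card_pos.1 (zero_lt_one.trans (one_lt_card_swapped d)))
  lt := Finset.min'_lt_max'_of_card _ (one_lt_card_swapped d)

/-- The plabic graph of a path in the one-skeleton: its sequence of edge labels is read as a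
sequence of bridges. -/
noncomputable def pathGraph {x y : Equiv.Perm (Fin n)} (p : (skeleton J).Walk x y) : PlabicMap n :=
  bridgeGraph J (p.darts.map edgeLabel)

end Paths

end BridgePolytope

/-!
# Faces of bridge polytopes and moves of plabic graphs

For each position and each cut `s`, membership in `permSet J` either decides whether the value at
the position lies below `s` or leaves the position *free* at `s`. Two permutations of `permSet J`
differ at a cut only by values of free positions moving up and down across it (`Above`). A face of
the polytope is spanned by the set `maxSet J c` of permutations maximizing a functional `c`, and
exchange arguments show that an edge exchanges two values such that every value strictly between
them is a fixed point, and that every allowed such exchange is an edge (`exists_swap_of_adj`,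
`adj_mul_swap`). Counting inversions relative to the order of `schubertPerm J`, one finds that a
step along an edge changes their number by exactly one. As the identity is reached from every vertex
by steps up, which increase it, a shortest path to the identity consists of such steps only
(`isUp_of_shortest`).

A value that is a fixed point stays one under steps up. Hence the wires passed over by a bridge
carry no later bridges (`UpPath.pairwise_avoids`), so that bridges never cross wires that are still
there. For such sequences the faces of the rotation system are found explicitly: apart from the
outermost one, each is bounded from below by exactly one bridge, and Euler's formula holds
(`isPlanar_bridgeGraph`).

Let the two halves of a two-dimensional face part at its vertex `u`. Their first steps exchange two
pairs of positions on which the functional is tied. If the pairs are disjoint, the face is the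
rectangle that they span, and the two halves have the labels `b, b'` and `b', b`
(`rectangle_of_disjoint`). If they share a position, all vertices of the face arrange the same three
values `i < j < k`, and each half has two or three steps (`trapezoid_or_hexagon`). Two steps occur
when `j` becomes a fixed point along the face, so that an exchange of `i` and `k` passes over it;
the face is then a trapezoid, with labels `(i j), (j k)` opposite `(j k), (i k)`, or
`(i j), (i k)` opposite `(j k), (i j)`. Otherwise the face is a hexagon, with labels
`(i j), (j k), (i j)` opposite `(j k), (i j), (j k)`, and `j` still has to be moved after the face,
so that the wire `j` carries a later bridge (`FaceLabels`, `reroute_labels`).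

It remains to compare two bridge graphs that differ by a short piece of the bridge sequence. Such a
graph is presented by names for its half-edges in which the part outside the piece does not depend
on the piece (`Tangle`, `splicePresentation`); a local move is then checked on finitely many
half-edges, and a bijection of names gives the homotopy.
* For a rectangle, the two bridges have no common wire, and exchanging their names is an isomorphism
  (`homotopic_of_disjoint`).
* For a trapezoid, the wire `j` ends with the face, so that in each of the two graphs the last foot
  on it has degree two. Removing it by (M3) leaves graphs that agree after contracting an edge with
  (M2) (`equivM2M3_cascade_forkRight`, `equivM2M3_descent_forkLeft`).
* For a hexagon, the bridges `(i j), (j k), (i j)` bound a pentagon with two adjacent white corners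
  on the wire `i`. A contraction and an expansion (M2) slide one of the two edges leaving this pair
  so that a square remains, with trivalent corners since the wire `j` continues below. After the
  square move (M1) the graph agrees with that of `(j k), (i j), (j k)` once a black edge is
  contracted in each (`exists_squareMove_hexagon`, `equivWithOneM1_hexagon`).
-/

namespace BridgePolytope

open Equiv

variable {n : ℕ} {J : Finset (Fin n)}

/-! ### Exchanges at a cut -/

/-- At the cut `s` a permutation of `permSet J` sends each position either below `s` or to at least
`s`; the position `x` is free at `s` when membership in `permSet J` does not decide which. -/
def Free (J : Finset (Fin n)) (s : ℕ) (x : Fin n) : Prop := x ∈ J ↔ (x : ℕ) < s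

/-- At some cut both positions are free, `x` has a value above the cut and `y` one below it. -/
def Above (J : Finset (Fin n)) (z : Perm (Fin n)) (x y : Fin n) : Prop :=
  ∃ s : ℕ, Free J s x ∧ Free J s y ∧ (z y : ℕ) < s ∧ s ≤ z x

theorem Above.lt {z : Perm (Fin n)} {x y : Fin n} (h : Above J z x y) : z y < z x := by
  obtain ⟨s, -, -, h1, h2⟩ := h
  exact Fin.lt_def.2 (h1.trans_le h2)

theorem Above.ne {z : Perm (Fin n)} {x y : Fin n} (h : Above J z x y) : x ≠ y := by
  rintro rfl
  exact lt_irrefl _ h.lt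

theorem mul_swap_mem {z : Perm (Fin n)} (hz : z ∈ permSet J) {x y : Fin n} (hlt : z y < z x)
    (hx : x ∈ J → x ≤ z y) (hy : y ∉ J → z x ≤ y) : z * swap x y ∈ permSet J := by
  have hxy : x ≠ y := by rintro rfl; exact lt_irrefl _ hlt
  intro j
  rcases eq_or_ne j x with rfl | hjx
  · simp only [Perm.mul_apply, swap_apply_left]
    exact ⟨hx, fun h => hlt.le.trans ((hz j).2 h)⟩
  rcases eq_or_ne j y with rfl | hjy
  · simp only [Perm.mul_apply, swap_apply_right]
    exact ⟨fun h => ((hz j).1 h).trans hlt.le, hy⟩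
  · simpa only [Perm.mul_apply, swap_apply_of_ne_of_ne hjx hjy] using hz j

theorem free_of_mul_swap_mem {z : Perm (Fin n)} (hz : z ∈ permSet J) {x y : Fin n}
    (h : z * swap x y ∈ permSet J) {s : ℕ} (h1 : (z y : ℕ) < s) (h2 : s ≤ z x) :
    Free J s x ∧ Free J s y := by
  have hx := h x
  have hy := h y
  simp only [Perm.mul_apply, swap_apply_left, swap_apply_right, Fin.le_def] at hx hy
  have hx' := hz x
  have hy' := hz y
  simp only [Fin.le_def] at hx' hy'
  unfold Free
  constructor
  · constructor
    · intro hJ; have := hx.1 hJ; omega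
    · intro hJ; by_contra hc; have := hx'.2 hc; omega
  · constructor
    · intro hJ; have := hy'.1 hJ; omega
    · intro hJ; by_contra hc; have := hy.2 hc; omega

theorem above_of_mul_swap_mem {z : Perm (Fin n)} (hz : z ∈ permSet J) {x y : Fin n}
    (h : z * swap x y ∈ permSet J) (hlt : z y < z x) : Above J z x y :=
  ⟨z x, (free_of_mul_swap_mem hz h hlt le_rfl).1, (free_of_mul_swap_mem hz h hlt le_rfl).2, hlt,
    le_rfl⟩

/-- A position that is not fixed is free at the two cuts next to its value. -/
theorem free_of_ne {z : Perm (Fin n)} (hz : z ∈ permSet J) {x : Fin n} (hx : z x ≠ x) :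
    Free J (z x) x ∧ Free J (z x + 1) x := by
  have h1 := hz x
  simp only [Fin.le_def] at h1
  have h2 : (z x : ℕ) ≠ x := fun h => hx (Fin.ext h)
  unfold Free
  constructor <;> constructor
  · intro hJ; have := h1.1 hJ; omega
  · intro hJ; by_contra hc; have := h1.2 hc; omega
  · intro hJ; have := h1.1 hJ; omega
  · intro hJ; by_contra hc; have := h1.2 hc; omega

/-- If exchanging the values of `x` and `y` is not allowed although both are free at a common cut,
then some position with a value in between can be exchanged with both of them. -/
theorem Above.exists_between {z : Perm (Fin n)} (hz : z ∈ permSet J) {x y : Fin n}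
    (h : Above J z x y) (hn : z * swap x y ∉ permSet J) :
    ∃ w, z y < z w ∧ z w < z x ∧ Above J z x w ∧ Above J z w y := by
  obtain ⟨s, hx, hy, h1, h2⟩ := h
  have hlt : z y < z x := Fin.lt_def.2 (h1.trans_le h2)
  -- the position that takes the value obstructing the exchange
  by_cases hxJ : x ∈ J → x ≤ z y
  · by_cases hyJ : y ∉ J → z x ≤ y
    · exact absurd (mul_swap_mem hz hlt hxJ hyJ) hn
    · push Not at hyJ
      obtain ⟨hyJ, hlt'⟩ := hyJ
      have hys : s ≤ (y : ℕ) := by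
        by_contra hc
        exact hyJ (hy.2 (not_le.1 hc))
      obtain ⟨w, hw⟩ := z.surjective y
      have hne : z w ≠ w := by
        intro h
        have : w = y := by rw [← hw, h]
        subst this
        have : z w = w := hw
        rw [Fin.ext_iff] at this
        omega
      have hf := free_of_ne hz hne
      rw [hw] at hf
      rw [Fin.lt_def] at hlt'
      refine ⟨w, by rw [hw, Fin.lt_def]; omega, by rw [hw]; exact hlt',
        ⟨y + 1, ?_, hf.2, by rw [hw]; omega, by omega⟩, ⟨y, hf.1, ?_, by omega, by rw [hw]⟩⟩
      · have := (hz x).2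
        unfold Free at hx ⊢
        constructor
        · intro hJ; have := hx.1 hJ; omega
        · intro hJ; by_contra hc
          have := (hz x).2 hc
          rw [Fin.le_def] at this
          omega
      · unfold Free
        simp [hyJ]
  · push Not at hxJ
    obtain ⟨hxJ, hlt'⟩ := hxJ
    have hxs : (x : ℕ) < s := hx.1 hxJ
    rw [Fin.lt_def] at hlt'
    obtain ⟨w, hw⟩ := z.surjective x
    have hne : z w ≠ w := by
      intro h
      have : w = x := by rw [← hw, h]
      subst this
      have : z w = w := hw
      rw [Fin.ext_iff] at this
      omega
    have hf := free_of_ne hz hne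
    rw [hw] at hf
    refine ⟨w, by rw [hw, Fin.lt_def]; exact hlt', by rw [hw, Fin.lt_def]; omega,
      ⟨x + 1, ?_, hf.2, by rw [hw]; omega, by omega⟩, ⟨x, hf.1, ?_, hlt', by rw [hw]⟩⟩
    · unfold Free
      simp [hxJ]
    · unfold Free at hy ⊢
      constructor
      · intro hJ
        have := (hz y).1 hJ
        rw [Fin.le_def] at this
        omega
      · intro hJ; by_contra hc
        exact hc (hy.2 (by omega))

/-! ### Maximizing linear functionals -/

/-- The value of the functional with coefficients `c` at the point of `z`, up to a constant. -/
def weight (c : Fin n → ℝ) (z : Perm (Fin n)) : ℝ := ∑ x, c x * ((z x : ℕ) : ℝ)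

/-- The permutations in `permSet J` at which the functional with coefficients `c` is maximal. -/
def maxSet (J : Finset (Fin n)) (c : Fin n → ℝ) : Set (Perm (Fin n)) :=
  {z | z ∈ permSet J ∧ ∀ w ∈ permSet J, weight c w ≤ weight c z}

theorem weight_mul_swap (c : Fin n → ℝ) (z : Perm (Fin n)) {x y : Fin n} (hxy : x ≠ y) :
    weight c (z * swap x y) = weight c z + (((z x : ℕ) : ℝ) - ((z y : ℕ) : ℝ)) * (c y - c x) := by
  have h : weight c (z * swap x y) - weight c z =
      ∑ w, (c w * (((z * swap x y) w : ℕ) : ℝ) - c w * ((z w : ℕ) : ℝ)) := by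
    rw [Finset.sum_sub_distrib]; rfl
  rw [Fintype.sum_eq_add x y hxy] at h
  · simp only [Perm.mul_apply, swap_apply_left, swap_apply_right] at h
    linarith
  · rintro w ⟨hx, hy⟩
    rw [Perm.mul_apply, swap_apply_of_ne_of_ne hx hy, sub_self]

theorem le_of_mem_maxSet {c : Fin n → ℝ} {z : Perm (Fin n)} (hz : z ∈ maxSet J c) :
    ∀ {x y : Fin n}, Above J z x y → c y ≤ c x := by
  suffices H : ∀ (m : ℕ) (x y : Fin n), (z x : ℕ) - z y ≤ m → Above J z x y → c y ≤ c x from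
    fun {_ _} h => H _ _ _ le_rfl h
  intro m
  induction m with
  | zero =>
    intro x y hm h
    have := Fin.lt_def.1 h.lt
    omega
  | succ m ih =>
    intro x y hm h
    by_cases hs : z * swap x y ∈ permSet J
    · have h1 := hz.2 _ hs
      rw [weight_mul_swap c z h.ne] at h1
      have h2 : ((z y : ℕ) : ℝ) < ((z x : ℕ) : ℝ) := by exact_mod_cast Fin.lt_def.1 h.lt
      nlinarith
    · obtain ⟨w, h1, h2, h3, h4⟩ := h.exists_between hz.1 hs
      rw [Fin.lt_def] at h1 h2
      exact (ih w y (by omega) h4).trans (ih x w (by omega) h3)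

theorem mul_swap_mem_maxSet {c : Fin n → ℝ} {z : Perm (Fin n)} (hz : z ∈ maxSet J c) {x y : Fin n}
    (hxy : x ≠ y) (hs : z * swap x y ∈ permSet J) (hc : c x = c y) :
    z * swap x y ∈ maxSet J c :=
  ⟨hs, fun w hw => by rw [weight_mul_swap c z hxy, hc]; simpa using hz.2 w hw⟩

theorem eq_of_mul_swap_mem_maxSet {c : Fin n → ℝ} {z : Perm (Fin n)} (hz : z ∈ maxSet J c)
    {x y : Fin n} (hxy : x ≠ y) (hs : z * swap x y ∈ maxSet J c) : c x = c y := by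
  have h1 := hz.2 _ hs.1
  have h2 := hs.2 _ hz.1
  rw [weight_mul_swap c z hxy] at h1 h2
  have h3 : (((z x : ℕ) : ℝ) - ((z y : ℕ) : ℝ)) * (c y - c x) = 0 := by linarith
  rcases mul_eq_zero.1 h3 with h | h
  · exfalso
    apply hxy
    apply z.injective
    apply Fin.ext
    have : ((z x : ℕ) : ℝ) = ((z y : ℕ) : ℝ) := by linarith
    exact_mod_cast this
  · linarith

/-- If, from `z` to `w`, the value at `x` drops below the cut `s` and the value at `y` rises to at
least `s`, then both positions are free at `s`. -/
theorem above_of_cut {z w : Perm (Fin n)} (hz : z ∈ permSet J) (hw : w ∈ permSet J) {s : ℕ}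
    {x y : Fin n} (hx1 : s ≤ (z x : ℕ)) (hx2 : (w x : ℕ) < s) (hy1 : (z y : ℕ) < s)
    (hy2 : s ≤ (w y : ℕ)) : Above J z x y ∧ Above J w y x := by
  have key : ∀ (z w : Perm (Fin n)), z ∈ permSet J → w ∈ permSet J → ∀ x, s ≤ (z x : ℕ) →
      (w x : ℕ) < s → Free J s x := by
    intro z w hz hw x h1 h2
    have := hz x
    have := hw x
    simp only [Fin.le_def] at *
    constructor
    · intro hJ; have := (hw x).1 hJ; omega
    · intro hJ; by_contra hc; have := (hz x).2 hc; omega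
  have h1 := key z w hz hw x hx1 hx2
  have h2 := key w z hw hz y hy2 hy1
  exact ⟨⟨s, h1, h2, hy1, hx1⟩, ⟨s, h2, h1, hx2, hy2⟩⟩

theorem exists_lt_of_cut (z w : Perm (Fin n)) {s : ℕ} {x : Fin n} (hx1 : s ≤ (z x : ℕ))
    (hx2 : (w x : ℕ) < s) : ∃ y, (z y : ℕ) < s ∧ s ≤ (w y : ℕ) := by
  by_contra hc
  push Not at hc
  -- otherwise `w⁻¹ (values ≥ s)` is a proper subset of `z⁻¹ (values ≥ s)`
  have key : ∀ z : Perm (Fin n), (Finset.univ.filter fun a => s ≤ (z a : ℕ)).card =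
      (Finset.univ.filter fun a : Fin n => s ≤ (a : ℕ)).card := by
    intro z
    refine Finset.card_bij (fun a _ => z a) ?_ ?_ ?_
    · intro a ha; simpa using ha
    · intro a _ b _ h; exact z.injective h
    · intro b hb; exact ⟨z.symm b, by simpa using hb, by simp⟩
  have hss : (Finset.univ.filter fun a => s ≤ (w a : ℕ)) ⊂
      Finset.univ.filter fun a => s ≤ (z a : ℕ) := by
    refine Finset.ssubset_iff_subset_ne.2 ⟨?_, ?_⟩
    · intro a ha
      simp only [Finset.mem_filter, Finset.mem_univ, true_and] at ha ⊢
      by_contra h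
      exact absurd ha (not_le.2 (hc a (not_le.1 h)))
    · intro h
      have : x ∈ Finset.univ.filter fun a => s ≤ (w a : ℕ) := by
        rw [h]; simpa using hx1
      simp only [Finset.mem_filter, Finset.mem_univ, true_and] at this
      omega
  have := Finset.card_lt_card hss
  rw [key, key] at this
  exact lt_irrefl _ this

theorem exists_ge_of_cut (z w : Perm (Fin n)) {s : ℕ} {x : Fin n} (hx1 : (z x : ℕ) < s)
    (hx2 : s ≤ (w x : ℕ)) : ∃ y, s ≤ (z y : ℕ) ∧ (w y : ℕ) < s := by
  obtain ⟨y, h1, h2⟩ := exists_lt_of_cut w z hx2 hx1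
  exact ⟨y, h2, h1⟩

/-- A maximizer `w` moves a position `x` of another maximizer `z` only if `x` is tied to, and
exchangeable with, another position. -/
theorem exists_tie_of_ne {c : Fin n → ℝ} {z w : Perm (Fin n)} (hz : z ∈ maxSet J c)
    (hw : w ∈ maxSet J c) {x : Fin n} (h : w x ≠ z x) :
    ∃ y, c x = c y ∧ (Above J z x y ∨ Above J z y x) := by
  rcases lt_or_gt_of_ne h with h | h
  · obtain ⟨y, h1, h2⟩ := exists_lt_of_cut z w (s := z x) le_rfl (Fin.lt_def.1 h)
    obtain ⟨h3, h4⟩ := above_of_cut hz.1 hw.1 le_rfl (Fin.lt_def.1 h) h1 h2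
    exact ⟨y, le_antisymm (le_of_mem_maxSet hw h4) (le_of_mem_maxSet hz h3), .inl h3⟩
  · obtain ⟨y, h1, h2⟩ := exists_ge_of_cut z w (s := w x) (Fin.lt_def.1 h) le_rfl
    obtain ⟨h3, h4⟩ := above_of_cut hz.1 hw.1 h1 h2 (Fin.lt_def.1 h) le_rfl
    exact ⟨y, le_antisymm (le_of_mem_maxSet hz h3) (le_of_mem_maxSet hw h4), .inr h3⟩

/-- Inside the value interval of an exchangeable tied pair there is a tied pair whose exchange stays
in `permSet J`. -/
theorem exists_swap_of_tie {c : Fin n → ℝ} {z : Perm (Fin n)} (hz : z ∈ maxSet J c) :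
    ∀ {x y : Fin n}, Above J z x y → c x = c y →
      ∃ x' y', Above J z x' y' ∧ c x' = c y' ∧ z y ≤ z y' ∧ z x' ≤ z x ∧
        z * swap x' y' ∈ maxSet J c := by
  suffices H : ∀ (m : ℕ) (x y : Fin n), (z x : ℕ) - z y ≤ m → Above J z x y → c x = c y →
      ∃ x' y', Above J z x' y' ∧ c x' = c y' ∧ z y ≤ z y' ∧ z x' ≤ z x ∧
        z * swap x' y' ∈ maxSet J c from fun {_ _} h => H _ _ _ le_rfl h
  intro m
  induction m with
  | zero =>
    intro x y hm h
    have := Fin.lt_def.1 h.lt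
    omega
  | succ m ih =>
    intro x y hm h hc
    by_cases hs : z * swap x y ∈ permSet J
    · exact ⟨x, y, h, hc, le_rfl, le_rfl, mul_swap_mem_maxSet hz h.ne hs hc⟩
    · obtain ⟨w, h1, h2, h3, h4⟩ := h.exists_between hz.1 hs
      have h5 := le_of_mem_maxSet hz h3
      have h6 := le_of_mem_maxSet hz h4
      obtain ⟨x', y', ha, hb, hc', hd, he⟩ :=
        ih x w (by rw [Fin.lt_def] at h1 h2; omega) h3 (by linarith)
      exact ⟨x', y', ha, hb, h1.le.trans hc', hd, he⟩

/-- A permutation that puts larger values, at every cut, on free positions of larger coefficient is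
a maximizer. -/
theorem mem_maxSet_of_greedy {c : Fin n → ℝ} {z : Perm (Fin n)} (hz : z ∈ permSet J)
    (h : ∀ x y, Above J z x y → c y ≤ c x) : z ∈ maxSet J c := by
  refine ⟨hz, fun w hw => ?_⟩
  have hlayer : ∀ z : Perm (Fin n), weight c z =
      ∑ s ∈ Finset.Icc 1 n, ∑ x, c x * (if s ≤ (z x : ℕ) then 1 else 0) := by
    intro z
    rw [Finset.sum_comm]
    refine Finset.sum_congr rfl fun x _ => ?_
    rw [← Finset.mul_sum, Finset.sum_boole]
    congr 2
    have : (Finset.Icc 1 n).filter (fun s => s ≤ (z x : ℕ)) = Finset.Icc 1 (z x : ℕ) := by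
      ext s
      have := (z x).isLt
      simp only [Finset.mem_filter, Finset.mem_Icc]
      omega
    rw [this]
    simp
  rw [hlayer, hlayer]
  refine Finset.sum_le_sum fun s _ => ?_
  rw [← sub_nonneg, ← Finset.sum_sub_distrib]
  have hcard : ∀ z : Perm (Fin n), ∑ x, (if s ≤ (z x : ℕ) then (1 : ℝ) else 0) =
      ∑ x : Fin n, if s ≤ (x : ℕ) then (1 : ℝ) else 0 := fun z =>
    Equiv.sum_comp z fun x : Fin n => if s ≤ (x : ℕ) then (1 : ℝ) else 0
  -- a coefficient that separates the positions that leave from those that enter at the cut `s`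
  obtain ⟨m, hm1, hm2⟩ : ∃ m : ℝ, (∀ x, s ≤ (z x : ℕ) → (w x : ℕ) < s → m ≤ c x) ∧
      ∀ y, (z y : ℕ) < s → s ≤ (w y : ℕ) → c y ≤ m := by
    by_cases hex : ∃ y, (z y : ℕ) < s ∧ s ≤ (w y : ℕ)
    · let S := Finset.univ.filter fun y => (z y : ℕ) < s ∧ s ≤ (w y : ℕ)
      obtain ⟨y0, hy0⟩ := hex
      obtain ⟨y, hy, hmax⟩ := S.exists_max_image c ⟨y0, by simpa [S] using hy0⟩
      have hy' : (z y : ℕ) < s ∧ s ≤ (w y : ℕ) := by simpa [S] using hy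
      refine ⟨c y, fun x h1 h2 => h x y (above_of_cut hz hw h1 h2 hy'.1 hy'.2).1, ?_⟩
      exact fun y' h1 h2 => hmax y' (by simp [S, h1, h2])
    · push Not at hex
      by_cases hex' : ∃ x, s ≤ (z x : ℕ) ∧ (w x : ℕ) < s
      · obtain ⟨x, h1, h2⟩ := hex'
        obtain ⟨y, h3, h4⟩ := exists_lt_of_cut z w h1 h2
        exact absurd h4 (not_le.2 (hex y h3))
      · push Not at hex'
        exact ⟨0, fun x h1 h2 => absurd (hex' x h1) (not_le.2 h2),
          fun y h1 h2 => absurd h2 (not_le.2 (hex y h1))⟩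
  have hzero : ∑ x, m * ((if s ≤ (z x : ℕ) then (1 : ℝ) else 0) -
      (if s ≤ (w x : ℕ) then (1 : ℝ) else 0)) = 0 := by
    rw [← Finset.mul_sum, Finset.sum_sub_distrib, hcard z, hcard w, sub_self, mul_zero]
  refine hzero.symm.le.trans (Finset.sum_le_sum fun x _ => ?_)
  by_cases h1 : s ≤ (z x : ℕ) <;> by_cases h2 : s ≤ (w x : ℕ) <;> simp only [h1, h2, if_true, if_false]
  · linarith
  · have := hm1 x h1 (not_le.1 h2); linarith
  · have := hm2 x (not_le.1 h1) h2; linarith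
  · linarith

end BridgePolytope

namespace BridgePolytope

open Equiv

variable {n : ℕ} {J : Finset (Fin n)}

/-! ### Faces and edges of the bridge polytope -/

theorem permPoint_injective : Function.Injective (permPoint (n := n)) := by
  intro z w h
  ext x
  have := congrFun h x
  simp only [permPoint, add_left_inj, Nat.cast_inj] at this
  exact this

theorem one_mem_permSet (J : Finset (Fin n)) : (1 : Perm (Fin n)) ∈ permSet J := by
  intro j
  simp

/-- The linear functional with coefficients `c`. -/
noncomputable def functional (c : Fin n → ℝ) : StrongDual ℝ (Fin n → ℝ) :=
  ∑ x, c x • ContinuousLinearMap.proj (R := ℝ) (φ := fun _ : Fin n => ℝ) x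

theorem functional_apply (c v : Fin n → ℝ) : functional c v = ∑ x, c x * v x := by
  simp [functional]

theorem exists_functional (l : StrongDual ℝ (Fin n → ℝ)) : ∃ c, l = functional c := by
  refine ⟨fun x => l (Pi.single x 1), ?_⟩
  ext v
  rw [functional_apply]
  conv_lhs => rw [pi_eq_sum_univ' v]
  rw [map_sum]
  refine Finset.sum_congr rfl fun x _ => ?_
  rw [map_smul, smul_eq_mul, mul_comm]

theorem functional_permPoint (c : Fin n → ℝ) (z : Perm (Fin n)) :
    functional c (permPoint z) = weight c z + ∑ x, c x := by
  rw [functional_apply, weight, ← Finset.sum_add_distrib]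
  refine Finset.sum_congr rfl fun x _ => ?_
  simp only [permPoint]
  ring

theorem permPoint_mem {z : Perm (Fin n)} (hz : z ∈ permSet J) : permPoint z ∈ bridgePolytope J :=
  subset_convexHull ℝ _ ⟨z, hz, rfl⟩

theorem permPoint_mem_toExposed {c : Fin n → ℝ} {z : Perm (Fin n)} (hz : z ∈ permSet J) :
    permPoint z ∈ (functional c).toExposed (bridgePolytope J) ↔ z ∈ maxSet J c := by
  constructor
  · rintro ⟨-, h⟩
    refine ⟨hz, fun w hw => ?_⟩
    have := h _ (permPoint_mem hw)
    rw [functional_permPoint, functional_permPoint] at this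
    linarith
  · rintro ⟨-, h⟩
    refine ⟨permPoint_mem hz, fun y hy => ?_⟩
    have hconv : Convex ℝ {y | functional c y ≤ functional c (permPoint z)} :=
      convex_halfSpace_le (functional c).toLinearMap.isLinear _
    refine convexHull_min ?_ hconv hy
    rintro _ ⟨w, hw, rfl⟩
    have := h w hw
    simp only [Set.mem_ofPred_eq, functional_permPoint]
    linarith

theorem isCompact_bridgePolytope (J : Finset (Fin n)) : IsCompact (bridgePolytope J) :=
  Set.Finite.isCompact_convexHull ℝ ((Set.toFinite _).image _)

theorem toExposed_eq (c : Fin n → ℝ) :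
    (functional c).toExposed (bridgePolytope J) = convexHull ℝ (permPoint '' maxSet J c) := by
  have hexp : IsExposed ℝ (bridgePolytope J) ((functional c).toExposed (bridgePolytope J)) :=
    ContinuousLinearMap.toExposed.isExposed
  have hconv := hexp.convex (convex_convexHull ℝ _)
  apply Set.Subset.antisymm
  · have hcomp := hexp.isCompact (isCompact_bridgePolytope J)
    rw [← closure_convexHull_extremePoints hcomp hconv]
    have hfin : (permPoint '' maxSet J c).Finite := (Set.toFinite _).image _
    refine closure_minimal (convexHull_mono ?_) (hfin.isCompact_convexHull ℝ).isClosed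
    intro x hx
    obtain ⟨z, hz, rfl⟩ := extremePoints_convexHull_subset
      (hexp.isExtreme.extremePoints_subset_extremePoints hx)
    exact ⟨z, (permPoint_mem_toExposed hz).1 hx.1, rfl⟩
  · refine convexHull_min ?_ hconv
    rintro _ ⟨z, hz, rfl⟩
    exact (permPoint_mem_toExposed hz.1).2 hz

theorem exists_maxSet_of_isExposed {F : Set (Fin n → ℝ)} (hF : IsExposed ℝ (bridgePolytope J) F)
    (hne : F.Nonempty) : ∃ c, F = convexHull ℝ (permPoint '' maxSet J c) ∧
      ∀ z ∈ permSet J, permPoint z ∈ F ↔ z ∈ maxSet J c := by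
  obtain ⟨l, hl⟩ := hF hne
  obtain ⟨c, rfl⟩ := exists_functional l
  have hF' : F = (functional c).toExposed (bridgePolytope J) := hl
  refine ⟨c, by rw [hF', toExposed_eq], fun z hz => ?_⟩
  rw [hF', permPoint_mem_toExposed hz]

theorem isExposed_convexHull_maxSet (c : Fin n → ℝ) :
    IsExposed ℝ (bridgePolytope J) (convexHull ℝ (permPoint '' maxSet J c)) := by
  rw [← toExposed_eq]
  exact ContinuousLinearMap.toExposed.isExposed

theorem eq_or_eq_mul_swap {u w : Perm (Fin n)} {x y : Fin n}
    (h : ∀ q, q ≠ x → q ≠ y → w q = u q) : w = u ∨ w = u * swap x y := by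
  -- the permutation `u⁻¹ w` fixes everything off `x` and `y`
  have key : ∀ q, q ≠ x → q ≠ y → (u⁻¹ * w) q = q := by
    intro q hx hy
    rw [Perm.mul_apply, h q hx hy]
    exact u.symm_apply_apply q
  have hcase : ∀ q, (u⁻¹ * w) q ≠ q → (u⁻¹ * w) q = x ∨ (u⁻¹ * w) q = y := by
    intro q hq
    by_contra hc
    push Not at hc
    exact hq ((u⁻¹ * w).injective (key _ hc.1 hc.2))
  have hgoal : u⁻¹ * w = 1 ∨ u⁻¹ * w = swap x y := by
    generalize u⁻¹ * w = g at key hcase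
    by_cases hx : g x = x
    · left
      ext1 q
      by_cases hqx : q = x
      · rw [hqx, hx]; rfl
      by_cases hqy : q = y
      · rw [hqy]
        by_contra hne
        rcases hcase y hne with h1 | h1
        · rw [← hx] at h1
          have := g.injective h1
          rw [hqy] at hqx
          exact hqx this
        · exact hne h1
      · exact key q hqx hqy
    · right
      have hxy : g x = y := (hcase x hx).resolve_left hx
      have hyx : g y = x := by
        by_cases hy : g y = y
        · exact absurd (g.injective (hxy.trans hy.symm)) fun h => hx (by rw [h] at hxy ⊢; exact hxy)
        · exact (hcase y hy).resolve_right hy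
      ext1 q
      by_cases hqx : q = x
      · rw [hqx, hxy, swap_apply_left]
      by_cases hqy : q = y
      · rw [hqy, hyx, swap_apply_right]
      · rw [key q hqx hqy, swap_apply_of_ne_of_ne hqx hqy]
  rcases hgoal with h | h
  · left; exact (inv_mul_eq_one.1 h).symm
  · right; rw [← h, mul_inv_cancel_left]

/-- A position that is not fixed and whose value lies between those of an exchangeable tied pair is
tied with the pair. -/
theorem tie_of_between {c : Fin n → ℝ} {u : Perm (Fin n)} (hu : u ∈ maxSet J c) {x y : Fin n}
    (hs : u * swap x y ∈ permSet J) (hc : c x = c y) {q : Fin n} (h1 : u y < u q) (h2 : u q < u x)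
    (hq : u q ≠ q) : c x = c q ∧ Above J u x q ∧ Above J u q y := by
  have hf := free_of_ne hu.1 hq
  rw [Fin.lt_def] at h1 h2
  have ha : Above J u x q := ⟨u q + 1,
    (free_of_mul_swap_mem hu.1 hs (by omega) (by omega)).1, hf.2, by omega, by omega⟩
  have hb : Above J u q y := ⟨u q, hf.1,
    (free_of_mul_swap_mem hu.1 hs (by omega) (by omega)).2, by omega, le_rfl⟩
  have h3 := le_of_mem_maxSet hu ha
  have h4 := le_of_mem_maxSet hu hb
  exact ⟨by linarith, ha, hb⟩

theorem mul_swap_inj {u : Perm (Fin n)} {x y x' y' : Fin n} (h : u * swap x y = u * swap x' y')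
    (h1 : u y < u x) (h2 : u y' < u x') : x = x' ∧ y = y' := by
  have h' : swap x y = swap x' y' := mul_left_cancel h
  have hxy : x ≠ y := by rintro rfl; exact lt_irrefl _ h1
  have hx : swap x' y' x = y := by rw [← h', swap_apply_left]
  by_cases ha : x = x'
  · subst ha
    rw [swap_apply_left] at hx
    exact ⟨rfl, hx.symm⟩
  · by_cases hb : x = y'
    · subst hb
      rw [swap_apply_right] at hx
      subst hx
      exact absurd h1 (lt_asymm h2)
    · rw [swap_apply_of_ne_of_ne ha hb] at hx
      exact absurd hx hxy

/-- Along an edge of the bridge polytope two values are exchanged, and every value strictly between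
them is a fixed point. -/
theorem exists_swap_of_adj {u v : Perm (Fin n)} (h : (skeleton J).Adj u v) :
    ∃ x y, u y < u x ∧ v = u * swap x y ∧ ∀ q, u y < u q → u q < u x → u q = q := by
  obtain ⟨hne, hu, hv, hexp⟩ := h
  obtain ⟨c, -, hc⟩ := exists_maxSet_of_isExposed hexp ⟨_, left_mem_segment ℝ _ _⟩
  have hu' := (hc u hu).1 (left_mem_segment ℝ _ _)
  have hv' := (hc v hv).1 (right_mem_segment ℝ _ _)
  -- an exchange inside the edge moves along the line through `u` and `v`
  have key : ∀ x y, u y < u x → u * swap x y ∈ maxSet J c → v = u * swap x y := by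
    intro x y hlt hs
    have hseg := (hc _ hs.1).2 hs
    rw [segment_eq_image'] at hseg
    obtain ⟨t, -, ht⟩ := hseg
    beta_reduce at ht
    have hxy : x ≠ y := by rintro rfl; exact lt_irrefl _ hlt
    have ht0 : t ≠ 0 := by
      rintro rfl
      rw [zero_smul, add_zero] at ht
      have := congrArg (fun z => z x) (permPoint_injective ht)
      simp only [Perm.mul_apply, swap_apply_left] at this
      exact hxy (u.injective this)
    refine (eq_or_eq_mul_swap fun q hx hy => ?_).resolve_left hne.symm
    have hq := congrFun ht q
    simp only [permPoint, Pi.add_apply, Pi.smul_apply, Pi.sub_apply, smul_eq_mul, Perm.mul_apply,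
      swap_apply_of_ne_of_ne hx hy] at hq
    have : t * (((v q : ℕ) : ℝ) - ((u q : ℕ) : ℝ)) = 0 := by linarith
    have := (mul_eq_zero.1 this).resolve_left ht0
    apply Fin.ext
    have h' : ((v q : ℕ) : ℝ) = ((u q : ℕ) : ℝ) := by linarith
    exact_mod_cast h'
  obtain ⟨x0, hx0⟩ : ∃ x0, v x0 ≠ u x0 := by
    by_contra hcon
    push Not at hcon
    exact hne (Equiv.ext fun q => (hcon q).symm)
  have hpair : ∃ x y, Above J u x y ∧ c x = c y := by
    obtain ⟨y0, hy0, h | h⟩ := exists_tie_of_ne hu' hv' hx0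
    · exact ⟨x0, y0, h, hy0⟩
    · exact ⟨y0, x0, h, hy0.symm⟩
  obtain ⟨x0, y0, ha, hxy0⟩ := hpair
  obtain ⟨x, y, ha, hcxy, -, -, hs⟩ := exists_swap_of_tie hu' ha hxy0
  have hv := key x y ha.lt hs
  refine ⟨x, y, ha.lt, hv, fun q h1 h2 => ?_⟩
  by_contra hq
  obtain ⟨h3, h4, -⟩ := tie_of_between hu' hs.1 hcxy h1 h2 hq
  obtain ⟨x', y', ha', -, h5, -, hs'⟩ := exists_swap_of_tie hu' h4 h3
  have hv' := key x' y' ha'.lt hs'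
  obtain ⟨-, rfl⟩ := mul_swap_inj (hv.symm.trans hv') ha.lt ha'.lt
  exact absurd h1 (not_lt.2 h5)

/-- An allowed exchange of two values such that all values in between are fixed points is an edge:
it is the only one that keeps the functional built from the midpoint of the two values maximal. -/
theorem adj_mul_swap {u : Perm (Fin n)} (hu : u ∈ permSet J) {x y : Fin n} (hlt : u y < u x)
    (hs : u * swap x y ∈ permSet J) (hfix : ∀ q, u y < u q → u q < u x → u q = q) :
    (skeleton J).Adj u (u * swap x y) := by
  have hxy : x ≠ y := by rintro rfl; exact lt_irrefl _ hlt
  have hlt' : ((u y : ℕ) : ℝ) < ((u x : ℕ) : ℝ) := by exact_mod_cast Fin.lt_def.1 hlt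
  classical
  set c : Fin n → ℝ := fun q =>
    if q = x ∨ q = y then (((u x : ℕ) : ℝ) + ((u y : ℕ) : ℝ)) / 2
    else if u y < u q ∧ u q < u x then (if q ∈ J then ((u y : ℕ) : ℝ) else ((u x : ℕ) : ℝ))
    else ((u q : ℕ) : ℝ) with hcdef
  set m : ℝ := (((u x : ℕ) : ℝ) + ((u y : ℕ) : ℝ)) / 2 with hm
  have hcx : c x = m := by simp [hcdef]
  have hcy : c y = m := by simp [hcdef]
  have hne_val : ∀ q p, q ≠ p → (u q : ℕ) ≠ u p := fun q p h h' => h (u.injective (Fin.ext h'))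
  -- positions of value at least `s`
  have hup : ∀ p (s : ℕ), Free J s p → s ≤ (u p : ℕ) → (s ≤ (u y : ℕ) ∨ (u x : ℕ) < s → (s : ℝ) ≤ c p) ∧
      ((u y : ℕ) < s → s ≤ (u x : ℕ) → m ≤ c p ∧ (c p = m → p = x)) := by
    intro p s hf hp
    have hp' : (s : ℝ) ≤ ((u p : ℕ) : ℝ) := by exact_mod_cast hp
    by_cases hpx : p = x
    · subst hpx
      rw [hcx]
      refine ⟨?_, fun _ _ => ⟨le_rfl, fun _ => rfl⟩⟩
      rintro (h | h)
      · have : (s : ℝ) ≤ ((u y : ℕ) : ℝ) := by exact_mod_cast h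
        linarith
      · omega
    by_cases hpy : p = y
    · subst hpy
      rw [hcy]
      refine ⟨fun _ => by linarith, fun h => by omega⟩
    by_cases hb : u y < u p ∧ u p < u x
    · have hcp : c p = if p ∈ J then ((u y : ℕ) : ℝ) else ((u x : ℕ) : ℝ) := by
        simp only [hcdef]
        rw [if_neg (by tauto), if_pos hb]
      have hfx := hfix p hb.1 hb.2
      rw [Fin.lt_def, Fin.lt_def] at hb
      constructor
      · rintro (h | h)
        · have : (s : ℝ) ≤ ((u y : ℕ) : ℝ) := by exact_mod_cast h
          rw [hcp]; split_ifs <;> linarith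
        · omega
      · intro h1 h2
        have hpJ : p ∉ J := fun h => by
          have := hf.1 h
          rw [hfx] at hp
          omega
        rw [hcp, if_neg hpJ]
        exact ⟨by linarith, fun h => by linarith⟩
    · have hcp : c p = ((u p : ℕ) : ℝ) := by
        simp only [hcdef]
        rw [if_neg (by tauto), if_neg hb]
      rw [hcp]
      refine ⟨fun _ => hp', fun h1 h2 => ?_⟩
      have h3 := hne_val p x hpx
      rw [Fin.lt_def, Fin.lt_def] at hb
      have : ((u x : ℕ) : ℝ) < ((u p : ℕ) : ℝ) := by
        have : (u x : ℕ) < u p := by omega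
        exact_mod_cast this
      exact ⟨by linarith, fun h => by linarith⟩
  -- positions of value less than `s`
  have hdown : ∀ p (s : ℕ), Free J s p → (u p : ℕ) < s →
      (s ≤ (u y : ℕ) ∨ (u x : ℕ) < s → c p < s) ∧
      ((u y : ℕ) < s → s ≤ (u x : ℕ) → c p ≤ m ∧ (c p = m → p = y)) := by
    intro p s hf hp
    have hp' : ((u p : ℕ) : ℝ) < s := by exact_mod_cast hp
    by_cases hpx : p = x
    · subst hpx
      rw [hcx]
      refine ⟨fun _ => by linarith, fun h => by omega⟩
    by_cases hpy : p = y
    · subst hpy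
      rw [hcy]
      refine ⟨?_, fun _ _ => ⟨le_rfl, fun _ => rfl⟩⟩
      rintro (h | h)
      · omega
      · have : ((u x : ℕ) : ℝ) < (s : ℝ) := by exact_mod_cast h
        linarith
    by_cases hb : u y < u p ∧ u p < u x
    · have hcp : c p = if p ∈ J then ((u y : ℕ) : ℝ) else ((u x : ℕ) : ℝ) := by
        simp only [hcdef]
        rw [if_neg (by tauto), if_pos hb]
      have hfx := hfix p hb.1 hb.2
      rw [Fin.lt_def, Fin.lt_def] at hb
      constructor
      · rintro (h | h)
        · omega
        · have : ((u x : ℕ) : ℝ) < (s : ℝ) := by exact_mod_cast h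
          rw [hcp]; split_ifs <;> linarith
      · intro h1 h2
        have hpJ : p ∈ J := hf.2 (by rw [hfx] at hp; exact hp)
        rw [hcp, if_pos hpJ]
        exact ⟨by linarith, fun h => by linarith⟩
    · have hcp : c p = ((u p : ℕ) : ℝ) := by
        simp only [hcdef]
        rw [if_neg (by tauto), if_neg hb]
      rw [hcp]
      refine ⟨fun _ => hp', fun h1 h2 => ?_⟩
      have h3 := hne_val p y hpy
      rw [Fin.lt_def, Fin.lt_def] at hb
      have : ((u p : ℕ) : ℝ) < ((u y : ℕ) : ℝ) := by
        have : (u p : ℕ) < u y := by omega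
        exact_mod_cast this
      exact ⟨by linarith, fun h => by linarith⟩
  have hgreedy : ∀ p q, Above J u p q → c q ≤ c p ∧ (c p = c q → p = x ∧ q = y) := by
    rintro p q ⟨s, hfp, hfq, hq, hp⟩
    have h1 := hup p s hfp hp
    have h2 := hdown q s hfq hq
    by_cases h : s ≤ (u y : ℕ) ∨ (u x : ℕ) < s
    · have := h1.1 h
      have := h2.1 h
      exact ⟨by linarith, fun h => by linarith⟩
    · push Not at h
      obtain ⟨h3, h4⟩ := h1.2 h.1 h.2
      obtain ⟨h5, h6⟩ := h2.2 h.1 h.2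
      exact ⟨by linarith, fun h => ⟨h4 (by linarith), h6 (by linarith)⟩⟩
  have hu' : u ∈ maxSet J c := mem_maxSet_of_greedy hu fun p q h => (hgreedy p q h).1
  have hs' : u * swap x y ∈ maxSet J c := mul_swap_mem_maxSet hu' hxy hs (by rw [hcx, hcy])
  have hmax : maxSet J c = {u, u * swap x y} := by
    apply Set.Subset.antisymm
    · intro w hw
      refine eq_or_eq_mul_swap fun q hqx hqy => ?_
      by_contra hne
      obtain ⟨p, hcp, h | h⟩ := exists_tie_of_ne hu' hw hne
      · exact hqx ((hgreedy _ _ h).2 hcp).1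
      · exact hqy ((hgreedy _ _ h).2 hcp.symm).2
    · rintro w (rfl | rfl)
      · exact hu'
      · exact hs'
  refine ⟨fun h => hxy ?_, hu, hs, ?_⟩
  · have := congrArg (fun z => z x) h
    simp only [Perm.mul_apply, swap_apply_left] at this
    exact u.injective this
  · have := isExposed_convexHull_maxSet (J := J) c
    rwa [hmax, Set.image_pair, convexHull_pair] at this

/-- A maximizer with a tied pair is the end of an edge between maximizers. -/
theorem exists_adj_of_tie {c : Fin n → ℝ} {u : Perm (Fin n)} (hu : u ∈ maxSet J c)
    {x y : Fin n} (h : Above J u x y) (hc : c x = c y) :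
    ∃ v ∈ maxSet J c, (skeleton J).Adj u v := by
  suffices H : ∀ (m : ℕ) (x y : Fin n), (u x : ℕ) - u y ≤ m → Above J u x y → c x = c y →
      ∃ v ∈ maxSet J c, (skeleton J).Adj u v from H _ x y le_rfl h hc
  intro m
  induction m with
  | zero =>
    intro x y hm h
    have := Fin.lt_def.1 h.lt
    omega
  | succ m ih =>
    intro x y hm h hc
    obtain ⟨x', y', h1, h2, h3, h4, h5⟩ := exists_swap_of_tie hu h hc
    by_cases hfix : ∀ q, u y' < u q → u q < u x' → u q = q
    · exact ⟨_, h5, adj_mul_swap hu.1 h1.lt h5.1 hfix⟩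
    · push Not at hfix
      obtain ⟨q, hq1, hq2, hq3⟩ := hfix
      obtain ⟨h6, h7, -⟩ := tie_of_between hu h5.1 h2 hq1 hq2 hq3
      refine ih x' q ?_ h7 h6
      rw [Fin.lt_def] at hq1 hq2
      rw [Fin.le_def] at h3 h4
      omega

end BridgePolytope

namespace BridgePolytope

open Equiv

variable {n : ℕ} {J : Finset (Fin n)}

/-! ### Shortest paths and inversions -/

theorem schubertPerm_lt {x y : Fin n} (h : schubertPerm J x < schubertPerm J y) :
    (x ∈ J → y ∈ J ∧ x < y) ∧ (y ∉ J → x ∉ J ∧ x < y) := by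
  have hval : schubertVal J x < schubertVal J y := h
  have key : ∀ (S : Finset (Fin n)) (a b : Fin n), a ≤ b →
      (S.filter (· < a)).card ≤ (S.filter (· < b)).card := by
    intro S a b hab
    refine Finset.card_le_card fun z hz => ?_
    simp only [Finset.mem_filter] at hz ⊢
    exact ⟨hz.1, hz.2.trans_le hab⟩
  have low : ∀ a : Fin n, ((Jᶜ).filter (· < a)).card ≤ (Jᶜ).card := fun a =>
    Finset.card_filter_le _ _
  unfold schubertVal at hval
  by_cases hx : x ∈ J <;> by_cases hy : y ∈ J <;> simp only [hx, hy, if_true, if_false] at hval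
  · refine ⟨fun _ => ⟨hy, ?_⟩, fun h => absurd hy h⟩
    by_contra hc
    have := key J y x (not_lt.1 hc)
    omega
  · have := low y; omega
  · exact ⟨fun h => absurd h hx, fun h => absurd hy h⟩
  · refine ⟨fun h => absurd h hx, fun _ => ⟨hx, ?_⟩⟩
    by_contra hc
    have := key Jᶜ y x (not_lt.1 hc)
    omega

/-- The number of inversions of `z` relative to `schubertPerm J`. -/
noncomputable def inversions (J : Finset (Fin n)) (z : Perm (Fin n)) : ℤ :=
  ∑ p, ∑ q, if schubertPerm J p < schubertPerm J q ∧ z q < z p then 1 else 0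

theorem inversions_mul_swap {u : Perm (Fin n)} {x y : Fin n} (h1 : u y < u x)
    (h2 : schubertPerm J y < schubertPerm J x)
    (h3 : ∀ q, schubertPerm J y < schubertPerm J q → schubertPerm J q < schubertPerm J x →
      u y < u q → ¬ u q < u x) :
    inversions J (u * swap x y) = inversions J u + 1 := by
  have hxy : x ≠ y := by rintro rfl; exact lt_irrefl _ h1
  have hx : (u * swap x y) x = u y := by simp
  have hy : (u * swap x y) y = u x := by simp
  have hq : ∀ q, q ≠ x → q ≠ y → (u * swap x y) q = u q := fun q h h' => by
    rw [Perm.mul_apply, swap_apply_of_ne_of_ne h h']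
  set v := u * swap x y with hv
  set d : Fin n → Fin n → ℤ := fun p q =>
    (if schubertPerm J p < schubertPerm J q ∧ v q < v p then 1 else 0) -
      (if schubertPerm J p < schubertPerm J q ∧ u q < u p then 1 else 0) with hd
  have hdiff : inversions J v - inversions J u = ∑ p, ∑ q, d p q := by
    simp only [inversions, hd, Finset.sum_sub_distrib]
  classical
  let S : Finset (Fin n) := (Finset.univ.erase x).erase y
  have hsplit : ∀ f : Fin n → ℤ, ∑ p, f p = ∑ p ∈ S, f p + f x + f y := by
    intro f
    rw [← Finset.sum_erase_add _ _ (Finset.mem_univ x),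
      ← Finset.sum_erase_add _ _ (show y ∈ Finset.univ.erase x by simp [hxy.symm])]
    ring
  have hS : ∀ p ∈ S, p ≠ x ∧ p ≠ y := by
    intro p hp
    simp only [S, Finset.mem_erase, Finset.mem_univ, and_true] at hp
    exact ⟨hp.2, hp.1⟩
  have h0 : ∑ p ∈ S, ∑ q ∈ S, d p q = 0 :=
    Finset.sum_eq_zero fun p hp => Finset.sum_eq_zero fun q hq' => by
      simp only [hd]
      rw [hq p (hS p hp).1 (hS p hp).2, hq q (hS q hq').1 (hS q hq').2, sub_self]
  have h4 : ∑ p ∈ S, (d p x + d p y + d x p + d y p) = 0 := by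
    refine Finset.sum_eq_zero fun p hp => ?_
    have hne := hS p hp
    have e1 : (u p : ℕ) ≠ u x := fun h => hne.1 (u.injective (Fin.ext h))
    have e2 : (u p : ℕ) ≠ u y := fun h => hne.2 (u.injective (Fin.ext h))
    have e3 : (schubertPerm J p : ℕ) ≠ schubertPerm J x := fun h =>
      hne.1 ((schubertPerm J).injective (Fin.ext h))
    have e4 : (schubertPerm J p : ℕ) ≠ schubertPerm J y := fun h =>
      hne.2 ((schubertPerm J).injective (Fin.ext h))
    have e5 := h3 p
    simp only [hd, hq p hne.1 hne.2, hx, hy]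
    simp only [Fin.lt_def] at h1 h2 e5 ⊢
    generalize (u p : ℕ) = a at *
    generalize (u x : ℕ) = a1 at *
    generalize (u y : ℕ) = a2 at *
    generalize (schubertPerm J p : ℕ) = b at *
    generalize (schubertPerm J x : ℕ) = b1 at *
    generalize (schubertPerm J y : ℕ) = b2 at *
    rcases lt_or_gt_of_ne e1 with e1 | e1 <;> rcases lt_or_gt_of_ne e2 with e2 | e2 <;>
      rcases lt_or_gt_of_ne e3 with e3 | e3 <;> rcases lt_or_gt_of_ne e4 with e4 | e4 <;>
      first
      | (exfalso; omega)
      | simp [e1, e2, e3, e4, e1.not_gt, e2.not_gt, e3.not_gt, e4.not_gt]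
  have h5 : d x x = 0 ∧ d y y = 0 ∧ d x y = 0 ∧ d y x = 1 := by
    simp [hd, hx, hy, h1, h2, h2.not_gt, h1.not_gt]
  have h6 : ∑ p, ∑ q, d p q = 1 := by
    rw [hsplit]
    simp only [hsplit (fun q => d _ q)]
    simp only [Finset.sum_add_distrib] at h4 ⊢
    obtain ⟨a1, a2, a3, a4⟩ := h5
    rw [h0, a1, a2, a3, a4]
    linarith
  linarith

/-- A step along an edge in the direction away from `schubertPerm J`: the two positions change from
the order of `schubertPerm J` to the opposite one. -/
def IsUp (J : Finset (Fin n)) (u v : Perm (Fin n)) : Prop :=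
  ∃ x y, u y < u x ∧ schubertPerm J y < schubertPerm J x ∧ v = u * swap x y ∧
    ∀ q, u y < u q → u q < u x → u q = q

theorem isUp_or_isUp {u v : Perm (Fin n)} (h : (skeleton J).Adj u v) : IsUp J u v ∨ IsUp J v u := by
  obtain ⟨x, y, h1, rfl, h3⟩ := exists_swap_of_adj h
  have hxy : x ≠ y := by rintro rfl; exact lt_irrefl _ h1
  rcases lt_or_gt_of_ne ((schubertPerm J).injective.ne hxy) with h4 | h4
  · right
    refine ⟨y, x, by simpa using h1, h4, by rw [swap_comm y x, mul_assoc, swap_mul_self, mul_one],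
      fun q => ?_⟩
    simp only [Perm.mul_apply, swap_apply_left, swap_apply_right]
    intro h5 h6
    have hqx : q ≠ x := by
      rintro rfl
      rw [swap_apply_left] at h5
      exact lt_irrefl _ h5
    have hqy : q ≠ y := by
      rintro rfl
      rw [swap_apply_right] at h6
      exact lt_irrefl _ h6
    rw [swap_apply_of_ne_of_ne hqx hqy] at h5 h6 ⊢
    exact h3 q h5 h6
  · exact .inl ⟨x, y, h1, h4, rfl, h3⟩

/-- No fixed point lies between the exchanged positions and between the exchanged values. -/
theorem not_between {u : Perm (Fin n)} {x y : Fin n} (hv : u * swap x y ∈ permSet J)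
    {q : Fin n} (hq : u q = q) (h1 : schubertPerm J y < schubertPerm J q)
    (h2 : schubertPerm J q < schubertPerm J x) (h3 : u y < u q) : ¬ u q < u x := by
  intro h4
  rw [hq] at h3 h4
  by_cases hqJ : q ∈ J
  · obtain ⟨h5, h6⟩ := (schubertPerm_lt h2).1 hqJ
    have := (hv x).1 h5
    rw [Perm.mul_apply, swap_apply_left] at this
    exact absurd h6 (not_lt.2 (this.trans h3.le))
  · obtain ⟨h5, h6⟩ := (schubertPerm_lt h1).2 hqJ
    have := (hv y).2 h5
    rw [Perm.mul_apply, swap_apply_right] at this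
    exact absurd h6 (not_lt.2 (h4.le.trans this))

theorem IsUp.inversions_eq {u v : Perm (Fin n)} (h : IsUp J u v) (hv : v ∈ permSet J) :
    inversions J v = inversions J u + 1 := by
  obtain ⟨x, y, h1, h2, rfl, h3⟩ := h
  exact inversions_mul_swap h1 h2 fun q h4 h5 h6 h7 => not_between hv (h3 q h6 h7) h4 h5 h6 h7

/-- From every permutation but the identity there is a step up. -/
theorem exists_isUp {u : Perm (Fin n)} (hu : u ∈ permSet J) (hne : u ≠ 1) :
    ∃ v, (skeleton J).Adj u v ∧ IsUp J u v := by
  have main : ∀ (m : ℕ) (x y : Fin n), (u x : ℕ) - u y ≤ m → u y < u x →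
      schubertPerm J y < schubertPerm J x → u x ≠ x → u y ≠ y →
      ∃ v, (skeleton J).Adj u v ∧ IsUp J u v := by
    intro m
    induction m with
    | zero =>
      intro x y hm h
      rw [Fin.lt_def] at h
      omega
    | succ m ih =>
      intro x y hm h1 h2 hx hy
      by_cases hfix : ∀ q, u y < u q → u q < u x → u q = q
      · have hs : u * swap x y ∈ permSet J := by
          refine mul_swap_mem hu h1 (fun hJ => ?_) fun hJ => ?_
          · by_contra hc
            obtain ⟨q, hq⟩ := u.surjective x
            have hxlt : x < u x := lt_of_le_of_ne ((hu x).1 hJ) hx.symm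
            have := hfix q (by rw [hq]; exact not_le.1 hc) (by rw [hq]; exact hxlt)
            rw [hq] at this
            subst this
            exact hx hq
          · by_contra hc
            obtain ⟨q, hq⟩ := u.surjective y
            have hylt : u y < y := lt_of_le_of_ne ((hu y).2 hJ) hy
            have := hfix q (by rw [hq]; exact hylt) (by rw [hq]; exact not_le.1 hc)
            rw [hq] at this
            subst this
            exact hy hq
        exact ⟨_, adj_mul_swap hu h1 hs hfix, x, y, h1, h2, rfl, hfix⟩
      · push Not at hfix
        obtain ⟨q, hq1, hq2, hq3⟩ := hfix
        rcases lt_or_ge (schubertPerm J y) (schubertPerm J q) with h4 | h4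
        · exact ih q y (by rw [Fin.lt_def] at hq1 hq2; omega) hq1 h4 hq3 hy
        · exact ih x q (by rw [Fin.lt_def] at hq1 hq2; omega) hq2 (h4.trans_lt h2) hx hq3
  -- the greatest position that is not fixed, and the position that has it as value
  have hex : (Finset.univ.filter fun a => u a ≠ a).Nonempty := by
    by_contra hc
    rw [Finset.not_nonempty_iff_eq_empty, Finset.filter_eq_empty_iff] at hc
    exact hne (Equiv.ext fun q => not_not.1 (hc (Finset.mem_univ q)))
  obtain ⟨a, ha, hmax⟩ := Finset.exists_max_image _ id hex
  simp only [Finset.mem_filter, Finset.mem_univ, true_and, id] at ha hmax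
  obtain ⟨b, hb⟩ := u.surjective a
  have hba : b ≠ a := by rintro rfl; exact ha hb
  have hua : u a < a := lt_of_le_of_ne (hmax _ fun h => ha (u.injective h)) ha
  have haJ : a ∉ J := fun h => absurd hua (not_lt.2 ((hu a).1 h))
  refine main _ b a le_rfl (by rw [hb]; exact hua) ?_ (by rw [hb]; exact hba.symm) ha
  by_contra hc
  have hlt : schubertPerm J b < schubertPerm J a :=
    lt_of_le_of_ne (not_lt.1 hc) ((schubertPerm J).injective.ne hba)
  obtain ⟨h1, h2⟩ := (schubertPerm_lt hlt).2 haJ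
  have := (hu b).2 h1
  rw [hb] at this
  exact absurd h2 (not_lt.2 this)

theorem inversions_le (u : Perm (Fin n)) : inversions J u ≤ n * n := by
  unfold inversions
  calc _ ≤ ∑ _p : Fin n, ∑ _q : Fin n, (1 : ℤ) :=
        Finset.sum_le_sum fun p _ => Finset.sum_le_sum fun q _ => by split_ifs <;> simp
    _ = n * n := by simp

theorem exists_walk_to_one {u : Perm (Fin n)} (hu : u ∈ permSet J) :
    ∃ p : (skeleton J).Walk u 1, (p.length : ℤ) = inversions J 1 - inversions J u := by
  suffices H : ∀ (m : ℕ) (u : Perm (Fin n)), u ∈ permSet J → n * n - inversions J u ≤ m →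
      ∃ p : (skeleton J).Walk u 1, (p.length : ℤ) = inversions J 1 - inversions J u from
    H (n * n - inversions J u).toNat u hu (Int.self_le_toNat _)
  intro m
  induction m with
  | zero =>
    intro u hu hm
    by_cases hne : u = 1
    · subst hne; exact ⟨.nil, by simp⟩
    obtain ⟨v, hadj, hup⟩ := exists_isUp hu hne
    have h1 := hup.inversions_eq hadj.2.2.1
    have := inversions_le (J := J) v
    push_cast at hm
    omega
  | succ m ih =>
    intro u hu hm
    by_cases hne : u = 1
    · subst hne; exact ⟨.nil, by simp⟩
    obtain ⟨v, hadj, hup⟩ := exists_isUp hu hne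
    have h1 := hup.inversions_eq hadj.2.2.1
    obtain ⟨p, hp⟩ := ih v hadj.2.2.1 (by push_cast at hm; omega)
    refine ⟨.cons hadj p, ?_⟩
    rw [SimpleGraph.Walk.length_cons]
    push_cast
    omega

theorem inversions_le_length {u v : Perm (Fin n)} (p : (skeleton J).Walk u v) :
    inversions J v - inversions J u ≤ p.length ∧
      (inversions J v - inversions J u = p.length → ∀ d ∈ p.darts, IsUp J d.fst d.snd) := by
  induction p with
  | nil => simp
  | @cons u v w h p ih =>
    rw [SimpleGraph.Walk.length_cons]
    push_cast
    rcases isUp_or_isUp h with hup | hup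
    · have h1 := hup.inversions_eq h.2.2.1
      refine ⟨by omega, fun heq => ?_⟩
      simp only [SimpleGraph.Walk.darts_cons, List.mem_cons]
      rintro d (rfl | hd)
      · exact hup
      · exact ih.2 (by omega) d hd
    · have h1 := hup.inversions_eq h.2.1
      exact ⟨by omega, fun heq => by omega⟩

/-- All steps of a shortest path to the identity are steps up. -/
theorem isUp_of_shortest {u : Perm (Fin n)} (hu : u ∈ permSet J) (p : (skeleton J).Walk u 1)
    (hp : p.length = (skeleton J).dist u 1) : ∀ d ∈ p.darts, IsUp J d.fst d.snd := by
  obtain ⟨q, hq⟩ := exists_walk_to_one hu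
  have h1 := SimpleGraph.dist_le q
  have h2 := inversions_le_length p
  exact h2.2 (by omega)

end BridgePolytope

namespace BridgePolytope

open Equiv

variable {n : ℕ} {J : Finset (Fin n)}

/-! ### Labels along paths of steps up -/

theorem edgeLabel_eq (d : (skeleton J).Dart) {x y : Fin n} (h : d.fst y < d.fst x)
    (hd : d.snd = d.fst * swap x y) : edgeLabel d = ⟨d.fst y, d.fst x, h⟩ := by
  have hxy : d.fst x ≠ d.fst y := h.ne'
  have hs : swapped d = {d.fst x, d.fst y} := by
    rw [swapped, hd, mul_swap_eq_swap_mul, mul_inv_cancel_right, Perm.support_swap hxy]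
  have hmin : ∀ hne, (swapped d).min' hne = d.fst y := by
    rw [hs]
    intro hne
    refine le_antisymm (Finset.min'_le _ _ (by simp)) (Finset.le_min' _ _ _ fun z hz => ?_)
    rcases Finset.mem_insert.1 hz with rfl | hz
    · exact h.le
    · rw [Finset.mem_singleton.1 hz]
  have hmax : ∀ hne, (swapped d).max' hne = d.fst x := by
    rw [hs]
    intro hne
    refine le_antisymm (Finset.max'_le _ _ _ fun z hz => ?_) (Finset.le_max' _ _ (by simp))
    rcases Finset.mem_insert.1 hz with rfl | hz
    · exact le_rfl
    · rw [Finset.mem_singleton.1 hz]; exact h.le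
  unfold edgeLabel
  simp only [hmin, hmax]

/-- `v` arises from `u` by a step up along an edge with label `b`. -/
def Step (J : Finset (Fin n)) (u v : Perm (Fin n)) (b : Bridge n) : Prop :=
  u ∈ permSet J ∧ v ∈ permSet J ∧ ∃ (x y : Fin n) (h : u y < u x),
    schubertPerm J y < schubertPerm J x ∧ v = u * swap x y ∧
    (∀ q, u y < u q → u q < u x → u q = q) ∧ b = ⟨u y, u x, h⟩

/-- There is a path of steps up from `u` to `v` with the given labels, all of whose vertices after
`u` are in `M`. -/
inductive UpPath (J : Finset (Fin n)) (M : Set (Perm (Fin n))) :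
    Perm (Fin n) → Perm (Fin n) → List (Bridge n) → Prop
  | nil (u) : UpPath J M u u []
  | cons {u u' v b l} : Step J u u' b → u' ∈ M → UpPath J M u' v l → UpPath J M u v (b :: l)

theorem step_of_dart (d : (skeleton J).Dart) (h : IsUp J d.fst d.snd) :
    Step J d.fst d.snd (edgeLabel d) := by
  obtain ⟨x, y, h1, h2, h3, h4⟩ := h
  exact ⟨d.adj.2.1, d.adj.2.2.1, x, y, h1, h2, h3, h4, edgeLabel_eq d h1 h3⟩

theorem upPath_of_walk {M : Set (Perm (Fin n))} {u v : Perm (Fin n)} (p : (skeleton J).Walk u v)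
    (h : ∀ d ∈ p.darts, IsUp J d.fst d.snd ∧ d.snd ∈ M) :
    UpPath J M u v (p.darts.map edgeLabel) := by
  induction p with
  | nil => exact .nil _
  | cons hadj p ih =>
    rw [SimpleGraph.Walk.darts_cons, List.map_cons]
    simp only [SimpleGraph.Walk.darts_cons, List.mem_cons, forall_eq_or_imp] at h
    exact .cons (step_of_dart ⟨(_, _), hadj⟩ h.1.1) h.1.2 (ih h.2)

theorem Step.inversions_eq {u v : Perm (Fin n)} {b : Bridge n} (h : Step J u v b) :
    inversions J v = inversions J u + 1 := by
  obtain ⟨-, hv, x, y, h1, h2, h3, h4, -⟩ := h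
  exact IsUp.inversions_eq ⟨x, y, h1, h2, h3, h4⟩ hv

/-- Fixed points are not moved by steps up. -/
theorem Step.fixed {u v : Perm (Fin n)} {b : Bridge n} (h : Step J u v b) {q : Fin n}
    (hq : u q = q) : v q = q ∧ q ≠ b.left ∧ q ≠ b.right := by
  obtain ⟨-, hv, x, y, h1, h2, rfl, -, rfl⟩ := h
  have hx := hv x
  have hy := hv y
  rw [Perm.mul_apply, swap_apply_left] at hx
  rw [Perm.mul_apply, swap_apply_right] at hy
  have hqx : q ≠ x := by
    rintro rfl
    rw [hq] at hy h1
    by_cases hJ : q ∈ J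
    · exact absurd (hx.1 hJ) (not_le.2 h1)
    · obtain ⟨h3, h4⟩ := (schubertPerm_lt h2).2 hJ
      exact absurd (hy.2 h3) (not_le.2 h4)
  have hqy : q ≠ y := by
    rintro rfl
    rw [hq] at hx h1
    by_cases hJ : q ∈ J
    · obtain ⟨h3, h4⟩ := (schubertPerm_lt h2).1 hJ
      exact absurd (hx.1 h3) (not_le.2 h4)
    · exact absurd (hy.2 hJ) (not_le.2 h1)
  refine ⟨by rw [Perm.mul_apply, swap_apply_of_ne_of_ne hqx hqy, hq], ?_, ?_⟩
  · change q ≠ u y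
    rw [← hq]
    exact u.injective.ne (hq.symm ▸ hqy)
  · change q ≠ u x
    rw [← hq]
    exact u.injective.ne (hq.symm ▸ hqx)

theorem UpPath.fixed {M : Set (Perm (Fin n))} {u v : Perm (Fin n)} {l : List (Bridge n)}
    (h : UpPath J M u v l) {q : Fin n} (hq : u q = q) :
    ∀ b ∈ l, q ≠ b.left ∧ q ≠ b.right := by
  induction h with
  | nil => simp
  | cons hs _ _ ih =>
    obtain ⟨h1, h2⟩ := hs.fixed hq
    simp only [List.mem_cons, forall_eq_or_imp]
    exact ⟨h2, ih h1⟩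

/-- No wire strictly between the ends of the bridge `b` carries an end of the bridge `b'`. -/
def Bridge.Avoids (b b' : Bridge n) : Prop :=
  ∀ a, b.left < a → a < b.right → a ≠ b'.left ∧ a ≠ b'.right

/-- The wires passed over by a bridge carry no later bridges: their values are fixed points. -/
theorem UpPath.pairwise_avoids {M : Set (Perm (Fin n))} {u v : Perm (Fin n)} {l : List (Bridge n)}
    (h : UpPath J M u v l) : l.Pairwise Bridge.Avoids := by
  induction h with
  | nil => exact List.Pairwise.nil
  | @cons u u' v b l hs _ hl ih =>
    refine List.Pairwise.cons (fun b' hb' a h1 h2 => ?_) ih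
    have hs' := hs
    obtain ⟨-, -, x, y, h3, h4, h5, h6, rfl⟩ := hs'
    obtain ⟨q, rfl⟩ := u.surjective a
    have hq := h6 q h1 h2
    rw [hq]
    exact hl.fixed (hs.fixed hq).1 b' hb'

/-- A value that is not yet at its place is moved by a later step. -/
theorem UpPath.exists_label {M : Set (Perm (Fin n))} {u v : Perm (Fin n)} {l : List (Bridge n)}
    (h : UpPath J M u v l) {q : Fin n} (hq : v q ≠ u q) :
    ∃ b ∈ l, u q = b.left ∨ u q = b.right := by
  induction h with
  | nil => exact absurd rfl hq
  | @cons u u' v b l hs _ hl ih =>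
    have hs' := hs
    obtain ⟨-, -, x, y, h3, h4, h5, h6, rfl⟩ := hs'
    by_cases hqx : q = x
    · exact ⟨_, List.mem_cons_self, .inr (by rw [hqx])⟩
    by_cases hqy : q = y
    · exact ⟨_, List.mem_cons_self, .inl (by rw [hqy])⟩
    have hu' : u' q = u q := by rw [h5, Perm.mul_apply, swap_apply_of_ne_of_ne hqx hqy]
    obtain ⟨b, hb, hb'⟩ := ih (by rwa [hu'])
    exact ⟨b, List.mem_cons_of_mem _ hb, by rwa [hu'] at hb'⟩

/-! ### Two-dimensional faces -/

theorem vectorSpan_face (c : Fin n → ℝ) :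
    vectorSpan ℝ (convexHull ℝ (permPoint '' maxSet J c)) =
      vectorSpan ℝ (permPoint '' maxSet J c) := by
  rw [← direction_affineSpan, affineSpan_convexHull, direction_affineSpan]

/-- Tied exchangeable positions give directions of the face. -/
theorem single_sub_single_mem {c : Fin n → ℝ} {z : Perm (Fin n)} (hz : z ∈ maxSet J c)
    {x y : Fin n} (h : Above J z x y) (hc : c x = c y) :
    (Pi.single x 1 - Pi.single y 1 : Fin n → ℝ) ∈ vectorSpan ℝ (permPoint '' maxSet J c) := by
  suffices H : ∀ (m : ℕ) (x y : Fin n), (z x : ℕ) - z y ≤ m → Above J z x y → c x = c y →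
      (Pi.single x 1 - Pi.single y 1 : Fin n → ℝ) ∈ vectorSpan ℝ (permPoint '' maxSet J c) from
    H _ x y le_rfl h hc
  intro m
  induction m with
  | zero =>
    intro x y hm h
    have := Fin.lt_def.1 h.lt
    omega
  | succ m ih =>
    intro x y hm h hc
    by_cases hs : z * swap x y ∈ permSet J
    · have hs' := mul_swap_mem_maxSet hz h.ne hs hc
      have hmem := vsub_mem_vectorSpan ℝ (Set.mem_image_of_mem permPoint hz)
        (Set.mem_image_of_mem permPoint hs')
      have hlt : ((z y : ℕ) : ℝ) < ((z x : ℕ) : ℝ) := by exact_mod_cast Fin.lt_def.1 h.lt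
      have heq : (Pi.single x 1 - Pi.single y 1 : Fin n → ℝ) =
          (((z x : ℕ) : ℝ) - ((z y : ℕ) : ℝ))⁻¹ • (permPoint z -ᵥ permPoint (z * swap x y)) := by
        have hne : (((z x : ℕ) : ℝ) - ((z y : ℕ) : ℝ)) ≠ 0 := by linarith
        ext q
        simp only [vsub_eq_sub, Pi.sub_apply, Pi.smul_apply, smul_eq_mul, permPoint, Perm.mul_apply]
        by_cases hqx : q = x
        · subst hqx
          rw [swap_apply_left, Pi.single_eq_same, Pi.single_eq_of_ne h.ne]
          field_simp
          ring
        by_cases hqy : q = y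
        · subst hqy
          rw [swap_apply_right, Pi.single_eq_same, Pi.single_eq_of_ne hqx]
          field_simp
          ring
        · rw [swap_apply_of_ne_of_ne hqx hqy, Pi.single_eq_of_ne hqx, Pi.single_eq_of_ne hqy]
          ring
      rw [heq]
      exact Submodule.smul_mem _ _ hmem
    · obtain ⟨w, h1, h2, h3, h4⟩ := h.exists_between hz.1 hs
      have h5 := le_of_mem_maxSet hz h3
      have h6 := le_of_mem_maxSet hz h4
      rw [Fin.lt_def] at h1 h2
      have ha := ih x w (by omega) h3 (by linarith)
      have hb := ih w y (by omega) h4 (by linarith)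
      have := Submodule.add_mem _ ha hb
      rwa [sub_add_sub_cancel] at this

/-- In a space of dimension two there is no independent pair together with a third vector on which a
functional vanishing on the pair does not vanish. -/
theorem no_third_direction {S : Submodule ℝ (Fin n → ℝ)} (hS : Module.finrank ℝ S = 2)
    {v₁ v₂ v₃ : Fin n → ℝ} (h₁ : v₁ ∈ S) (h₂ : v₂ ∈ S) (h₃ : v₃ ∈ S)
    (hli : ∀ a b : ℝ, a • v₁ + b • v₂ = 0 → a = 0 ∧ b = 0) (φ : (Fin n → ℝ) →ₗ[ℝ] ℝ)
    (hφ₁ : φ v₁ = 0) (hφ₂ : φ v₂ = 0) (hφ₃ : φ v₃ ≠ 0) : False := by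
  have hind : LinearIndependent ℝ ![(⟨v₁, h₁⟩ : S), ⟨v₂, h₂⟩, ⟨v₃, h₃⟩] := by
    rw [Fintype.linearIndependent_iff]
    intro g hg
    rw [Fin.sum_univ_three] at hg
    have hg' : g 0 • v₁ + g 1 • v₂ + g 2 • v₃ = 0 := congrArg Subtype.val hg
    have h2 : g 2 = 0 := by
      have := congrArg φ hg'
      simp only [map_add, map_smul, hφ₁, hφ₂, smul_eq_mul, mul_zero, zero_add, map_zero] at this
      exact (mul_eq_zero.1 this).resolve_right hφ₃
    rw [h2, zero_smul, add_zero] at hg'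
    obtain ⟨h0, h1⟩ := hli _ _ hg'
    intro i
    fin_cases i
    · exact h0
    · exact h1
    · exact h2
  have := hind.fintype_card_le_finrank
  rw [hS] at this
  simp at this

end BridgePolytope

namespace BridgePolytope

open Equiv

variable {n : ℕ} {J : Finset (Fin n)}

theorem Step.label_eq {u : Perm (Fin n)} {x y : Fin n} {b : Bridge n}
    (h : Step J u (u * swap x y) b) (hlt : u y < u x) : b = ⟨u y, u x, hlt⟩ := by
  obtain ⟨-, -, x', y', h1, -, h2, -, rfl⟩ := h
  obtain ⟨rfl, rfl⟩ := mul_swap_inj h2 hlt h1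
  rfl

/-- In a graded set a path of steps up from an element of maximal rank is trivial. -/
theorem UpPath.eq_nil {M : Set (Perm (Fin n))} {u v : Perm (Fin n)} {l : List (Bridge n)}
    (h : UpPath J M u v l) (hM : ∀ w ∈ M, inversions J w ≤ inversions J u) : l = [] ∧ v = u := by
  cases h with
  | nil => exact ⟨rfl, rfl⟩
  | cons hs hm _ =>
    have := hM _ hm
    rw [hs.inversions_eq] at this
    omega

theorem UpPath.eq_nil_or_cons {M : Set (Perm (Fin n))} {u v : Perm (Fin n)} {l : List (Bridge n)}
    (h : UpPath J M u v l) : (l = [] ∧ v = u) ∨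
      ∃ u' b l', l = b :: l' ∧ Step J u u' b ∧ u' ∈ M ∧ UpPath J M u' v l' := by
  cases h with
  | nil => exact .inl ⟨rfl, rfl⟩
  | cons hs hm hl => exact .inr ⟨_, _, _, rfl, hs, hm, hl⟩

theorem eq_of_no_tie {c : Fin n → ℝ} {z w : Perm (Fin n)} (hz : z ∈ maxSet J c)
    (hw : w ∈ maxSet J c) {x : Fin n}
    (h : ∀ p q, Above J z p q → c p = c q → x ≠ p ∧ x ≠ q) : w x = z x := by
  by_contra hne
  obtain ⟨y, hy, ha | ha⟩ := exists_tie_of_ne hz hw hne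
  · exact (h _ _ ha hy).1 rfl
  · exact (h _ _ ha hy.symm).2 rfl

/-- A position all of whose ties are with one other position either keeps its value or receives the
value of that position. -/
theorem pair_cases {c : Fin n → ℝ} {u w : Perm (Fin n)} (hu : u ∈ maxSet J c)
    (hw : w ∈ maxSet J c) {x y : Fin n} (hlt : u y < u x)
    (h : ∀ p q, Above J u p q → c p = c q → (p = x ∨ p = y ∨ q = x ∨ q = y) → p = x ∧ q = y) :
    (w x = u x ∧ w y = u y) ∨ (w x = u y ∧ w y = u x) := by
  have cut : ∀ (s : ℕ) p q, s ≤ (u p : ℕ) → (w p : ℕ) < s → (u q : ℕ) < s → s ≤ (w q : ℕ) →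
      (p = x ∨ p = y ∨ q = x ∨ q = y) → p = x ∧ q = y := by
    intro s p q h1 h2 h3 h4 h5
    obtain ⟨h6, h7⟩ := above_of_cut hu.1 hw.1 h1 h2 h3 h4
    exact h p q h6 (le_antisymm (le_of_mem_maxSet hw h7) (le_of_mem_maxSet hu h6)) h5
  have hxy : x ≠ y := by rintro rfl; exact lt_irrefl _ hlt
  have hdown : ∀ s : ℕ, (w x : ℕ) < s → s ≤ u x → (u y : ℕ) < s ∧ s ≤ w y := by
    intro s h1 h2
    obtain ⟨q, h3, h4⟩ := exists_lt_of_cut u w h2 h1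
    obtain ⟨-, rfl⟩ := cut s x q h2 h1 h3 h4 (.inl rfl)
    exact ⟨h3, h4⟩
  have hup : ∀ s : ℕ, (u y : ℕ) < s → s ≤ w y → s ≤ u x ∧ (w x : ℕ) < s := by
    intro s h1 h2
    obtain ⟨q, h3, h4⟩ := exists_ge_of_cut u w h1 h2
    obtain ⟨rfl, -⟩ := cut s q y h3 h4 h1 h2 (.inr (.inr (.inr rfl)))
    exact ⟨h3, h4⟩
  have hxle : (w x : ℕ) ≤ u x := by
    by_contra hc
    obtain ⟨q, h3, h4⟩ := exists_ge_of_cut u w (s := w x) (x := x) (by omega) le_rfl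
    exact hxy (cut _ q x h3 h4 (by omega) le_rfl (.inr (.inr (.inl rfl)))).2
  have hyge : (u y : ℕ) ≤ w y := by
    by_contra hc
    obtain ⟨q, h3, h4⟩ := exists_lt_of_cut u w (s := u y) (x := y) le_rfl (by omega)
    exact hxy (cut _ y q le_rfl (by omega) h3 h4 (.inr (.inl rfl))).1.symm
  rw [Fin.lt_def] at hlt
  simp only [Fin.ext_iff]
  rcases eq_or_lt_of_le hxle with h1 | h1
  · left
    refine ⟨h1, ?_⟩
    by_contra hne
    have := (hup (u y + 1) (by omega) (by omega)).2
    omega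
  · right
    have h2 := hdown (u x) h1 le_rfl
    have h3 := hdown (w x + 1) (by omega) (by omega)
    have h4 := hup (w y) (by omega) le_rfl
    have h5 := hup (u y + 1) (by omega) (by omega)
    omega

/-- Every permutation in a face is an extreme point of it. -/
theorem extremePoints_face (c : Fin n → ℝ) :
    (convexHull ℝ (permPoint '' maxSet J c)).extremePoints ℝ = permPoint '' maxSet J c := by
  apply Set.Subset.antisymm extremePoints_convexHull_subset
  rintro _ ⟨z, hz, rfl⟩
  have hmax : maxSet J (fun q => ((z q : ℕ) : ℝ)) = {z} := by
    have hmem : z ∈ maxSet J (fun q => ((z q : ℕ) : ℝ)) := by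
      refine mem_maxSet_of_greedy hz.1 fun x y h => ?_
      have := Fin.lt_def.1 h.lt
      exact_mod_cast this.le
    refine Set.Subset.antisymm (fun w hw => ?_) (by rintro _ rfl; exact hmem)
    refine Equiv.ext fun q => eq_of_no_tie hmem hw fun x y h hc => ?_
    have : z x = z y := Fin.ext (by exact_mod_cast hc)
    exact absurd this h.lt.ne'
  have hexp := isExposed_convexHull_maxSet (J := J) fun q => ((z q : ℕ) : ℝ)
  rw [hmax, Set.image_singleton, convexHull_singleton] at hexp
  have hext : permPoint z ∈ (bridgePolytope J).extremePoints ℝ :=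
    exposedPoints_subset_extremePoints (mem_exposedPoints_iff_exposed_singleton.2 hexp)
  refine inter_extremePoints_subset_extremePoints_of_subset
    (isExposed_convexHull_maxSet (J := J) c).subset ⟨subset_convexHull ℝ _ ⟨z, hz, rfl⟩, hext⟩

section Rectangle

variable {c : Fin n → ℝ} {u v : Perm (Fin n)} {x y x' y' : Fin n}

/-- Two disjoint tied pairs span a rectangle. -/
theorem rectangle_of_disjoint
    (hS : Module.finrank ℝ (vectorSpan ℝ (permPoint '' maxSet J c)) = 2)
    (hu : u ∈ maxSet J c) (hlt : u y < u x) (hlt' : u y' < u x')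
    (ha : u * swap x y ∈ maxSet J c) (ha' : u * swap x' y' ∈ maxSet J c)
    (hN : inversions J (u * swap x y) = inversions J u + 1)
    (hN' : inversions J (u * swap x' y') = inversions J u + 1)
    (h1 : x ≠ x') (h2 : x ≠ y') (h3 : y ≠ x') (h4 : y ≠ y') {l l' : List (Bridge n)}
    (hl : UpPath J (maxSet J c) (u * swap x y) v l)
    (hl' : UpPath J (maxSet J c) (u * swap x' y') v l') (hlen : l.length = l'.length) :
    IsRectangle (convexHull ℝ (permPoint '' maxSet J c)) ∧ l = [⟨u y', u x', hlt'⟩] ∧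
      l' = [⟨u y, u x, hlt⟩] := by
  have hxy : x ≠ y := by rintro rfl; exact lt_irrefl _ hlt
  have hxy' : x' ≠ y' := by rintro rfl; exact lt_irrefl _ hlt'
  have hA := above_of_mul_swap_mem hu.1 ha.1 hlt
  have hA' := above_of_mul_swap_mem hu.1 ha'.1 hlt'
  have hc := eq_of_mul_swap_mem_maxSet hu hxy ha
  have hc' := eq_of_mul_swap_mem_maxSet hu hxy' ha'
  have hli : ∀ a b : ℝ, a • (Pi.single x 1 - Pi.single y 1 : Fin n → ℝ) +
      b • (Pi.single x' 1 - Pi.single y' 1 : Fin n → ℝ) = 0 → a = 0 ∧ b = 0 := by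
    intro a b hab
    have e1 := congrFun hab x
    have e2 := congrFun hab x'
    simp [h1, h2, hxy] at e1
    simp [h1.symm, h3.symm, hxy'] at e2
    exact ⟨e1, e2⟩
  -- a third tied pair would give a third direction
  have hthird : ∀ p q, Above J u p q → c p = c q → ∀ φ : (Fin n → ℝ) →ₗ[ℝ] ℝ,
      φ (Pi.single x 1 - Pi.single y 1) = 0 → φ (Pi.single x' 1 - Pi.single y' 1) = 0 →
      φ (Pi.single p 1 - Pi.single q 1) ≠ 0 → False := fun p q hpq hcpq φ e1 e2 e3 =>
    no_third_direction hS (single_sub_single_mem hu hA hc) (single_sub_single_mem hu hA' hc')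
      (single_sub_single_mem hu hpq hcpq) hli φ e1 e2 e3
  have hmem : ∀ p q, Above J u p q → c p = c q →
      (p = x ∨ p = y ∨ p = x' ∨ p = y') ∧ (q = x ∨ q = y ∨ q = x' ∨ q = y') := by
    intro p q hpq hcpq
    constructor
    · by_contra hc
      push Not at hc
      obtain ⟨e1, e2, e3, e4⟩ := hc
      refine hthird p q hpq hcpq (LinearMap.proj p) ?_ ?_ ?_
      · simp [e1, e2]
      · simp [e3, e4]
      · simp [hpq.ne]
    · by_contra hc
      push Not at hc
      obtain ⟨e1, e2, e3, e4⟩ := hc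
      refine hthird p q hpq hcpq (LinearMap.proj q) ?_ ?_ ?_
      · simp [e1, e2]
      · simp [e3, e4]
      · simp [hpq.ne.symm]
  have hcross : ∀ p q, Above J u p q → c p = c q → ((p = x ∨ p = y) ↔ (q = x ∨ q = y)) := by
    intro p q hpq hcpq
    by_contra hiff
    refine hthird p q hpq hcpq 
      ((LinearMap.proj x : (Fin n → ℝ) →ₗ[ℝ] ℝ) + LinearMap.proj y) ?_ ?_ ?_
    · simp [hxy, hxy.symm]
    · simp [h1, h2, h3, h4]
    · by_cases hp : p = x ∨ p = y
      · have hq : ¬ (q = x ∨ q = y) := fun hq => hiff ⟨fun _ => hq, fun _ => hp⟩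
        push Not at hq
        rcases hp with rfl | rfl
        · simp [hxy.symm, hq.1.symm, hq.2.symm]
        · simp [hxy, hq.1.symm, hq.2.symm]
      · have hq : q = x ∨ q = y := by
          by_contra hq
          exact hiff ⟨fun h => absurd h hp, fun h => absurd h hq⟩
        push Not at hp
        rcases hq with rfl | rfl
        · simp [hxy.symm, hp.1.symm, hp.2.symm]
        · simp [hxy, hp.1.symm, hp.2.symm]
  have horder : ∀ p q, Above J u p q → p ≠ q ∧ ¬ (p = y ∧ q = x) ∧ ¬ (p = y' ∧ q = x') := by
    intro p q hpq
    refine ⟨hpq.ne, ?_, ?_⟩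
    · rintro ⟨rfl, rfl⟩; exact absurd hpq.lt (lt_asymm hlt)
    · rintro ⟨rfl, rfl⟩; exact absurd hpq.lt (lt_asymm hlt')
  have hpair : ∀ w ∈ maxSet J c, (w x = u x ∧ w y = u y) ∨ (w x = u y ∧ w y = u x) := by
    intro w hw
    refine pair_cases hu hw hlt fun p q hpq hcpq hor => ?_
    have := hcross p q hpq hcpq
    have := horder p q hpq
    grind
  have hpair' : ∀ w ∈ maxSet J c, (w x' = u x' ∧ w y' = u y') ∨ (w x' = u y' ∧ w y' = u x') := by
    intro w hw
    refine pair_cases hu hw hlt' fun p q hpq hcpq hor => ?_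
    have := hcross p q hpq hcpq
    have := horder p q hpq
    have := hmem p q hpq hcpq
    grind
  have hoff : ∀ w ∈ maxSet J c, ∀ q, q ≠ x → q ≠ y → q ≠ x' → q ≠ y' → w q = u q := by
    intro w hw q e1 e2 e3 e4
    refine eq_of_no_tie hu hw fun p r hpr hcpr => ?_
    have := hmem p r hpr hcpr
    grind
  set a := u * swap x y with hadef
  set a' := u * swap x' y' with hadef'
  set t := a * swap x' y' with htdef
  have ax : a x = u y := by simp [hadef]
  have ay : a y = u x := by simp [hadef]
  have ax' : a x' = u x' := by
    rw [hadef, Perm.mul_apply, swap_apply_of_ne_of_ne h1.symm h3.symm]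
  have ay' : a y' = u y' := by
    rw [hadef, Perm.mul_apply, swap_apply_of_ne_of_ne h2.symm h4.symm]
  have a'x : a' x = u x := by rw [hadef', Perm.mul_apply, swap_apply_of_ne_of_ne h1 h2]
  have a'y : a' y = u y := by rw [hadef', Perm.mul_apply, swap_apply_of_ne_of_ne h3 h4]
  have ta' : t = a' * swap x y := by
    rw [htdef, hadef, hadef', mul_assoc, mul_assoc]
    congr 1
    refine Equiv.ext fun q => ?_
    simp only [Perm.mul_apply, swap_apply_def]
    grind
  have ht : t ∈ maxSet J c := by
    refine mul_swap_mem_maxSet ha hxy' ?_ hc'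
    refine mul_swap_mem ha.1 (by rw [ax', ay']; exact hlt') ?_ ?_
    · rw [ay']
      intro hJ
      have := (ha'.1 x').1 hJ
      rwa [hadef', Perm.mul_apply, swap_apply_left] at this
    · rw [ax']
      intro hJ
      have := (ha'.1 y').2 hJ
      rwa [hadef', Perm.mul_apply, swap_apply_right] at this
  have hmax : maxSet J c = {u, a, t, a'} := by
    apply Set.Subset.antisymm
    · intro w hw
      simp only [Set.mem_insert_iff, Set.mem_singleton_iff]
      rcases hpair w hw with ⟨e1, e2⟩ | ⟨e1, e2⟩
      · have : w = u ∨ w = u * swap x' y' := eq_or_eq_mul_swap fun q e3 e4 => by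
          by_cases hqx : q = x
          · rw [hqx, e1]
          by_cases hqy : q = y
          · rw [hqy, e2]
          exact hoff w hw q hqx hqy e3 e4
        tauto
      · have : w = a ∨ w = a * swap x' y' := eq_or_eq_mul_swap fun q e3 e4 => by
          by_cases hqx : q = x
          · rw [hqx, e1, ax]
          by_cases hqy : q = y
          · rw [hqy, e2, ay]
          rw [hoff w hw q hqx hqy e3 e4, hadef, Perm.mul_apply, swap_apply_of_ne_of_ne hqx hqy]
        tauto
    · rintro w (rfl | rfl | rfl | rfl)
      exacts [hu, ha, ht, ha']
  have haa' : a ≠ a' := fun h => by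
    have := congrArg (fun z : Perm (Fin n) => z x) h
    simp only [ax, a'x] at this
    exact hlt.ne this
  refine ⟨?_, ?_⟩
  · refine ⟨permPoint u, permPoint a, permPoint t, permPoint a', ?_, ?_, ?_, ?_, ?_⟩
    · rw [hmax]
      simp only [Set.image_insert_eq, Set.image_singleton]
    · intro h
      rw [permPoint_injective h] at hN
      omega
    · intro h
      rw [permPoint_injective h] at hN'
      omega
    · ext q
      simp only [Pi.sub_apply, permPoint]
      by_cases hq : q = x ∨ q = y
      · have e1 : a' q = u q := by rcases hq with rfl | rfl <;> assumption
        have e2 : t q = a q := by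
          have e3 : q ≠ x' ∧ q ≠ y' := by rcases hq with rfl | rfl <;> constructor <;> assumption
          rw [htdef, Perm.mul_apply, swap_apply_of_ne_of_ne e3.1 e3.2]
        rw [e1, e2]
      · push Not at hq
        have e1 : a q = u q := by
          rw [hadef, Perm.mul_apply, swap_apply_of_ne_of_ne hq.1 hq.2]
        have e2 : t q = a' q := by
          rw [ta', Perm.mul_apply, swap_apply_of_ne_of_ne hq.1 hq.2]
        rw [e1, e2, sub_self, sub_self]
    · rw [dotProduct]
      refine Finset.sum_eq_zero fun q _ => ?_
      simp only [Pi.sub_apply, permPoint]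
      by_cases hq : q = x ∨ q = y
      · have : a' q = u q := by rcases hq with rfl | rfl <;> assumption
        rw [this]; ring
      · push Not at hq
        rw [hadef, Perm.mul_apply, swap_apply_of_ne_of_ne hq.1 hq.2]; ring
  · -- both paths lead to the fourth vertex
    have hrank : ∀ w ∈ maxSet J c, inversions J w = inversions J u + 2 → w = t := by
      intro w hw hNw
      rw [hmax] at hw
      rcases hw with rfl | rfl | rfl | rfl
      · omega
      · omega
      · rfl
      · omega
    have hnil : ∀ {l : List (Bridge n)}, UpPath J (maxSet J c) t v l →
        inversions J t = inversions J u + 2 → l = [] := by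
      intro l h hNt
      refine (h.eq_nil fun w hw => ?_).1
      rw [hmax] at hw
      rcases hw with rfl | rfl | rfl | rfl <;> omega
    rcases hl.eq_nil_or_cons with ⟨rfl, hv⟩ | ⟨b, β, l₁, rfl, hs, hm, hl₁⟩
    · rcases hl'.eq_nil_or_cons with ⟨-, hv'⟩ | ⟨_, _, _, rfl, _, _, _⟩
      · exact absurd (hv.symm.trans hv') haa'
      · simp at hlen
    · rcases hl'.eq_nil_or_cons with ⟨rfl, _⟩ | ⟨b', β', l₁', rfl, hs', hm', hl₁'⟩
      · simp at hlen
      have hNb := hs.inversions_eq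
      have hbt : b = t := hrank b hm (by omega)
      rw [hbt] at hs hl₁ hNb
      have hNb' := hs'.inversions_eq
      have hbt' : b' = t := hrank b' hm' (by omega)
      rw [hbt'] at hs' hl₁'
      have hβ := hs.label_eq (by rw [ax', ay']; exact hlt')
      rw [ta'] at hs'
      have hβ' := hs'.label_eq (by rw [a'x, a'y]; exact hlt)
      rw [hnil hl₁ (by omega), hnil hl₁' (by omega), hβ, hβ']
      simp only [ax', ay', a'x, a'y, and_self]

end Rectangle

end BridgePolytope

namespace BridgePolytope

open Equiv

variable {n : ℕ} {J : Finset (Fin n)}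

section Triple

variable {c : Fin n → ℝ} {u v : Perm (Fin n)} {x y z : Fin n}

/-- If the ties of a two-dimensional face form a triangle, then the vertices of the face agree
outside of it. -/
theorem eq_off_triple (hS : Module.finrank ℝ (vectorSpan ℝ (permPoint '' maxSet J c)) = 2)
    (hu : u ∈ maxSet J c) (hxy : u x < u y) (hyz : u y < u z)
    (ha : u * swap y x ∈ maxSet J c) (ha' : u * swap z y ∈ maxSet J c) {w : Perm (Fin n)}
    (hw : w ∈ maxSet J c) {q : Fin n} (h1 : q ≠ x) (h2 : q ≠ y) (h3 : q ≠ z) : w q = u q := by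
  have nxy : x ≠ y := by rintro rfl; exact lt_irrefl _ hxy
  have nyz : y ≠ z := by rintro rfl; exact lt_irrefl _ hyz
  have nxz : x ≠ z := by rintro rfl; exact lt_asymm hxy hyz
  have hA := above_of_mul_swap_mem hu.1 ha.1 hxy
  have hA' := above_of_mul_swap_mem hu.1 ha'.1 hyz
  have hc := eq_of_mul_swap_mem_maxSet hu nxy.symm ha
  have hc' := eq_of_mul_swap_mem_maxSet hu nyz.symm ha'
  have hli : ∀ a b : ℝ, a • (Pi.single y 1 - Pi.single x 1 : Fin n → ℝ) +
      b • (Pi.single z 1 - Pi.single y 1 : Fin n → ℝ) = 0 → a = 0 ∧ b = 0 := by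
    intro a b hab
    have e1 := congrFun hab x
    have e2 := congrFun hab z
    simp [nxy, nxz] at e1
    simp [nxz.symm, nyz.symm] at e2
    exact ⟨e1, e2⟩
  refine eq_of_no_tie hu hw fun p r hpr hcpr => ?_
  have key : ∀ s : Fin n, (s = p ∨ s = r) → q ≠ s := by
    rintro s hs rfl
    refine no_third_direction hS (single_sub_single_mem hu hA hc) (single_sub_single_mem hu hA' hc')
      (single_sub_single_mem hu hpr hcpr) hli (LinearMap.proj q) ?_ ?_ ?_
    · simp [h1, h2]
    · simp [h2, h3]
    · rcases hs with rfl | rfl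
      · simp [hpr.ne]
      · simp [hpr.ne.symm]
  exact ⟨key p (.inl rfl), key r (.inr rfl)⟩

set_option maxHeartbeats 1000000 in
/-- If the ties of a two-dimensional face form a triangle, then the face is a trapezoid or a
hexagon.  The positions `x`, `y`, `z` are listed in the order of `schubertPerm J`, and `u` is the
vertex of the face at which their values increase. -/
theorem trapezoid_or_hexagon
    (hS : Module.finrank ℝ (vectorSpan ℝ (permPoint '' maxSet J c)) = 2)
    (hu : u ∈ maxSet J c) (hxy : u x < u y) (hyz : u y < u z)
    (ha : u * swap y x ∈ maxSet J c) (ha' : u * swap z y ∈ maxSet J c)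
    (fxy : ∀ q, u x < u q → u q < u y → u q = q) (fyz : ∀ q, u y < u q → u q < u z → u q = q)
    (hN : inversions J (u * swap y x) = inversions J u + 1)
    (hN' : inversions J (u * swap z y) = inversions J u + 1) {l l' : List (Bridge n)}
    (hl : UpPath J (maxSet J c) (u * swap y x) v l)
    (hl' : UpPath J (maxSet J c) (u * swap z y) v l') (hlen : l.length = l'.length) :
    (IsTrapezoid (convexHull ℝ (permPoint '' maxSet J c)) ∧ v (u y) = u y ∧
      l = [⟨u y, u z, hyz⟩] ∧ l' = [⟨u x, u z, hxy.trans hyz⟩]) ∨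
    (IsTrapezoid (convexHull ℝ (permPoint '' maxSet J c)) ∧ v (u y) = u y ∧
      l = [⟨u x, u z, hxy.trans hyz⟩] ∧ l' = [⟨u x, u y, hxy⟩]) ∨
    (IsHexagon (convexHull ℝ (permPoint '' maxSet J c)) ∧ v y = u y ∧ u y ≠ y ∧
      l = [⟨u y, u z, hyz⟩, ⟨u x, u y, hxy⟩] ∧ l' = [⟨u x, u y, hxy⟩, ⟨u y, u z, hyz⟩]) := by
  have nxy : x ≠ y := by rintro rfl; exact lt_irrefl _ hxy
  have nyz : y ≠ z := by rintro rfl; exact lt_irrefl _ hyz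
  have nxz : x ≠ z := by rintro rfl; exact lt_asymm hxy hyz
  have vxy : u x ≠ u y := hxy.ne
  have vyz : u y ≠ u z := hyz.ne
  have vxz : u x ≠ u z := (hxy.trans hyz).ne
  have hc := eq_of_mul_swap_mem_maxSet hu nxy.symm ha
  have hc' := eq_of_mul_swap_mem_maxSet hu nyz.symm ha'
  have hoff : ∀ w ∈ maxSet J c, ∀ q, q ≠ x → q ≠ y → q ≠ z → w q = u q :=
    fun w hw q h1 h2 h3 => eq_off_triple hS hu hxy hyz ha ha' hw h1 h2 h3
  set a := u * swap y x with hadef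
  set a' := u * swap z y with hadef'
  set e := a * swap z x with hedef
  set e' := a' * swap z x with hedef'
  set t := u * swap z x with htdef
  -- the values of the six arrangements at `x`, `y`, `z`
  have ax : a x = u y := by simp [hadef]
  have ay : a y = u x := by simp [hadef]
  have az : a z = u z := by
    rw [hadef, Perm.mul_apply, swap_apply_of_ne_of_ne nyz.symm nxz.symm]
  have a'x : a' x = u x := by rw [hadef', Perm.mul_apply, swap_apply_of_ne_of_ne nxz nxy]
  have a'y : a' y = u z := by simp [hadef']
  have a'z : a' z = u y := by simp [hadef']
  have ex : e x = u z := by rw [hedef, Perm.mul_apply, swap_apply_right, az]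
  have ey : e y = u x := by
    rw [hedef, Perm.mul_apply, swap_apply_of_ne_of_ne nyz nxy.symm, ay]
  have ez : e z = u y := by rw [hedef, Perm.mul_apply, swap_apply_left, ax]
  have e'x : e' x = u y := by rw [hedef', Perm.mul_apply, swap_apply_right, a'z]
  have e'y : e' y = u z := by
    rw [hedef', Perm.mul_apply, swap_apply_of_ne_of_ne nyz nxy.symm, a'y]
  have e'z : e' z = u x := by rw [hedef', Perm.mul_apply, swap_apply_left, a'x]
  have tx : t x = u z := by simp [htdef]
  have ty : t y = u y := by
    rw [htdef, Perm.mul_apply, swap_apply_of_ne_of_ne nyz nxy.symm]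
  have tz : t z = u x := by simp [htdef]
  have aoff : ∀ q, q ≠ x → q ≠ y → q ≠ z → a q = u q := fun q h1 h2 h3 => by
    rw [hadef, Perm.mul_apply, swap_apply_of_ne_of_ne h2 h1]
  have a'off : ∀ q, q ≠ x → q ≠ y → q ≠ z → a' q = u q := fun q h1 h2 h3 => by
    rw [hadef', Perm.mul_apply, swap_apply_of_ne_of_ne h3 h2]
  have eoff : ∀ q, q ≠ x → q ≠ y → q ≠ z → e q = u q := fun q h1 h2 h3 => by
    rw [hedef, Perm.mul_apply, swap_apply_of_ne_of_ne h3 h1, aoff q h1 h2 h3]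
  have e'off : ∀ q, q ≠ x → q ≠ y → q ≠ z → e' q = u q := fun q h1 h2 h3 => by
    rw [hedef', Perm.mul_apply, swap_apply_of_ne_of_ne h3 h1, a'off q h1 h2 h3]
  have toff : ∀ q, q ≠ x → q ≠ y → q ≠ z → t q = u q := fun q h1 h2 h3 => by
    rw [htdef, Perm.mul_apply, swap_apply_of_ne_of_ne h3 h1]
  have ext3 : ∀ w w' : Perm (Fin n), (∀ q, q ≠ x → q ≠ y → q ≠ z → w q = w' q) →
      w x = w' x → w y = w' y → w z = w' z → w = w' := by
    intro w w' h h1 h2 h3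
    refine Equiv.ext fun q => ?_
    by_cases e1 : q = x
    · rw [e1, h1]
    by_cases e2 : q = y
    · rw [e2, h2]
    by_cases e3 : q = z
    · rw [e3, h3]
    exact h q e1 e2 e3
  have ae' : e' = a * swap z y := by
    refine ext3 _ _ (fun q h1 h2 h3 => ?_) ?_ ?_ ?_
    · rw [e'off q h1 h2 h3, Perm.mul_apply, swap_apply_of_ne_of_ne h3 h2, aoff q h1 h2 h3]
    · rw [e'x, Perm.mul_apply, swap_apply_of_ne_of_ne nxz nxy, ax]
    · rw [e'y, Perm.mul_apply, swap_apply_right, az]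
    · rw [e'z, Perm.mul_apply, swap_apply_left, ay]
  have a'e : e = a' * swap y x := by
    refine ext3 _ _ (fun q h1 h2 h3 => ?_) ?_ ?_ ?_
    · rw [eoff q h1 h2 h3, Perm.mul_apply, swap_apply_of_ne_of_ne h2 h1, a'off q h1 h2 h3]
    · rw [ex, Perm.mul_apply, swap_apply_right, a'y]
    · rw [ey, Perm.mul_apply, swap_apply_left, a'x]
    · rw [ez, Perm.mul_apply, swap_apply_of_ne_of_ne nyz.symm nxz.symm, a'z]
  have et : t = e * swap z y := by
    refine ext3 _ _ (fun q h1 h2 h3 => ?_) ?_ ?_ ?_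
    · rw [toff q h1 h2 h3, Perm.mul_apply, swap_apply_of_ne_of_ne h3 h2, eoff q h1 h2 h3]
    · rw [tx, Perm.mul_apply, swap_apply_of_ne_of_ne nxz nxy, ex]
    · rw [ty, Perm.mul_apply, swap_apply_right, ez]
    · rw [tz, Perm.mul_apply, swap_apply_left, ey]
  have e't : t = e' * swap y x := by
    refine ext3 _ _ (fun q h1 h2 h3 => ?_) ?_ ?_ ?_
    · rw [toff q h1 h2 h3, Perm.mul_apply, swap_apply_of_ne_of_ne h2 h1, e'off q h1 h2 h3]
    · rw [tx, Perm.mul_apply, swap_apply_right, e'y]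
    · rw [ty, Perm.mul_apply, swap_apply_left, e'x]
    · rw [tz, Perm.mul_apply, swap_apply_of_ne_of_ne nyz.symm nxz.symm, e'z]
  have te : e = t * swap z y := by rw [et, mul_assoc, swap_mul_self, mul_one]
  have hsub : ∀ w ∈ maxSet J c, w = u ∨ w = a ∨ w = a' ∨ w = e ∨ w = e' ∨ w = t := by
    intro w hw
    have hval : w x = u x ∨ w x = u y ∨ w x = u z := by
      by_contra hcon
      push Not at hcon
      obtain ⟨q, hq⟩ := u.surjective (w x)
      have h1 : q ≠ x := by rintro rfl; exact hcon.1 hq.symm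
      have h2 : q ≠ y := by rintro rfl; exact hcon.2.1 hq.symm
      have h3 : q ≠ z := by rintro rfl; exact hcon.2.2 hq.symm
      exact h1 (w.injective ((hoff w hw q h1 h2 h3).trans hq))
    rcases hval with h | h | h
    · have : w = u ∨ w = u * swap z y := eq_or_eq_mul_swap fun q h1 h2 => by
        by_cases h3 : q = x
        · rw [h3, h]
        · exact hoff w hw q h3 h2 h1
      tauto
    · have : w = a ∨ w = a * swap z y := eq_or_eq_mul_swap fun q h1 h2 => by
        by_cases h3 : q = x
        · rw [h3, h, ax]
        · rw [hoff w hw q h3 h2 h1, aoff q h3 h2 h1]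
      rw [← ae'] at this
      tauto
    · have : w = t ∨ w = t * swap z y := eq_or_eq_mul_swap fun q h1 h2 => by
        by_cases h3 : q = x
        · rw [h3, h, tx]
        · rw [hoff w hw q h3 h2 h1, toff q h3 h2 h1]
      rw [← te] at this
      tauto
  have cx := ha.1 x
  have cy := ha.1 y
  have cy' := ha'.1 y
  have cz' := ha'.1 z
  have ux := hu.1 x
  have uz := hu.1 z
  rw [ax] at cx
  rw [ay] at cy
  rw [a'y] at cy'
  rw [a'z] at cz'
  have hmem_e : (x ∉ J → u z ≤ x) → e ∈ maxSet J c := fun h =>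
    mul_swap_mem_maxSet ha nxz.symm (mul_swap_mem ha.1 (by rw [ax, az]; exact hyz)
      (by rw [ax]; exact cz'.1) (by rw [az]; exact h)) (hc'.trans hc)
  have hmem_e' : (z ∈ J → z ≤ u x) → e' ∈ maxSet J c := fun h =>
    mul_swap_mem_maxSet ha' nxz.symm (mul_swap_mem ha'.1 (by rw [a'x, a'z]; exact hxy)
      (by rw [a'x]; exact h) (by rw [a'z]; exact cx.2)) (hc'.trans hc)
  have hmem_t : (x ∉ J → u z ≤ x) → (z ∈ J → z ≤ u x) → t ∈ maxSet J c := fun h h' => by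
    rw [et]
    exact mul_swap_mem_maxSet (hmem_e h) nyz.symm (mul_swap_mem (hmem_e h).1
      (by rw [ey, ez]; exact hxy) (by rw [ey]; exact h')
      (by rw [ez]; exact fun hJ => hyz.le.trans (cy'.2 hJ))) hc'
  have haa' : a ≠ a' := fun h => by
    have := congrArg (fun z : Perm (Fin n) => z x) h
    simp only [ax, a'x] at this
    exact vxy this.symm
  -- the differences of values, as real numbers
  have rxy : ((u x : ℕ) : ℝ) < ((u y : ℕ) : ℝ) := by exact_mod_cast Fin.lt_def.1 hxy
  have ryz : ((u y : ℕ) : ℝ) < ((u z : ℕ) : ℝ) := by exact_mod_cast Fin.lt_def.1 hyz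
  have rx_y : ((u y : ℕ) : ℝ) - ((u x : ℕ) : ℝ) ≠ 0 := by linarith
  have ry_z : ((u z : ℕ) : ℝ) - ((u y : ℕ) : ℝ) ≠ 0 := by linarith
  have rcases3 : ∀ {P : Fin n → Prop}, P x → P y → P z → (∀ q, q ≠ x → q ≠ y → q ≠ z → P q) →
      ∀ q, P q := by
    intro P h1 h2 h3 h q
    by_cases e1 : q = x
    · rwa [e1]
    by_cases e2 : q = y
    · rwa [e2]
    by_cases e3 : q = z
    · rwa [e3]
    exact h q e1 e2 e3
  -- two paths of steps up that meet at the only vertex two steps above `u`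
  have quad : ∀ s : Perm (Fin n), maxSet J c = {u, a, s, a'} →
      ∃ β β', l = [β] ∧ l' = [β'] ∧ v = s ∧ Step J a s β ∧ Step J a' s β' := by
    intro s hmax
    have hrank : ∀ w ∈ maxSet J c, inversions J w = inversions J u + 2 → w = s := by
      intro w hw hNw
      rw [hmax] at hw
      rcases hw with rfl | rfl | rfl | rfl
      · omega
      · omega
      · rfl
      · omega
    have hnil : ∀ {l : List (Bridge n)}, UpPath J (maxSet J c) s v l →
        inversions J s = inversions J u + 2 → l = [] ∧ v = s := by
      intro l h hNt
      refine h.eq_nil fun w hw => ?_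
      rw [hmax] at hw
      rcases hw with rfl | rfl | rfl | rfl <;> omega
    rcases hl.eq_nil_or_cons with ⟨rfl, hv⟩ | ⟨b, β, l₁, rfl, hs, hm, hl₁⟩
    · rcases hl'.eq_nil_or_cons with ⟨-, hv'⟩ | ⟨_, _, _, rfl, _, _, _⟩
      · exact absurd (hv.symm.trans hv') haa'
      · simp at hlen
    · rcases hl'.eq_nil_or_cons with ⟨rfl, _⟩ | ⟨b', β', l₁', rfl, hs', hm', hl₁'⟩
      · simp at hlen
      have hNb := hs.inversions_eq
      have hbt : b = s := hrank b hm (by omega)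
      rw [hbt] at hs hl₁ hNb
      have hNb' := hs'.inversions_eq
      have hbt' : b' = s := hrank b' hm' (by omega)
      rw [hbt'] at hs' hl₁'
      obtain ⟨rfl, hvs⟩ := hnil hl₁ (by omega)
      obtain ⟨rfl, -⟩ := hnil hl₁' (by omega)
      exact ⟨β, β', rfl, rfl, hvs, hs, hs'⟩
  by_cases hA : x ∉ J → u z ≤ x
  · by_cases hB : z ∈ J → z ≤ u x
    · right; right
      have he := hmem_e hA
      have he' := hmem_e' hB
      have ht := hmem_t hA hB
      have hmax : maxSet J c = {u, a, a', e, e', t} := by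
        apply Set.Subset.antisymm
        · exact fun w hw => by simpa using hsub w hw
        · rintro w (rfl | rfl | rfl | rfl | rfl | rfl) <;> assumption
      have hhex : IsHexagon (convexHull ℝ (permPoint '' maxSet J c)) := by
        have hne : ∀ w w' : Perm (Fin n), (w x ≠ w' x ∨ w y ≠ w' y) → w ≠ w' := by
          rintro w w' h rfl
          rcases h with h | h <;> exact h rfl
        rw [IsHexagon, extremePoints_face, Set.ncard_image_of_injective _ permPoint_injective, hmax]
        rw [Set.ncard_insert_of_notMem, Set.ncard_insert_of_notMem, Set.ncard_insert_of_notMem,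
          Set.ncard_insert_of_notMem, Set.ncard_insert_of_notMem, Set.ncard_singleton]
        · rw [Set.mem_singleton_iff]
          exact hne _ _ (.inl (by rw [e'x, tx]; exact vyz))
        · simp only [Set.mem_insert_iff, Set.mem_singleton_iff, not_or]
          exact ⟨hne _ _ (.inl (by rw [ex, e'x]; exact vyz.symm)),
            hne _ _ (.inr (by rw [ey, ty]; exact vxy))⟩
        · simp only [Set.mem_insert_iff, Set.mem_singleton_iff, not_or]
          exact ⟨hne _ _ (.inl (by rw [a'x, ex]; exact vxz)),
            hne _ _ (.inl (by rw [a'x, e'x]; exact vxy)),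
            hne _ _ (.inl (by rw [a'x, tx]; exact vxz))⟩
        · simp only [Set.mem_insert_iff, Set.mem_singleton_iff, not_or]
          exact ⟨haa', hne _ _ (.inl (by rw [ax, ex]; exact vyz)),
            hne _ _ (.inr (by rw [ay, e'y]; exact vxz)),
            hne _ _ (.inl (by rw [ax, tx]; exact vyz))⟩
        · simp only [Set.mem_insert_iff, Set.mem_singleton_iff, not_or]
          exact ⟨hne _ _ (.inl (by rw [ax]; exact vxy)),
            hne _ _ (.inr (by rw [a'y]; exact vyz)),
            hne _ _ (.inl (by rw [ex]; exact vxz)),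
            hne _ _ (.inl (by rw [e'x]; exact vxy)),
            hne _ _ (.inl (by rw [tx]; exact vxz))⟩
      have hyne : u y ≠ y := by
        intro h
        by_cases hJ : y ∈ J
        · exact absurd (cy.1 hJ) (not_le.2 (hxy.trans_eq h))
        · exact absurd (cy'.2 hJ) (not_le.2 (h.symm.trans_lt hyz))
      have hxne : u y ≠ x := by
        intro h
        by_cases hJ : x ∈ J
        · exact absurd (ux.1 hJ) (not_le.2 (hxy.trans_eq h))
        · exact absurd (hA hJ) (not_le.2 (h.symm.trans_lt hyz))
      have hzne : u y ≠ z := by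
        intro h
        by_cases hJ : z ∈ J
        · exact absurd (hB hJ) (not_le.2 (hxy.trans_eq h))
        · exact absurd (uz.2 hJ) (not_le.2 (h.symm.trans_lt hyz))
      -- an edge moves only two positions
      have three : ∀ (w w' : Perm (Fin n)) b, Step J w w' b → w' x ≠ w x → w' y ≠ w y →
          w' z ≠ w z → False := by
        rintro w w' b ⟨-, -, p, q, -, -, rfl, -, -⟩ h1 h2 h3
        have key : ∀ r, (w * swap p q) r ≠ w r → r = p ∨ r = q := by
          intro r hr
          by_contra hcon
          push Not at hcon
          exact hr (by rw [Perm.mul_apply, swap_apply_of_ne_of_ne hcon.1 hcon.2])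
        have := key x h1
        have := key y h2
        have := key z h3
        grind
      have hNt : ∀ {w b}, Step J w t b → inversions J t = inversions J w + 1 :=
        fun h => h.inversions_eq
      rcases hl.eq_nil_or_cons with ⟨rfl, hv⟩ | ⟨b, β, l₁, rfl, hs, hm, hl₁⟩
      · rcases hl'.eq_nil_or_cons with ⟨-, hv'⟩ | ⟨_, _, _, rfl, _, _, _⟩
        · exact absurd (hv.symm.trans hv') haa'
        · simp at hlen
      rcases hl'.eq_nil_or_cons with ⟨rfl, _⟩ | ⟨b', β', l₁', rfl, hs', hm', hl₁'⟩
      · simp at hlen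
      have hNb := hs.inversions_eq
      have hNb' := hs'.inversions_eq
      have hbe : b = e := by
        rcases hsub b hm with rfl | rfl | rfl | rfl | rfl | rfl
        · omega
        · omega
        · omega
        · rfl
        · exfalso
          obtain ⟨-, -, p, q, h1, -, h2, h3, -⟩ := hs
          obtain ⟨rfl, rfl⟩ := mul_swap_inj (ae'.symm.trans h2) (by rw [ay, az]; exact hxy.trans hyz) h1
          have := h3 x (by rw [ay, ax]; exact hxy) (by rw [ax, az]; exact hyz)
          exact hxne (ax.symm.trans this)
        · exact (three _ _ _ hs (by rw [tx, ax]; exact vyz.symm) (by rw [ty, ay]; exact vxy.symm)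
            (by rw [tz, az]; exact vxz)).elim
      have hbe' : b' = e' := by
        rcases hsub b' hm' with rfl | rfl | rfl | rfl | rfl | rfl
        · omega
        · omega
        · omega
        · exfalso
          obtain ⟨-, -, p, q, h1, -, h2, h3, -⟩ := hs'
          obtain ⟨rfl, rfl⟩ := mul_swap_inj (a'e.symm.trans h2)
            (by rw [a'x, a'y]; exact hxy.trans hyz) h1
          have := h3 z (by rw [a'x, a'z]; exact hxy) (by rw [a'z, a'y]; exact hyz)
          exact hzne (a'z.symm.trans this)
        · rfl
        · exact (three _ _ _ hs' (by rw [tx, a'x]; exact vxz.symm) (by rw [ty, a'y]; exact vyz)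
            (by rw [tz, a'z]; exact vxy)).elim
      rw [hbe] at hs hl₁ hNb
      rw [hbe'] at hs' hl₁' hNb'
      have hrank : ∀ w ∈ maxSet J c, inversions J w = inversions J u + 3 → w = t := by
        intro w hw hNw
        rcases hsub w hw with rfl | rfl | rfl | rfl | rfl | rfl <;> omega
      rcases hl₁.eq_nil_or_cons with ⟨rfl, hv⟩ | ⟨d, γ, l₂, rfl, hs₁, hm₁, hl₂⟩
      · rcases hl₁'.eq_nil_or_cons with ⟨-, hv'⟩ | ⟨_, _, _, rfl, _, _, _⟩
        · exact absurd (hv.symm.trans hv') fun h => by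
            have := congrArg (fun z : Perm (Fin n) => z x) h
            simp only [ex, e'x] at this
            exact vyz this.symm
        · simp at hlen
      rcases hl₁'.eq_nil_or_cons with ⟨rfl, _⟩ | ⟨d', γ', l₂', rfl, hs₁', hm₁', hl₂'⟩
      · simp at hlen
      have hNd := hs₁.inversions_eq
      have hNd' := hs₁'.inversions_eq
      rw [hrank d hm₁ (by omega)] at hs₁ hl₂ hNd
      rw [hrank d' hm₁' (by omega)] at hs₁' hl₂' hNd'
      have hnil : ∀ {l : List (Bridge n)}, UpPath J (maxSet J c) t v l → l = [] ∧ v = t := by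
        intro l h
        refine h.eq_nil fun w hw => ?_
        rcases hsub w hw with rfl | rfl | rfl | rfl | rfl | rfl <;> omega
      obtain ⟨rfl, hvt⟩ := hnil hl₂
      obtain ⟨rfl, -⟩ := hnil hl₂'
      have hβ := hs.label_eq (by rw [ax, az]; exact hyz)
      have hβ' := hs'.label_eq (by rw [a'x, a'z]; exact hxy)
      rw [et] at hs₁
      rw [e't] at hs₁'
      have hγ := hs₁.label_eq (by rw [ey, ez]; exact hxy)
      have hγ' := hs₁'.label_eq (by rw [e'x, e'y]; exact hyz)
      refine ⟨hhex, by rw [hvt, ty], hyne, ?_, ?_⟩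
      · rw [hβ, hγ]
        simp only [ax, az, ey, ez]
      · rw [hβ', hγ']
        simp only [a'x, a'z, e'x, e'y]
    · left
      push Not at hB
      obtain ⟨hzJ, hlt⟩ := hB
      have he := hmem_e hA
      have hzval : u y = z := by
        by_contra hne
        obtain ⟨q, hq⟩ := u.surjective z
        have := fxy q (by rw [hq]; exact hlt)
          (by rw [hq]; exact lt_of_le_of_ne (cz'.1 hzJ) (Ne.symm hne))
        rw [hq] at this
        subst this
        rw [← hq] at hlt
        exact absurd (cz'.1 hzJ) (not_le.2 (hyz.trans_eq hq))
      have hmax : maxSet J c = {u, a, e, a'} := by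
        apply Set.Subset.antisymm
        · intro w hw
          simp only [Set.mem_insert_iff, Set.mem_singleton_iff]
          have hwz : w z ≠ u x := fun h => by
            have := (hw.1 z).1 hzJ
            rw [h] at this
            exact absurd hlt (not_lt.2 this)
          rcases hsub w hw with h | h | h | h | h | h
          · exact .inl h
          · exact .inr (.inl h)
          · exact .inr (.inr (.inr h))
          · exact .inr (.inr (.inl h))
          · exact absurd (by rw [h, e'z]) hwz
          · exact absurd (by rw [h, tz]) hwz
        · rintro w (rfl | rfl | rfl | rfl) <;> assumption
      obtain ⟨β, β', rfl, rfl, rfl, hs, hs'⟩ := quad e hmax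
      have hβ := hs.label_eq (by rw [ax, az]; exact hyz)
      rw [a'e] at hs'
      have hβ' := hs'.label_eq (by rw [a'x, a'y]; exact hxy.trans hyz)
      refine ⟨?_, ?_, ?_, ?_⟩
      · refine ⟨permPoint u, permPoint a, permPoint e, permPoint a',
          (((u z : ℕ) : ℝ) - ((u x : ℕ) : ℝ)) / (((u y : ℕ) : ℝ) - ((u x : ℕ) : ℝ)),
          ?_, ?_, ?_, ?_, ?_⟩
        · rw [hmax]
          simp only [Set.image_insert_eq, Set.image_singleton]
        · rw [LinearIndependent.pair_iff]
          intro s r h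
          have h1 := congrFun h x
          have h2 := congrFun h z
          simp only [Pi.add_apply, Pi.smul_apply, Pi.sub_apply, permPoint, smul_eq_mul, ax, a'x, az,
            a'z, Pi.zero_apply] at h1 h2
          constructor
          · exact (mul_eq_zero.1 (show s * (((u y : ℕ) : ℝ) - ((u x : ℕ) : ℝ)) = 0 by
              linarith)).resolve_right rx_y
          · exact (mul_eq_zero.1 (show r * (((u z : ℕ) : ℝ) - ((u y : ℕ) : ℝ)) = 0 by
              linarith)).resolve_right ry_z
        · apply div_pos <;> linarith
        · rw [Ne, div_eq_one_iff_eq rx_y]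
          intro h
          linarith
        · refine funext (rcases3 ?_ ?_ ?_ ?_)
          · simp only [Pi.smul_apply, Pi.sub_apply, permPoint, smul_eq_mul, ex, a'x, ax]
            field_simp
            ring
          · simp only [Pi.smul_apply, Pi.sub_apply, permPoint, smul_eq_mul, ey, a'y, ay]
            field_simp
            ring
          · simp only [Pi.smul_apply, Pi.sub_apply, permPoint, smul_eq_mul, ez, a'z, az]
            ring
          · intro q h1 h2 h3
            simp only [Pi.smul_apply, Pi.sub_apply, permPoint, smul_eq_mul, eoff q h1 h2 h3,
              a'off q h1 h2 h3, aoff q h1 h2 h3]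
            ring
      · rw [hzval, ez, hzval]
      · rw [hβ]
        simp only [ax, az]
      · rw [hβ']
        simp only [a'x, a'y]
  · right; left
    push Not at hA
    obtain ⟨hxJ, hlt⟩ := hA
    have hxval : u y = x := by
      by_contra hne
      obtain ⟨q, hq⟩ := u.surjective x
      have := fyz q (by rw [hq]; exact lt_of_le_of_ne (cx.2 hxJ) hne) (by rw [hq]; exact hlt)
      rw [hq] at this
      subst this
      exact absurd (cx.2 hxJ) (not_le.2 (hq.symm.trans_lt hxy))
    have hB : z ∈ J → z ≤ u x := by
      intro hJ
      by_contra hcon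
      obtain ⟨q, hq⟩ := u.surjective z
      have hzx : z ≠ u y := fun h => nxz.symm (h.trans hxval)
      have := fxy q (by rw [hq]; exact not_le.1 hcon)
        (by rw [hq]; exact lt_of_le_of_ne (cz'.1 hJ) hzx)
      rw [hq] at this
      subst this
      exact absurd (cz'.1 hJ) (not_le.2 (hyz.trans_eq hq))
    have he' := hmem_e' hB
    have hmax : maxSet J c = {u, a, e', a'} := by
      apply Set.Subset.antisymm
      · intro w hw
        simp only [Set.mem_insert_iff, Set.mem_singleton_iff]
        have hwx : w x ≠ u z := fun h => by
          have := (hw.1 x).2 hxJ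
          rw [h] at this
          exact absurd hlt (not_lt.2 this)
        rcases hsub w hw with h | h | h | h | h | h
        · exact .inl h
        · exact .inr (.inl h)
        · exact .inr (.inr (.inr h))
        · exact absurd (by rw [h, ex]) hwx
        · exact .inr (.inr (.inl h))
        · exact absurd (by rw [h, tx]) hwx
      · rintro w (rfl | rfl | rfl | rfl) <;> assumption
    obtain ⟨β, β', rfl, rfl, rfl, hs, hs'⟩ := quad e' hmax
    have hβ' := hs'.label_eq (by rw [a'x, a'z]; exact hxy)
    rw [ae'] at hs
    have hβ := hs.label_eq (by rw [ay, az]; exact hxy.trans hyz)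
    refine ⟨?_, ?_, ?_, ?_⟩
    · refine ⟨permPoint u, permPoint a', permPoint e', permPoint a,
        (((u z : ℕ) : ℝ) - ((u x : ℕ) : ℝ)) / (((u z : ℕ) : ℝ) - ((u y : ℕ) : ℝ)),
        ?_, ?_, ?_, ?_, ?_⟩
      · rw [hmax, Set.insert_comm a e', Set.pair_comm a a', Set.insert_comm e' a']
        simp only [Set.image_insert_eq, Set.image_singleton]
      · rw [LinearIndependent.pair_iff]
        intro s r h
        have h1 := congrFun h x
        have h2 := congrFun h z
        simp only [Pi.add_apply, Pi.smul_apply, Pi.sub_apply, permPoint, smul_eq_mul, ax, a'x, az,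
          a'z, Pi.zero_apply] at h1 h2
        constructor
        · exact (mul_eq_zero.1 (show s * (((u z : ℕ) : ℝ) - ((u y : ℕ) : ℝ)) = 0 by
            linarith)).resolve_right ry_z
        · exact (mul_eq_zero.1 (show r * (((u y : ℕ) : ℝ) - ((u x : ℕ) : ℝ)) = 0 by
            linarith)).resolve_right rx_y
      · apply div_pos <;> linarith
      · rw [Ne, div_eq_one_iff_eq ry_z]
        intro h
        linarith
      · refine funext (rcases3 ?_ ?_ ?_ ?_)
        · simp only [Pi.smul_apply, Pi.sub_apply, permPoint, smul_eq_mul, e'x, a'x, ax]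
          ring
        · simp only [Pi.smul_apply, Pi.sub_apply, permPoint, smul_eq_mul, e'y, a'y, ay]
          field_simp
          ring
        · simp only [Pi.smul_apply, Pi.sub_apply, permPoint, smul_eq_mul, e'z, a'z, az]
          field_simp
          ring
        · intro q h1 h2 h3
          simp only [Pi.smul_apply, Pi.sub_apply, permPoint, smul_eq_mul, e'off q h1 h2 h3,
            a'off q h1 h2 h3, aoff q h1 h2 h3]
          ring
    · rw [hxval, e'x, hxval]
    · rw [hβ]
      simp only [ay, az]
    · rw [hβ']
      simp only [a'x, a'z]

end Triple

end BridgePolytope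

namespace BridgePolytope

open Equiv

variable {n : ℕ} {J : Finset (Fin n)}

/-- The labels along the two halves `m` and `m'` of the boundary of a two-dimensional face `F` with
top vertex `v`, together with the shape of `F`. -/
def FaceLabels (F : Set (Fin n → ℝ)) (v : Perm (Fin n)) (m m' : List (Bridge n)) : Prop :=
  (IsRectangle F ∧ ∃ b b' : Bridge n, b.left ≠ b'.left ∧ b.left ≠ b'.right ∧ b.right ≠ b'.left ∧
      b.right ≠ b'.right ∧ m = [b, b'] ∧ m' = [b', b]) ∨
    (IsTrapezoid F ∧ ∃ (i j k : Fin n) (hij : i < j) (hjk : j < k), v j = j ∧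
      ((m = [⟨i, j, hij⟩, ⟨j, k, hjk⟩] ∧ m' = [⟨j, k, hjk⟩, ⟨i, k, hij.trans hjk⟩]) ∨
        (m = [⟨i, j, hij⟩, ⟨i, k, hij.trans hjk⟩] ∧ m' = [⟨j, k, hjk⟩, ⟨i, j, hij⟩]))) ∨
    (IsHexagon F ∧ ∃ (i j k : Fin n) (hij : i < j) (hjk : j < k), (∃ q, v q = j ∧ q ≠ j) ∧
      m = [⟨i, j, hij⟩, ⟨j, k, hjk⟩, ⟨i, j, hij⟩] ∧ m' = [⟨j, k, hjk⟩, ⟨i, j, hij⟩, ⟨j, k, hjk⟩])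

section

variable {c : Fin n → ℝ} {u a a' v : Perm (Fin n)} {b b' : Bridge n} {l l' : List (Bridge n)}

/-- The combinatorics of a two-dimensional face, read off from two paths of steps up that part at
`u`. -/
theorem faceLabels (hS : Module.finrank ℝ (vectorSpan ℝ (permPoint '' maxSet J c)) = 2)
    (hu : u ∈ maxSet J c) (hs : Step J u a b) (ha : a ∈ maxSet J c) (hs' : Step J u a' b')
    (ha' : a' ∈ maxSet J c) (hne : a ≠ a') (hl : UpPath J (maxSet J c) a v l)
    (hl' : UpPath J (maxSet J c) a' v l') (hlen : l.length = l'.length) :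
    FaceLabels (convexHull ℝ (permPoint '' maxSet J c)) v (b :: l) (b' :: l') ∨
      FaceLabels (convexHull ℝ (permPoint '' maxSet J c)) v (b' :: l') (b :: l) := by
  have hN := hs.inversions_eq
  have hN' := hs'.inversions_eq
  obtain ⟨-, -, x, y, hlt, hrk, rfl, hfix, rfl⟩ := hs
  obtain ⟨-, -, x', y', hlt', hrk', rfl, hfix', rfl⟩ := hs'
  have hux := hu.1
  by_cases hxx : x = x'
  · -- two steps that lower the value of the same position are impossible
    exfalso
    subst hxx
    have key : ∀ y y' : Fin n, u y < u x → schubertPerm J y' < schubertPerm J x → u y' < u x →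
        u * swap x y ∈ permSet J → u * swap x y' ∈ permSet J →
        (∀ q, u y < u q → u q < u x → u q = q) → (∀ q, u y' < u q → u q < u x → u q = q) →
        ¬ schubertPerm J y < schubertPerm J y' := by
      intro y y' h1 h2 h3 h4 h5 h6 h7 h8
      rcases lt_trichotomy (u y) (u y') with h | h | h
      · exact not_between h4 (h6 y' h h3) h8 h2 h h3
      · rw [u.injective h] at h8
        exact lt_irrefl _ h8
      · have hy := h7 y h h1
        by_cases hJ : y ∈ J
        · obtain ⟨h9, h10⟩ := (schubertPerm_lt h8).1 hJ
          have := (hux y').1 h9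
          exact absurd (h10.trans_le this) (not_lt.2 (h.le.trans_eq hy))
        · have := (h4 y).2 hJ
          rw [Perm.mul_apply, swap_apply_right] at this
          exact absurd this (not_le.2 (hy.symm.trans_lt h1))
    rcases lt_trichotomy (schubertPerm J y) (schubertPerm J y') with h | h | h
    · exact key y y' hlt hrk' hlt' ha.1 ha'.1 hfix hfix' h
    · exact hne (by rw [(schubertPerm J).injective h])
    · exact key y' y hlt' hrk hlt ha'.1 ha.1 hfix' hfix h
  by_cases hyy : y = y'
  · -- two steps that raise the value of the same position are impossible
    exfalso
    subst hyy
    have key : ∀ x x' : Fin n, u y < u x → schubertPerm J y < schubertPerm J x → u y < u x' →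
        u * swap x y ∈ permSet J → u * swap x' y ∈ permSet J →
        (∀ q, u y < u q → u q < u x → u q = q) → (∀ q, u y < u q → u q < u x' → u q = q) →
        ¬ schubertPerm J x < schubertPerm J x' := by
      intro x x' h1 h2 h3 h4 h5 h6 h7 h8
      rcases lt_trichotomy (u x) (u x') with h | h | h
      · exact not_between h5 (h7 x h1 h) h2 h8 h1 h
      · rw [u.injective h] at h8
        exact lt_irrefl _ h8
      · have hx := h6 x' h3 h
        by_cases hJ : x' ∈ J
        · have := (h5 x').1 hJ
          rw [Perm.mul_apply, swap_apply_left] at this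
          exact absurd this (not_le.2 (h3.trans_eq hx))
        · obtain ⟨h9, h10⟩ := (schubertPerm_lt h8).2 hJ
          have := (hux x).2 h9
          exact absurd (this.trans_lt h10) (not_lt.2 (hx.symm.le.trans h.le))
    rcases lt_trichotomy (schubertPerm J x) (schubertPerm J x') with h | h | h
    · exact key x x' hlt hrk hlt' ha.1 ha'.1 hfix hfix' h
    · exact hxx ((schubertPerm J).injective h)
    · exact key x' x hlt' hrk' hlt ha'.1 ha.1 hfix' hfix h
  by_cases hxy' : x = y'
  · subst hxy'
    left
    rcases trapezoid_or_hexagon hS hu hlt hlt' ha ha' hfix hfix' hN hN' hl hl' hlen with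
      ⟨h1, h2, rfl, rfl⟩ | ⟨h1, h2, rfl, rfl⟩ | ⟨h1, h2, h3, rfl, rfl⟩
    · exact .inr (.inl ⟨h1, u y, u x, u x', hlt, hlt', h2, .inl ⟨rfl, rfl⟩⟩)
    · exact .inr (.inl ⟨h1, u y, u x, u x', hlt, hlt', h2, .inr ⟨rfl, rfl⟩⟩)
    · exact .inr (.inr ⟨h1, u y, u x, u x', hlt, hlt', ⟨x, h2, h3.symm⟩, rfl, rfl⟩)
  by_cases hx'y : x' = y
  · subst hx'y
    right
    rcases trapezoid_or_hexagon hS hu hlt' hlt ha' ha hfix' hfix hN' hN hl' hl hlen.symm with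
      ⟨h1, h2, rfl, rfl⟩ | ⟨h1, h2, rfl, rfl⟩ | ⟨h1, h2, h3, rfl, rfl⟩
    · exact .inr (.inl ⟨h1, u y', u x', u x, hlt', hlt, h2, .inl ⟨rfl, rfl⟩⟩)
    · exact .inr (.inl ⟨h1, u y', u x', u x, hlt', hlt, h2, .inr ⟨rfl, rfl⟩⟩)
    · exact .inr (.inr ⟨h1, u y', u x', u x, hlt', hlt, ⟨x', h2, h3.symm⟩, rfl, rfl⟩)
  left; left
  obtain ⟨h1, rfl, rfl⟩ := rectangle_of_disjoint hS hu hlt hlt' ha ha' hN hN' hxx hxy'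
    (Ne.symm hx'y) hyy hl hl' hlen
  exact ⟨h1, _, _, u.injective.ne hyy, u.injective.ne (Ne.symm hx'y), u.injective.ne hxy',
    u.injective.ne hxx, rfl, rfl⟩

end

theorem mem_permSet_of_walk {u : Perm (Fin n)} (p : (skeleton J).Walk u 1) : u ∈ permSet J := by
  have : ∀ {u v : Perm (Fin n)} (_ : (skeleton J).Walk u v), v ∈ permSet J → u ∈ permSet J := by
    intro u v p hv
    cases p with
    | nil => exact hv
    | cons h _ => exact h.2.1
  exact this p (one_mem_permSet J)

/-- The two label sequences of a rerouted shortest path: they differ only along the face, all wires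
passed over by a bridge end above it, and the behaviour of the middle wire after the face is
determined by the value at the top vertex of the face. -/
theorem reroute_labels
    (p p' : (skeleton J).Walk (schubertPerm J) (1 : Perm (Fin n)))
    (hp : p.length = (skeleton J).dist (schubertPerm J) 1)
    (F : Set (Fin n → ℝ)) (hF : IsTwoFace J F) (hpp' : IsReroute J F p p') :
    (p.darts.map edgeLabel).Pairwise Bridge.Avoids ∧
      (p'.darts.map edgeLabel).Pairwise Bridge.Avoids ∧
      ∃ (w₁ m m' w₂ : List (Bridge n)) (v : Perm (Fin n)),
        p.darts.map edgeLabel = w₁ ++ m ++ w₂ ∧ p'.darts.map edgeLabel = w₁ ++ m' ++ w₂ ∧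
        (∃ M, UpPath J M v 1 w₂) ∧ (FaceLabels F v m m' ∨ FaceLabels F v m' m) := by
  obtain ⟨u, v, q₁, r, r', q₂, rfl, rfl, hr, hr', hdisj, hsides, hcard⟩ := hpp'
  obtain ⟨hexp, hrank⟩ := hF
  have hFne : F.Nonempty := by
    by_contra hc
    rw [Set.not_nonempty_iff_eq_empty] at hc
    subst hc
    rw [vectorSpan_empty, finrank_bot] at hrank
    omega
  obtain ⟨c, rfl, hc⟩ := exists_maxSet_of_isExposed hexp hFne
  rw [vectorSpan_face] at hrank
  -- both halves have the same length
  have hlen : r.length = r'.length := by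
    classical
    have hfin : {e | e ∈ r.edges ∨ e ∈ r'.edges} = ((r.edges ++ r'.edges).toFinset : Set _) := by
      ext e; simp
    rw [← hsides, hfin, Set.ncard_coe_finset, List.toFinset_card_of_nodup, List.length_append,
      SimpleGraph.Walk.length_edges, SimpleGraph.Walk.length_edges] at hcard
    · omega
    · exact List.nodup_append'.2 ⟨hr.isTrail.edges_nodup, hr'.isTrail.edges_nodup, hdisj⟩
  have hlen' : (q₁.append (r'.append q₂)).length = (q₁.append (r.append q₂)).length := by
    simp only [SimpleGraph.Walk.length_append, hlen]
  have hsch := mem_permSet_of_walk (q₁.append (r.append q₂))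
  have hup := isUp_of_shortest hsch _ hp
  have hup' := isUp_of_shortest hsch _ (hlen'.trans hp)
  simp only [SimpleGraph.Walk.darts_append, List.mem_append] at hup hup'
  refine ⟨(upPath_of_walk (M := Set.univ) _ fun d hd => ⟨isUp_of_shortest hsch _ hp d hd,
      trivial⟩).pairwise_avoids, (upPath_of_walk (M := Set.univ) _ fun d hd =>
      ⟨isUp_of_shortest hsch _ (hlen'.trans hp) d hd, trivial⟩).pairwise_avoids,
    q₁.darts.map edgeLabel, r.darts.map edgeLabel, r'.darts.map edgeLabel, q₂.darts.map edgeLabel,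
    v, by simp, by simp, ⟨Set.univ, upPath_of_walk _ fun d hd =>
      ⟨hup d (.inr (.inr hd)), trivial⟩⟩, ?_⟩
  -- the steps of both halves stay in the face
  have hin : ∀ e, (e ∈ r.edges ∨ e ∈ r'.edges) → ∀ z ∈ e, z ∈ permSet J → z ∈ maxSet J c := by
    intro e he z hz hzJ
    have : e ∈ sides J (convexHull ℝ (permPoint '' maxSet J c)) := by
      rw [← hsides]; exact he
    exact (hc z hzJ).1 (this.2 z hz)
  -- the face has a side
  have hpos : 0 < (sides J (convexHull ℝ (permPoint '' maxSet J c))).ncard := by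
    rw [Set.ncard_pos (Set.toFinite _)]
    have hnt : (maxSet J c).Nontrivial := by
      by_contra hsub
      rw [Set.not_nontrivial_iff] at hsub
      rw [vectorSpan_of_subsingleton ℝ (hsub.image _), finrank_bot] at hrank
      omega
    obtain ⟨z, hz, w, hw, hzw⟩ := hnt
    obtain ⟨q, hq⟩ : ∃ q, w q ≠ z q := by
      by_contra hcon
      push Not at hcon
      exact hzw (Equiv.ext fun q => (hcon q).symm)
    obtain ⟨t, ht, hadj⟩ : ∃ t ∈ maxSet J c, (skeleton J).Adj z t := by
      obtain ⟨y, hy, h | h⟩ := exists_tie_of_ne hz hw hq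
      · exact exists_adj_of_tie hz h hy
      · exact exists_adj_of_tie hz h hy.symm
    refine ⟨s(z, t), hadj, fun x hx => ?_⟩
    rcases Sym2.mem_iff.1 hx with rfl | rfl
    · exact (hc _ hz.1).2 hz
    · exact (hc _ ht.1).2 ht
  cases r with
  | nil => simp at hcard; omega
  | @cons _ a _ h r =>
    cases r' with
    | nil => simp at hlen
    | @cons _ a' _ h' r' =>
      have hu : u ∈ maxSet J c := hin s(u, a) (.inl (by simp)) u (by simp) h.2.1
      have haa' : a ≠ a' := by
        rintro rfl
        exact hdisj (a := s(u, a)) (by simp) (by simp)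
      have ha : a ∈ maxSet J c := hin s(u, a) (.inl (by simp)) a (by simp) h.2.2.1
      have ha' : a' ∈ maxSet J c := hin s(u, a') (.inr (by simp)) a' (by simp) h'.2.2.1
      have hs := step_of_dart ⟨(u, a), h⟩ (hup ⟨(u, a), h⟩ (.inr (.inl (by simp))))
      have hs' := step_of_dart ⟨(u, a'), h'⟩ (hup' ⟨(u, a'), h'⟩ (.inr (.inl (by simp))))
      have hl := upPath_of_walk (M := maxSet J c) r fun d hd =>
        ⟨hup d (.inr (.inl (by simp [hd]))), hin d.edge
          (.inl (List.mem_map_of_mem (by simp [hd]))) d.snd (by simp [SimpleGraph.Dart.edge])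
          d.adj.2.2.1⟩
      have hl' := upPath_of_walk (M := maxSet J c) r' fun d hd =>
        ⟨hup' d (.inr (.inl (by simp [hd]))), hin d.edge
          (.inr (List.mem_map_of_mem (by simp [hd]))) d.snd (by simp [SimpleGraph.Dart.edge])
          d.adj.2.2.1⟩
      exact faceLabels hrank hu hs ha hs' ha' haa' hl hl' (by simpa using hlen)

end BridgePolytope

namespace BridgePolytope

open Equiv

/-! ### Counting cycles -/

theorem eq_of_sameCycle {α T : Type} {f : Perm α} {g : α → T} (h : ∀ x, g (f x) = g x) {x y : α}
    (hxy : f.SameCycle x y) : g x = g y := by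
  obtain ⟨i, rfl⟩ := hxy
  induction i with
  | zero => simp
  | succ i ih => rw [ih, add_comm (i : ℤ), zpow_one_add, Perm.mul_apply, h]
  | pred i ih =>
    rw [ih, ← h ((f ^ (-(i : ℤ) - 1)) x), ← Perm.mul_apply, ← zpow_one_add]
    congr 3
    ring

theorem numCycles_eq_card {α T : Type} {f : Perm α} (g : α → T) (hg : Function.Surjective g)
    (h : ∀ x y, g x = g y ↔ f.SameCycle x y) : PlabicMap.numCycles f = Nat.card T := by
  refine Nat.card_congr (Equiv.ofBijective
    (Quotient.lift (s := Perm.SameCycle.setoid f) g fun x y hxy => (h x y).2 hxy) ⟨?_, ?_⟩)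
  · intro a b
    induction a using Quotient.inductionOn with | _ x => ?_
    induction b using Quotient.inductionOn with | _ y => ?_
    intro hxy
    exact Quotient.sound ((h x y).1 hxy)
  · intro t
    obtain ⟨x, rfl⟩ := hg t
    exact ⟨Quotient.mk _ x, rfl⟩

theorem sameCycle_apply {α : Type} (f : Perm α) (x : α) : f.SameCycle x (f x) :=
  ⟨1, by simp⟩

/-! ### Planarity of bridge graphs -/

section Planar

variable {n : ℕ} {w : List (Bridge n)}

theorem boundaryDart_injective : Function.Injective (boundaryDart w) :=
  (bridgeGraph ∅ w).bdry_injective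

theorem sphereRot_of_notMem (J : Finset (Fin n)) {d : BridgeDart w}
    (h : d ∉ Set.range (boundaryDart w)) : (bridgeGraph J w).sphereRot d = d.cw := by
  exact congrArg (bridgeGraph J w).rot
    (Perm.viaEmbedding_apply_of_notMem (finRotate n)⁻¹ ⟨boundaryDart w, boundaryDart_injective⟩ d h)

theorem sphereRot_boundaryDart (J : Finset (Fin n)) (a : Fin n) :
    (bridgeGraph J w).sphereRot (boundaryDart w a) = boundaryDart w ((finRotate n)⁻¹ a) := by
  change (bridgeGraph J w).rot (Perm.viaEmbedding _ _ _) = _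
  have := Perm.viaEmbedding_apply (finRotate n)⁻¹ ⟨boundaryDart w, boundaryDart_injective⟩ a
  rw [Function.Embedding.coeFn_mk] at this
  refine (congrArg _ this).trans ((bridgeGraph J w).rot_bdry _)

theorem finRotate_inv_val (a : Fin n) (ha : (a : ℕ) ≠ 0) :
    (((finRotate n)⁻¹ a : Fin n) : ℕ) = a - 1 := by
  obtain ⟨m, rfl⟩ : ∃ m, n = m + 1 := ⟨n - 1, by have := a.isLt; omega⟩
  have : (finRotate (m + 1))⁻¹ a = ⟨a - 1, by omega⟩ := by
    rw [Perm.inv_eq_iff_eq, finRotate_apply]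
    ext
    rw [Fin.val_add_one_of_lt]
    · simp only; omega
    · rw [Fin.lt_def, Fin.val_last]
      simp only
      have := a.isLt
      omega
  rw [this]

theorem finRotate_inv_val_zero (a : Fin n) (ha : (a : ℕ) = 0) :
    (((finRotate n)⁻¹ a : Fin n) : ℕ) = n - 1 := by
  obtain ⟨m, rfl⟩ : ∃ m, n = m + 1 := ⟨n - 1, by have := a.isLt; omega⟩
  have : (finRotate (m + 1))⁻¹ a = Fin.last m := by
    rw [Perm.inv_eq_iff_eq, finRotate_apply]
    ext
    rw [ha]
    simp
  rw [this]
  simp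

theorem down_notMem_range {v u : Foot w} (h : above w v = some u) :
    (BridgeDart.down v) ∉ Set.range (boundaryDart w) := by
  rw [← dartColor_eq_none ∅]
  simp [dartColor, h]

theorem up_notMem_range (v : Foot w) : (BridgeDart.up v) ∉ Set.range (boundaryDart w) := by
  rw [← dartColor_eq_none ∅]
  simp [dartColor]

theorem cross_notMem_range (v : Foot w) : (BridgeDart.cross v) ∉ Set.range (boundaryDart w) := by
  rw [← dartColor_eq_none ∅]
  simp [dartColor]

theorem leaf_notMem_range (a) : (BridgeDart.leaf a : BridgeDart w) ∉ Set.range (boundaryDart w) := by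
  rw [← dartColor_eq_none ∅]
  simp [dartColor]

/-- The vertex at a half-edge, after the boundary vertices have been merged into one, `none`. -/
noncomputable def vertexOf : BridgeDart w → Option (Foot w ⊕ {a : Fin n // ¬ ∃ v, wire w v = a})
  | .up v => some (.inl v)
  | .cross v => some (.inl v)
  | .down v => (above w v).map .inl
  | .stub _ => none
  | .leaf a => some (.inr a)

theorem vertexOf_boundaryDart (a : Fin n) : vertexOf (boundaryDart w a) = none := by
  rcases boundaryDart_cases (w := w) a with ⟨v, -, hv, h⟩ | ⟨h', h⟩ <;> rw [h]
  · simp [vertexOf, hv]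
  · rfl

theorem vertexOf_cw (d : BridgeDart w) : vertexOf d.cw = vertexOf d := by
  rcases d with v | v | v | a | a
  · obtain ⟨t, s⟩ := v
    cases s
    · simp [BridgeDart.cw, vertexOf]
    · rcases h : below w (t, true) with _ | v'
      · simp [BridgeDart.cw, BridgeDart.downFrom, vertexOf, h]
      · simp [BridgeDart.cw, BridgeDart.downFrom, vertexOf, h, above_of_below h]
  · rcases h : above w v with _ | u
    · simp [BridgeDart.cw, h]
    · obtain ⟨t, s⟩ := u
      cases s <;> simp [BridgeDart.cw, vertexOf, h]
  · obtain ⟨t, s⟩ := v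
    cases s
    · rcases h : below w (t, false) with _ | v'
      · simp [BridgeDart.cw, BridgeDart.downFrom, vertexOf, h]
      · simp [BridgeDart.cw, BridgeDart.downFrom, vertexOf, h, above_of_below h]
    · simp [BridgeDart.cw, vertexOf]
  · rfl
  · rfl

theorem vertexOf_sphereRot (J : Finset (Fin n)) (d : BridgeDart w) :
    vertexOf ((bridgeGraph J w).sphereRot d) = vertexOf d := by
  by_cases h : d ∈ Set.range (boundaryDart w)
  · obtain ⟨a, rfl⟩ := h
    rw [sphereRot_boundaryDart, vertexOf_boundaryDart, vertexOf_boundaryDart]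
  · rw [sphereRot_of_notMem J h, vertexOf_cw]

theorem sameCycle_boundaryDart (J : Finset (Fin n)) (a b : Fin n) :
    (bridgeGraph J w).sphereRot.SameCycle (boundaryDart w a) (boundaryDart w b) := by
  have key : ∀ (m : ℕ) (a : Fin n), (a : ℕ) = m → (bridgeGraph J w).sphereRot.SameCycle
      (boundaryDart w a) (boundaryDart w ⟨0, by have := a.isLt; omega⟩) := by
    intro m
    induction m with
    | zero =>
      intro a ha
      have : a = ⟨0, by have := a.isLt; omega⟩ := Fin.ext ha
      rw [← this]
      exact Perm.SameCycle.refl _ _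
    | succ m ih =>
      intro a ha
      have h1 := sameCycle_apply (bridgeGraph J w).sphereRot (boundaryDart w a)
      rw [sphereRot_boundaryDart] at h1
      exact h1.trans (ih _ (by rw [finRotate_inv_val a (by omega)]; omega))
  exact (key _ a rfl).trans (key _ b rfl).symm

theorem sameCycle_of_vertexOf (J : Finset (Fin n)) {d : BridgeDart w} {v : Foot w}
    (h : vertexOf d = some (.inl v)) : (bridgeGraph J w).sphereRot.SameCycle d (.up v) := by
  have hrot : ∀ d' : BridgeDart w, d' ∉ Set.range (boundaryDart w) →
      (bridgeGraph J w).sphereRot.SameCycle d' d'.cw := fun d' hd => by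
    have := sameCycle_apply (bridgeGraph J w).sphereRot d'
    rwa [sphereRot_of_notMem J hd] at this
  have hcross : ∀ v : Foot w,
      (bridgeGraph J w).sphereRot.SameCycle (.cross v : BridgeDart w) (.up v) := by
    rintro ⟨t, s⟩
    cases s
    · have := hrot _ (up_notMem_range (w := w) (t, false))
      simp only [BridgeDart.cw, cond_false] at this
      exact this.symm
    · have := hrot _ (cross_notMem_range (w := w) (t, true))
      simpa only [BridgeDart.cw, cond_true] using this
  rcases d with v' | v' | v' | a | a
  · simp only [vertexOf, Option.some.injEq, Sum.inl.injEq] at h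
    rw [h]
    exact Perm.SameCycle.refl _ _
  · rcases ha : above w v' with _ | u
    · simp [vertexOf, ha] at h
    · simp only [vertexOf, ha, Option.map_some, Option.some.injEq, Sum.inl.injEq] at h
      subst h
      have := hrot _ (down_notMem_range ha)
      obtain ⟨t, s⟩ := u
      cases s
      · simpa only [BridgeDart.cw, ha, cond_false] using this
      · simp only [BridgeDart.cw, ha, cond_true] at this
        exact this.trans (hcross _)
  · simp only [vertexOf, Option.some.injEq, Sum.inl.injEq] at h
    rw [h]
    exact hcross v
  · simp [vertexOf] at h
  · simp [vertexOf] at h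

theorem exists_boundaryDart_of_vertexOf {d : BridgeDart w} (h : vertexOf d = none) :
    ∃ a, d = boundaryDart w a := by
  rcases d with v | v | v | a | a
  · simp [vertexOf] at h
  · exact ⟨wire w v, (boundaryDart_of_top (by simpa [vertexOf] using h)).symm⟩
  · simp [vertexOf] at h
  · exact ⟨a, (boundaryDart_of_untouched a).symm⟩
  · simp [vertexOf] at h

theorem numCycles_sphereRot (J : Finset (Fin n)) (w : List (Bridge n)) (hn : 0 < n) :
    PlabicMap.numCycles (bridgeGraph J w).sphereRot =
      2 * w.length + Nat.card {a : Fin n // ¬ ∃ v, wire w v = a} + 1 := by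
  rw [numCycles_eq_card (f := (bridgeGraph J w).sphereRot) (vertexOf (w := w))]
  · rw [Finite.card_option, Nat.card_sum, Nat.card_prod, Nat.card_fin,
      Nat.card_eq_fintype_card (α := Bool), Fintype.card_bool]
    ring
  · rintro (_ | v | a)
    · exact ⟨_, vertexOf_boundaryDart ⟨0, hn⟩⟩
    · exact ⟨.up v, rfl⟩
    · exact ⟨.leaf a, rfl⟩
  · intro x y
    refine ⟨fun h => ?_, eq_of_sameCycle (vertexOf_sphereRot J)⟩
    rcases hx : vertexOf x with _ | v | a
    · obtain ⟨a, rfl⟩ := exists_boundaryDart_of_vertexOf hx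
      obtain ⟨b, rfl⟩ := exists_boundaryDart_of_vertexOf (h.symm.trans hx)
      exact sameCycle_boundaryDart J a b
    · exact (sameCycle_of_vertexOf J hx).trans (sameCycle_of_vertexOf J (h.symm.trans hx)).symm
    · have key : ∀ d : BridgeDart w, vertexOf d = some (.inr a) → d = .leaf a := by
        rintro (v | v | v | b | b) hd
        · simp [vertexOf] at hd
        · rcases ha : above w v with _ | u <;> simp [vertexOf, ha] at hd
        · simp [vertexOf] at hd
        · simp [vertexOf] at hd
        · simp only [vertexOf, Option.some.injEq, Sum.inr.injEq] at hd
          rw [hd]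
      rw [key x hx, key y (h.symm.trans hx)]
      exact Perm.SameCycle.refl _ _

/-- The edge of a half-edge. -/
def edgeOf : BridgeDart w → Foot w ⊕ Fin w.length ⊕ {a : Fin n // ¬ ∃ v, wire w v = a}
  | .up v => .inl v
  | .down v => .inl v
  | .cross v => .inr (.inl v.1)
  | .stub a => .inr (.inr a)
  | .leaf a => .inr (.inr a)

theorem eq_or_eq_opp_of_edgeOf {x y : BridgeDart w} (h : edgeOf x = edgeOf y) :
    y = x ∨ y = x.opp := by
  rcases x with v | v | ⟨t, s⟩ | a | a <;> rcases y with v' | v' | ⟨t', s'⟩ | a' | a' <;>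
    simp_all [edgeOf, BridgeDart.opp]
  cases s <;> cases s' <;> simp

theorem numCycles_edge (J : Finset (Fin n)) (w : List (Bridge n)) :
    PlabicMap.numCycles (bridgeGraph J w).edge =
      3 * w.length + Nat.card {a : Fin n // ¬ ∃ v, wire w v = a} := by
  rw [numCycles_eq_card (f := (bridgeGraph J w).edge) (edgeOf (w := w))]
  · rw [Nat.card_sum, Nat.card_sum, Nat.card_prod, Nat.card_fin,
      Nat.card_eq_fintype_card (α := Bool), Fintype.card_bool]
    ring
  · rintro (v | t | a)
    · exact ⟨.up v, rfl⟩
    · exact ⟨.cross (t, false), rfl⟩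
    · exact ⟨.leaf a, rfl⟩
  · intro x y
    constructor
    · intro h
      have : y = x ∨ y = (bridgeGraph J w).edge x := by
        exact eq_or_eq_opp_of_edgeOf h
      rcases this with rfl | rfl
      · exact Perm.SameCycle.refl _ _
      · exact sameCycle_apply _ _
    · refine eq_of_sameCycle fun x => ?_
      change edgeOf x.opp = edgeOf x
      rcases x with v | v | v | a | a <;> rfl

/-- The bridge `b` spans the strip between the wires `g - 1` and `g`. -/
def Bridge.Spans (b : Bridge n) (g : ℕ) : Prop := (b.left : ℕ) < g ∧ g ≤ b.right

/-- The face at height `t` in the strip between the wires `g - 1` and `g`, named by the bridge that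
bounds it from below; the outermost face has number `w.length`. -/
noncomputable def faceNum (w : List (Bridge n)) (g t : ℕ) : ℕ :=
  sInf {s | t ≤ s ∧ ∀ h : s < w.length, (w.get ⟨s, h⟩).Spans g}

theorem faceNum_le (g : ℕ) {t : ℕ} (ht : t ≤ w.length) : faceNum w g t ≤ w.length :=
  Nat.sInf_le ⟨ht, fun h => absurd h (lt_irrefl _)⟩

theorem faceNum_eq_self {g t : ℕ} (h : ∀ h : t < w.length, (w.get ⟨t, h⟩).Spans g) :
    faceNum w g t = t :=
  le_antisymm (Nat.sInf_le ⟨le_rfl, h⟩) (le_csInf ⟨t, le_rfl, h⟩ fun _ hs => hs.1)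

theorem faceNum_skip {g t t' : ℕ} (h1 : t ≤ t') (h2 : t' ≤ w.length)
    (h : ∀ s (hs : s < w.length), t ≤ s → s < t' → ¬ (w.get ⟨s, hs⟩).Spans g) :
    faceNum w g t = faceNum w g t' := by
  unfold faceNum
  congr 1
  ext s
  constructor
  · rintro ⟨h3, h4⟩
    refine ⟨?_, h4⟩
    by_contra hc
    have hs : s < w.length := by omega
    exact h s hs h3 (not_le.1 hc) (h4 hs)
  · rintro ⟨h3, h4⟩
    exact ⟨h1.trans h3, h4⟩

theorem faceNum_congr {g g' t : ℕ}
    (h : ∀ s (hs : s < w.length), t ≤ s → ((w.get ⟨s, hs⟩).Spans g ↔ (w.get ⟨s, hs⟩).Spans g')) :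
    faceNum w g t = faceNum w g' t := by
  unfold faceNum
  congr 1
  ext s
  constructor <;> rintro ⟨h3, h4⟩ <;> refine ⟨h3, fun hs => ?_⟩
  · exact (h s hs h3).1 (h4 hs)
  · exact (h s hs h3).2 (h4 hs)

/-- The face to the left of a half-edge, when one walks from its vertex along the edge. -/
noncomputable def faceOf : BridgeDart w → ℕ
  | .up v => faceNum w (wire w v) v.1
  | .down v => faceNum w (wire w v + 1) v.1
  | .cross v => bif v.2 then faceNum w (wire w v) (v.1 + 1) else faceNum w (wire w v + 1) v.1
  | .stub a => faceNum w ((a : Fin n) + 1) 0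
  | .leaf a => faceNum w (a : Fin n) 0

theorem faceOf_le (d : BridgeDart w) : faceOf d ≤ w.length := by
  rcases d with v | v | ⟨t, s⟩ | a | a
  · exact faceNum_le _ v.1.isLt.le
  · exact faceNum_le _ v.1.isLt.le
  · cases s
    · exact faceNum_le _ t.isLt.le
    · exact faceNum_le _ t.isLt
  · exact faceNum_le _ (Nat.zero_le _)
  · exact faceNum_le _ (Nat.zero_le _)

theorem wire_false (t : Fin w.length) : wire w (t, false) = (w.get t).left := rfl

theorem wire_true (t : Fin w.length) : wire w (t, true) = (w.get t).right := rfl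

/-- A wire carries no foot at a bridge that is not between consecutive feet. -/
theorem ne_of_no_foot {a : Fin n} {s : ℕ} (hs : s < w.length)
    (h : ∀ u, wire w u = a → (u.1 : ℕ) ≠ s) :
    (w.get ⟨s, hs⟩).left ≠ a ∧ (w.get ⟨s, hs⟩).right ≠ a :=
  ⟨fun h' => h (⟨s, hs⟩, false) h' rfl, fun h' => h (⟨s, hs⟩, true) h' rfl⟩

/-- Along a wire without feet the faces on both sides agree. -/
theorem faceNum_succ_of_no_foot {a : Fin n} {t : ℕ}
    (h : ∀ u, wire w u = a → (u.1 : ℕ) < t) : faceNum w (a + 1) t = faceNum w a t := by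
  refine faceNum_congr fun s hs hts => ?_
  have := ne_of_no_foot (a := a) hs fun u hu => by have := h u hu; omega
  have h1 : ((w.get ⟨s, hs⟩).left : ℕ) ≠ a := fun h => this.1 (Fin.ext h)
  have h2 : ((w.get ⟨s, hs⟩).right : ℕ) ≠ a := fun h => this.2 (Fin.ext h)
  unfold Bridge.Spans
  omega

theorem not_spans (hw : w.Pairwise Bridge.Avoids) {v : Foot w} {s : ℕ} (hs : s < w.length) (hsv : s < v.1)
    (h : ∀ u, wire w u = wire w v → (u.1 : ℕ) ≠ s) :
    ¬ (w.get ⟨s, hs⟩).Spans (wire w v) ∧ ¬ (w.get ⟨s, hs⟩).Spans (wire w v + 1) := by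
  have hne := ne_of_no_foot hs h
  have h1 : ((w.get ⟨s, hs⟩).left : ℕ) ≠ wire w v := fun h => hne.1 (Fin.ext h)
  have h2 : ((w.get ⟨s, hs⟩).right : ℕ) ≠ wire w v := fun h => hne.2 (Fin.ext h)
  have hav : (w.get ⟨s, hs⟩).Avoids (w.get v.1) :=
    List.pairwise_iff_get.1 hw ⟨s, hs⟩ v.1 hsv
  have key : ¬ (((w.get ⟨s, hs⟩).left : ℕ) < wire w v ∧ (wire w v : ℕ) < (w.get ⟨s, hs⟩).right) := by
    rintro ⟨h3, h4⟩
    have := hav (wire w v) h3 h4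
    obtain ⟨t, b⟩ := v
    cases b
    · exact this.1 rfl
    · exact this.2 rfl
  unfold Bridge.Spans
  omega

/-- Between two consecutive feet of a wire no bridge passes. -/
theorem faceNum_of_isNext (hw : w.Pairwise Bridge.Avoids) {u v : Foot w} (h : IsNext w u v)
    {t : ℕ} (h1 : (u.1 : ℕ) < t) (h2 : t ≤ v.1) : faceNum w (wire w v) t = faceNum w (wire w v) v.1 ∧
      faceNum w (wire w v + 1) t = faceNum w (wire w v + 1) v.1 := by
  have key : ∀ s (hs : s < w.length), t ≤ s → s < v.1 →
      ¬ (w.get ⟨s, hs⟩).Spans (wire w v) ∧ ¬ (w.get ⟨s, hs⟩).Spans (wire w v + 1) := by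
    intro s hs h3 h4
    refine not_spans hw hs h4 fun x hx hxs => ?_
    have := h.2.2 x (hx.trans h.1.symm)
    rw [Fin.lt_def, Fin.lt_def] at this
    omega
  exact ⟨faceNum_skip h2 v.1.isLt.le fun s hs h3 h4 => (key s hs h3 h4).1,
    faceNum_skip h2 v.1.isLt.le fun s hs h3 h4 => (key s hs h3 h4).2⟩

/-- Above the first foot of a wire no bridge passes. -/
theorem faceNum_of_top (hw : w.Pairwise Bridge.Avoids) {v : Foot w} (h : above w v = none) :
    faceNum w (wire w v) 0 = faceNum w (wire w v) v.1 ∧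
      faceNum w (wire w v + 1) 0 = faceNum w (wire w v + 1) v.1 := by
  have key : ∀ s (hs : s < w.length), 0 ≤ s → s < v.1 →
      ¬ (w.get ⟨s, hs⟩).Spans (wire w v) ∧ ¬ (w.get ⟨s, hs⟩).Spans (wire w v + 1) := by
    intro s hs _ h4
    refine not_spans hw hs h4 fun x hx hxs => ?_
    -- the first foot of the wire of `v` is `v` itself
    obtain ⟨y, ⟨hy, hyv⟩, hmax⟩ := Set.exists_max_image {y | wire w y = wire w v ∧ y.1 < v.1}
      Prod.fst (Set.toFinite _) ⟨x, hx, by rw [Fin.lt_def]; omega⟩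
    have : above w v = some y := above_eq_some.2 ⟨hy, hyv, fun z hz hlt =>
      absurd (hmax z ⟨hz.trans hy, hlt.2⟩) (not_le.2 hlt.1)⟩
    rw [h] at this
    cases this
  exact ⟨faceNum_skip (Nat.zero_le _) v.1.isLt.le fun s hs h3 h4 => (key s hs h3 h4).1,
    faceNum_skip (Nat.zero_le _) v.1.isLt.le fun s hs h3 h4 => (key s hs h3 h4).2⟩

theorem no_foot_of_below {v : Foot w} (h : below w v = none) (u : Foot w)
    (hu : wire w u = wire w v) : (u.1 : ℕ) < v.1 + 1 := by
  by_contra hc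
  obtain ⟨y, ⟨hy, hyv⟩, hmin⟩ := Set.exists_min_image {y | wire w y = wire w v ∧ v.1 < y.1}
    Prod.fst (Set.toFinite _) ⟨u, hu, by rw [Fin.lt_def]; omega⟩
  have : below w v = some y := below_eq_some.2 ⟨hy.symm, hyv, fun z hz hlt =>
    absurd (hmin z ⟨hz, hlt.1⟩) (not_le.2 hlt.2)⟩
  rw [h] at this
  cases this

theorem faceOf_boundaryDart (hw : w.Pairwise Bridge.Avoids) (a : Fin n) :
    faceOf (boundaryDart w a) = faceNum w (a + 1) 0 := by
  rcases boundaryDart_cases (w := w) a with ⟨v, rfl, hv, h⟩ | ⟨h', h⟩ <;> rw [h]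
  · exact ((faceNum_of_top hw hv).2).symm
  · rfl

theorem faceOf_sphereRot_boundaryDart (hw : w.Pairwise Bridge.Avoids) (J : Finset (Fin n)) (a : Fin n) :
    faceOf ((bridgeGraph J w).sphereRot (boundaryDart w a)) = faceNum w a 0 := by
  rw [sphereRot_boundaryDart, faceOf_boundaryDart hw]
  by_cases ha : (a : ℕ) = 0
  · rw [finRotate_inv_val_zero a ha, ha]
    refine faceNum_congr fun s hs _ => ?_
    have := (w.get ⟨s, hs⟩).right.isLt
    have := a.isLt
    unfold Bridge.Spans
    omega
  · rw [finRotate_inv_val a ha]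
    congr 1
    omega

/-- Below a bridge the strips between its two ends belong to one face. -/
theorem faceNum_below_bridge (hw : w.Pairwise Bridge.Avoids) (t : Fin w.length) :
    faceNum w (w.get t).right (t + 1) = faceNum w ((w.get t).left + 1) (t + 1) := by
  refine faceNum_congr fun s hs hts => ?_
  have hav : (w.get t).Avoids (w.get ⟨s, hs⟩) :=
    List.pairwise_iff_get.1 hw t ⟨s, hs⟩ (by rw [Fin.lt_def]; exact hts)
  have h0 := (w.get t).lt
  have h1 := hav (w.get ⟨s, hs⟩).left
  have h2 := hav (w.get ⟨s, hs⟩).right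
  rw [Fin.lt_def] at h0
  simp only [Fin.lt_def] at h1 h2
  unfold Bridge.Spans
  have h3 : ¬ (((w.get t).left : ℕ) < (w.get ⟨s, hs⟩).left ∧
      ((w.get ⟨s, hs⟩).left : ℕ) < (w.get t).right) := fun h => (h1 h.1 h.2).1 rfl
  have h4 : ¬ (((w.get t).left : ℕ) < (w.get ⟨s, hs⟩).right ∧
      ((w.get ⟨s, hs⟩).right : ℕ) < (w.get t).right) := fun h => (h2 h.1 h.2).2 rfl
  omega

theorem faceOf_next (hw : w.Pairwise Bridge.Avoids) (J : Finset (Fin n)) (d : BridgeDart w) :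
    faceOf (((bridgeGraph J w).sphereRot * (bridgeGraph J w).edge) d) = faceOf d := by
  change faceOf ((bridgeGraph J w).sphereRot d.opp) = faceOf d
  rcases d with v | v | ⟨t, s⟩ | a | a
  · simp only [BridgeDart.opp]
    rcases h : above w v with _ | u
    · rw [← boundaryDart_of_top h, faceOf_sphereRot_boundaryDart hw, (faceNum_of_top hw h).1]
      rfl
    · rw [sphereRot_of_notMem J (down_notMem_range h)]
      have hn := above_eq_some.1 h
      have hlt : (u.1 : ℕ) < v.1 := hn.2.1
      have hf := (faceNum_of_isNext hw hn (t := u.1 + 1) (by omega) (by omega)).1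
      obtain ⟨t, s⟩ := u
      have hwire := hn.1
      cases s
      · simp only [BridgeDart.cw, h, cond_false, faceOf]
        rw [← hf, hwire]
        refine faceNum_skip (by simp) (by have := v.1.isLt; omega) fun s hs h1 h2 => ?_
        obtain rfl : s = t := by simp only at h1 h2; omega
        rw [← hwire, wire_false]
        exact fun h => absurd h.1 (lt_irrefl _)
      · simp only [BridgeDart.cw, h, cond_true, faceOf]
        rw [← hf, hwire]
  · simp only [BridgeDart.opp]
    rw [sphereRot_of_notMem J (up_notMem_range v)]
    obtain ⟨t, s⟩ := v
    cases s
    · rfl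
    · simp only [BridgeDart.cw, cond_true, faceOf]
      have hstep : faceNum w (wire w (t, true) + 1) t = faceNum w (wire w (t, true) + 1) (t + 1) := by
        refine faceNum_skip (Nat.le_succ _) t.isLt fun s hs h1 h2 => ?_
        obtain rfl : s = t := by omega
        rw [wire_true]
        exact fun h => absurd h.2 (by simp)
      rcases h : below w (t, true) with _ | v'
      · simp only [BridgeDart.downFrom, h, cond_true]
        rw [hstep]
        exact (faceNum_succ_of_no_foot fun u hu => no_foot_of_below h u hu).symm
      · simp only [BridgeDart.downFrom, h]
        have hn := below_eq_some.1 h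
        have hlt : (t : ℕ) < v'.1 := hn.2.1
        rw [hstep, hn.1]
        exact (faceNum_of_isNext hw hn (t := t + 1) (by simp) (by omega)).2.symm
  · cases s
    · simp only [BridgeDart.opp, Bool.not_false]
      rw [sphereRot_of_notMem J (cross_notMem_range _)]
      simp only [BridgeDart.cw, cond_true, faceOf, cond_false]
      have := (w.get t).lt
      rw [Fin.lt_def] at this
      rw [wire_true, wire_false, faceNum_eq_self, faceNum_eq_self]
      · exact fun _ => ⟨by simp, by simpa using this⟩
      · exact fun _ => ⟨by simpa using this, le_rfl⟩
    · simp only [BridgeDart.opp, Bool.not_true]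
      rw [sphereRot_of_notMem J (cross_notMem_range _)]
      simp only [BridgeDart.cw, cond_true, faceOf, cond_false]
      rw [wire_true, faceNum_below_bridge hw]
      rcases h : below w (t, false) with _ | v'
      · simp only [BridgeDart.downFrom, h]
        rw [← wire_false]
        rw [faceNum_succ_of_no_foot (a := wire w (t, false)) fun u hu => no_foot_of_below h u hu]
        refine faceNum_skip (t := t) (Nat.le_succ _) t.isLt fun s hs h1 h2 => ?_
        obtain rfl : s = t := by simp only at h1 h2; omega
        rw [wire_false]
        exact fun h => absurd h.1 (lt_irrefl _)
      · simp only [BridgeDart.downFrom, h]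
        have hn := below_eq_some.1 h
        have hlt : (t : ℕ) < v'.1 := hn.2.1
        rw [← wire_false, hn.1]
        exact (faceNum_of_isNext hw hn (t := t + 1) (by simp) (by omega)).2.symm
  · simp only [BridgeDart.opp]
    rw [sphereRot_of_notMem J (leaf_notMem_range a)]
    simp only [BridgeDart.cw, faceOf]
    exact (faceNum_succ_of_no_foot fun u hu => absurd ⟨u, hu⟩ a.2).symm
  · simp only [BridgeDart.opp]
    rw [← boundaryDart_of_untouched, faceOf_sphereRot_boundaryDart hw]
    rfl

/-- A quantity that decreases along the boundary of a face until a bridge is crossed from left to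
right or the boundary of the disk is passed from the first to the last vertex. -/
noncomputable def progress : BridgeDart w → ℕ
  | .up v => wire w v * (2 * w.length + 5) + v.1 + 1
  | .down v => wire w v * (2 * w.length + 5) + (2 * w.length + 2 - v.1)
  | .cross v => wire w v * (2 * w.length + 5)
  | .stub a => (a : Fin n) * (2 * w.length + 5) + 1
  | .leaf a => (a : Fin n) * (2 * w.length + 5)

theorem progress_boundaryDart_le (a : Fin n) :
    progress (boundaryDart w a) ≤ a * (2 * w.length + 5) + (2 * w.length + 2) := by
  rcases boundaryDart_cases (w := w) a with ⟨v, rfl, hv, h⟩ | ⟨h', h⟩ <;> rw [h] <;>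
    simp only [progress] <;> omega

theorem progress_sphereRot_boundaryDart_lt (J : Finset (Fin n)) {a : Fin n} (ha : (a : ℕ) ≠ 0) :
    progress ((bridgeGraph J w).sphereRot (boundaryDart w a)) < a * (2 * w.length + 5) := by
  rw [sphereRot_boundaryDart]
  refine (progress_boundaryDart_le _).trans_lt ?_
  rw [finRotate_inv_val a ha]
  obtain ⟨m, hm⟩ : ∃ m, (a : ℕ) = m + 1 := ⟨a - 1, by omega⟩
  rw [hm, Nat.add_sub_cancel, add_mul]
  omega

theorem progress_lt (J : Finset (Fin n)) (hn : 0 < n) (d : BridgeDart w)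
    (hd : d.opp ≠ boundaryDart w ⟨0, hn⟩) (hd' : ∀ t, d ≠ .cross (t, false)) :
    (∃ t, (bridgeGraph J w).sphereRot d.opp = .cross (t, false)) ∨
      progress ((bridgeGraph J w).sphereRot d.opp) < progress d := by
  have hne : ∀ a : Fin n, d.opp = boundaryDart w a → (a : ℕ) ≠ 0 := by
    rintro a h h0
    exact hd (by rw [h]; congr 1; exact Fin.ext h0)
  rcases d with v | v | ⟨t, s⟩ | a | a
  · right
    simp only [BridgeDart.opp] at hne ⊢
    rcases h : above w v with _ | u
    · rw [← boundaryDart_of_top h] at hne ⊢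
      refine (progress_sphereRot_boundaryDart_lt J (hne _ rfl)).trans_le ?_
      simp only [progress]
      omega
    · rw [sphereRot_of_notMem J (down_notMem_range h)]
      have hnx := above_eq_some.1 h
      have hlt : (u.1 : ℕ) < v.1 := hnx.2.1
      obtain ⟨t, s⟩ := u
      cases s <;> simp only [BridgeDart.cw, h, cond_false, cond_true, progress, hnx.1] <;> 
        simp only at hlt <;> omega
  · simp only [BridgeDart.opp]
    rw [sphereRot_of_notMem J (up_notMem_range v)]
    obtain ⟨t, s⟩ := v
    cases s
    · exact .inl ⟨t, rfl⟩
    · right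
      simp only [BridgeDart.cw, cond_true]
      have := t.isLt
      rcases h : below w (t, true) with _ | v'
      · simp only [BridgeDart.downFrom, h, progress]
        omega
      · have hnx := below_eq_some.1 h
        have hlt : (t : ℕ) < v'.1 := hnx.2.1
        have := v'.1.isLt
        simp only [BridgeDart.downFrom, h, progress, hnx.1]
        omega
  · cases s
    · exact absurd rfl (hd' t)
    · right
      simp only [BridgeDart.opp, Bool.not_true]
      rw [sphereRot_of_notMem J (cross_notMem_range _)]
      simp only [BridgeDart.cw, cond_false]
      have h0 := (w.get t).lt
      rw [Fin.lt_def] at h0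
      have hmul : (wire w (t, false) : ℕ) * (2 * w.length + 5) + (2 * w.length + 5) ≤
          wire w (t, true) * (2 * w.length + 5) := by
        rw [← Nat.succ_mul]
        exact Nat.mul_le_mul_right _ h0
      rcases h : below w (t, false) with _ | v'
      · simp only [BridgeDart.downFrom, h, progress]
        have := t.isLt
        omega
      · have hnx := below_eq_some.1 h
        simp only [BridgeDart.downFrom, h, progress, ← hnx.1]
        omega
  · right
    simp only [BridgeDart.opp]
    rw [sphereRot_of_notMem J (leaf_notMem_range a)]
    simp [BridgeDart.cw, progress]
  · right
    simp only [BridgeDart.opp] at hne ⊢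
    rw [← boundaryDart_of_untouched] at hne ⊢
    exact progress_sphereRot_boundaryDart_lt J (hne _ rfl)

/-- Every face contains a bridge crossed from left to right or the last side of the disk. -/
theorem exists_sameCycle_face (J : Finset (Fin n)) (hn : 0 < n) (d : BridgeDart w) :
    ∃ e : BridgeDart w, ((bridgeGraph J w).sphereRot * (bridgeGraph J w).edge).SameCycle d e ∧
      (e.opp = boundaryDart w ⟨0, hn⟩ ∨ ∃ t, e = .cross (t, false)) := by
  suffices H : ∀ (m : ℕ) (d : BridgeDart w), progress d < m →
      ∃ e : BridgeDart w, ((bridgeGraph J w).sphereRot * (bridgeGraph J w).edge).SameCycle d e ∧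
      (e.opp = boundaryDart w ⟨0, hn⟩ ∨ ∃ t, e = .cross (t, false)) from H _ d (Nat.lt_succ_self _)
  intro m
  induction m with
  | zero => intro d h; omega
  | succ m ih =>
    intro d hm
    by_cases h1 : d.opp = boundaryDart w ⟨0, hn⟩
    · exact ⟨d, Perm.SameCycle.refl _ _, .inl h1⟩
    by_cases h2 : ∃ t, d = .cross (t, false)
    · exact ⟨d, Perm.SameCycle.refl _ _, .inr h2⟩
    push Not at h2
    have hstep := sameCycle_apply ((bridgeGraph J w).sphereRot * (bridgeGraph J w).edge) d
    rcases progress_lt J hn d h1 h2 with ⟨t, ht⟩ | hlt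
    · exact ⟨_, hstep, .inr ⟨t, ht⟩⟩
    · obtain ⟨e, he, he'⟩ := ih ((bridgeGraph J w).sphereRot d.opp) (by omega)
      exact ⟨e, hstep.trans he, he'⟩

theorem numCycles_face (J : Finset (Fin n)) (hw : w.Pairwise Bridge.Avoids) (hn : 0 < n) :
    PlabicMap.numCycles ((bridgeGraph J w).sphereRot * (bridgeGraph J w).edge) = w.length + 1 := by
  let g : BridgeDart w → Fin (w.length + 1) := fun d => ⟨faceOf d, Nat.lt_succ_of_le (faceOf_le d)⟩
  have hcross : ∀ t : Fin w.length, faceOf (.cross (t, false) : BridgeDart w) = t := by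
    intro t
    have := (w.get t).lt
    rw [Fin.lt_def] at this
    simp only [faceOf, cond_false]
    rw [wire_false, faceNum_eq_self]
    exact fun _ => ⟨by simp, by simpa using this⟩
  have hinv : ∀ d, g (((bridgeGraph J w).sphereRot * (bridgeGraph J w).edge) d) = g d := fun d =>
    Fin.ext (faceOf_next hw J d)
  have hwrap : ∀ d : BridgeDart w, d.opp = boundaryDart w ⟨0, hn⟩ → faceOf d = w.length := by
    intro d hd
    have h1 := faceOf_next hw J d
    have h2 : ((bridgeGraph J w).sphereRot * (bridgeGraph J w).edge) d =
        (bridgeGraph J w).sphereRot (boundaryDart w ⟨0, hn⟩) := by rw [← hd]; rfl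
    rw [h2, faceOf_sphereRot_boundaryDart hw] at h1
    rw [← h1, faceNum_skip (Nat.zero_le _) le_rfl (fun s hs _ _ h => absurd h.1 (by simp)),
      faceNum_eq_self fun h => absurd h (lt_irrefl _)]
  rw [numCycles_eq_card (f := (bridgeGraph J w).sphereRot * (bridgeGraph J w).edge) g, Nat.card_fin]
  · intro t
    by_cases ht : (t : ℕ) < w.length
    · exact ⟨.cross (⟨t, ht⟩, false), Fin.ext (hcross _)⟩
    · refine ⟨(boundaryDart w ⟨0, hn⟩).opp, Fin.ext ?_⟩
      have := t.isLt
      refine (hwrap _ ((bridgeGraph J w).edge_edge _)).trans ?_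
      omega
  · intro x y
    refine ⟨fun h => ?_, eq_of_sameCycle hinv⟩
    obtain ⟨e, he, he'⟩ := exists_sameCycle_face J hn x
    obtain ⟨f, hf, hf'⟩ := exists_sameCycle_face J hn y
    have hef : faceOf e = faceOf f := by
      have h1 := eq_of_sameCycle hinv he
      have h2 := eq_of_sameCycle hinv hf
      exact congrArg Fin.val (h1.symm.trans (h.trans h2))
    suffices e = f by subst this; exact he.trans hf.symm
    rcases he' with he' | ⟨t, rfl⟩ <;> rcases hf' with hf' | ⟨t', rfl⟩
    · have := he'.trans hf'.symm
      exact (bridgeGraph J w).edge.injective this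
    · rw [hwrap e he', hcross] at hef
      exact absurd hef.symm t'.isLt.ne
    · rw [hwrap f hf', hcross] at hef
      exact absurd hef t.isLt.ne
    · rw [hcross, hcross] at hef
      rw [Fin.ext hef]

/-- A bridge graph is planar when all wires passed over by a bridge end above it: its faces other
than the outermost one correspond to the bridges bounding them from below. -/
theorem isPlanar_bridgeGraph (J : Finset (Fin n)) (hw : w.Pairwise Bridge.Avoids) (hn : 0 < n) :
    (bridgeGraph J w).IsPlanar := by
  unfold PlabicMap.IsPlanar
  rw [numCycles_sphereRot J w hn, numCycles_face J hw hn, numCycles_edge]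
  ring

end Planar

end BridgePolytope

namespace BridgePolytope

open Equiv

namespace PlabicMap

variable {n : ℕ}

/-! ### Contracting unicolored edges -/

theorem color_bdry (G : PlabicMap n) (i : Fin n) : G.color (G.bdry i) = none :=
  (G.color_eq_none _).2 ⟨i, rfl⟩

theorem ne_bdry (G : PlabicMap n) {d : G.Dart} (h : G.color d ≠ none) (i : Fin n) :
    G.bdry i ≠ d := by
  rintro rfl
  exact h (G.color_bdry i)

theorem color_of_sameVertex (G : PlabicMap n) {d e : G.Dart} (h : G.SameVertex d e) :
    G.color d = G.color e :=
  eq_of_sameCycle G.color_rot h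

/-- A set of half-edges that contains the boundary and is closed under `edge` and `rot` is
everything. -/
theorem mem_of_closed (G : PlabicMap n) (S : G.Dart → Prop) (hb : ∀ i, S (G.bdry i))
    (he : ∀ x, S x → S (G.edge x)) (hr : ∀ x, S x → S (G.rot x)) (d : G.Dart) : S d := by
  obtain ⟨i, hi⟩ := G.connected d
  induction hi with
  | refl => exact hb i
  | tail _ h ih =>
    rcases h with rfl | rfl
    · exact he _ ih
    · exact hr _ ih

/-- An internal edge that joins two distinct vertices of the same color. -/
def IsUnicolored (G : PlabicMap n) (d : G.Dart) : Prop :=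
  G.color d ≠ none ∧ G.color (G.edge d) = G.color d ∧ ¬ G.SameVertex d (G.edge d)

theorem IsUnicolored.symm {G : PlabicMap n} {d : G.Dart} (h : G.IsUnicolored d) :
    G.IsUnicolored (G.edge d) := by
  refine ⟨h.2.1 ▸ h.1, ?_, fun hs => h.2.2 ?_⟩
  · rw [G.edge_edge, h.2.1]
  · rw [G.edge_edge] at hs
    exact hs.symm

theorem IsUnicolored.rot_ne {G : PlabicMap n} {d : G.Dart} (h : G.IsUnicolored d) :
    G.rot d ≠ d := by
  intro hd
  have hb : d ∉ Set.range G.bdry := fun hb => h.1 ((G.color_eq_none d).2 hb)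
  have := (G.color_eq_none _).2 (G.leafless d hd hb)
  rw [h.2.1] at this
  exact h.1 this

theorem IsUnicolored.rot_ne_edge {G : PlabicMap n} {d : G.Dart} (h : G.IsUnicolored d) :
    G.rot d ≠ G.edge d := fun hd => h.2.2 (hd ▸ sameCycle_apply G.rot d)

open Classical in
/-- Clockwise rotation after the contraction of the edge with halves `d` and `e`. -/
noncomputable def contractRot {X : Type} (rot : X → X) (d e x : X) : X :=
  if rot x = d then rot e else if rot x = e then rot d else rot x

theorem contractRot_mem {G : PlabicMap n} {d : G.Dart} (h : G.IsUnicolored d) (x : G.Dart) :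
    contractRot G.rot d (G.edge d) x ≠ d ∧ contractRot G.rot d (G.edge d) x ≠ G.edge d := by
  unfold contractRot
  split_ifs with h3 h4
  · have := h.symm.rot_ne_edge
    rw [G.edge_edge] at this
    exact ⟨this, h.symm.rot_ne⟩
  · exact ⟨h.rot_ne, h.rot_ne_edge⟩
  · exact ⟨h3, h4⟩

theorem contractRot_injective {G : PlabicMap n} {d x y : G.Dart}
    (hx : x ≠ d ∧ x ≠ G.edge d) (hy : y ≠ d ∧ y ≠ G.edge d)
    (hxy : contractRot G.rot d (G.edge d) x = contractRot G.rot d (G.edge d) y) : x = y := by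
  have hed := G.edge_ne d
  unfold contractRot at hxy
  split_ifs at hxy with h1 h2 h3 h4 h5 h6 h7
  · exact G.rot.injective (h1.trans h2.symm)
  · exact absurd (G.rot.injective hxy) hed
  · exact absurd (G.rot.injective hxy).symm hy.2
  · exact absurd (G.rot.injective hxy).symm hed
  · exact G.rot.injective (h4.trans h6.symm)
  · exact absurd (G.rot.injective hxy).symm hy.1
  · exact absurd (G.rot.injective hxy) hx.2
  · exact absurd (G.rot.injective hxy) hx.1
  · exact G.rot.injective hxy

/-- If `rot d` lies in a set that is closed under the rotation of the contracted graph, then so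
does the successor of the other half of the contracted edge. -/
theorem rot_edge_mem_of_closed {G : PlabicMap n} {d : G.Dart} (h : G.IsUnicolored d)
    (S : G.Dart → Prop)
    (hS : ∀ x, x ≠ d → x ≠ G.edge d → S x → S (contractRot G.rot d (G.edge d) x))
    (hd : S (G.rot d)) : S (G.rot (G.edge d)) := by
  have := G.finite
  have hpow : ∀ k : ℕ, G.SameVertex d ((G.rot ^ k) (G.rot d)) := fun k =>
    (sameCycle_apply G.rot d).trans ⟨k, by simp⟩
  obtain ⟨k, hk⟩ : ∃ k : ℕ, (G.rot ^ k) (G.rot d) = G.rot⁻¹ d := by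
    have : G.rot.SameCycle (G.rot d) (G.rot⁻¹ d) :=
      (sameCycle_apply G.rot d).symm.trans ⟨-1, by simp⟩
    exact this.exists_nat_pow_eq
  have ha : G.rot (G.rot⁻¹ d) = d := by simp
  have had : G.rot⁻¹ d ≠ d := fun h' => h.rot_ne (by rw [h'] at ha; exact ha)
  have hae : G.rot⁻¹ d ≠ G.edge d := fun h' => h.2.2 (h' ▸ ⟨-1, by simp⟩)
  suffices S (G.rot⁻¹ d) by
    have h1 := hS _ had hae this
    rwa [contractRot, if_pos ha] at h1
  by_contra hna
  have key : ∀ m : ℕ, S ((G.rot ^ m) (G.rot d)) ∧ (G.rot ^ m) (G.rot d) ≠ d := by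
    intro m
    induction m with
    | zero => exact ⟨by simpa using hd, by simpa using h.rot_ne⟩
    | succ m ih =>
      have hne : G.rot ((G.rot ^ m) (G.rot d)) ≠ d := by
        intro h1
        rw [← h1] at hna
        rw [Perm.inv_eq_iff_eq.2 rfl] at hna
        exact hna ih.1
      have hne' : G.rot ((G.rot ^ m) (G.rot d)) ≠ G.edge d := by
        intro h1
        have := hpow (m + 1)
        rw [pow_succ', Perm.mul_apply, h1] at this
        exact h.2.2 this
      have hme : (G.rot ^ m) (G.rot d) ≠ G.edge d := fun h1 => h.2.2 (h1 ▸ hpow m)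
      have h2 := hS _ ih.2 hme ih.1
      rw [contractRot, if_neg hne, if_neg hne'] at h2
      rw [pow_succ', Perm.mul_apply]
      exact ⟨h2, hne⟩
  exact hna (hk ▸ (key k).1)

theorem color_contractRot {G : PlabicMap n} {d : G.Dart} (h : G.IsUnicolored d) (x : G.Dart) :
    G.color (contractRot G.rot d (G.edge d) x) = G.color x := by
  unfold contractRot
  split_ifs with h1 h2
  · rw [G.color_rot, h.2.1, ← h1, G.color_rot]
  · rw [G.color_rot, ← h.2.1, ← h2, G.color_rot]
  · rw [G.color_rot]

/-- The graph obtained by contracting a unicolored edge. -/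
noncomputable def contract (G : PlabicMap n) (d : G.Dart) (h : G.IsUnicolored d) :
    PlabicMap n where
  Dart := {x // x ≠ d ∧ x ≠ G.edge d}
  finite := have := G.finite; inferInstance
  edge := G.edge.subtypePerm fun x => by
    have h1 : G.edge x = d ↔ x = G.edge d := by
      constructor
      · rintro rfl
        rw [G.edge_edge]
      · rintro rfl
        rw [G.edge_edge]
    rw [Ne, Ne, Ne, Ne, h1, G.edge.injective.eq_iff, and_comm]
  edge_edge x := Subtype.ext (G.edge_edge x)
  edge_ne x hx := G.edge_ne x (congrArg Subtype.val hx)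
  rot := Equiv.ofBijective
    (fun x => ⟨contractRot G.rot d (G.edge d) x, contractRot_mem h x⟩) <| by
      have := G.finite
      refine Finite.injective_iff_bijective.1 fun x y hxy => Subtype.ext ?_
      exact contractRot_injective x.2 y.2 (congrArg Subtype.val hxy)
  bdry i := ⟨G.bdry i, G.ne_bdry h.1 i, G.ne_bdry h.symm.1 i⟩
  bdry_injective i j hij := G.bdry_injective (congrArg Subtype.val hij)
  rot_bdry i := Subtype.ext <| by
    change contractRot G.rot d (G.edge d) (G.bdry i) = G.bdry i
    rw [contractRot, G.rot_bdry, if_neg (G.ne_bdry h.1 i), if_neg (G.ne_bdry h.symm.1 i)]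
  color x := G.color x
  color_rot x := color_contractRot h x
  color_eq_none x := by
    rw [G.color_eq_none]
    constructor
    · rintro ⟨i, hi⟩
      exact ⟨i, Subtype.ext hi⟩
    · rintro ⟨i, hi⟩
      exact ⟨i, congrArg Subtype.val hi⟩
  leafless x hx hb := by
    have hx' : contractRot G.rot d (G.edge d) x = x := congrArg Subtype.val hx
    have hb' : (x : G.Dart) ∉ Set.range G.bdry := by
      rintro ⟨i, hi⟩
      exact hb ⟨i, Subtype.ext hi⟩
    unfold contractRot at hx'
    split_ifs at hx' with h1 h2
    · refine absurd ?_ h.symm.2.2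
      rw [G.edge_edge]
      exact ⟨2, by rw [zpow_ofNat, pow_two, Perm.mul_apply, hx', h1]⟩
    · refine absurd ?_ h.2.2
      exact ⟨2, by rw [zpow_ofNat, pow_two, Perm.mul_apply, hx', h2]⟩
    · obtain ⟨i, hi⟩ := G.leafless x hx' hb'
      exact ⟨i, Subtype.ext hi⟩
  connected := by
    intro z
    by_contra hz
    push Not at hz
    let R : {x // x ≠ d ∧ x ≠ G.edge d} → {x // x ≠ d ∧ x ≠ G.edge d} → Prop := fun x y =>
      (y : G.Dart) = G.edge x ∨ (y : G.Dart) = contractRot G.rot d (G.edge d) x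
    let S : G.Dart → Prop := fun x => ∃ hx : x ≠ d ∧ x ≠ G.edge d, ∃ i, Relation.ReflTransGen R
      ⟨G.bdry i, G.ne_bdry h.1 i, G.ne_bdry h.symm.1 i⟩ ⟨x, hx⟩
    have hrot : ∀ x, x ≠ d → x ≠ G.edge d → S x → S (contractRot G.rot d (G.edge d) x) := by
      rintro x h1 h2 ⟨hx, i, hi⟩
      exact ⟨contractRot_mem h x, i, hi.tail (.inr rfl)⟩
    have hd1 : S (G.rot d) → S (G.rot (G.edge d)) := rot_edge_mem_of_closed h S hrot
    have hd2 : S (G.rot (G.edge d)) → S (G.rot d) := by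
      have := rot_edge_mem_of_closed h.symm S (fun x h1 h2 hx => by
        rw [G.edge_edge] at h2 ⊢
        have := hrot x h2 h1 hx
        unfold contractRot at this ⊢
        by_cases h3 : G.rot x = d
        · rw [if_pos h3] at this
          rwa [if_neg (by rw [h3]; exact (G.edge_ne d).symm), if_pos h3]
        · rw [if_neg h3] at this
          by_cases h4 : G.rot x = G.edge d
          · rw [if_pos h4] at this ⊢
            exact this
          · rw [if_neg h4] at this ⊢
            rwa [if_neg h3])
      rwa [G.edge_edge] at this
    have hall := G.mem_of_closed (fun x => S x ∨ ((x = d ∨ x = G.edge d) ∧ S (G.rot d)))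
      (fun i => .inl ⟨⟨G.ne_bdry h.1 i, G.ne_bdry h.symm.1 i⟩, i, .refl⟩)
      (by
        rintro x (⟨hx, i, hi⟩ | ⟨rfl | rfl, hS⟩)
        · refine .inl ⟨⟨fun h1 => hx.2 ?_, fun h1 => hx.1 (G.edge.injective h1)⟩, i,
            hi.tail (.inl rfl)⟩
          rw [← h1, G.edge_edge]
        · exact .inr ⟨.inr rfl, hS⟩
        · exact .inr ⟨.inl (G.edge_edge _), hS⟩)
      (by
        rintro x (hS | ⟨rfl | rfl, hS⟩)
        · have hx := hS.1
          have h1 := hrot x hx.1 hx.2 hS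
          unfold contractRot at h1
          split_ifs at h1 with h2 h3
          · exact .inr ⟨.inl h2, hd2 h1⟩
          · exact .inr ⟨.inr h3, h1⟩
          · exact .inl h1
        · exact .inl hS
        · exact .inl (hd1 hS))
    rcases hall z with ⟨hx, i, hi⟩ | ⟨h1 | h1, -⟩
    · refine hz i (Relation.ReflTransGen.mono ?_ _ _ hi)
      rintro x y (h1 | h1)
      · exact .inl (Subtype.ext h1)
      · exact .inr (Subtype.ext h1)
    · exact z.2.1 h1
    · exact z.2.2 h1

theorem contraction_contract (G : PlabicMap n) (d : G.Dart) (h : G.IsUnicolored d) :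
    Contraction G (G.contract d h) := by
  refine ⟨d, ⟨Subtype.val, Subtype.val_injective⟩, h.1, h.2.1, h.2.2, ?_, fun x => rfl,
    fun x => rfl, fun i => rfl, fun x => rfl⟩
  refine Subtype.range_val.trans (Set.ext fun x => ?_)
  simp only [Set.mem_compl_iff, Set.mem_insert_iff, Set.mem_singleton_iff, not_or]
  rfl

/-! ### Removing vertices of degree two -/

/-- The half-edge `d` lies at an internal vertex of degree two. -/
def IsMiddle (G : PlabicMap n) (d : G.Dart) : Prop :=
  G.color d ≠ none ∧ G.rot d ≠ d ∧ G.rot (G.rot d) = d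

open Classical in
/-- The other half of an edge after the removal of a vertex with half-edges `d` and `e`. -/
noncomputable def glueEdge {X : Type} (edge : X → X) (d e x : X) : X :=
  if edge x = d then edge e else if edge x = e then edge d else edge x

/-- A vertex of degree two does not carry a loop, since the loop would be a component of its
own. -/
theorem IsMiddle.edge_ne {G : PlabicMap n} {d : G.Dart} (h : G.IsMiddle d) :
    G.edge d ≠ G.rot d := by
  intro he
  have := G.mem_of_closed (fun x => x ≠ d ∧ x ≠ G.rot d)
    (fun i => ⟨G.ne_bdry h.1 i, G.ne_bdry (by rw [G.color_rot]; exact h.1) i⟩)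
    (by
      rintro x ⟨h1, h2⟩
      refine ⟨fun h3 => h2 ?_, fun h3 => h1 ?_⟩
      · rw [← he, ← h3, G.edge_edge]
      · rw [← he] at h3
        exact G.edge.injective h3)
    (by
      rintro x ⟨h1, h2⟩
      refine ⟨fun h3 => h2 ?_, fun h3 => h1 (G.rot.injective h3)⟩
      rw [← h.2.2] at h3
      exact G.rot.injective h3) d
  exact this.1 rfl

theorem edge_eq_iff (G : PlabicMap n) {x y : G.Dart} : G.edge x = y ↔ x = G.edge y := by
  constructor <;> rintro rfl <;> rw [G.edge_edge]

theorem glueEdge_mem {G : PlabicMap n} {d : G.Dart} (h : G.IsMiddle d) (x : G.Dart) :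
    glueEdge G.edge d (G.rot d) x ≠ d ∧ glueEdge G.edge d (G.rot d) x ≠ G.rot d := by
  have he := h.edge_ne
  have he' : G.edge (G.rot d) ≠ d := fun h1 => he (G.edge_eq_iff.1 h1).symm
  unfold glueEdge
  split_ifs with h1 h2
  · exact ⟨he', G.edge_ne _⟩
  · exact ⟨G.edge_ne _, he⟩
  · exact ⟨h1, h2⟩

theorem glueEdge_glueEdge {G : PlabicMap n} {d : G.Dart} (h : G.IsMiddle d) {x : G.Dart}
    (hx : x ≠ d ∧ x ≠ G.rot d) :
    glueEdge G.edge d (G.rot d) (glueEdge G.edge d (G.rot d) x) = x := by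
  have hr := h.2.1
  by_cases h1 : G.edge x = d
  · have : glueEdge G.edge d (G.rot d) x = G.edge (G.rot d) := if_pos h1
    rw [this, glueEdge, G.edge_edge, if_neg hr, if_pos rfl, ← h1, G.edge_edge]
  by_cases h2 : G.edge x = G.rot d
  · have : glueEdge G.edge d (G.rot d) x = G.edge d := by rw [glueEdge, if_neg h1, if_pos h2]
    rw [this, glueEdge, G.edge_edge, if_pos rfl, ← h2, G.edge_edge]
  · have : glueEdge G.edge d (G.rot d) x = G.edge x := by rw [glueEdge, if_neg h1, if_neg h2]
    rw [this, glueEdge, G.edge_edge, if_neg hx.1, if_neg hx.2]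

theorem glueEdge_ne {G : PlabicMap n} {d : G.Dart} (h : G.IsMiddle d) (x : G.Dart) :
    glueEdge G.edge d (G.rot d) x ≠ x := by
  have hr := h.2.1
  unfold glueEdge
  split_ifs with h1 h2
  · intro h3
    rw [← h3, G.edge_edge] at h1
    exact hr h1
  · intro h3
    rw [← h3, G.edge_edge] at h2
    exact hr h2.symm
  · exact G.edge_ne x

/-- The graph obtained by removing a vertex of degree two. -/
noncomputable def removeMiddle (G : PlabicMap n) (d : G.Dart) (h : G.IsMiddle d) :
    PlabicMap n where
  Dart := {x // x ≠ d ∧ x ≠ G.rot d}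
  finite := have := G.finite; inferInstance
  edge := ⟨fun x => ⟨glueEdge G.edge d (G.rot d) x, glueEdge_mem h x⟩,
    fun x => ⟨glueEdge G.edge d (G.rot d) x, glueEdge_mem h x⟩,
    fun x => Subtype.ext (glueEdge_glueEdge h x.2), fun x => Subtype.ext (glueEdge_glueEdge h x.2)⟩
  edge_edge x := Subtype.ext (glueEdge_glueEdge h x.2)
  edge_ne x hx := glueEdge_ne h x (congrArg Subtype.val hx)
  rot := G.rot.subtypePerm fun x => by
    have h1 : G.rot x = d ↔ x = G.rot d := by
      conv_lhs => rw [← h.2.2]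
      exact G.rot.injective.eq_iff
    rw [Ne, Ne, Ne, Ne, h1, G.rot.injective.eq_iff, and_comm]
  bdry i := ⟨G.bdry i, G.ne_bdry h.1 i, G.ne_bdry (by rw [G.color_rot]; exact h.1) i⟩
  bdry_injective i j hij := G.bdry_injective (congrArg Subtype.val hij)
  rot_bdry i := Subtype.ext (G.rot_bdry i)
  color x := G.color x
  color_rot x := G.color_rot x
  color_eq_none x := by
    rw [G.color_eq_none]
    constructor
    · rintro ⟨i, hi⟩
      exact ⟨i, Subtype.ext hi⟩
    · rintro ⟨i, hi⟩
      exact ⟨i, congrArg Subtype.val hi⟩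
  leafless x hx hb := by
    have hb' : (x : G.Dart) ∉ Set.range G.bdry := by
      rintro ⟨i, hi⟩
      exact hb ⟨i, Subtype.ext hi⟩
    obtain ⟨i, hi⟩ := G.leafless x (congrArg Subtype.val hx) hb'
    refine ⟨i, Subtype.ext ?_⟩
    change G.bdry i = glueEdge G.edge d (G.rot d) x
    rw [glueEdge, ← hi, if_neg (G.ne_bdry h.1 i),
      if_neg (G.ne_bdry (by rw [G.color_rot]; exact h.1) i)]
  connected := by
    intro z
    by_contra hz
    push Not at hz
    let R : {x // x ≠ d ∧ x ≠ G.rot d} → {x // x ≠ d ∧ x ≠ G.rot d} → Prop := fun x y =>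
      (y : G.Dart) = glueEdge G.edge d (G.rot d) x ∨ (y : G.Dart) = G.rot x
    let S : G.Dart → Prop := fun x => ∃ hx : x ≠ d ∧ x ≠ G.rot d, ∃ i, Relation.ReflTransGen R
      ⟨G.bdry i, G.ne_bdry h.1 i, G.ne_bdry (by rw [G.color_rot]; exact h.1) i⟩ ⟨x, hx⟩
    have hedge : ∀ x, S x → S (glueEdge G.edge d (G.rot d) x) := by
      rintro x ⟨hx, i, hi⟩
      exact ⟨glueEdge_mem h x, i, hi.tail (.inl rfl)⟩
    have h1 : glueEdge G.edge d (G.rot d) (G.edge d) = G.edge (G.rot d) := by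
      rw [glueEdge, G.edge_edge, if_pos rfl]
    have h2 : glueEdge G.edge d (G.rot d) (G.edge (G.rot d)) = G.edge d := by
      rw [glueEdge, G.edge_edge, if_neg h.2.1, if_pos rfl]
    have hall := G.mem_of_closed (fun x => S x ∨ ((x = d ∨ x = G.rot d) ∧ S (G.edge d)))
      (fun i => .inl ⟨⟨G.ne_bdry h.1 i, G.ne_bdry (by rw [G.color_rot]; exact h.1) i⟩, i, .refl⟩)
      (by
        rintro x (hS | ⟨rfl | rfl, hS⟩)
        · have h3 := hedge x hS
          by_cases h4 : G.edge x = d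
          · refine .inr ⟨.inl h4, ?_⟩
            rwa [← G.edge_eq_iff.1 h4]
          by_cases h5 : G.edge x = G.rot d
          · refine .inr ⟨.inr h5, ?_⟩
            rwa [glueEdge, if_neg h4, if_pos h5] at h3
          · rw [glueEdge, if_neg h4, if_neg h5] at h3
            exact .inl h3
        · exact .inl hS
        · refine .inl ?_
          rw [← h1]
          exact hedge _ hS)
      (by
        rintro x (⟨hx, i, hi⟩ | ⟨rfl | rfl, hS⟩)
        · refine .inl ⟨⟨fun h3 => hx.2 ?_, fun h3 => hx.1 (G.rot.injective h3)⟩, i,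
            hi.tail (.inr rfl)⟩
          rw [← h.2.2] at h3
          exact G.rot.injective h3
        · exact .inr ⟨.inr rfl, hS⟩
        · exact .inr ⟨.inl h.2.2, hS⟩)
    rcases hall z with ⟨hx, i, hi⟩ | ⟨h1 | h1, -⟩
    · refine hz i (Relation.ReflTransGen.mono ?_ _ _ hi)
      rintro x y (h1 | h1)
      · exact .inl (Subtype.ext h1)
      · exact .inr (Subtype.ext h1)
    · exact z.2.1 h1
    · exact z.2.2 h1

theorem middleVertexRemoval_removeMiddle (G : PlabicMap n) (d : G.Dart) (h : G.IsMiddle d) :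
    MiddleVertexRemoval G (G.removeMiddle d h) := by
  refine ⟨d, ⟨Subtype.val, Subtype.val_injective⟩, h.1, h.2.1, h.2.2, ?_, fun x => rfl,
    fun x => rfl, fun i => rfl, fun x => rfl⟩
  refine Subtype.range_val.trans (Set.ext fun x => ?_)
  simp only [Set.mem_compl_iff, Set.mem_insert_iff, Set.mem_singleton_iff, not_or]
  rfl

end PlabicMap

end BridgePolytope

namespace BridgePolytope

open Equiv

/-- A set closed under a permutation of a finite set contains with a point its whole cycle. -/
theorem mem_of_sameCycle {α : Type} [Finite α] {f : Perm α} (S : α → Prop)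
    (hS : ∀ x, S x → S (f x)) {x y : α} (h : f.SameCycle x y) (hx : S x) : S y := by
  obtain ⟨k, rfl⟩ := h.exists_nat_pow_eq
  induction k with
  | zero => simpa using hx
  | succ k ih =>
    rw [pow_succ', Perm.mul_apply]
    exact hS _ (ih ⟨k, by simp⟩)

theorem Color.flip_flip (c : Color) : c.flip.flip = c := by
  cases c <;> rfl

theorem Color.flip_ne (c : Color) : c.flip ≠ c := by
  cases c <;> simp [Color.flip]

namespace PlabicMap

variable {n : ℕ} {G H K : PlabicMap n}

/-! ### Moves as relations -/

theorem Homotopic.symm (h : Homotopic G H) : Homotopic H G := by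
  obtain ⟨f, he, hr, hb, hc⟩ := h
  refine ⟨f.symm, fun d => ?_, fun d => ?_, fun i => ?_, fun d => ?_⟩
  · rw [f.symm_apply_eq, he, f.apply_symm_apply]
  · rw [f.symm_apply_eq, hr, f.apply_symm_apply]
  · rw [f.symm_apply_eq, hb]
  · rw [← hc, f.apply_symm_apply]

theorem EquivM2M3.symm (h : EquivM2M3 G H) : EquivM2M3 H G := Relation.EqvGen.symm _ _ h

theorem EquivM2M3.trans (h : EquivM2M3 G H) (h' : EquivM2M3 H K) : EquivM2M3 G K :=
  Relation.EqvGen.trans _ _ _ h h'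

theorem sameVertex_map {f : G.Dart ≃ H.Dart} (hr : ∀ d, f (G.rot d) = H.rot (f d)) {d e : G.Dart} :
    H.SameVertex (f d) (f e) ↔ G.SameVertex d e := by
  have := G.finite
  have := H.finite
  constructor
  · intro h
    have := mem_of_sameCycle (fun x => G.SameVertex d (f.symm x)) (fun x hx => ?_) h
      (by rw [f.symm_apply_apply]; exact Perm.SameCycle.refl _ _)
    · rwa [f.symm_apply_apply] at this
    · have h1 : f.symm (H.rot x) = G.rot (f.symm x) := by
        rw [f.symm_apply_eq, hr, f.apply_symm_apply]
      rw [h1]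
      exact hx.trans (sameCycle_apply _ _)
  · intro h
    refine mem_of_sameCycle (fun x => H.SameVertex (f d) (f x)) (fun x hx => ?_) h
      (Perm.SameCycle.refl _ _)
    rw [hr]
    exact hx.trans (sameCycle_apply _ _)

theorem SquareMove.symm (h : SquareMove G H) : SquareMove H G := by
  obtain ⟨x, f, h4, hne, htri, ⟨c, h0, h1, h2, h3⟩, he, hr, hb, hin, hout⟩ := h
  have hcor : ∀ k, H.corner (f x) k = f (G.corner x k) := by
    intro k
    unfold corner
    induction k with
    | zero => rfl
    | succ k ih => rw [Function.iterate_succ_apply', Function.iterate_succ_apply', ih, ← he, ← hr]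
  have hsv : ∀ d, (∃ k < 4, H.SameVertex d (H.corner (f x) k)) ↔
      ∃ k < 4, G.SameVertex (f.symm d) (G.corner x k) := by
    intro d
    refine exists_congr fun k => and_congr_right fun _ => ?_
    rw [hcor, ← sameVertex_map hr, f.apply_symm_apply]
  have hcol : ∀ k < 4, H.color (H.corner (f x) k) = (G.color (G.corner x k)).map Color.flip := by
    intro k hk
    rw [hcor, hin _ ⟨k, hk, Perm.SameCycle.refl _ _⟩]
  refine ⟨f x, f.symm, ?_, ?_, ?_, ⟨c.flip, ?_, ?_, ?_, ?_⟩, fun d => ?_, fun d => ?_, fun i => ?_,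
    fun d hd => ?_, fun d hd => ?_⟩
  · rw [hcor, h4]
  · intro k hk l hl hkl
    rw [hcor, hcor, sameVertex_map hr]
    exact hne k hk l hl hkl
  · intro k hk
    rw [hcor, ← hr, ← hr, ← hr]
    exact ⟨fun h => (htri k hk).1 (f.injective h), congrArg f (htri k hk).2⟩
  · rw [hcol 0 (by omega), h0]; rfl
  · rw [hcol 1 (by omega), h1]; rfl
  · rw [hcol 2 (by omega), h2]; rfl
  · rw [hcol 3 (by omega), h3]; rfl
  · rw [f.symm_apply_eq, he, f.apply_symm_apply]
  · rw [f.symm_apply_eq, hr, f.apply_symm_apply]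
  · rw [f.symm_apply_eq, hb]
  · have := hin _ ((hsv d).1 hd)
    rw [f.apply_symm_apply] at this
    rw [this, Option.map_map]
    have : Color.flip ∘ Color.flip = id := funext Color.flip_flip
    rw [this, Option.map_id, id]
  · have := hout _ fun h => hd ((hsv d).2 h)
    rw [f.apply_symm_apply] at this
    exact this.symm

theorem EquivWithOneM1.symm (h : EquivWithOneM1 G H) : EquivWithOneM1 H G := by
  obtain ⟨G', H', h1, h2, h3⟩ := h
  exact ⟨H', G', h3.symm, h2.symm, h1.symm⟩

/-! ### Graphs with a common contraction -/

theorem contractRot_map {X Y : Type} {φ : X → Y} (hφ : Function.Injective φ) {rot : X → X}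
    {rot' : Y → Y} (h : ∀ x, φ (rot x) = rot' (φ x)) (d e x : X) :
    φ (contractRot rot d e x) = contractRot rot' (φ d) (φ e) (φ x) := by
  unfold contractRot
  rw [← h, ← h, ← h, hφ.eq_iff, hφ.eq_iff]
  split_ifs <;> rfl

theorem glueEdge_map {X Y : Type} {φ : X → Y} (hφ : Function.Injective φ) {edge : X → X}
    {edge' : Y → Y} (h : ∀ x, φ (edge x) = edge' (φ x)) (d e x : X) :
    φ (glueEdge edge d e x) = glueEdge edge' (φ d) (φ e) (φ x) :=
  contractRot_map hφ h d e x

/-- Two graphs with the same half-edges that agree after the contraction of one unicolored edge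
each. -/
theorem equivM2M3_of_contract (ψ : G.Dart ≃ H.Dart) {d : G.Dart} (hG : G.IsUnicolored d)
    (hH : H.IsUnicolored (ψ d)) (hd : ψ (G.edge d) = H.edge (ψ d))
    (he : ∀ x, x ≠ d → x ≠ G.edge d → ψ (G.edge x) = H.edge (ψ x))
    (hr : ∀ x, x ≠ d → x ≠ G.edge d → ψ (contractRot G.rot d (G.edge d) x) =
      contractRot H.rot (ψ d) (H.edge (ψ d)) (ψ x))
    (hb : ∀ i, ψ (G.bdry i) = H.bdry i)
    (hc : ∀ x, x ≠ d → x ≠ G.edge d → H.color (ψ x) = G.color x) : EquivM2M3 G H := by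
  refine .trans (.rel _ _ (.inr (.inl (G.contraction_contract d hG)))) (.trans ?_
    (.symm (.rel _ _ (.inr (.inl (H.contraction_contract _ hH))))))
  refine .rel _ _ (.inl ⟨ψ.subtypeEquiv fun x => ?_, fun x => Subtype.ext (he x.1 x.2.1 x.2.2),
    fun x => Subtype.ext (hr x.1 x.2.1 x.2.2), fun i => Subtype.ext (hb i),
    fun x => hc x.1 x.2.1 x.2.2⟩)
  rw [← hd, Ne, Ne, Ne, Ne, ψ.injective.eq_iff, ψ.injective.eq_iff]

theorem sameVertex_of_removeMiddle {m : G.Dart} {h : G.IsMiddle m}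
    {x y : (G.removeMiddle m h).Dart} (hxy : (G.removeMiddle m h).SameVertex x y) :
    G.SameVertex x.1 y.1 := by
  have := (G.removeMiddle m h).finite
  exact mem_of_sameCycle (fun z : (G.removeMiddle m h).Dart => G.SameVertex x.1 z.1)
    (fun z hz => hz.trans (sameCycle_apply G.rot z.1)) hxy (Perm.SameCycle.refl _ _)

/-- Two graphs with the same half-edges that agree after the removal of one vertex of degree two
and the contraction of one unicolored edge each. -/
theorem equivM2M3_of_removeMiddle_contract (ψ : G.Dart ≃ H.Dart) {m c c₂ : G.Dart}
    (hGm : G.IsMiddle m) (hHm : H.IsMiddle (ψ m)) (hm : ψ (G.rot m) = H.rot (ψ m))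
    (hcm : c ≠ m ∧ c ≠ G.rot m) (hcc : glueEdge G.edge m (G.rot m) c = c₂)
    (hcc' : glueEdge H.edge (ψ m) (H.rot (ψ m)) (ψ c) = ψ c₂)
    (hG : G.color c ≠ none ∧ G.color c₂ = G.color c ∧ ¬ G.SameVertex c c₂)
    (hH : H.color (ψ c) ≠ none ∧ H.color (ψ c₂) = H.color (ψ c) ∧ ¬ H.SameVertex (ψ c) (ψ c₂))
    (he : ∀ x, x ≠ m → x ≠ G.rot m → x ≠ c → x ≠ c₂ →
      ψ (glueEdge G.edge m (G.rot m) x) = glueEdge H.edge (ψ m) (H.rot (ψ m)) (ψ x))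
    (hr : ∀ x, x ≠ m → x ≠ G.rot m → x ≠ c → x ≠ c₂ →
      ψ (contractRot G.rot c c₂ x) = contractRot H.rot (ψ c) (ψ c₂) (ψ x))
    (hb : ∀ i, ψ (G.bdry i) = H.bdry i)
    (hc : ∀ x, x ≠ m → x ≠ G.rot m → x ≠ c → x ≠ c₂ → H.color (ψ x) = G.color x) :
    EquivM2M3 G H := by
  refine .trans (.rel _ _ (.inr (.inr (G.middleVertexRemoval_removeMiddle m hGm)))) (.trans ?_
    (.symm (.rel _ _ (.inr (.inr (H.middleVertexRemoval_removeMiddle _ hHm))))))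
  let f : (G.removeMiddle m hGm).Dart ≃ (H.removeMiddle _ hHm).Dart :=
    ψ.subtypeEquiv fun x => by
      rw [← hm, Ne, Ne, Ne, Ne, ψ.injective.eq_iff, ψ.injective.eq_iff]
  let d : (G.removeMiddle m hGm).Dart := ⟨c, hcm⟩
  have hd : ((G.removeMiddle m hGm).edge d).val = c₂ := hcc
  have hd' : ((H.removeMiddle _ hHm).edge (f d)).val = ψ c₂ := hcc'
  have hne : ∀ x : (G.removeMiddle m hGm).Dart, x ≠ d → x ≠ (G.removeMiddle m hGm).edge d →
      x.1 ≠ m ∧ x.1 ≠ G.rot m ∧ x.1 ≠ c ∧ x.1 ≠ c₂ := fun x h1 h2 =>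
    ⟨x.2.1, x.2.2, fun h => h1 (Subtype.ext h), fun h => h2 (Subtype.ext (h.trans hd.symm))⟩
  refine equivM2M3_of_contract f (d := d) ⟨hG.1, ?_, fun h => hG.2.2 ?_⟩
    ⟨hH.1, ?_, fun h => hH.2.2 ?_⟩ (Subtype.ext ?_) (fun x h1 h2 => ?_) (fun x h1 h2 => ?_)
    (fun i => Subtype.ext (hb i)) (fun x h1 h2 => ?_)
  · exact (congrArg G.color hd).trans hG.2.1
  · rw [← hd]
    exact sameVertex_of_removeMiddle h
  · exact (congrArg H.color hd').trans hH.2.1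
  · rw [← hd']
    exact sameVertex_of_removeMiddle h
  · exact (congrArg ψ hd).trans hd'.symm
  · obtain ⟨h3, h4, h5, h6⟩ := hne x h1 h2
    exact Subtype.ext (he x.1 h3 h4 h5 h6)
  · obtain ⟨h3, h4, h5, h6⟩ := hne x h1 h2
    refine Subtype.ext ?_
    refine (congrArg ψ (contractRot_map (φ := Subtype.val) Subtype.val_injective (rot' := G.rot)
      (fun _ => rfl) _ _ _)).trans (Eq.trans ?_ (contractRot_map (φ := Subtype.val)
      Subtype.val_injective (rot' := H.rot) (fun _ => rfl) _ _ _).symm)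
    rw [hd, hd']
    exact hr x.1 h3 h4 h5 h6
  · obtain ⟨h3, h4, h5, h6⟩ := hne x h1 h2
    exact hc x.1 h3 h4 h5 h6

/-! ### Sliding an edge along a unicolored edge -/

open Classical in
/-- The rotation after the following change at the edge with halves `d` and `e`, where `d` lies at
a trivalent vertex: the clockwise next half-edge after `d` moves to the vertex of `e`, just before
`e`, and the one after `e` moves to the vertex of `d`, just before `d`. -/
noncomputable def slideRot {X : Type} (rot : X → X) (d e x : X) : X :=
  if x = d then rot (rot d)
  else if x = rot (rot d) then rot e
  else if x = rot e then d
  else if x = rot d then e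
  else if x = e then if rot (rot e) = e then rot d else rot (rot e)
  else if rot x = e then rot d
  else rot x

theorem slideRot_map {X Y : Type} {φ : X → Y} (hφ : Function.Injective φ) {rot : X → X}
    {rot' : Y → Y} (h : ∀ x, φ (rot x) = rot' (φ x)) (d e x : X) :
    φ (slideRot rot d e x) = slideRot rot' (φ d) (φ e) (φ x) := by
  have hi : ∀ x y, φ x = φ y → x = y := fun _ _ h => hφ h
  unfold slideRot
  split_ifs <;> grind

/-- A unicolored edge with half `d` at a trivalent vertex. -/
def IsSlidable (G : PlabicMap n) (d : G.Dart) : Prop :=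
  G.IsUnicolored d ∧ G.rot (G.rot (G.rot d)) = d

section Slide

variable {d : G.Dart}

theorem IsSlidable.rot_rot_ne (h : G.IsSlidable d) : G.rot (G.rot d) ≠ d := fun h1 => by
  have := h.2
  rw [h1] at this
  exact h.1.rot_ne this

/-- The half-edges at the two ends of a slidable edge are distinct. -/
theorem IsSlidable.ne_of_sameVertex (h : G.IsSlidable d) {x y : G.Dart} (hx : G.SameVertex d x)
    (hy : G.SameVertex (G.edge d) y) : x ≠ y := by
  rintro rfl
  exact h.1.2.2 (hx.trans hy.symm)

theorem sameVertex_rot (d : G.Dart) : G.SameVertex d (G.rot d) := sameCycle_apply _ _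

theorem sameVertex_rot_rot (d : G.Dart) : G.SameVertex d (G.rot (G.rot d)) :=
  (sameVertex_rot d).trans (sameVertex_rot _)

/-- The inequalities between the half-edges around a slidable edge. -/
theorem IsSlidable.ne (h : G.IsSlidable d) :
    G.rot d ≠ d ∧ G.rot (G.rot d) ≠ d ∧ G.rot (G.rot d) ≠ G.rot d ∧ G.rot (G.edge d) ≠ G.edge d ∧
      d ≠ G.edge d ∧ d ≠ G.rot (G.edge d) ∧ G.rot d ≠ G.edge d ∧ G.rot d ≠ G.rot (G.edge d) ∧
      G.rot (G.rot d) ≠ G.edge d ∧ G.rot (G.rot d) ≠ G.rot (G.edge d) := by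
  have hv := sameVertex_rot d
  have hv' := sameVertex_rot_rot d
  have hw := sameVertex_rot (G.edge d)
  have hr : G.SameVertex d d := Perm.SameCycle.refl _ _
  have hr' : G.SameVertex (G.edge d) (G.edge d) := Perm.SameCycle.refl _ _
  exact ⟨h.1.rot_ne, h.rot_rot_ne, fun h1 => h.1.rot_ne (G.rot.injective h1), h.1.symm.rot_ne,
    h.ne_of_sameVertex hr hr', h.ne_of_sameVertex hr hw, h.ne_of_sameVertex hv hr',
    h.ne_of_sameVertex hv hw, h.ne_of_sameVertex hv' hr', h.ne_of_sameVertex hv' hw⟩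

theorem slideRot_injective (h : G.IsSlidable d) :
    Function.Injective (slideRot G.rot d (G.edge d)) := by
  have hi : ∀ x y, G.rot x = G.rot y → x = y := fun _ _ h => G.rot.injective h
  have h3 := h.2
  obtain ⟨n1, n2, n3, n4, n5, n6, n7, n8, n9, n10⟩ := h.ne
  have e1 : slideRot G.rot d (G.edge d) d = G.rot (G.rot d) := by grind [slideRot]
  have e2 : slideRot G.rot d (G.edge d) (G.rot (G.rot d)) = G.rot (G.edge d) := by
    grind [slideRot]
  have e3 : slideRot G.rot d (G.edge d) (G.rot (G.edge d)) = d := by grind [slideRot]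
  have e4 : slideRot G.rot d (G.edge d) (G.rot d) = G.edge d := by grind [slideRot]
  have key : ∀ x y, slideRot G.rot d (G.edge d) x = slideRot G.rot d (G.edge d) y →
      (x = d ∨ x = G.rot (G.rot d) ∨ x = G.rot (G.edge d) ∨ x = G.rot d) → x = y := by
    rintro x y hxy (rfl | rfl | rfl | rfl)
    · rw [e1, slideRot] at hxy; split_ifs at hxy <;> grind
    · rw [e2, slideRot] at hxy; split_ifs at hxy <;> grind
    · rw [e3, slideRot] at hxy; split_ifs at hxy <;> grind
    · rw [e4, slideRot] at hxy; split_ifs at hxy <;> grind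
  intro x y hxy
  by_cases hx : x = d ∨ x = G.rot (G.rot d) ∨ x = G.rot (G.edge d) ∨ x = G.rot d
  · exact key x y hxy hx
  by_cases hy : y = d ∨ y = G.rot (G.rot d) ∨ y = G.rot (G.edge d) ∨ y = G.rot d
  · exact (key y x hxy.symm hy).symm
  push Not at hx hy
  clear e1 e2 e3 e4 key
  rw [slideRot, slideRot, if_neg hx.1, if_neg hx.2.1, if_neg hx.2.2.1, if_neg hx.2.2.2,
    if_neg hy.1, if_neg hy.2.1, if_neg hy.2.2.1, if_neg hy.2.2.2] at hxy
  split_ifs at hxy <;> grind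

theorem color_slideRot (h : G.IsSlidable d) (x : G.Dart) :
    G.color (slideRot G.rot d (G.edge d) x) = G.color x := by
  have h1 := h.1.2.1
  unfold slideRot
  split_ifs with h2 h3 h4 h5 h6 h7 h8
  · rw [G.color_rot, G.color_rot, h2]
  · rw [h3, G.color_rot, G.color_rot, G.color_rot, h1]
  · rw [h4, G.color_rot, h1]
  · rw [h5, G.color_rot, h1]
  · rw [G.color_rot, h6, h1]
  · rw [G.color_rot, G.color_rot, h6]
  · rw [G.color_rot, ← h1, ← h8, G.color_rot]
  · rw [G.color_rot]

/-- The graph after sliding. -/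
noncomputable def slide (G : PlabicMap n) (d : G.Dart) (h : G.IsSlidable d) : PlabicMap n where
  Dart := G.Dart
  finite := G.finite
  edge := G.edge
  edge_edge := G.edge_edge
  edge_ne := G.edge_ne
  rot := Equiv.ofBijective (slideRot G.rot d (G.edge d)) <| by
    have := G.finite
    exact Finite.injective_iff_bijective.1 (slideRot_injective h)
  bdry := G.bdry
  bdry_injective := G.bdry_injective
  rot_bdry i := by
    have hb := G.rot_bdry i
    have hc : ∀ x, G.color x = G.color d → G.bdry i ≠ x := fun x hx =>
      G.ne_bdry (by rw [hx]; exact h.1.1) i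
    change slideRot G.rot d (G.edge d) (G.bdry i) = G.bdry i
    rw [slideRot, hb, if_neg (hc _ rfl), if_neg (hc _ (by rw [G.color_rot, G.color_rot])),
      if_neg (hc _ (by rw [G.color_rot, h.1.2.1])), if_neg (hc _ (by rw [G.color_rot])),
      if_neg (hc _ h.1.2.1), if_neg (hc _ h.1.2.1)]
  color := G.color
  color_rot := color_slideRot h
  color_eq_none := G.color_eq_none
  leafless x hx := by
    refine G.leafless x ?_
    have hx' : slideRot G.rot d (G.edge d) x = x := hx
    obtain ⟨n1, n2, n3, n4, n5, n6, n7, n8, n9, n10⟩ := h.ne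
    unfold slideRot at hx'
    split_ifs at hx' <;> grind
  connected := by
    have hfin := G.finite
    let R : G.Dart → G.Dart → Prop := fun x y => y = G.edge x ∨ y = slideRot G.rot d (G.edge d) x
    let f : Perm G.Dart := Equiv.ofBijective (slideRot G.rot d (G.edge d))
      (Finite.injective_iff_bijective.1 (slideRot_injective h))
    let S : G.Dart → Prop := fun x => ∃ i, Relation.ReflTransGen R (G.bdry i) x
    have hE : ∀ x, S x → S (G.edge x) := fun x ⟨i, hi⟩ => ⟨i, hi.tail (.inl rfl)⟩
    have hF : ∀ x, S x → S (slideRot G.rot d (G.edge d) x) := fun x ⟨i, hi⟩ => ⟨i, hi.tail (.inr rfl)⟩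
    have hB : ∀ x, S (slideRot G.rot d (G.edge d) x) → S x := fun x hx =>
      mem_of_sameCycle (f := f) S hF (sameCycle_apply f x).symm hx
    obtain ⟨n1, n2, n3, n4, n5, n6, n7, n8, n9, n10⟩ := h.ne
    have e1 : slideRot G.rot d (G.edge d) d = G.rot (G.rot d) := by grind [slideRot]
    have e2 : slideRot G.rot d (G.edge d) (G.rot (G.rot d)) = G.rot (G.edge d) := by grind [slideRot]
    have e3 : slideRot G.rot d (G.edge d) (G.rot (G.edge d)) = d := by grind [slideRot]
    have e4 : slideRot G.rot d (G.edge d) (G.rot d) = G.edge d := by grind [slideRot]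
    -- all half-edges at the two vertices are reached together
    have hde : S d → S (G.rot (G.rot d)) ∧ S (G.rot (G.edge d)) ∧ S (G.rot d) ∧ S (G.edge d) := by
      intro hd
      have h1 : S (G.rot (G.rot d)) := e1 ▸ hF _ hd
      exact ⟨h1, e2 ▸ hF _ h1, hB _ (e4.symm ▸ hE _ hd), hE _ hd⟩
    have hed : S (G.edge d) → S d := fun h1 => by
      have := hE _ h1
      rwa [G.edge_edge] at this
    refine G.mem_of_closed S (fun i => ⟨i, .refl⟩) hE fun x hx => ?_
    have hx' := hF x hx
    by_cases c1 : x = d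
    · rw [c1] at hx ⊢
      exact (hde hx).2.2.1
    by_cases c2 : x = G.rot (G.rot d)
    · rw [c2, h.2]
      rw [c2, ← e1] at hx
      exact hB _ hx
    by_cases c3 : x = G.rot (G.edge d)
    · rw [c3, e3] at hx'
      have h1 := hF _ (hde hx').2.2.2
      rw [c3]
      by_cases c7 : G.rot (G.rot (G.edge d)) = G.edge d
      · rw [c7]
        exact (hde hx').2.2.2
      · have : slideRot G.rot d (G.edge d) (G.edge d) = G.rot (G.rot (G.edge d)) := by
          grind [slideRot]
        rwa [this] at h1
    by_cases c4 : x = G.rot d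
    · rw [c4, e4] at hx'
      rw [c4]
      exact (hde (hed hx')).1
    by_cases c5 : x = G.edge d
    · rw [c5] at hx ⊢
      exact (hde (hed hx)).2.1
    rw [slideRot, if_neg c1, if_neg c2, if_neg c3, if_neg c4, if_neg c5] at hx'
    split_ifs at hx' with c6
    · rw [c6]
      exact e4 ▸ hF _ hx'
    · exact hx'

theorem equivM2M3_slide (h : G.IsSlidable d) : EquivM2M3 G (G.slide d h) := by
  have := G.finite
  obtain ⟨n1, n2, n3, n4, n5, n6, n7, n8, n9, n10⟩ := h.ne
  have h3 := h.2
  have hi := G.rot.injective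
  refine equivM2M3_of_contract (G := G) (H := G.slide d h) (Equiv.refl _) h.1
    ⟨h.1.1, h.1.2.1, fun hs => ?_⟩ rfl (fun _ _ _ => rfl) (fun x h1 h2 => ?_) (fun _ => rfl)
    (fun _ _ _ => rfl)
  · -- after sliding, the vertex of `d` carries the half-edges `d`, `rot (rot d)`, `rot (edge d)`
    have hcl := mem_of_sameCycle (α := G.Dart) (f := (G.slide d h).rot)
      (fun x => x = d ∨ x = G.rot (G.rot d) ∨ x = G.rot (G.edge d)) (fun x hx => by
        change slideRot G.rot d (G.edge d) x = d ∨ slideRot G.rot d (G.edge d) x = _ ∨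
          slideRot G.rot d (G.edge d) x = _
        grind [slideRot]) hs (.inl rfl)
    change G.edge d = d ∨ G.edge d = _ ∨ G.edge d = _ at hcl
    grind
  · change contractRot G.rot d (G.edge d) x =
      contractRot (slideRot G.rot d (G.edge d)) d (G.edge d) x
    grind [slideRot, contractRot]

end Slide

end PlabicMap

end BridgePolytope

namespace BridgePolytope

open Equiv

namespace PlabicMap

variable {n : ℕ} {G H : PlabicMap n}

/-! ### Square moves and explicit presentations of plabic graphs -/

theorem sameVertex_iff_of_trivalent {x y : G.Dart} (h : G.rot (G.rot (G.rot x)) = x) :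
    G.SameVertex y x ↔ y = x ∨ y = G.rot x ∨ y = G.rot (G.rot x) := by
  have := G.finite
  constructor
  · intro hs
    refine mem_of_sameCycle (fun z => z = x ∨ z = G.rot x ∨ z = G.rot (G.rot x)) ?_ hs.symm
      (.inl rfl)
    rintro z (rfl | rfl | rfl)
    · exact .inr (.inl rfl)
    · exact .inr (.inr rfl)
    · exact .inl h
  · rintro (rfl | rfl | rfl)
    · exact Perm.SameCycle.refl _ _
    · exact (sameVertex_rot x).symm
    · exact (sameVertex_rot_rot x).symm

open Classical in
/-- The graph with the colors of the vertices at the first four corners of a face switched. -/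
noncomputable def switchColors (G : PlabicMap n) (x : G.Dart) : PlabicMap n where
  Dart := G.Dart
  finite := G.finite
  edge := G.edge
  edge_edge := G.edge_edge
  edge_ne := G.edge_ne
  rot := G.rot
  bdry := G.bdry
  bdry_injective := G.bdry_injective
  rot_bdry := G.rot_bdry
  color d := if ∃ k < 4, G.SameVertex d (G.corner x k) then (G.color d).map Color.flip
    else G.color d
  color_rot d := by
    have : ∀ k, G.SameVertex (G.rot d) (G.corner x k) ↔ G.SameVertex d (G.corner x k) := fun k =>
      ⟨fun h => (sameVertex_rot d).trans h, fun h => (sameVertex_rot d).symm.trans h⟩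
    rw [G.color_rot]
    have h' := exists_congr fun k => and_congr_right fun (_ : k < 4) => this k
    by_cases h : ∃ k < 4, G.SameVertex d (G.corner x k)
    · rw [if_pos h, if_pos (h'.2 h)]
    · rw [if_neg h, if_neg fun hd => h (h'.1 hd)]
  color_eq_none d := by
    rw [← G.color_eq_none]
    split_ifs <;> simp
  leafless := G.leafless
  connected := G.connected

theorem squareMove_switchColors {x : G.Dart} (h4 : G.corner x 4 = x)
    (h02 : ¬ G.SameVertex (G.corner x 0) (G.corner x 2))
    (h13 : ¬ G.SameVertex (G.corner x 1) (G.corner x 3))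
    (htri : ∀ k < 4, G.rot (G.corner x k) ≠ G.corner x k ∧
      G.rot (G.rot (G.rot (G.corner x k))) = G.corner x k)
    {c : Color} (h0 : G.color (G.corner x 0) = some c) (h1 : G.color (G.corner x 1) = some c.flip)
    (h2 : G.color (G.corner x 2) = some c) (h3 : G.color (G.corner x 3) = some c.flip) :
    SquareMove G (G.switchColors x) := by
  have hne : ∀ d e : G.Dart, G.color d = some c → G.color e = some c.flip →
      ¬ G.SameVertex d e ∧ ¬ G.SameVertex e d := by
    intro d e hd he
    have key : ¬ G.SameVertex d e := fun h => by
      have := color_of_sameVertex G h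
      rw [hd, he, Option.some.injEq] at this
      exact c.flip_ne this.symm
    exact ⟨key, fun h => key h.symm⟩
  refine ⟨x, Equiv.refl _, h4, ?_, htri, ⟨c, h0, h1, h2, h3⟩, fun _ => rfl, fun _ => rfl,
    fun _ => rfl, fun d hd => if_pos hd, fun d hd => if_neg hd⟩
  intro k hk l hl hkl
  interval_cases k <;> interval_cases l
  · exact absurd rfl hkl
  · exact (hne _ _ h0 h1).1
  · exact h02
  · exact (hne _ _ h0 h3).1
  · exact (hne _ _ h0 h1).2
  · exact absurd rfl hkl
  · exact (hne _ _ h2 h1).2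
  · exact h13
  · exact fun h => h02 h.symm
  · exact (hne _ _ h2 h1).1
  · exact absurd rfl hkl
  · exact (hne _ _ h2 h3).1
  · exact (hne _ _ h0 h3).2
  · exact fun h => h13 h.symm
  · exact (hne _ _ h2 h3).2
  · exact absurd rfl hkl

/-- A plabic graph written in terms of names for its half-edges. -/
structure Presentation (G : PlabicMap n) (X : Type) where
  toDart : X ≃ G.Dart
  edge : X → X
  rot : X → X
  color : X → Option Color
  toDart_edge : ∀ x, toDart (edge x) = G.edge (toDart x)
  toDart_rot : ∀ x, toDart (rot x) = G.rot (toDart x)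
  color_toDart : ∀ x, G.color (toDart x) = color x

namespace Presentation

variable {X : Type}

/-- Two half-edges of the same color at distinct internal vertices, the first of them trivalent. -/
def Joinable (P : Presentation G X) (c c₂ : X) : Prop :=
  P.color c ≠ none ∧ P.color c₂ = P.color c ∧ P.rot (P.rot (P.rot c)) = c ∧
    c₂ ≠ c ∧ c₂ ≠ P.rot c ∧ c₂ ≠ P.rot (P.rot c)

theorem Joinable.spec {P : Presentation G X} {c c₂ : X} (h : P.Joinable c c₂) :
    G.color (P.toDart c) ≠ none ∧ G.color (P.toDart c₂) = G.color (P.toDart c) ∧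
      ¬ G.SameVertex (P.toDart c) (P.toDart c₂) := by
  obtain ⟨h1, h2, h3, h4, h5, h6⟩ := h
  refine ⟨by rwa [P.color_toDart], by rwa [P.color_toDart, P.color_toDart], fun h => ?_⟩
  have h3' : G.rot (G.rot (G.rot (P.toDart c))) = P.toDart c := by
    rw [← P.toDart_rot, ← P.toDart_rot, ← P.toDart_rot, h3]
  have := (sameVertex_iff_of_trivalent h3').1 (Perm.SameCycle.symm h)
  rw [← P.toDart_rot, ← P.toDart_rot, P.toDart.injective.eq_iff, P.toDart.injective.eq_iff,
    P.toDart.injective.eq_iff] at this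
  rcases this with h | h | h
  · exact h4 h
  · exact h5 h
  · exact h6 h

theorem Joinable.isUnicolored {P : Presentation G X} {c c₂ : X} (h : P.Joinable c c₂)
    (hc : P.edge c = c₂) : G.IsUnicolored (P.toDart c) := by
  unfold IsUnicolored
  rw [← P.toDart_edge, hc]
  exact h.spec

theorem homotopic (P : Presentation G X) (Q : Presentation H X) (π : X ≃ X)
    (he : ∀ x, π (P.edge x) = Q.edge (π x)) (hr : ∀ x, π (P.rot x) = Q.rot (π x))
    (hb : ∀ i, ∃ x, G.bdry i = P.toDart x ∧ H.bdry i = Q.toDart (π x))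
    (hc : ∀ x, Q.color (π x) = P.color x) : Homotopic G H := by
  refine ⟨P.toDart.symm.trans (π.trans Q.toDart), fun d => ?_, fun d => ?_, fun i => ?_,
    fun d => ?_⟩
  · obtain ⟨x, rfl⟩ := P.toDart.surjective d
    simp [← P.toDart_edge, he, Q.toDart_edge]
  · obtain ⟨x, rfl⟩ := P.toDart.surjective d
    simp [← P.toDart_rot, hr, Q.toDart_rot]
  · obtain ⟨x, h1, h2⟩ := hb i
    simp [h1, h2]
  · obtain ⟨x, rfl⟩ := P.toDart.surjective d
    simp [P.color_toDart, Q.color_toDart, hc]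

theorem equivM2M3_of_contract (P : Presentation G X) (Q : Presentation H X) (π : X ≃ X)
    {c c₂ : X} (hc : P.edge c = c₂) (hc' : Q.edge (π c) = π c₂) (hP : P.Joinable c c₂)
    (hQ : Q.Joinable (π c) (π c₂))
    (he : ∀ x, x ≠ c → x ≠ c₂ → π (P.edge x) = Q.edge (π x))
    (hr : ∀ x, x ≠ c → x ≠ c₂ →
      π (contractRot P.rot c c₂ x) = contractRot Q.rot (π c) (π c₂) (π x))
    (hb : ∀ i, ∃ x, G.bdry i = P.toDart x ∧ H.bdry i = Q.toDart (π x))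
    (hcol : ∀ x, x ≠ c → x ≠ c₂ → Q.color (π x) = P.color x) : EquivM2M3 G H := by
  have hPi := P.toDart.injective
  have hψ : ∀ x, (P.toDart.symm.trans (π.trans Q.toDart)) (P.toDart x) = Q.toDart (π x) :=
    fun x => by simp
  have h1 : G.edge (P.toDart c) = P.toDart c₂ := by rw [← P.toDart_edge, hc]
  have h2 : H.edge (Q.toDart (π c)) = Q.toDart (π c₂) := by rw [← Q.toDart_edge, hc']
  refine PlabicMap.equivM2M3_of_contract (P.toDart.symm.trans (π.trans Q.toDart))
    (d := P.toDart c) (hP.isUnicolored hc) ?_ ?_ (fun d hd hd' => ?_) (fun d hd hd' => ?_)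
    (fun i => ?_) (fun d hd hd' => ?_)
  · rw [hψ]
    exact hQ.isUnicolored hc'
  · rw [hψ, h1, hψ, h2]
  · obtain ⟨x, rfl⟩ := P.toDart.surjective d
    rw [h1] at hd'
    rw [← P.toDart_edge, hψ, hψ, ← Q.toDart_edge, he x (fun h => hd (congrArg _ h))
      (fun h => hd' (congrArg _ h))]
  · obtain ⟨x, rfl⟩ := P.toDart.surjective d
    rw [h1] at hd' ⊢
    rw [← contractRot_map hPi P.toDart_rot, hψ, hψ, hψ, h2,
      ← contractRot_map Q.toDart.injective Q.toDart_rot, hr x (fun h => hd (congrArg _ h))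
      (fun h => hd' (congrArg _ h))]
  · obtain ⟨x, h1, h2⟩ := hb i
    rw [h1, h2, hψ]
  · obtain ⟨x, rfl⟩ := P.toDart.surjective d
    rw [h1] at hd'
    rw [hψ, P.color_toDart, Q.color_toDart, hcol x (fun h => hd (congrArg _ h))
      (fun h => hd' (congrArg _ h))]

/-- The half-edge `m` lies at an internal vertex of degree two. -/
def Middle (P : Presentation G X) (m m₂ : X) : Prop :=
  P.color m ≠ none ∧ m₂ ≠ m ∧ P.rot m = m₂ ∧ P.rot m₂ = m

theorem Middle.spec {P : Presentation G X} {m m₂ : X} (h : P.Middle m m₂) :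
    G.IsMiddle (P.toDart m) := by
  obtain ⟨h1, h2, h3, h4⟩ := h
  unfold IsMiddle
  rw [P.color_toDart, ← P.toDart_rot, ← P.toDart_rot, h3, h4]
  exact ⟨h1, fun h => h2 (P.toDart.injective h), rfl⟩

theorem equivM2M3_of_removeMiddle_contract (P : Presentation G X) (Q : Presentation H X)
    (π : X ≃ X) {m m₂ c c₂ : X} (hPm : P.Middle m m₂) (hQm : Q.Middle (π m) (π m₂))
    (hcm : c ≠ m ∧ c ≠ m₂) (hc : glueEdge P.edge m m₂ c = c₂)
    (hc' : glueEdge Q.edge (π m) (π m₂) (π c) = π c₂)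
    (hP : P.Joinable c c₂) (hQ : Q.Joinable (π c) (π c₂))
    (he : ∀ x, x ≠ m → x ≠ m₂ → x ≠ c → x ≠ c₂ →
      π (glueEdge P.edge m m₂ x) = glueEdge Q.edge (π m) (π m₂) (π x))
    (hr : ∀ x, x ≠ m → x ≠ m₂ → x ≠ c → x ≠ c₂ →
      π (contractRot P.rot c c₂ x) = contractRot Q.rot (π c) (π c₂) (π x))
    (hb : ∀ i, ∃ x, G.bdry i = P.toDart x ∧ H.bdry i = Q.toDart (π x))
    (hcol : ∀ x, x ≠ m → x ≠ m₂ → x ≠ c → x ≠ c₂ → Q.color (π x) = P.color x) :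
    EquivM2M3 G H := by
  have hPi := P.toDart.injective
  have hψ : ∀ x, (P.toDart.symm.trans (π.trans Q.toDart)) (P.toDart x) = Q.toDart (π x) :=
    fun x => by simp
  have h1 : G.rot (P.toDart m) = P.toDart m₂ := by rw [← P.toDart_rot, hPm.2.2.1]
  have h2 : H.rot (Q.toDart (π m)) = Q.toDart (π m₂) := by rw [← Q.toDart_rot, hQm.2.2.1]
  refine PlabicMap.equivM2M3_of_removeMiddle_contract (P.toDart.symm.trans (π.trans Q.toDart))
    (m := P.toDart m) (c := P.toDart c) (c₂ := P.toDart c₂) hPm.spec ?_ ?_ ?_ ?_ ?_ hP.spec ?_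
    (fun d d1 d2 d3 d4 => ?_) (fun d d1 d2 d3 d4 => ?_) (fun i => ?_) (fun d d1 d2 d3 d4 => ?_)
  · rw [hψ]
    exact hQm.spec
  · rw [hψ, h1, hψ, h2]
  · rw [h1]
    exact ⟨fun h => hcm.1 (hPi h), fun h => hcm.2 (hPi h)⟩
  · rw [h1, ← glueEdge_map hPi P.toDart_edge, hc]
  · rw [hψ, hψ, hψ, h2, ← glueEdge_map Q.toDart.injective Q.toDart_edge, hc']
  · rw [hψ, hψ]
    exact hQ.spec
  · obtain ⟨x, rfl⟩ := P.toDart.surjective d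
    rw [h1] at d2 ⊢
    rw [← glueEdge_map hPi P.toDart_edge, hψ, hψ, hψ, h2,
      ← glueEdge_map Q.toDart.injective Q.toDart_edge, he x (fun h => d1 (congrArg _ h))
      (fun h => d2 (congrArg _ h)) (fun h => d3 (congrArg _ h)) (fun h => d4 (congrArg _ h))]
  · obtain ⟨x, rfl⟩ := P.toDart.surjective d
    rw [h1] at d2
    rw [← contractRot_map hPi P.toDart_rot, hψ, hψ, hψ, hψ,
      ← contractRot_map Q.toDart.injective Q.toDart_rot, hr x (fun h => d1 (congrArg _ h))
      (fun h => d2 (congrArg _ h)) (fun h => d3 (congrArg _ h)) (fun h => d4 (congrArg _ h))]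
  · obtain ⟨x, h1, h2⟩ := hb i
    rw [h1, h2, hψ]
  · obtain ⟨x, rfl⟩ := P.toDart.surjective d
    rw [h1] at d2
    rw [hψ, P.color_toDart, Q.color_toDart, hcol x (fun h => d1 (congrArg _ h))
      (fun h => d2 (congrArg _ h)) (fun h => d3 (congrArg _ h)) (fun h => d4 (congrArg _ h))]

theorem Joinable.isSlidable {P : Presentation G X} {c c₂ : X} (h : P.Joinable c c₂)
    (hc : P.edge c = c₂) : G.IsSlidable (P.toDart c) := by
  refine ⟨h.isUnicolored hc, ?_⟩
  rw [← P.toDart_rot, ← P.toDart_rot, ← P.toDart_rot, h.2.2.1]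

/-- The presentation of the graph after sliding. -/
noncomputable def slide (P : Presentation G X) {c c₂ : X} (h : P.Joinable c c₂)
    (hc : P.edge c = c₂) : Presentation (G.slide (P.toDart c) (h.isSlidable hc)) X where
  toDart := P.toDart
  edge := P.edge
  rot := slideRot P.rot c c₂
  color := P.color
  toDart_edge := P.toDart_edge
  toDart_rot x := by
    have h2 : P.toDart c₂ = G.edge (P.toDart c) := by rw [← P.toDart_edge, hc]
    exact (slideRot_map P.toDart.injective P.toDart_rot _ _ _).trans
      (congrArg (fun e => slideRot G.rot (P.toDart c) e (P.toDart x)) h2)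
  color_toDart := P.color_toDart

open Classical in
/-- The presentation of a graph after switching the colors at four trivalent vertices. -/
noncomputable def switchColors (P : Presentation G X) {x : X} (S : X → Prop)
    (hS : ∀ y, S y ↔ ∃ k < 4, G.SameVertex (P.toDart y) (G.corner (P.toDart x) k)) :
    Presentation (G.switchColors (P.toDart x)) X where
  toDart := P.toDart
  edge := P.edge
  rot := P.rot
  color y := if S y then (P.color y).map Color.flip else P.color y
  toDart_edge := P.toDart_edge
  toDart_rot := P.toDart_rot
  color_toDart y := by
    by_cases h : S y
    · exact (if_pos ((hS y).1 h)).trans ((congrArg _ (P.color_toDart y)).trans (if_pos h).symm)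
    · exact (if_neg fun h' => h ((hS y).2 h')).trans ((P.color_toDart y).trans (if_neg h).symm)

theorem corner_toDart (P : Presentation G X) (x : X) (k : ℕ) :
    G.corner (P.toDart x) k = P.toDart ((fun y => P.rot (P.edge y))^[k] x) := by
  unfold corner
  induction k with
  | zero => rfl
  | succ k ih =>
    rw [Function.iterate_succ_apply', Function.iterate_succ_apply', ih, P.toDart_rot, P.toDart_edge]

/-- The corners `x₀, x₁, x₂, x₃` of a square face are trivalent and alternate in color. -/
structure IsSquare (P : Presentation G X) (x₀ x₁ x₂ x₃ : X) (c : Color) : Prop where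
  next₀ : P.rot (P.edge x₀) = x₁
  next₁ : P.rot (P.edge x₁) = x₂
  next₂ : P.rot (P.edge x₂) = x₃
  next₃ : P.rot (P.edge x₃) = x₀
  tri₀ : P.rot x₀ ≠ x₀ ∧ P.rot (P.rot (P.rot x₀)) = x₀
  tri₁ : P.rot x₁ ≠ x₁ ∧ P.rot (P.rot (P.rot x₁)) = x₁
  tri₂ : P.rot x₂ ≠ x₂ ∧ P.rot (P.rot (P.rot x₂)) = x₂
  tri₃ : P.rot x₃ ≠ x₃ ∧ P.rot (P.rot (P.rot x₃)) = x₃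
  color₀ : P.color x₀ = some c
  color₁ : P.color x₁ = some c.flip
  color₂ : P.color x₂ = some c
  color₃ : P.color x₃ = some c.flip
  ne₀₂ : x₀ ≠ x₂ ∧ x₀ ≠ P.rot x₂ ∧ x₀ ≠ P.rot (P.rot x₂)
  ne₁₃ : x₁ ≠ x₃ ∧ x₁ ≠ P.rot x₃ ∧ x₁ ≠ P.rot (P.rot x₃)

/-- The half-edges at the corners of a square. -/
def AtSquare (P : Presentation G X) (x₀ x₁ x₂ x₃ y : X) : Prop :=
  (y = x₀ ∨ y = P.rot x₀ ∨ y = P.rot (P.rot x₀)) ∨ (y = x₁ ∨ y = P.rot x₁ ∨ y = P.rot (P.rot x₁)) ∨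
    (y = x₂ ∨ y = P.rot x₂ ∨ y = P.rot (P.rot x₂)) ∨ (y = x₃ ∨ y = P.rot x₃ ∨ y = P.rot (P.rot x₃))

section

variable {P : Presentation G X} {x₀ x₁ x₂ x₃ : X} {c : Color}

theorem sameVertex_toDart {x y : X} (h : P.rot (P.rot (P.rot x)) = x) :
    G.SameVertex (P.toDart y) (P.toDart x) ↔ y = x ∨ y = P.rot x ∨ y = P.rot (P.rot x) := by
  have h' : G.rot (G.rot (G.rot (P.toDart x))) = P.toDart x := by
    rw [← P.toDart_rot, ← P.toDart_rot, ← P.toDart_rot, h]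
  rw [sameVertex_iff_of_trivalent h', ← P.toDart_rot, ← P.toDart_rot, P.toDart.injective.eq_iff,
    P.toDart.injective.eq_iff, P.toDart.injective.eq_iff]

theorem IsSquare.corner (h : P.IsSquare x₀ x₁ x₂ x₃ c) :
    G.corner (P.toDart x₀) 0 = P.toDart x₀ ∧ G.corner (P.toDart x₀) 1 = P.toDart x₁ ∧
      G.corner (P.toDart x₀) 2 = P.toDart x₂ ∧ G.corner (P.toDart x₀) 3 = P.toDart x₃ ∧
      G.corner (P.toDart x₀) 4 = P.toDart x₀ := by
  refine ⟨?_, ?_, ?_, ?_, ?_⟩ <;> rw [P.corner_toDart] <;>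
    simp [h.next₀, h.next₁, h.next₂, h.next₃]

theorem IsSquare.squareMove (h : P.IsSquare x₀ x₁ x₂ x₃ c) :
    SquareMove G (G.switchColors (P.toDart x₀)) := by
  obtain ⟨c0, c1, c2, c3, c4⟩ := h.corner
  refine squareMove_switchColors (c := c) c4 ?_ ?_ ?_ ?_ ?_ ?_ ?_
  · rw [c0, c2, sameVertex_toDart h.tri₂.2]
    exact fun h' => by rcases h' with h' | h' | h' <;> simp_all [h.ne₀₂]
  · rw [c1, c3, sameVertex_toDart h.tri₃.2]
    exact fun h' => by rcases h' with h' | h' | h' <;> simp_all [h.ne₁₃]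
  · intro k hk
    interval_cases k <;> simp only [c0, c1, c2, c3, ← P.toDart_rot, Ne, P.toDart.injective.eq_iff]
    · exact h.tri₀
    · exact h.tri₁
    · exact h.tri₂
    · exact h.tri₃
  · rw [c0, P.color_toDart, h.color₀]
  · rw [c1, P.color_toDart, h.color₁]
  · rw [c2, P.color_toDart, h.color₂]
  · rw [c3, P.color_toDart, h.color₃]

theorem IsSquare.atSquare_iff (h : P.IsSquare x₀ x₁ x₂ x₃ c) (y : X) :
    P.AtSquare x₀ x₁ x₂ x₃ y ↔
      ∃ k < 4, G.SameVertex (P.toDart y) (G.corner (P.toDart x₀) k) := by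
  obtain ⟨c0, c1, c2, c3, -⟩ := h.corner
  have h0 := sameVertex_toDart (P := P) (y := y) h.tri₀.2
  have h1 := sameVertex_toDart (P := P) (y := y) h.tri₁.2
  have h2 := sameVertex_toDart (P := P) (y := y) h.tri₂.2
  have h3 := sameVertex_toDart (P := P) (y := y) h.tri₃.2
  unfold AtSquare
  rw [← h0, ← h1, ← h2, ← h3, ← c0, ← c1, ← c2, ← c3, c0]
  constructor
  · rintro (h | h | h | h)
    · exact ⟨0, by omega, h⟩
    · exact ⟨1, by omega, h⟩
    · exact ⟨2, by omega, h⟩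
    · exact ⟨3, by omega, h⟩
  · rintro ⟨k, hk, h⟩
    interval_cases k
    · exact .inl h
    · exact .inr (.inl h)
    · exact .inr (.inr (.inl h))
    · exact .inr (.inr (.inr h))

end

end Presentation

end PlabicMap

end BridgePolytope

namespace BridgePolytope

open Equiv

variable {n : ℕ} {J : Finset (Fin n)}

/-! ### Wires of a concatenation of bridge sequences -/

section Append

theorem no_foot_of_above {w : List (Bridge n)} {v : Foot w} (h : above w v = none) (u : Foot w)
    (hu : wire w u = wire w v) : v.1 ≤ u.1 := by
  by_contra hc
  obtain ⟨y, ⟨hy, hyv⟩, hmax⟩ := Set.exists_max_image {y | wire w y = wire w v ∧ y.1 < v.1}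
    Prod.fst (Set.toFinite _) ⟨u, hu, not_le.1 hc⟩
  have : above w v = some y := above_eq_some.2 ⟨hy, hyv, fun z hz hlt =>
    absurd (hmax z ⟨hz.trans hy, hlt.2⟩) (not_le.2 hlt.1)⟩
  rw [h] at this
  cases this

theorem exists_bottom {w : List (Bridge n)} {a : Fin n} (h : ∃ v, wire w v = a) :
    ∃ v, wire w v = a ∧ below w v = none := by
  obtain ⟨v, hv, hmax⟩ := Set.exists_max_image {v | wire w v = a} Prod.fst (Set.toFinite _) h
  refine ⟨v, hv, ?_⟩
  by_contra hne
  obtain ⟨u, hu⟩ := Option.ne_none_iff_exists'.1 hne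
  have hn := below_eq_some.1 hu
  exact absurd (hmax u (hn.1.symm.trans hv)) (not_le.2 hn.2.1)

open Classical in
/-- The highest foot on a wire. -/
noncomputable def first (w : List (Bridge n)) (a : Fin n) : Option (Foot w) :=
  if h : ∃ v, wire w v = a then some (exists_top h).choose else none

open Classical in
/-- The lowest foot on a wire. -/
noncomputable def last (w : List (Bridge n)) (a : Fin n) : Option (Foot w) :=
  if h : ∃ v, wire w v = a then some (exists_bottom h).choose else none

variable {w p q : List (Bridge n)}

theorem first_eq_some {a : Fin n} {v : Foot w} :
    first w a = some v ↔ wire w v = a ∧ above w v = none := by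
  unfold first
  constructor
  · intro h
    split_ifs at h with hx
    cases h
    exact (exists_top hx).choose_spec
  · rintro ⟨h1, h2⟩
    have hx : ∃ v, wire w v = a := ⟨v, h1⟩
    have hs := (exists_top hx).choose_spec
    rw [dif_pos hx, top_unique (hs.1.trans h1.symm) hs.2 h2]

theorem last_eq_some {a : Fin n} {v : Foot w} :
    last w a = some v ↔ wire w v = a ∧ below w v = none := by
  unfold last
  constructor
  · intro h
    split_ifs at h with hx
    cases h
    exact (exists_bottom hx).choose_spec
  · rintro ⟨h1, h2⟩
    have hx : ∃ v, wire w v = a := ⟨v, h1⟩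
    have hs := (exists_bottom hx).choose_spec
    have e1 := no_foot_of_below hs.2 v (h1.trans hs.1.symm)
    have e2 := no_foot_of_below h2 _ (hs.1.trans h1.symm)
    rw [dif_pos hx, foot_ext (Fin.ext (by omega)) (hs.1.trans h1.symm)]

theorem first_eq_none {a : Fin n} : first w a = none ↔ ∀ v, wire w v ≠ a := by
  unfold first
  split_ifs with h
  · simpa only [reduceCtorEq, false_iff, not_forall, not_not] using h
  · simpa only [true_iff, not_exists] using h

theorem last_eq_none {a : Fin n} : last w a = none ↔ ∀ v, wire w v ≠ a := by
  unfold last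
  split_ifs with h
  · simpa only [reduceCtorEq, false_iff, not_forall, not_not] using h
  · simpa only [true_iff, not_exists] using h

/-- A foot of `p` as a foot of `p ++ q`. -/
def leftFoot (q : List (Bridge n)) (v : Foot p) : Foot (p ++ q) :=
  (⟨v.1, by rw [List.length_append]; have := v.1.isLt; omega⟩, v.2)

/-- A foot of `q` as a foot of `p ++ q`. -/
def rightFoot (p : List (Bridge n)) (v : Foot q) : Foot (p ++ q) :=
  (⟨p.length + v.1, by rw [List.length_append]; have := v.1.isLt; omega⟩, v.2)

theorem leftFoot_val (v : Foot p) : ((leftFoot q v).1 : ℕ) = v.1 := rfl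

theorem rightFoot_val (v : Foot q) : ((rightFoot p v).1 : ℕ) = p.length + v.1 := rfl

theorem wire_leftFoot (v : Foot p) : wire (p ++ q) (leftFoot q v) = wire p v := by
  unfold wire leftFoot
  simp

theorem wire_rightFoot (v : Foot q) : wire (p ++ q) (rightFoot p v) = wire q v := by
  unfold wire rightFoot
  simp

theorem foot_append_cases (v : Foot (p ++ q)) :
    (∃ u : Foot p, v = leftFoot q u) ∨ ∃ u : Foot q, v = rightFoot p u := by
  obtain ⟨⟨t, ht⟩, s⟩ := v
  rw [List.length_append] at ht
  by_cases h : t < p.length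
  · exact .inl ⟨(⟨t, h⟩, s), rfl⟩
  · refine .inr ⟨(⟨t - p.length, by omega⟩, s), ?_⟩
    unfold rightFoot
    congr 2
    simp only
    omega

theorem leftFoot_injective : Function.Injective (leftFoot (p := p) q) := by
  intro u v h
  unfold leftFoot at h
  rw [Prod.mk.injEq, Fin.mk.injEq] at h
  exact Prod.ext (Fin.ext h.1) h.2

theorem rightFoot_injective : Function.Injective (rightFoot (q := q) p) := by
  intro u v h
  unfold rightFoot at h
  rw [Prod.mk.injEq, Fin.mk.injEq] at h
  exact Prod.ext (Fin.ext (by omega)) h.2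

theorem leftFoot_ne_rightFoot (u : Foot p) (v : Foot q) : leftFoot q u ≠ rightFoot p v := by
  intro h
  have := congrArg (fun x => (x.1 : ℕ)) h
  simp only [leftFoot_val, rightFoot_val] at this
  have := u.1.isLt
  omega

theorem isNext_leftFoot {u v : Foot p} :
    IsNext (p ++ q) (leftFoot q u) (leftFoot q v) ↔ IsNext p u v := by
  unfold IsNext
  rw [wire_leftFoot, wire_leftFoot]
  refine and_congr_right fun _ => and_congr Iff.rfl ⟨fun h x hx => ?_, fun h x hx => ?_⟩
  · exact h (leftFoot q x) (by rw [wire_leftFoot, hx])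
  · rcases foot_append_cases x with ⟨x, rfl⟩ | ⟨x, rfl⟩
    · rw [wire_leftFoot] at hx
      exact h x hx
    · rw [Fin.lt_def, Fin.lt_def, rightFoot_val, leftFoot_val, leftFoot_val]
      have := v.1.isLt
      omega

theorem isNext_rightFoot {u v : Foot q} :
    IsNext (p ++ q) (rightFoot p u) (rightFoot p v) ↔ IsNext q u v := by
  unfold IsNext
  rw [wire_rightFoot, wire_rightFoot, Fin.lt_def, rightFoot_val, rightFoot_val,
    Nat.add_lt_add_iff_left]
  refine and_congr_right fun _ => and_congr Iff.rfl ⟨fun h x hx => ?_, fun h x hx => ?_⟩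
  · have := h (rightFoot p x) (by rw [wire_rightFoot, hx])
    rwa [Fin.lt_def, Fin.lt_def, rightFoot_val, rightFoot_val, rightFoot_val,
      Nat.add_lt_add_iff_left, Nat.add_lt_add_iff_left] at this
  · rcases foot_append_cases x with ⟨x, rfl⟩ | ⟨x, rfl⟩
    · rw [Fin.lt_def, Fin.lt_def, rightFoot_val, rightFoot_val, leftFoot_val]
      have := x.1.isLt
      omega
    · rw [wire_rightFoot] at hx
      have := h x hx
      rwa [Fin.lt_def, Fin.lt_def, rightFoot_val, rightFoot_val, rightFoot_val,
        Nat.add_lt_add_iff_left, Nat.add_lt_add_iff_left]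

theorem not_isNext_rightFoot_leftFoot {u : Foot q} {v : Foot p} :
    ¬ IsNext (p ++ q) (rightFoot p u) (leftFoot q v) := by
  rintro ⟨-, h, -⟩
  rw [Fin.lt_def, rightFoot_val, leftFoot_val] at h
  have := v.1.isLt
  omega

theorem isNext_leftFoot_rightFoot {u : Foot p} {v : Foot q} :
    IsNext (p ++ q) (leftFoot q u) (rightFoot p v) ↔
      below p u = none ∧ first q (wire p u) = some v := by
  rw [first_eq_some]
  constructor
  · intro h
    have hw := h.1
    rw [wire_leftFoot, wire_rightFoot] at hw
    refine ⟨?_, hw.symm, ?_⟩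
    · by_contra hne
      obtain ⟨x, hx⟩ := Option.ne_none_iff_exists'.1 hne
      exact leftFoot_ne_rightFoot _ _ ((isNext_leftFoot.2 (below_eq_some.1 hx)).right_unique h)
    · by_contra hne
      obtain ⟨x, hx⟩ := Option.ne_none_iff_exists'.1 hne
      exact leftFoot_ne_rightFoot _ _ (h.left_unique (isNext_rightFoot.2 (above_eq_some.1 hx)))
  · rintro ⟨h1, h2, h3⟩
    refine ⟨by rw [wire_leftFoot, wire_rightFoot, h2], ?_, fun x hx => ?_⟩
    · rw [Fin.lt_def, rightFoot_val, leftFoot_val]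
      have := u.1.isLt
      omega
    · rw [wire_leftFoot] at hx
      rcases foot_append_cases x with ⟨x, rfl⟩ | ⟨x, rfl⟩
      · rw [wire_leftFoot] at hx
        have := no_foot_of_below h1 x hx
        rw [Fin.lt_def, leftFoot_val, leftFoot_val]
        omega
      · rw [wire_rightFoot] at hx
        have := no_foot_of_above h3 x (hx.trans h2.symm)
        rw [Fin.le_def] at this
        rw [Fin.lt_def, Fin.lt_def, rightFoot_val, rightFoot_val]
        omega

theorem below_leftFoot (u : Foot p) : below (p ++ q) (leftFoot q u) =
    ((below p u).map (leftFoot q)).or ((first q (wire p u)).map (rightFoot p)) := by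
  rcases hb : below p u with _ | v
  · rcases hf : first q (wire p u) with _ | v
    · change below (p ++ q) (leftFoot q u) = none
      by_contra hne
      obtain ⟨x, hx⟩ := Option.ne_none_iff_exists'.1 hne
      have hx := below_eq_some.1 hx
      rcases foot_append_cases x with ⟨x, rfl⟩ | ⟨x, rfl⟩
      · rw [below_eq_some.2 (isNext_leftFoot.1 hx)] at hb
        cases hb
      · rw [(isNext_leftFoot_rightFoot.1 hx).2] at hf
        cases hf
    · exact below_eq_some.2 (isNext_leftFoot_rightFoot.2 ⟨hb, hf⟩)
  · exact below_eq_some.2 (isNext_leftFoot.2 (below_eq_some.1 hb))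

theorem below_rightFoot (u : Foot q) : below (p ++ q) (rightFoot p u) =
    (below q u).map (rightFoot p) := by
  rcases hb : below q u with _ | v
  · change below (p ++ q) (rightFoot p u) = none
    by_contra hne
    obtain ⟨x, hx⟩ := Option.ne_none_iff_exists'.1 hne
    have hx := below_eq_some.1 hx
    rcases foot_append_cases x with ⟨x, rfl⟩ | ⟨x, rfl⟩
    · exact not_isNext_rightFoot_leftFoot hx
    · rw [below_eq_some.2 (isNext_rightFoot.1 hx)] at hb
      cases hb
  · exact below_eq_some.2 (isNext_rightFoot.2 (below_eq_some.1 hb))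

theorem last_iff_first {u : Foot p} {v : Foot q} :
    below p u = none ∧ first q (wire p u) = some v ↔
      above q v = none ∧ last p (wire q v) = some u := by
  rw [first_eq_some, last_eq_some]
  constructor
  · rintro ⟨h1, h2, h3⟩
    exact ⟨h3, h2.symm, h1⟩
  · rintro ⟨h1, h2, h3⟩
    exact ⟨h3, h2.symm, h1⟩

theorem above_leftFoot (u : Foot p) : above (p ++ q) (leftFoot q u) =
    (above p u).map (leftFoot q) := by
  rcases hb : above p u with _ | v
  · change above (p ++ q) (leftFoot q u) = none
    by_contra hne
    obtain ⟨x, hx⟩ := Option.ne_none_iff_exists'.1 hne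
    have hx := above_eq_some.1 hx
    rcases foot_append_cases x with ⟨x, rfl⟩ | ⟨x, rfl⟩
    · rw [above_eq_some.2 (isNext_leftFoot.1 hx)] at hb
      cases hb
    · exact not_isNext_rightFoot_leftFoot hx
  · exact above_eq_some.2 (isNext_leftFoot.2 (above_eq_some.1 hb))

theorem above_rightFoot (v : Foot q) : above (p ++ q) (rightFoot p v) =
    ((above q v).map (rightFoot p)).or ((last p (wire q v)).map (leftFoot q)) := by
  rcases hb : above q v with _ | u
  · rcases hf : last p (wire q v) with _ | u
    · change above (p ++ q) (rightFoot p v) = none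
      by_contra hne
      obtain ⟨x, hx⟩ := Option.ne_none_iff_exists'.1 hne
      have hx := above_eq_some.1 hx
      rcases foot_append_cases x with ⟨x, rfl⟩ | ⟨x, rfl⟩
      · rw [(last_iff_first.1 (isNext_leftFoot_rightFoot.1 hx)).2] at hf
        cases hf
      · rw [above_eq_some.2 (isNext_rightFoot.1 hx)] at hb
        cases hb
    · exact above_eq_some.2 (isNext_leftFoot_rightFoot.2 (last_iff_first.2 ⟨hb, hf⟩))
  · exact above_eq_some.2 (isNext_rightFoot.2 (above_eq_some.1 hb))

theorem first_append (a : Fin n) : first (p ++ q) a =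
    ((first p a).map (leftFoot q)).or ((first q a).map (rightFoot p)) := by
  rcases hp : first p a with _ | v
  · rcases hq : first q a with _ | v
    · refine first_eq_none.2 fun x => ?_
      rcases foot_append_cases x with ⟨x, rfl⟩ | ⟨x, rfl⟩
      · rw [wire_leftFoot]
        exact first_eq_none.1 hp x
      · rw [wire_rightFoot]
        exact first_eq_none.1 hq x
    · obtain ⟨h1, h2⟩ := first_eq_some.1 hq
      refine first_eq_some.2 ⟨by rw [wire_rightFoot, h1], ?_⟩
      rw [above_rightFoot, h2, h1, last_eq_none.2 (first_eq_none.1 hp)]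
      rfl
  · obtain ⟨h1, h2⟩ := first_eq_some.1 hp
    exact first_eq_some.2 ⟨by rw [wire_leftFoot, h1], by rw [above_leftFoot, h2]; rfl⟩

theorem last_append (a : Fin n) : last (p ++ q) a =
    ((last q a).map (rightFoot p)).or ((last p a).map (leftFoot q)) := by
  rcases hq : last q a with _ | v
  · rcases hp : last p a with _ | v
    · refine last_eq_none.2 fun x => ?_
      rcases foot_append_cases x with ⟨x, rfl⟩ | ⟨x, rfl⟩
      · rw [wire_leftFoot]
        exact last_eq_none.1 hp x
      · rw [wire_rightFoot]
        exact last_eq_none.1 hq x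
    · obtain ⟨h1, h2⟩ := last_eq_some.1 hp
      refine last_eq_some.2 ⟨by rw [wire_leftFoot, h1], ?_⟩
      rw [below_leftFoot, h2, h1, first_eq_none.2 (last_eq_none.1 hq)]
      rfl
  · obtain ⟨h1, h2⟩ := last_eq_some.1 hq
    exact last_eq_some.2 ⟨by rw [wire_rightFoot, h1], by rw [below_rightFoot, h2]; rfl⟩

theorem boundaryDart_of_first {a : Fin n} {v : Foot w} (h : first w a = some v) :
    boundaryDart w a = .down v := by
  obtain ⟨rfl, h2⟩ := first_eq_some.1 h
  exact boundaryDart_of_top h2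

/-! ### Sequences of two or three bridges -/

theorem below_singleton (b : Bridge n) (v : Foot [b]) : below [b] v = none := by
  by_contra hne
  obtain ⟨x, hx⟩ := Option.ne_none_iff_exists'.1 hne
  have h := (below_eq_some.1 hx).2.1
  exact absurd h (by rw [Subsingleton.elim (α := Fin 1) v.1 x.1]; exact lt_irrefl _)

theorem above_singleton (b : Bridge n) (v : Foot [b]) : above [b] v = none := by
  by_contra hne
  obtain ⟨x, hx⟩ := Option.ne_none_iff_exists'.1 hne
  have h := (above_eq_some.1 hx).2.1
  exact absurd h (by rw [Subsingleton.elim (α := Fin 1) v.1 x.1]; exact lt_irrefl _)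

theorem first_singleton (b : Bridge n) (a : Fin n) : first [b] a =
    if b.left = a then some ((0 : Fin 1), false) else
      if b.right = a then some ((0 : Fin 1), true) else none := by
  split_ifs with h1 h2
  · exact first_eq_some.2 ⟨h1, above_singleton _ _⟩
  · exact first_eq_some.2 ⟨h2, above_singleton _ _⟩
  · refine first_eq_none.2 ?_
    rintro ⟨t, s⟩
    have : t = (0 : Fin 1) := Subsingleton.elim (α := Fin 1) _ _
    subst this
    cases s
    · exact h1
    · exact h2

theorem last_singleton (b : Bridge n) (a : Fin n) : last [b] a =
    if b.left = a then some ((0 : Fin 1), false) else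
      if b.right = a then some ((0 : Fin 1), true) else none := by
  split_ifs with h1 h2
  · exact last_eq_some.2 ⟨h1, below_singleton _ _⟩
  · exact last_eq_some.2 ⟨h2, below_singleton _ _⟩
  · refine last_eq_none.2 ?_
    rintro ⟨t, s⟩
    have : t = (0 : Fin 1) := Subsingleton.elim (α := Fin 1) _ _
    subst this
    cases s
    · exact h1
    · exact h2

end Append

end BridgePolytope

namespace BridgePolytope

open Equiv

variable {n : ℕ} {J : Finset (Fin n)}

/-! ### Replacing a short piece of a bridge sequence -/

/-- The part of a bridge sequence of length `m` that matters for its surroundings, in explicit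
form: the wires of its feet, the order of the feet on the wires, and the highest and the lowest
foot of each wire. -/
structure Tangle (n m : ℕ) where
  wire : Fin m × Bool → Fin n
  below : Fin m × Bool → Option (Fin m × Bool)
  above : Fin m × Bool → Option (Fin m × Bool)
  first : Fin n → Option (Fin m × Bool)
  last : Fin n → Option (Fin m × Bool)

/-- A foot named by its number, as a foot of the sequence `q`. -/
def castFoot {q : List (Bridge n)} {m : ℕ} (hq : q.length = m) (u : Fin m × Bool) : Foot q :=
  (Fin.cast hq.symm u.1, u.2)

/-- The data of the tangle `Θ` are those of the bridge sequence `q`. -/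
structure Tangle.Describes {m : ℕ} (Θ : Tangle n m) (q : List (Bridge n)) : Prop where
  length_eq : q.length = m
  wire_eq : ∀ u, BridgePolytope.wire q (castFoot length_eq u) = Θ.wire u
  below_eq : ∀ u, BridgePolytope.below q (castFoot length_eq u) =
    (Θ.below u).map (castFoot length_eq)
  above_eq : ∀ u, BridgePolytope.above q (castFoot length_eq u) =
    (Θ.above u).map (castFoot length_eq)
  first_eq : ∀ a, BridgePolytope.first q a = (Θ.first a).map (castFoot length_eq)
  last_eq : ∀ a, BridgePolytope.last q a = (Θ.last a).map (castFoot length_eq)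

/-- The three half-edges that belong to a foot. -/
inductive Kind where
  | up
  | down
  | cross

/-- Names for the half-edges of a bridge graph in which `m` consecutive bridges are distinguished:
`O` stands for the other feet and `S` for the wires without bridges. -/
inductive SpliceDart (O : Type) (m : ℕ) (S : Type) where
  | outer (k : Kind) (v : O)
  | inner (k : Kind) (u : Fin m × Bool)
  | stub (a : S)
  | leaf (a : S)

section Splice

variable (p r : List (Bridge n)) {m : ℕ} (Θ : Tangle n m)

/-- The feet of `p ++ q ++ r`, where `q` has `m` bridges. -/
abbrev SpliceFoot (p r : List (Bridge n)) (m : ℕ) : Type := (Foot p ⊕ Foot r) ⊕ (Fin m × Bool)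

/-- The wires that carry no foot, if `T` is the set of wires with feet in the middle piece. -/
abbrev Untouched (T : Fin n → Prop) : Type :=
  {a : Fin n // (∀ v, wire p v ≠ a) ∧ (∀ v, wire r v ≠ a) ∧ ¬ T a}

/-- The half-edge of kind `k` of the foot `v`. -/
def SpliceFoot.dart {p r : List (Bridge n)} {m : ℕ} {S : Type} (k : Kind) :
    SpliceFoot p r m → SpliceDart (Foot p ⊕ Foot r) m S
  | .inl v => .outer k v
  | .inr u => .inner k u

/-- Whether a foot is the right foot of its bridge. -/
def SpliceFoot.side {p r : List (Bridge n)} {m : ℕ} : SpliceFoot p r m → Bool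
  | .inl (.inl v) => v.2
  | .inl (.inr v) => v.2
  | .inr u => u.2

/-- The other foot of the bridge. -/
def SpliceFoot.opp {p r : List (Bridge n)} {m : ℕ} : SpliceFoot p r m → SpliceFoot p r m
  | .inl (.inl v) => .inl (.inl (v.1, !v.2))
  | .inl (.inr v) => .inl (.inr (v.1, !v.2))
  | .inr u => .inr (u.1, !u.2)

/-- The next foot below. -/
noncomputable def spliceBelow : SpliceFoot p r m → Option (SpliceFoot p r m)
  | .inl (.inl v) => ((below p v).map fun x => .inl (.inl x)).or
      (((Θ.first (wire p v)).map .inr).or ((first r (wire p v)).map fun x => .inl (.inr x)))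
  | .inl (.inr v) => (below r v).map fun x => .inl (.inr x)
  | .inr u => ((Θ.below u).map .inr).or ((first r (Θ.wire u)).map fun x => .inl (.inr x))

/-- The next foot above. -/
noncomputable def spliceAbove : SpliceFoot p r m → Option (SpliceFoot p r m)
  | .inl (.inl v) => (above p v).map fun x => .inl (.inl x)
  | .inl (.inr v) => ((above r v).map fun x => .inl (.inr x)).or
      (((Θ.last (wire r v)).map .inr).or ((last p (wire r v)).map fun x => .inl (.inl x)))
  | .inr u => ((Θ.above u).map .inr).or ((last p (Θ.wire u)).map fun x => .inl (.inl x))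

/-- The clockwise next half-edge. -/
noncomputable def footRot {S : Type} (k : Kind) (v : SpliceFoot p r m) :
    SpliceDart (Foot p ⊕ Foot r) m S :=
  match k with
  | .up => bif v.side then
      match spliceBelow p r Θ v with
      | some v' => SpliceFoot.dart .down v'
      | none => SpliceFoot.dart .cross v
    else SpliceFoot.dart .cross v
  | .cross => bif v.side then SpliceFoot.dart .up v else
      match spliceBelow p r Θ v with
      | some v' => SpliceFoot.dart .down v'
      | none => SpliceFoot.dart .up v
  | .down =>
      match spliceAbove p r Θ v with
      | some u => bif u.side then SpliceFoot.dart .cross u else SpliceFoot.dart .up u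
      | none => SpliceFoot.dart .down v

/-- The other half of the edge. -/
def footEdge {S : Type} (k : Kind) (v : SpliceFoot p r m) : SpliceDart (Foot p ⊕ Foot r) m S :=
  match k with
  | .up => SpliceFoot.dart .down v
  | .down => SpliceFoot.dart .up v
  | .cross => SpliceFoot.dart .cross v.opp

/-- The color of a half-edge. -/
noncomputable def footColor (k : Kind) (v : SpliceFoot p r m) : Option Color :=
  match k with
  | .up => some (bif v.side then .black else .white)
  | .cross => some (bif v.side then .black else .white)
  | .down => (spliceAbove p r Θ v).map fun u => bif u.side then .black else .white

variable {S : Type}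

/-- Clockwise rotation in terms of names. -/
noncomputable def spliceRot : SpliceDart (Foot p ⊕ Foot r) m S → SpliceDart (Foot p ⊕ Foot r) m S
  | .outer k v => footRot p r Θ k (.inl v)
  | .inner k u => footRot p r Θ k (.inr u)
  | .stub a => .stub a
  | .leaf a => .leaf a

/-- The other half of an edge in terms of names. -/
def spliceEdge : SpliceDart (Foot p ⊕ Foot r) m S → SpliceDart (Foot p ⊕ Foot r) m S
  | .outer k v => footEdge p r k (.inl v)
  | .inner k u => footEdge p r k (.inr u)
  | .stub a => .leaf a
  | .leaf a => .stub a

/-- The color of a half-edge in terms of names; `c` gives the colors of the boundary leaves. -/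
noncomputable def spliceColor (c : S → Color) : SpliceDart (Foot p ⊕ Foot r) m S → Option Color
  | .outer k v => footColor p r Θ k (.inl v)
  | .inner k u => footColor p r Θ k (.inr u)
  | .stub _ => none
  | .leaf a => some (c a)

variable {p r Θ} {q : List (Bridge n)}

/-- The foot of `p ++ q ++ r` with a given name. -/
def SpliceFoot.toFoot (hq : q.length = m) : SpliceFoot p r m → Foot (p ++ q ++ r)
  | .inl (.inl v) => leftFoot r (leftFoot q v)
  | .inl (.inr v) => rightFoot (p ++ q) v
  | .inr u => leftFoot r (rightFoot p (castFoot hq u))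

theorem castFoot_injective (hq : q.length = m) : Function.Injective (castFoot hq) := by
  subst hq
  exact fun _ _ h => h

theorem castFoot_surjective (hq : q.length = m) : Function.Surjective (castFoot hq) := by
  subst hq
  exact fun x => ⟨x, rfl⟩

theorem SpliceFoot.toFoot_injective (hq : q.length = m) :
    Function.Injective (SpliceFoot.toFoot (p := p) (r := r) hq) := by
  rintro ((u | u) | u) ((v | v) | v) h
  · rw [leftFoot_injective (leftFoot_injective h)]
  · exact absurd h (leftFoot_ne_rightFoot _ _)
  · exact absurd (leftFoot_injective h) (leftFoot_ne_rightFoot _ _)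
  · exact absurd h.symm (leftFoot_ne_rightFoot _ _)
  · rw [rightFoot_injective h]
  · exact absurd h.symm (leftFoot_ne_rightFoot _ _)
  · exact absurd (leftFoot_injective h).symm (leftFoot_ne_rightFoot _ _)
  · exact absurd h (leftFoot_ne_rightFoot _ _)
  · rw [castFoot_injective hq (rightFoot_injective (leftFoot_injective h))]

theorem SpliceFoot.toFoot_surjective (hq : q.length = m) :
    Function.Surjective (SpliceFoot.toFoot (p := p) (r := r) hq) := by
  intro x
  rcases foot_append_cases x with ⟨x, rfl⟩ | ⟨x, rfl⟩
  · rcases foot_append_cases x with ⟨x, rfl⟩ | ⟨x, rfl⟩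
    · exact ⟨.inl (.inl x), rfl⟩
    · obtain ⟨u, rfl⟩ := castFoot_surjective hq x
      exact ⟨.inr u, rfl⟩
  · exact ⟨.inl (.inr x), rfl⟩

theorem below_toFoot (h : Θ.Describes q) (v : SpliceFoot p r m) :
    below (p ++ q ++ r) (v.toFoot h.length_eq) =
      (spliceBelow p r Θ v).map (SpliceFoot.toFoot h.length_eq) := by
  rcases v with (v | v) | u
  · simp only [SpliceFoot.toFoot, below_leftFoot, spliceBelow, wire_leftFoot, h.first_eq]
    rcases below p v with _ | x <;> rcases Θ.first (wire p v) with _ | y <;>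
      rcases first r (wire p v) with _ | z <;> rfl
  · simp only [SpliceFoot.toFoot, below_rightFoot, spliceBelow]
    rcases below r v with _ | x <;> rfl
  · simp only [SpliceFoot.toFoot, below_leftFoot, below_rightFoot, spliceBelow, wire_rightFoot,
      h.below_eq, h.wire_eq]
    rcases Θ.below u with _ | x <;> rcases first r (Θ.wire u) with _ | z <;> rfl

theorem above_toFoot (h : Θ.Describes q) (v : SpliceFoot p r m) :
    above (p ++ q ++ r) (v.toFoot h.length_eq) =
      (spliceAbove p r Θ v).map (SpliceFoot.toFoot h.length_eq) := by
  rcases v with (v | v) | u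
  · simp only [SpliceFoot.toFoot, above_leftFoot, spliceAbove]
    rcases above p v with _ | x <;> rfl
  · simp only [SpliceFoot.toFoot, above_rightFoot, spliceAbove, last_append, h.last_eq]
    rcases above r v with _ | x <;> rcases Θ.last (wire r v) with _ | y <;>
      rcases last p (wire r v) with _ | z <;> rfl
  · simp only [SpliceFoot.toFoot, above_leftFoot, above_rightFoot, spliceAbove, h.above_eq,
      h.wire_eq]
    rcases Θ.above u with _ | x <;> rcases last p (Θ.wire u) with _ | z <;> rfl

/-- The half-edge of a given kind at a foot. -/
def kindDart {w : List (Bridge n)} (k : Kind) (v : Foot w) : BridgeDart w :=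
  match k with
  | .up => .up v
  | .down => .down v
  | .cross => .cross v

theorem Tangle.Describes.untouched {T : Fin n → Prop} (h : Θ.Describes q)
    (hT : ∀ a, T a ↔ Θ.first a ≠ none) (a : Fin n) :
    ((∀ v, BridgePolytope.wire p v ≠ a) ∧ (∀ v, BridgePolytope.wire r v ≠ a) ∧ ¬ T a) ↔
      ¬ ∃ v, BridgePolytope.wire (p ++ q ++ r) v = a := by
  rw [← first_eq_none, ← first_eq_none, hT, not_not]
  have h1 : (¬ ∃ v, BridgePolytope.wire (p ++ q ++ r) v = a) ↔
      BridgePolytope.first (p ++ q ++ r) a = none := by rw [first_eq_none, not_exists]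
  rw [h1, first_append, first_append, h.first_eq]
  rcases BridgePolytope.first p a with _ | x <;> rcases Θ.first a with _ | y <;>
    rcases BridgePolytope.first r a with _ | z <;> simp

/-- The half-edge with a given name. -/
def SpliceDart.toDart {T : Fin n → Prop} (h : Θ.Describes q) (hT : ∀ a, T a ↔ Θ.first a ≠ none) :
    SpliceDart (Foot p ⊕ Foot r) m (Untouched p r T) → BridgeDart (p ++ q ++ r)
  | .outer k v => kindDart k (SpliceFoot.toFoot h.length_eq (.inl v))
  | .inner k u => kindDart k (SpliceFoot.toFoot h.length_eq (.inr u))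
  | .stub a => .stub ⟨a, (h.untouched hT a).1 a.2⟩
  | .leaf a => .leaf ⟨a, (h.untouched hT a).1 a.2⟩

variable {T : Fin n → Prop} (h : Θ.Describes q) (hT : ∀ a, T a ↔ Θ.first a ≠ none)

theorem toDart_dart (k : Kind) (v : SpliceFoot p r m) :
    SpliceDart.toDart h hT (SpliceFoot.dart k v) = kindDart k (v.toFoot h.length_eq) := by
  rcases v with v | u <;> rfl

theorem SpliceDart.toDart_bijective :
    Function.Bijective (SpliceDart.toDart (p := p) (r := r) h hT) := by
  have key : ∀ (k k' : Kind) (v v' : SpliceFoot p r m),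
      kindDart k (v.toFoot h.length_eq) = kindDart k' (v'.toFoot h.length_eq) → k = k' ∧ v = v' := by
    intro k k' v v' hv
    have : k = k' ∧ v.toFoot h.length_eq = v'.toFoot h.length_eq := by
      cases k <;> cases k' <;> simp_all [kindDart]
    exact ⟨this.1, SpliceFoot.toFoot_injective _ this.2⟩
  constructor
  · rintro (⟨k, v⟩ | ⟨k, u⟩ | a | a) (⟨k', v'⟩ | ⟨k', u'⟩ | a' | a') hx
    · obtain ⟨rfl, h2⟩ := key _ _ _ _ hx
      rw [Sum.inl.inj h2]
    · cases (key _ _ _ _ hx).2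
    · cases k <;> cases hx
    · cases k <;> cases hx
    · cases (key _ _ _ _ hx).2
    · obtain ⟨rfl, h2⟩ := key _ _ _ _ hx
      rw [Sum.inr.inj h2]
    · cases k <;> cases hx
    · cases k <;> cases hx
    · cases k' <;> cases hx
    · cases k' <;> cases hx
    · have := congrArg Subtype.val (BridgeDart.stub.inj hx)
      exact congrArg SpliceDart.stub (Subtype.ext this)
    · cases hx
    · cases k' <;> cases hx
    · cases k' <;> cases hx
    · cases hx
    · have := congrArg Subtype.val (BridgeDart.leaf.inj hx)
      exact congrArg SpliceDart.leaf (Subtype.ext this)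
  · have hk : ∀ (k : Kind) (v : Foot (p ++ q ++ r)), ∃ x, SpliceDart.toDart h hT x = kindDart k v := by
      intro k v
      obtain ⟨v, rfl⟩ := SpliceFoot.toFoot_surjective h.length_eq v
      exact ⟨_, toDart_dart h hT k v⟩
    rintro (v | v | v | a | a)
    · exact hk .up v
    · exact hk .down v
    · exact hk .cross v
    · exact ⟨.stub ⟨a, (h.untouched hT a).2 a.2⟩, rfl⟩
    · exact ⟨.leaf ⟨a, (h.untouched hT a).2 a.2⟩, rfl⟩

theorem toFoot_snd (v : SpliceFoot p r m) : (v.toFoot h.length_eq).2 = v.side := by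
  rcases v with (v | v) | u <;> rfl

theorem toFoot_opp (v : SpliceFoot p r m) : v.opp.toFoot h.length_eq =
    ((v.toFoot h.length_eq).1, !(v.toFoot h.length_eq).2) := by
  rcases v with (v | v) | u <;> rfl

theorem toDart_footRot (k : Kind) (v : SpliceFoot p r m) :
    SpliceDart.toDart h hT (footRot p r Θ k v) = (kindDart k (v.toFoot h.length_eq)).cw := by
  have hs := toFoot_snd h v
  have hb := below_toFoot h v
  have ha := above_toFoot h v
  cases k
  · simp only [footRot, kindDart, BridgeDart.cw, hs]
    cases v.side
    · simp only [cond_false, toDart_dart, kindDart]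
    · rcases e : spliceBelow p r Θ v with _ | x <;> rw [e] at hb <;>
        simp only [cond_true, toDart_dart, kindDart, BridgeDart.downFrom, hb, Option.map_none,
          Option.map_some]
  · rcases e : spliceAbove p r Θ v with _ | x
    · rw [e] at ha
      simp only [footRot, kindDart, BridgeDart.cw, ha, e, toDart_dart, Option.map_none]
    · rw [e] at ha
      have hs' := toFoot_snd h x
      simp only [footRot, kindDart, BridgeDart.cw, ha, e, Option.map_some, hs']
      cases x.side <;> simp only [cond_true, cond_false, toDart_dart, kindDart]
  · simp only [footRot, kindDart, BridgeDart.cw, hs]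
    cases v.side
    · rcases e : spliceBelow p r Θ v with _ | x <;> rw [e] at hb <;>
        simp only [cond_false, toDart_dart, kindDart, BridgeDart.downFrom, hb, Option.map_none,
          Option.map_some]
    · simp only [cond_true, toDart_dart, kindDart]

theorem toDart_footEdge (k : Kind) (v : SpliceFoot p r m) :
    SpliceDart.toDart h hT (footEdge p r k v) = (kindDart k (v.toFoot h.length_eq)).opp := by
  cases k
  · exact toDart_dart h hT _ _
  · exact toDart_dart h hT _ _
  · simp only [footEdge, toDart_dart, kindDart, BridgeDart.opp, toFoot_opp h]

theorem dartColor_kindDart (k : Kind) (v : SpliceFoot p r m) :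
    dartColor (p ++ q ++ r) J (kindDart k (v.toFoot h.length_eq)) = footColor p r Θ k v := by
  have hs := toFoot_snd h v
  cases k
  · simp only [kindDart, dartColor, footColor, hs]
  · simp only [kindDart, dartColor, footColor, above_toFoot h]
    rcases spliceAbove p r Θ v with _ | x
    · rfl
    · simp only [Option.map_some, toFoot_snd h]
  · simp only [kindDart, dartColor, footColor, hs]

/-- The color of the boundary leaf of a wire without bridges. -/
def leafColor (J : Finset (Fin n)) (a : Untouched p r T) : Color :=
  if (a : Fin n) ∈ J then .white else .black

/-- The bridge graph of `p ++ q ++ r` in terms of names. -/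
noncomputable def splicePresentation (J : Finset (Fin n)) :
    (bridgeGraph J (p ++ q ++ r)).Presentation
      (SpliceDart (Foot p ⊕ Foot r) m (Untouched p r T)) where
  toDart := Equiv.ofBijective _ (SpliceDart.toDart_bijective h hT)
  edge := spliceEdge p r
  rot := spliceRot p r Θ
  color := spliceColor p r Θ (leafColor J)
  toDart_edge := by
    rintro (⟨k, v⟩ | ⟨k, u⟩ | a | a)
    · exact toDart_footEdge h hT k _
    · exact toDart_footEdge h hT k _
    · rfl
    · rfl
  toDart_rot := by
    rintro (⟨k, v⟩ | ⟨k, u⟩ | a | a)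
    · exact toDart_footRot h hT k _
    · exact toDart_footRot h hT k _
    · rfl
    · rfl
  color_toDart := by
    rintro (⟨k, v⟩ | ⟨k, u⟩ | a | a)
    · exact dartColor_kindDart h k _
    · exact dartColor_kindDart h k _
    · rfl
    · rfl

/-- The boundary half-edges in terms of names. -/
theorem bdry_splice (J : Finset (Fin n)) (a : Fin n) :
    (∃ v, (bridgeGraph J (p ++ q ++ r)).bdry a =
        (splicePresentation h hT J).toDart (.outer .down v) ∧
      ((∃ v', v = .inl v' ∧ first p a = some v') ∨
        (first p a = none ∧ Θ.first a = none ∧ ∃ v', v = .inr v' ∧ first r a = some v'))) ∨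
    (∃ u, (bridgeGraph J (p ++ q ++ r)).bdry a =
        (splicePresentation h hT J).toDart (.inner .down u) ∧
      first p a = none ∧ Θ.first a = some u) ∨
    (∃ hs, (bridgeGraph J (p ++ q ++ r)).bdry a =
        (splicePresentation h hT J).toDart (.stub ⟨a, hs⟩)) := by
  have hw : first (p ++ q ++ r) a = ((((first p a).map (leftFoot q)).or (((Θ.first a).map
      (castFoot h.length_eq)).map (rightFoot p))).map (leftFoot r)).or
      ((first r a).map (rightFoot (p ++ q))) := by
    rw [first_append, first_append, h.first_eq]
  rcases h1 : first p a with _ | v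
  · rcases h2 : Θ.first a with _ | u
    · rcases h3 : first r a with _ | v
      · rw [h1, h2, h3] at hw
        refine .inr (.inr ⟨⟨first_eq_none.1 h1, first_eq_none.1 h3, fun h' => (hT a).1 h' h2⟩, ?_⟩)
        exact boundaryDart_of_untouched ⟨a, by
          rw [not_exists]; exact first_eq_none.1 hw⟩
      · rw [h1, h2, h3] at hw
        exact .inl ⟨.inr v, boundaryDart_of_first hw, .inr ⟨rfl, rfl, v, rfl, rfl⟩⟩
    · rw [h1, h2] at hw
      exact .inr (.inl ⟨u, boundaryDart_of_first hw, rfl, rfl⟩)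
  · rw [h1] at hw
    exact .inl ⟨.inl v, boundaryDart_of_first hw, .inl ⟨v, rfl, rfl⟩⟩

/-- A renaming of the half-edges in the middle piece. -/
def renameInner (O S : Type) (π : Kind × Fin m × Bool ≃ Kind × Fin m × Bool) :
    SpliceDart O m S ≃ SpliceDart O m S where
  toFun
    | .outer k v => .outer k v
    | .inner k u => .inner (π (k, u)).1 (π (k, u)).2
    | .stub a => .stub a
    | .leaf a => .leaf a
  invFun
    | .outer k v => .outer k v
    | .inner k u => .inner (π.symm (k, u)).1 (π.symm (k, u)).2
    | .stub a => .stub a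
    | .leaf a => .leaf a
  left_inv := by rintro (⟨k, v⟩ | ⟨k, u⟩ | a | a) <;> simp
  right_inv := by rintro (⟨k, v⟩ | ⟨k, u⟩ | a | a) <;> simp

end Splice

theorem bdry_rename {p q q' r : List (Bridge n)} {m : ℕ} {Θ Θ' : Tangle n m} {T : Fin n → Prop}
    (h : Θ.Describes q) (hT : ∀ a, T a ↔ Θ.first a ≠ none)
    (h' : Θ'.Describes q') (hT' : ∀ a, T a ↔ Θ'.first a ≠ none)
    (π : Kind × Fin m × Bool ≃ Kind × Fin m × Bool)
    (hπ : ∀ a u, Θ.first a = some u → ∃ u', Θ'.first a = some u' ∧ π (.down, u) = (.down, u'))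
    (J : Finset (Fin n)) (a : Fin n) :
    ∃ x, (bridgeGraph J (p ++ q ++ r)).bdry a = (splicePresentation h hT J).toDart x ∧
      (bridgeGraph J (p ++ q' ++ r)).bdry a =
        (splicePresentation h' hT' J).toDart (renameInner _ _ π x) := by
  have hn : Θ.first a = none ↔ Θ'.first a = none := not_iff_not.1 ((hT a).symm.trans (hT' a))
  rcases bdry_splice (p := p) (r := r) h hT J a with
    ⟨v, h1, h2⟩ | ⟨u, h1, h2, h3⟩ | ⟨hs, h1⟩ <;>
  rcases bdry_splice (p := p) (r := r) h' hT' J a with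
    ⟨v', h1', h2'⟩ | ⟨u', h1', h2', h3'⟩ | ⟨hs', h1'⟩
  · refine ⟨_, h1, ?_⟩
    have : v = v' := by
      rcases h2 with ⟨x, rfl, hx⟩ | ⟨hp, hm, x, rfl, hx⟩ <;>
        rcases h2' with ⟨x', rfl, hx'⟩ | ⟨hp', hm', x', rfl, hx'⟩ <;> simp_all
    subst this
    exact h1'
  · rcases h2 with ⟨x, rfl, hx⟩ | ⟨hp, hm, x, rfl, hx⟩ <;> simp_all
  · exfalso
    rcases h2 with ⟨x, rfl, hx⟩ | ⟨hp, hm, x, rfl, hx⟩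
    · rw [first_eq_none.2 hs'.1] at hx
      cases hx
    · rw [first_eq_none.2 hs'.2.1] at hx
      cases hx
  · rcases h2' with ⟨x, rfl, hx⟩ | ⟨hp, hm, x, rfl, hx⟩ <;> simp_all
  · obtain ⟨u'', h4, h5⟩ := hπ a u h3
    rw [h3', Option.some.injEq] at h4
    subst h4
    refine ⟨_, h1, ?_⟩
    rw [h1']
    simp only [renameInner, Equiv.coe_fn_mk, h5]
  · exact absurd ((hT a).2 (by rw [h3]; simp)) hs'.2.2
  · exfalso
    rcases h2' with ⟨x, rfl, hx⟩ | ⟨hp, hm, x, rfl, hx⟩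
    · rw [first_eq_none.2 hs.1] at hx
      cases hx
    · rw [first_eq_none.2 hs.2.1] at hx
      cases hx
  · exact absurd ((hT' a).2 (by rw [h3']; simp)) hs.2.2
  · exact ⟨_, h1, h1'⟩

/-! ### The tangles of two and of three bridges -/

/-- Two bridges in a row. -/
def twoTangle (b₀ b₁ : Bridge n) : Tangle n 2 where
  wire
    | (0, false) => b₀.left
    | (0, true) => b₀.right
    | (1, false) => b₁.left
    | (1, true) => b₁.right
  below
    | (0, s) =>
      if b₁.left = bif s then b₀.right else b₀.left then some (1, false)
      else if b₁.right = bif s then b₀.right else b₀.left then some (1, true) else none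
    | (1, _) => none
  above
    | (0, _) => none
    | (1, s) =>
      if b₀.left = bif s then b₁.right else b₁.left then some (0, false)
      else if b₀.right = bif s then b₁.right else b₁.left then some (0, true) else none
  first a :=
    if b₀.left = a then some (0, false) else if b₀.right = a then some (0, true)
    else if b₁.left = a then some (1, false) else if b₁.right = a then some (1, true) else none
  last a :=
    if b₁.left = a then some (1, false) else if b₁.right = a then some (1, true)
    else if b₀.left = a then some (0, false) else if b₀.right = a then some (0, true) else none

theorem wire_singleton (b : Bridge n) (s : Bool) :
    wire [b] ((0 : Fin 1), s) = bif s then b.right else b.left := rfl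

theorem twoTangle_describes (b₀ b₁ : Bridge n) : (twoTangle b₀ b₁).Describes [b₀, b₁] where
  length_eq := rfl
  wire_eq := by
    rintro ⟨t, s⟩
    fin_cases t <;> cases s <;> rfl
  below_eq := by
    rintro ⟨t, s⟩
    fin_cases t
    · refine (below_leftFoot (p := [b₀]) (q := [b₁]) ((0 : Fin 1), s)).trans ?_
      rw [below_singleton, first_singleton, wire_singleton]
      simp only [twoTangle]
      split_ifs <;> rfl
    · refine (below_rightFoot (p := [b₀]) (q := [b₁]) ((0 : Fin 1), s)).trans ?_
      rw [below_singleton]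
      rfl
  above_eq := by
    rintro ⟨t, s⟩
    fin_cases t
    · refine (above_leftFoot (p := [b₀]) (q := [b₁]) ((0 : Fin 1), s)).trans ?_
      rw [above_singleton]
      rfl
    · refine (above_rightFoot (p := [b₀]) (q := [b₁]) ((0 : Fin 1), s)).trans ?_
      rw [above_singleton, last_singleton, wire_singleton]
      simp only [twoTangle]
      split_ifs <;> rfl
  first_eq a := by
    refine (first_append (p := [b₀]) (q := [b₁]) a).trans ?_
    rw [first_singleton, first_singleton]
    simp only [twoTangle]
    split_ifs <;> rfl
  last_eq a := by
    refine (last_append (p := [b₀]) (q := [b₁]) a).trans ?_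
    rw [last_singleton, last_singleton]
    simp only [twoTangle]
    split_ifs <;> rfl

/-- Three bridges in a row. -/
def threeTangle (b₀ b₁ b₂ : Bridge n) : Tangle n 3 where
  wire
    | (0, false) => b₀.left
    | (0, true) => b₀.right
    | (1, false) => b₁.left
    | (1, true) => b₁.right
    | (2, false) => b₂.left
    | (2, true) => b₂.right
  below
    | (0, s) =>
      if b₁.left = bif s then b₀.right else b₀.left then some (1, false)
      else if b₁.right = bif s then b₀.right else b₀.left then some (1, true)
      else if b₂.left = bif s then b₀.right else b₀.left then some (2, false)
      else if b₂.right = bif s then b₀.right else b₀.left then some (2, true) else none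
    | (1, s) =>
      if b₂.left = bif s then b₁.right else b₁.left then some (2, false)
      else if b₂.right = bif s then b₁.right else b₁.left then some (2, true) else none
    | (2, _) => none
  above
    | (0, _) => none
    | (1, s) =>
      if b₀.left = bif s then b₁.right else b₁.left then some (0, false)
      else if b₀.right = bif s then b₁.right else b₁.left then some (0, true) else none
    | (2, s) =>
      if b₁.left = bif s then b₂.right else b₂.left then some (1, false)
      else if b₁.right = bif s then b₂.right else b₂.left then some (1, true)
      else if b₀.left = bif s then b₂.right else b₂.left then some (0, false)
      else if b₀.right = bif s then b₂.right else b₂.left then some (0, true) else none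
  first a :=
    if b₀.left = a then some (0, false) else if b₀.right = a then some (0, true)
    else if b₁.left = a then some (1, false) else if b₁.right = a then some (1, true)
    else if b₂.left = a then some (2, false) else if b₂.right = a then some (2, true) else none
  last a :=
    if b₂.left = a then some (2, false) else if b₂.right = a then some (2, true)
    else if b₁.left = a then some (1, false) else if b₁.right = a then some (1, true)
    else if b₀.left = a then some (0, false) else if b₀.right = a then some (0, true) else none

theorem wire_pair_fst (b b' : Bridge n) (s : Bool) :
    wire [b, b'] ((0 : Fin 2), s) = bif s then b.right else b.left := rfl

theorem wire_pair_snd (b b' : Bridge n) (s : Bool) :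
    wire [b, b'] ((1 : Fin 2), s) = bif s then b'.right else b'.left := rfl

theorem threeTangle_describes (b₀ b₁ b₂ : Bridge n) :
    (threeTangle b₀ b₁ b₂).Describes [b₀, b₁, b₂] where
  length_eq := rfl
  wire_eq := by
    rintro ⟨t, s⟩
    fin_cases t <;> cases s <;> rfl
  below_eq := by
    rintro ⟨t, s⟩
    fin_cases t
    · refine (below_leftFoot (p := [b₀]) (q := [b₁, b₂]) ((0 : Fin 1), s)).trans ?_
      rw [below_singleton, (twoTangle_describes b₁ b₂).first_eq, wire_singleton]
      simp only [twoTangle, threeTangle]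
      split_ifs <;> rfl
    · refine (below_rightFoot (p := [b₀]) (q := [b₁, b₂]) ((0 : Fin 2), s)).trans ?_
      refine (congrArg _ ((twoTangle_describes b₁ b₂).below_eq (0, s))).trans ?_
      simp only [twoTangle, threeTangle]
      split_ifs <;> rfl
    · refine (below_rightFoot (p := [b₀]) (q := [b₁, b₂]) ((1 : Fin 2), s)).trans ?_
      refine (congrArg _ ((twoTangle_describes b₁ b₂).below_eq (1, s))).trans ?_
      rfl
  above_eq := by
    rintro ⟨t, s⟩
    fin_cases t
    · refine (above_leftFoot (p := [b₀]) (q := [b₁, b₂]) ((0 : Fin 1), s)).trans ?_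
      rw [above_singleton]
      rfl
    · refine (above_rightFoot (p := [b₀]) (q := [b₁, b₂]) ((0 : Fin 2), s)).trans ?_
      refine (congrArg (fun o => (Option.map _ o).or _)
        ((twoTangle_describes b₁ b₂).above_eq (0, s))).trans ?_
      rw [last_singleton, wire_pair_fst]
      simp only [twoTangle, threeTangle]
      split_ifs <;> rfl
    · refine (above_rightFoot (p := [b₀]) (q := [b₁, b₂]) ((1 : Fin 2), s)).trans ?_
      refine (congrArg (fun o => (Option.map _ o).or _)
        ((twoTangle_describes b₁ b₂).above_eq (1, s))).trans ?_
      rw [last_singleton, wire_pair_snd]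
      simp only [twoTangle, threeTangle]
      split_ifs <;> rfl
  first_eq a := by
    refine (first_append (p := [b₀]) (q := [b₁, b₂]) a).trans ?_
    rw [first_singleton, (twoTangle_describes b₁ b₂).first_eq]
    simp only [twoTangle, threeTangle]
    split_ifs <;> rfl
  last_eq a := by
    refine (last_append (p := [b₀]) (q := [b₁, b₂]) a).trans ?_
    rw [last_singleton, (twoTangle_describes b₁ b₂).last_eq]
    simp only [twoTangle, threeTangle]
    split_ifs <;> rfl

end BridgePolytope

namespace BridgePolytope

open Equiv PlabicMap

variable {n : ℕ}

/-! ### Comparing two tangles -/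

theorem rel_imp {α β : Type} {R R' : α → β → Prop} (h : ∀ a b, R a b → R' a b) {o : Option α}
    {o' : Option β} (ho : Option.Rel R o o') : Option.Rel R' o o' := by
  rcases ho with ⟨ho⟩ | _
  · exact .some (h _ _ ho)
  · exact .none

theorem exists_of_rel_some {α β : Type} {R : α → β → Prop} {a : α} {o' : Option β}
    (ho : Option.Rel R (some a) o') : ∃ b, o' = some b ∧ R a b := by
  rcases ho with ⟨ho⟩
  exact ⟨_, rfl, ho⟩

section Compare

variable {p r : List (Bridge n)} {m : ℕ} {S : Type}

/-- The half-edge after the half-edge that enters the foot `u` from below. -/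
def turn {O : Type} (u : Fin m × Bool) : SpliceDart O m S :=
  bif u.2 then .inner .cross u else .inner .up u

/-- If `f` and `g` modify the results of the rotations at inner half-edges only, then it suffices to
compare the modified rotations of two tangles at the ports, where wires enter and leave. -/
theorem rename_rot_outer {Θ Θ' : Tangle n m} (π : Kind × Fin m × Bool ≃ Kind × Fin m × Bool)
    {f g : SpliceDart (Foot p ⊕ Foot r) m S → SpliceDart (Foot p ⊕ Foot r) m S}
    (hf : ∀ k v, f (.outer k v) = .outer k v) (hg : ∀ k v, g (.outer k v) = .outer k v)
    (hfirst : ∀ a, Option.Rel (fun u u' => renameInner _ _ π (f (.inner .down u)) =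
      g (.inner .down u')) (Θ.first a) (Θ'.first a))
    (hlast : ∀ v : Foot r, Option.Rel (fun u u' => renameInner _ _ π (f (turn u)) =
      g (turn u')) (Θ.last (wire r v)) (Θ'.last (wire r v)))
    (k : Kind) (v : Foot p ⊕ Foot r) :
    renameInner _ _ π (f (spliceRot p r Θ (.outer k v))) = g (spliceRot p r Θ' (.outer k v)) := by
  have key : ∀ k v, renameInner _ _ π (f (.outer k v)) = g (.outer k v) := fun k v => by
    rw [hf, hg]
    rfl
  rcases v with v | v
  · have h := hfirst (wire p v)
    have hd : ∀ k', renameInner _ _ π (f (match spliceBelow p r Θ (.inl (.inl v)) with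
        | some v' => SpliceFoot.dart .down v'
        | none => .outer k' (.inl v))) = g (match spliceBelow p r Θ' (.inl (.inl v)) with
        | some v' => SpliceFoot.dart .down v'
        | none => .outer k' (.inl v)) := by
      intro k'
      simp only [spliceBelow]
      rcases below p v with _ | x
      · revert h
        generalize Θ.first (wire p v) = o
        generalize Θ'.first (wire p v) = o'
        intro h
        rcases h with ⟨h⟩ | _
        · exact h
        · rcases first r (wire p v) with _ | y
          · exact key _ _
          · exact key _ _
      · exact key _ _
    cases k
    · simp only [spliceRot, footRot, SpliceFoot.side, SpliceFoot.dart]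
      cases v.2
      · exact key _ _
      · exact hd _
    · simp only [spliceRot, footRot, spliceAbove]
      rcases above p v with _ | x
      · exact key _ _
      · simp only [Option.map_some, SpliceFoot.side, SpliceFoot.dart]
        cases x.2 <;> exact key _ _
    · simp only [spliceRot, footRot, SpliceFoot.side, SpliceFoot.dart]
      cases v.2
      · exact hd _
      · exact key _ _
  · have h := hlast v
    cases k
    · simp only [spliceRot, footRot, spliceBelow, SpliceFoot.side, SpliceFoot.dart]
      cases v.2
      · exact key _ _
      · rcases below r v with _ | x <;> exact key _ _
    · simp only [spliceRot, footRot, spliceAbove]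
      rcases above r v with _ | x
      · revert h
        generalize Θ.last (wire r v) = o
        generalize Θ'.last (wire r v) = o'
        intro h
        rcases h with ⟨h⟩ | _
        · exact h
        · rcases last p (wire r v) with _ | y
          · exact key _ _
          · simp only [Option.map_none, Option.map_some, Option.none_or, SpliceFoot.side,
              SpliceFoot.dart]
            cases y.2 <;> exact key _ _
      · simp only [Option.map_some, Option.some_or, SpliceFoot.side, SpliceFoot.dart]
        cases x.2 <;> exact key _ _
    · simp only [spliceRot, footRot, spliceBelow, SpliceFoot.side, SpliceFoot.dart]
      cases v.2
      · rcases below r v with _ | x <;> exact key _ _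
      · exact key _ _

theorem color_outer {Θ Θ' : Tangle n m} (c : S → Color)
    {k : Kind} {v : Foot p ⊕ Foot r}
    (hlast : ∀ v', k = .down → v = .inr v' → above r v' = none →
      Option.Rel (fun u u' => u.2 = u'.2) (Θ.last (wire r v')) (Θ'.last (wire r v'))) :
    spliceColor p r Θ c (.outer k v) = spliceColor p r Θ' c (.outer k v) := by
  cases k
  · rfl
  · rcases v with v | v
    · rfl
    · have h := hlast v rfl rfl
      simp only [spliceColor, footColor, spliceAbove]
      rcases hv : above r v with _ | x
      · have h := h hv
        revert h
        generalize Θ.last (wire r v) = o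
        generalize Θ'.last (wire r v) = o'
        intro h
        rcases h with ⟨h⟩ | _
        · simp only [Option.map_none, Option.map_some, Option.none_or, Option.some_or,
            SpliceFoot.side, h]
        · rfl
      · rfl
  · rfl

/-- The half-edge through which the wire `a` leaves the middle piece at the bottom, or `d` if the
wire ends there. -/
noncomputable def bottomPort (r : List (Bridge n)) {P : Type} (a : Fin n)
    (d : SpliceDart (P ⊕ Foot r) m S) : SpliceDart (P ⊕ Foot r) m S :=
  match first r a with
  | some x => .outer .down (.inr x)
  | none => d

/-- The half-edge after the half-edge `d` through which the wire `a` leaves the middle piece at the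
top. -/
noncomputable def topPort (p : List (Bridge n)) {R : Type} (a : Fin n)
    (d : SpliceDart (Foot p ⊕ R) m S) : SpliceDart (Foot p ⊕ R) m S :=
  match last p a with
  | some x => bif x.2 then .outer .cross (.inl x) else .outer .up (.inl x)
  | none => d

theorem map_bottomPort {P : Type} {f : SpliceDart (P ⊕ Foot r) m S → SpliceDart (P ⊕ Foot r) m S}
    (hf : ∀ k v, f (.outer k v) = .outer k v) (a : Fin n) (d : SpliceDart (P ⊕ Foot r) m S) :
    f (bottomPort r a d) = bottomPort r a (f d) := by
  unfold bottomPort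
  rcases first r a with _ | x
  · rfl
  · exact hf _ _

theorem map_topPort {R : Type} {f : SpliceDart (Foot p ⊕ R) m S → SpliceDart (Foot p ⊕ R) m S}
    (hf : ∀ k v, f (.outer k v) = .outer k v) (a : Fin n) (d : SpliceDart (Foot p ⊕ R) m S) :
    f (topPort p a d) = topPort p a (f d) := by
  unfold topPort
  rcases last p a with _ | x
  · rfl
  · cases h : x.2
    · simp only [cond_false, hf, h]
    · simp only [cond_true, hf, h]

variable {Θ : Tangle n m}

theorem spliceRot_up (t : Fin m) (s : Bool) :
    (spliceRot p r Θ (.inner .up (t, s)) : SpliceDart (Foot p ⊕ Foot r) m S) =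
      bif s then (match Θ.below (t, s) with
        | some u => .inner .down u
        | none => bottomPort r (Θ.wire (t, s)) (.inner .cross (t, s)))
      else .inner .cross (t, s) := by
  simp only [spliceRot, footRot, SpliceFoot.side, spliceBelow, bottomPort, SpliceFoot.dart]
  cases s
  · rfl
  · rcases Θ.below (t, true) with _ | u
    · rcases first r (Θ.wire (t, true)) with _ | x <;> rfl
    · rfl

theorem spliceRot_cross (t : Fin m) (s : Bool) :
    (spliceRot p r Θ (.inner .cross (t, s)) : SpliceDart (Foot p ⊕ Foot r) m S) =
      bif s then .inner .up (t, s) else (match Θ.below (t, s) with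
        | some u => .inner .down u
        | none => bottomPort r (Θ.wire (t, s)) (.inner .up (t, s))) := by
  simp only [spliceRot, footRot, SpliceFoot.side, spliceBelow, bottomPort, SpliceFoot.dart]
  cases s
  · rcases Θ.below (t, false) with _ | u
    · rcases first r (Θ.wire (t, false)) with _ | x <;> rfl
    · rfl
  · rfl

theorem spliceRot_down (u : Fin m × Bool) :
    (spliceRot p r Θ (.inner .down u) : SpliceDart (Foot p ⊕ Foot r) m S) =
      match Θ.above u with
      | some u' => turn u'
      | none => topPort p (Θ.wire u) (.inner .down u) := by
  simp only [spliceRot, footRot, spliceAbove, topPort, SpliceFoot.dart]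
  rcases Θ.above u with _ | u'
  · rcases last p (Θ.wire u) with _ | x
    · rfl
    · simp only [Option.map_none, Option.map_some, Option.none_or, SpliceFoot.side]
  · simp only [Option.map_some, Option.some_or, SpliceFoot.side, turn]

/-- The color above the middle piece on the wire `a`. -/
noncomputable def topColor (p : List (Bridge n)) (a : Fin n) : Option Color :=
  (last p a).map fun x => bif x.2 then .black else .white

theorem spliceColor_down (c : S → Color) (u : Fin m × Bool) :
    spliceColor p r Θ c (.inner .down u) =
      match Θ.above u with
      | some u' => some (bif u'.2 then .black else .white)
      | none => topColor p (Θ.wire u) := by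
  simp only [spliceColor, footColor, spliceAbove, topColor]
  rcases Θ.above u with _ | u'
  · rcases last p (Θ.wire u) with _ | x <;> rfl
  · rfl

theorem spliceColor_up (c : S → Color) (u : Fin m × Bool) :
    spliceColor p r Θ c (.inner .up u) = some (bif u.2 then .black else .white) := rfl

theorem spliceColor_cross (c : S → Color) (u : Fin m × Bool) :
    spliceColor p r Θ c (.inner .cross u) = some (bif u.2 then .black else .white) := rfl

theorem renameInner_inner {O : Type} (π : Kind × Fin m × Bool ≃ Kind × Fin m × Bool) (k : Kind)
    (u : Fin m × Bool) :
    renameInner O S π (.inner k u) = .inner (π (k, u)).1 (π (k, u)).2 := rfl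

theorem renameInner_topPort {R : Type} (π : Kind × Fin m × Bool ≃ Kind × Fin m × Bool) (a : Fin n)
    (d : SpliceDart (Foot p ⊕ R) m S) :
    renameInner _ _ π (topPort p a d) = topPort p a (renameInner _ _ π d) :=
  map_topPort (fun _ _ => rfl) a d

theorem renameInner_bottomPort {P : Type} (π : Kind × Fin m × Bool ≃ Kind × Fin m × Bool)
    (a : Fin n) (d : SpliceDart (P ⊕ Foot r) m S) :
    renameInner _ _ π (bottomPort r a d) = bottomPort r a (renameInner _ _ π d) :=
  map_bottomPort (f := renameInner _ _ π) (fun _ _ => rfl) a d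

end Compare

/-! ### Exchanging disjoint bridges -/

/-- Exchanging the two rows of feet. -/
def swapRows : Kind × Fin 2 × Bool ≃ Kind × Fin 2 × Bool where
  toFun x := (x.1, Fin.rev x.2.1, x.2.2)
  invFun x := (x.1, Fin.rev x.2.1, x.2.2)
  left_inv x := by simp
  right_inv x := by simp

/-- Two consecutive bridges without a common wire commute up to homotopy. -/
theorem homotopic_of_disjoint (J : Finset (Fin n)) (p r : List (Bridge n)) {b b' : Bridge n}
    (h1 : b.left ≠ b'.left) (h2 : b.left ≠ b'.right) (h3 : b.right ≠ b'.left)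
    (h4 : b.right ≠ b'.right) :
    Homotopic (bridgeGraph J (p ++ [b, b'] ++ r)) (bridgeGraph J (p ++ [b', b] ++ r)) := by
  have hb := b.lt.ne
  have hb' := b'.lt.ne
  obtain ⟨T, hT⟩ : ∃ T : Fin n → Prop, ∀ a, T a ↔ (twoTangle b b').first a ≠ none :=
    ⟨_, fun _ => Iff.rfl⟩
  have hT' : ∀ a, T a ↔ (twoTangle b' b).first a ≠ none := by
    intro a
    rw [hT]
    simp only [twoTangle]
    split_ifs <;> simp_all
  have hfirst : ∀ a, Option.Rel (fun u u' => swapRows (.down, u) = (.down, u'))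
      ((twoTangle b b').first a) ((twoTangle b' b).first a) := by
    intro a
    simp only [twoTangle]
    split_ifs <;> first | exact .none | (exact .some rfl) | (exfalso; simp_all)
  have hlast : ∀ a, Option.Rel (fun u u' => swapRows (.down, u) = (.down, u'))
      ((twoTangle b b').last a) ((twoTangle b' b).last a) := by
    intro a
    simp only [twoTangle]
    split_ifs <;> first | exact .none | (exact .some rfl) | (exfalso; simp_all)
  have hturn : ∀ u u' : Fin 2 × Bool, swapRows (.down, u) = (.down, u') →
      renameInner (Foot p ⊕ Foot r) (Untouched p r T)
        swapRows (turn u) = turn u' := by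
    rintro ⟨t, s⟩ ⟨t', s'⟩ h
    cases h
    cases s <;> rfl
  refine Presentation.homotopic (splicePresentation (twoTangle_describes b b') hT J)
    (splicePresentation (twoTangle_describes b' b) hT' J) (renameInner _ _ swapRows) ?_ ?_
    (bdry_rename _ _ _ _ _ (fun a u hu => ?_) J) ?_
  · rintro (⟨k, v | v⟩ | ⟨k, t, s⟩ | a | a)
    · cases k <;> rfl
    · cases k <;> rfl
    · cases k <;> rfl
    · rfl
    · rfl
  · rintro (⟨k, v⟩ | ⟨k, t, s⟩ | a | a)
    · refine rename_rot_outer (f := id) (g := id) swapRows (fun _ _ => rfl) (fun _ _ => rfl)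
        (fun a => ?_) (fun v => ?_) k v
      · exact rel_imp (fun u u' h => by simp [renameInner, h]) (hfirst a)
      · exact rel_imp hturn (hlast (wire r v))
    · change renameInner _ _ swapRows (spliceRot p r _ (.inner k (t, s))) =
        spliceRot p r _ (.inner k (Fin.rev t, s))
      fin_cases t <;> cases s <;> cases k <;>
        simp [spliceRot_up, spliceRot_down, spliceRot_cross, twoTangle, renameInner_topPort,
          renameInner_bottomPort, renameInner_inner, swapRows,
          h1, h2, h3, h4, h1.symm, h2.symm, h3.symm, h4.symm]
    · rfl
    · rfl
  · exact exists_of_rel_some (hu ▸ hfirst a)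
  · rintro (⟨k, v⟩ | ⟨k, t, s⟩ | a | a)
    · have hl : ∀ v : Foot r, Option.Rel (fun u u' => u.2 = u'.2)
          ((twoTangle b b').last (wire r v)) ((twoTangle b' b).last (wire r v)) :=
        fun v => rel_imp (fun u u' h => congrArg (fun x => x.2.2) h) (hlast (wire r v))
      exact (color_outer (leafColor (p := p) (r := r) (T := T) J) fun v _ _ _ => hl v).symm
    · fin_cases t <;> cases s <;> cases k <;>
        simp [spliceColor_up, spliceColor_down, spliceColor_cross, twoTangle, splicePresentation,
          renameInner_inner, swapRows, h1, h2, h3, h4, h1.symm, h2.symm, h3.symm, h4.symm]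
    · rfl
    · rfl

end BridgePolytope

namespace BridgePolytope

open Equiv PlabicMap

variable {n : ℕ}

/-! ### Trapezoids -/

open Classical in
/-- The correction to the rotation that is made when the edge with halves `d` and `e` is
contracted; `d'` and `e'` are the half-edges that follow `d` and `e`. -/
noncomputable def joinStep {X : Type} (d e d' e' y : X) : X :=
  if y = d then e' else if y = e then d' else y

theorem contractRot_eq {X : Type} (rot : X → X) (d e x : X) :
    contractRot rot d e x = joinStep d e (rot d) (rot e) (rot x) := rfl

section JoinStep

variable {p r : List (Bridge n)} {m : ℕ} {S : Type} {k k' : Kind} {u u' : Fin m × Bool}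

theorem joinStep_outer {O : Type} {d' e' : SpliceDart O m S} (k₀ : Kind) (v : O) :
    joinStep (.inner k u) (.inner k' u') d' e' (.outer k₀ v) = .outer k₀ v := by
  simp [joinStep]

theorem joinStep_topPort {R : Type} {d' e' : SpliceDart (Foot p ⊕ R) m S} (a : Fin n)
    (x : SpliceDart (Foot p ⊕ R) m S) :
    joinStep (.inner k u) (.inner k' u') d' e' (topPort p a x) =
      topPort p a (joinStep (.inner k u) (.inner k' u') d' e' x) :=
  map_topPort (fun _ _ => joinStep_outer _ _) a x

theorem joinStep_bottomPort {P : Type} {d' e' : SpliceDart (P ⊕ Foot r) m S} (a : Fin n)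
    (x : SpliceDart (P ⊕ Foot r) m S) :
    joinStep (.inner k u) (.inner k' u') d' e' (bottomPort r a x) =
      bottomPort r a (joinStep (.inner k u) (.inner k' u') d' e' x) :=
  map_bottomPort (f := joinStep _ _ _ _) (fun _ _ => joinStep_outer _ _) a x

end JoinStep

/-- The renaming of half-edges from the bridges `(i j), (j k)` to the bridges `(j k), (i k)`. -/
def forkRightRename : Kind × Fin 2 × Bool ≃ Kind × Fin 2 × Bool where
  toFun
    | (.up, 0, false) => (.up, 1, false)
    | (.down, 0, false) => (.down, 1, false)
    | (.cross, 0, false) => (.cross, 1, false)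
    | (.up, 0, true) => (.cross, 0, true)
    | (.down, 0, true) => (.down, 0, false)
    | (.cross, 0, true) => (.cross, 1, true)
    | (.up, 1, false) => (.up, 0, false)
    | (.down, 1, false) => (.down, 1, true)
    | (.cross, 1, false) => (.cross, 0, false)
    | (.up, 1, true) => (.up, 0, true)
    | (.down, 1, true) => (.down, 0, true)
    | (.cross, 1, true) => (.up, 1, true)
  invFun
    | (.up, 1, false) => (.up, 0, false)
    | (.down, 1, false) => (.down, 0, false)
    | (.cross, 1, false) => (.cross, 0, false)
    | (.cross, 0, true) => (.up, 0, true)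
    | (.down, 0, false) => (.down, 0, true)
    | (.cross, 1, true) => (.cross, 0, true)
    | (.up, 0, false) => (.up, 1, false)
    | (.down, 1, true) => (.down, 1, false)
    | (.cross, 0, false) => (.cross, 1, false)
    | (.up, 0, true) => (.up, 1, true)
    | (.down, 0, true) => (.down, 1, true)
    | (.up, 1, true) => (.cross, 1, true)
  left_inv := by
    rintro ⟨k, t, s⟩
    fin_cases t <;> cases s <;> cases k <;> rfl
  right_inv := by
    rintro ⟨k, t, s⟩
    fin_cases t <;> cases s <;> cases k <;> rfl

/-- Clockwise rotation at the bridges `(i j), (j k)`, if no bridge below touches the wire `j`. -/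
noncomputable def rotCascade (p r : List (Bridge n)) (S : Type) (i j k : Fin n) :
    Kind → Fin 2 × Bool → SpliceDart (Foot p ⊕ Foot r) 2 S
  | .up, (0, false) => .inner .cross (0, false)
  | .up, (0, true) => .inner .down (1, false)
  | .up, (1, false) => .inner .cross (1, false)
  | .up, (1, true) => bottomPort r k (.inner .cross (1, true))
  | .cross, (0, false) => bottomPort r i (.inner .up (0, false))
  | .cross, (0, true) => .inner .up (0, true)
  | .cross, (1, false) => .inner .up (1, false)
  | .cross, (1, true) => .inner .up (1, true)
  | .down, (0, false) => topPort p i (.inner .down (0, false))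
  | .down, (0, true) => topPort p j (.inner .down (0, true))
  | .down, (1, false) => .inner .cross (0, true)
  | .down, (1, true) => topPort p k (.inner .down (1, true))

theorem spliceRot_cascade {p r : List (Bridge n)} {S : Type} {i j k : Fin n} (hij : i < j)
    (hjk : j < k) (hj : first r j = none) (d : Kind) (u : Fin 2 × Bool) :
    spliceRot p r (twoTangle ⟨i, j, hij⟩ ⟨j, k, hjk⟩) (.inner d u) = rotCascade p r S i j k d u := by
  have hport : ∀ x : SpliceDart (Foot p ⊕ Foot r) 2 S, bottomPort r j x = x :=
    fun x => by rw [bottomPort, hj]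
  obtain ⟨t, s⟩ := u
  fin_cases t <;> cases s <;> cases d <;>
    simp [spliceRot_up, spliceRot_down, spliceRot_cross, twoTangle, turn, hport, rotCascade,
      hij.ne, hij.ne', hjk.ne, (hij.trans hjk).ne, (hij.trans hjk).ne']

/-- Clockwise rotation at the bridges `(j k), (i k)`, if no bridge below touches the wire `j`. -/
noncomputable def rotForkRight (p r : List (Bridge n)) (S : Type) (i j k : Fin n) :
    Kind → Fin 2 × Bool → SpliceDart (Foot p ⊕ Foot r) 2 S
  | .up, (0, false) => .inner .cross (0, false)
  | .up, (0, true) => .inner .down (1, true)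
  | .up, (1, false) => .inner .cross (1, false)
  | .up, (1, true) => bottomPort r k (.inner .cross (1, true))
  | .cross, (0, false) => .inner .up (0, false)
  | .cross, (0, true) => .inner .up (0, true)
  | .cross, (1, false) => bottomPort r i (.inner .up (1, false))
  | .cross, (1, true) => .inner .up (1, true)
  | .down, (0, false) => topPort p j (.inner .down (0, false))
  | .down, (0, true) => topPort p k (.inner .down (0, true))
  | .down, (1, false) => topPort p i (.inner .down (1, false))
  | .down, (1, true) => .inner .cross (0, true)

theorem spliceRot_forkRight {p r : List (Bridge n)} {S : Type} {i j k : Fin n} (hij : i < j)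
    (hjk : j < k) (hj : first r j = none) (d : Kind) (u : Fin 2 × Bool) :
    spliceRot p r (twoTangle ⟨j, k, hjk⟩ ⟨i, k, hij.trans hjk⟩) (.inner d u) =
      rotForkRight p r S i j k d u := by
  have hport : ∀ x : SpliceDart (Foot p ⊕ Foot r) 2 S, bottomPort r j x = x :=
    fun x => by rw [bottomPort, hj]
  obtain ⟨t, s⟩ := u
  fin_cases t <;> cases s <;> cases d <;>
    simp [spliceRot_up, spliceRot_down, spliceRot_cross, twoTangle, turn, hport, rotForkRight,
      hij.ne, hij.ne', hjk.ne, hjk.ne', (hij.trans hjk).ne, (hij.trans hjk).ne']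

/-- Where the wire `j` ends, the lower foot on it has degree two. After its removal, the two black
feet of the bridges are adjacent, and contracting the edge between them gives the same graph for
both sequences of bridges. -/
theorem equivM2M3_cascade_forkRight (J : Finset (Fin n)) (p r : List (Bridge n)) {i j k : Fin n}
    (hij : i < j) (hjk : j < k) (hj : ∀ v, wire r v ≠ j) :
    EquivM2M3 (bridgeGraph J (p ++ [⟨i, j, hij⟩, ⟨j, k, hjk⟩] ++ r))
      (bridgeGraph J (p ++ [⟨j, k, hjk⟩, ⟨i, k, hij.trans hjk⟩] ++ r)) := by
  have e1 := hij.ne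
  have e2 := hij.ne'
  have e3 := hjk.ne
  have e4 := hjk.ne'
  have e5 := (hij.trans hjk).ne
  have e6 := (hij.trans hjk).ne'
  have hrj : first r j = none := first_eq_none.2 hj
  obtain ⟨ΘA, hA⟩ : ∃ Θ : Tangle n 2, Θ = twoTangle ⟨i, j, hij⟩ ⟨j, k, hjk⟩ := ⟨_, rfl⟩
  obtain ⟨ΘB, hB⟩ : ∃ Θ : Tangle n 2, Θ = twoTangle ⟨j, k, hjk⟩ ⟨i, k, hij.trans hjk⟩ := ⟨_, rfl⟩
  have hdA : ΘA.Describes [⟨i, j, hij⟩, ⟨j, k, hjk⟩] := hA ▸ twoTangle_describes _ _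
  have hdB : ΘB.Describes [⟨j, k, hjk⟩, ⟨i, k, hij.trans hjk⟩] := hB ▸ twoTangle_describes _ _
  obtain ⟨T, hT⟩ : ∃ T : Fin n → Prop, ∀ a, T a ↔ ΘA.first a ≠ none := ⟨_, fun _ => Iff.rfl⟩
  have hT' : ∀ a, T a ↔ ΘB.first a ≠ none := by
    intro a
    rw [hT, hA, hB]
    simp only [twoTangle]
    split_ifs <;> simp_all
  have rA : ∀ d u, spliceRot p r ΘA (.inner d u) = rotCascade p r (Untouched p r T) i j k d u :=
    fun d u => by rw [hA, spliceRot_cascade hij hjk hrj]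
  have rB : ∀ d u, spliceRot p r ΘB (.inner d u) = rotForkRight p r (Untouched p r T) i j k d u :=
    fun d u => by rw [hB, spliceRot_forkRight hij hjk hrj]
  have hfirst : ∀ a, Option.Rel (fun u u' => forkRightRename (.down, u) = (.down, u') ∧
      u ≠ (1, false)) (ΘA.first a) (ΘB.first a) := by
    intro a
    simp only [hA, hB, twoTangle]
    split_ifs <;> first
      | exact .none
      | exact .some ⟨rfl, by decide⟩
      | (exfalso; simp_all)
  have hlast : ∀ v, (ΘA.last (wire r v) = some (0, false) ∧ ΘB.last (wire r v) = some (1, false)) ∨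
      (ΘA.last (wire r v) = some (1, true) ∧ ΘB.last (wire r v) = some (1, true)) ∨
      (ΘA.last (wire r v) = none ∧ ΘB.last (wire r v) = none) := by
    intro v
    have := hj v
    simp only [hA, hB, twoTangle]
    split_ifs <;> simp_all
  have cA : ∀ u, spliceColor p r ΘA (leafColor J)
      (.inner .down u : SpliceDart _ _ (Untouched p r T)) =
      if u = (1, false) then some .black else topColor p (ΘA.wire u) := by
    rintro ⟨t, s⟩
    rw [spliceColor_down, hA]
    fin_cases t <;> cases s <;> simp [twoTangle, e1, e3, e5]
  have cB : ∀ u, spliceColor p r ΘB (leafColor J)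
      (.inner .down u : SpliceDart _ _ (Untouched p r T)) =
      if u = (1, true) then some .black else topColor p (ΘB.wire u) := by
    rintro ⟨t, s⟩
    rw [spliceColor_down, hB]
    fin_cases t <;> cases s <;> simp [twoTangle, e2, e3, e6]
  -- the foot `(1, false)`, the last one on the wire `j`, has degree two; its removal turns `c` and
  -- `c₂` into the halves of the edge between the black feet of the two bridges
  refine Presentation.equivM2M3_of_removeMiddle_contract (splicePresentation hdA hT J)
    (splicePresentation hdB hT' J) (renameInner _ _ forkRightRename)
    (m := .inner .up (1, false)) (m₂ := .inner .cross (1, false))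
    (c := .inner .down (1, false)) (c₂ := .inner .cross (1, true))
    ?_ ?_ ?_ ?_ ?_ ?_ ?_ ?_ ?_
    (bdry_rename _ _ _ _ _ (fun a u hu => ?_) J) ?_
  · simp [Presentation.Middle, splicePresentation, rA, rotCascade, spliceColor_up]
  · simp [Presentation.Middle, splicePresentation, rB, rotForkRight, spliceColor_up,
      renameInner_inner, forkRightRename]
  · simp
  · simp [glueEdge, splicePresentation, spliceEdge, footEdge, SpliceFoot.dart, SpliceFoot.opp]
  · simp [glueEdge, splicePresentation, spliceEdge, footEdge, SpliceFoot.dart,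
      renameInner_inner, forkRightRename]
  · simp [Presentation.Joinable, splicePresentation, rA, rotCascade, cA, spliceColor_cross]
  · simp [Presentation.Joinable, splicePresentation, rB, rotForkRight, cB, spliceColor_up,
      renameInner_inner, forkRightRename]
  · rintro (⟨d, v | v⟩ | ⟨d, t, s⟩ | a | a) h1 h2 h3 h4
    · cases d <;> simp [glueEdge, splicePresentation, spliceEdge, footEdge, SpliceFoot.dart,
        SpliceFoot.opp, renameInner]
    · cases d <;> simp [glueEdge, splicePresentation, spliceEdge, footEdge, SpliceFoot.dart,
        SpliceFoot.opp, renameInner]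
    · revert h1 h2 h3 h4
      fin_cases t <;> cases s <;> cases d <;>
        simp [glueEdge, splicePresentation, spliceEdge, footEdge, SpliceFoot.dart,
          SpliceFoot.opp, renameInner_inner, forkRightRename]
    · simp [glueEdge, splicePresentation, spliceEdge, renameInner]
    · simp [glueEdge, splicePresentation, spliceEdge, renameInner]
  · rintro (⟨d, v⟩ | ⟨d, t, s⟩ | a | a) h1 h2 h3 h4
    · refine rename_rot_outer (f := joinStep _ _ _ _) (g := joinStep _ _ _ _) forkRightRename
        (fun _ _ => joinStep_outer _ _) (fun _ _ => joinStep_outer _ _) (fun a => ?_) (fun v => ?_)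
        d v
      · refine rel_imp (fun u u' h => ?_) (hfirst a)
        obtain ⟨t, s⟩ := u
        obtain ⟨hx, hy⟩ := h
        fin_cases t <;> cases s <;> cases hx <;> first
          | exact absurd rfl hy
          | simp [joinStep, renameInner_inner, forkRightRename]
      · simp only [splicePresentation]
        rcases hlast v with ⟨h, h'⟩ | ⟨h, h'⟩ | ⟨h, h'⟩ <;> rw [h, h'] <;> constructor <;>
          simp [turn, joinStep, renameInner_inner, forkRightRename, rA, rotCascade]
    · change renameInner _ _ forkRightRename (contractRot (spliceRot p r ΘA) _ _ _) =
        contractRot (spliceRot p r ΘB) _ _ _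
      revert h1 h2 h3 h4
      simp only [contractRot_eq, renameInner_inner, rA, rB]
      fin_cases t <;> cases s <;> cases d <;>
        simp [rotCascade, rotForkRight, forkRightRename, renameInner_topPort,
          renameInner_bottomPort, joinStep_topPort, joinStep_bottomPort] <;>
        simp [joinStep, renameInner_inner]
    · simp [contractRot_eq, joinStep, splicePresentation, spliceRot, renameInner]
    · simp [contractRot_eq, joinStep, splicePresentation, spliceRot, renameInner]
  · obtain ⟨u', h, h', -⟩ := exists_of_rel_some (hu ▸ hfirst a)
    exact ⟨u', h, h'⟩
  · rintro (⟨d, v⟩ | ⟨d, t, s⟩ | a | a) h1 h2 h3 h4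
    · have hl : ∀ v : Foot r, Option.Rel (fun u u' => u.2 = u'.2)
          (ΘA.last (wire r v)) (ΘB.last (wire r v)) := by
        intro v
        rcases hlast v with ⟨h, h'⟩ | ⟨h, h'⟩ | ⟨h, h'⟩ <;> rw [h, h'] <;> constructor <;> rfl
      exact (color_outer (leafColor (p := p) (r := r) (T := T) J) fun v _ _ _ => hl v).symm
    · revert h1 h2 h3 h4
      fin_cases t <;> cases s <;> cases d <;>
        simp [splicePresentation, renameInner_inner, forkRightRename, spliceColor_up,
          spliceColor_cross, cA, cB] <;> simp [hA, hB, twoTangle]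
    · rfl
    · rfl

/-- The renaming of half-edges from the bridges `(j k), (i j)` to the bridges `(i j), (i k)`. -/
def forkLeftRename : Kind × Fin 2 × Bool ≃ Kind × Fin 2 × Bool where
  toFun
    | (.up, 0, true) => (.up, 1, true)
    | (.down, 0, true) => (.down, 1, true)
    | (.cross, 0, true) => (.cross, 1, true)
    | (.cross, 0, false) => (.cross, 1, false)
    | (.up, 0, false) => (.cross, 0, false)
    | (.down, 0, false) => (.down, 0, true)
    | (.up, 1, false) => (.up, 0, false)
    | (.down, 1, false) => (.down, 0, false)
    | (.up, 1, true) => (.up, 0, true)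
    | (.cross, 1, true) => (.cross, 0, true)
    | (.down, 1, true) => (.down, 1, false)
    | (.cross, 1, false) => (.up, 1, false)
  invFun
    | (.up, 1, true) => (.up, 0, true)
    | (.down, 1, true) => (.down, 0, true)
    | (.cross, 1, true) => (.cross, 0, true)
    | (.cross, 1, false) => (.cross, 0, false)
    | (.cross, 0, false) => (.up, 0, false)
    | (.down, 0, true) => (.down, 0, false)
    | (.up, 0, false) => (.up, 1, false)
    | (.down, 0, false) => (.down, 1, false)
    | (.up, 0, true) => (.up, 1, true)
    | (.cross, 0, true) => (.cross, 1, true)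
    | (.down, 1, false) => (.down, 1, true)
    | (.up, 1, false) => (.cross, 1, false)
  left_inv := by
    rintro ⟨k, t, s⟩
    fin_cases t <;> cases s <;> cases k <;> rfl
  right_inv := by
    rintro ⟨k, t, s⟩
    fin_cases t <;> cases s <;> cases k <;> rfl

/-- Clockwise rotation at the bridges `(j k), (i j)`, if no bridge below touches the wire `j`. -/
noncomputable def rotDescent (p r : List (Bridge n)) (S : Type) (i j k : Fin n) :
    Kind → Fin 2 × Bool → SpliceDart (Foot p ⊕ Foot r) 2 S
  | .up, (0, false) => .inner .cross (0, false)
  | .up, (0, true) => bottomPort r k (.inner .cross (0, true))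
  | .up, (1, false) => .inner .cross (1, false)
  | .up, (1, true) => .inner .cross (1, true)
  | .cross, (0, false) => .inner .down (1, true)
  | .cross, (0, true) => .inner .up (0, true)
  | .cross, (1, false) => bottomPort r i (.inner .up (1, false))
  | .cross, (1, true) => .inner .up (1, true)
  | .down, (0, false) => topPort p j (.inner .down (0, false))
  | .down, (0, true) => topPort p k (.inner .down (0, true))
  | .down, (1, false) => topPort p i (.inner .down (1, false))
  | .down, (1, true) => .inner .up (0, false)

theorem spliceRot_descent {p r : List (Bridge n)} {S : Type} {i j k : Fin n} (hij : i < j)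
    (hjk : j < k) (hj : first r j = none) (d : Kind) (u : Fin 2 × Bool) :
    spliceRot p r (twoTangle ⟨j, k, hjk⟩ ⟨i, j, hij⟩) (.inner d u) =
      rotDescent p r S i j k d u := by
  have hport : ∀ x : SpliceDart (Foot p ⊕ Foot r) 2 S, bottomPort r j x = x :=
    fun x => by rw [bottomPort, hj]
  obtain ⟨t, s⟩ := u
  fin_cases t <;> cases s <;> cases d <;>
    simp [spliceRot_up, spliceRot_down, spliceRot_cross, twoTangle, turn, hport, rotDescent,
      hij.ne, hij.ne', hjk.ne, (hij.trans hjk).ne, (hij.trans hjk).ne']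

/-- Clockwise rotation at the bridges `(i j), (i k)`, if no bridge below touches the wire `j`. -/
noncomputable def rotForkLeft (p r : List (Bridge n)) (S : Type) (i j k : Fin n) :
    Kind → Fin 2 × Bool → SpliceDart (Foot p ⊕ Foot r) 2 S
  | .up, (0, false) => .inner .cross (0, false)
  | .up, (0, true) => .inner .cross (0, true)
  | .up, (1, false) => .inner .cross (1, false)
  | .up, (1, true) => bottomPort r k (.inner .cross (1, true))
  | .cross, (0, false) => .inner .down (1, false)
  | .cross, (0, true) => .inner .up (0, true)
  | .cross, (1, false) => bottomPort r i (.inner .up (1, false))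
  | .cross, (1, true) => .inner .up (1, true)
  | .down, (0, false) => topPort p i (.inner .down (0, false))
  | .down, (0, true) => topPort p j (.inner .down (0, true))
  | .down, (1, false) => .inner .up (0, false)
  | .down, (1, true) => topPort p k (.inner .down (1, true))

theorem spliceRot_forkLeft {p r : List (Bridge n)} {S : Type} {i j k : Fin n} (hij : i < j)
    (hjk : j < k) (hj : first r j = none) (d : Kind) (u : Fin 2 × Bool) :
    spliceRot p r (twoTangle ⟨i, j, hij⟩ ⟨i, k, hij.trans hjk⟩) (.inner d u) =
      rotForkLeft p r S i j k d u := by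
  have hport : ∀ x : SpliceDart (Foot p ⊕ Foot r) 2 S, bottomPort r j x = x :=
    fun x => by rw [bottomPort, hj]
  obtain ⟨t, s⟩ := u
  fin_cases t <;> cases s <;> cases d <;>
    simp [spliceRot_up, spliceRot_down, spliceRot_cross, twoTangle, turn, hport, rotForkLeft,
      hij.ne, hjk.ne, hjk.ne', (hij.trans hjk).ne]

/-- The mirror image of `equivM2M3_cascade_forkRight`: here the foot of degree two is black and the
contracted edge is white. -/
theorem equivM2M3_descent_forkLeft (J : Finset (Fin n)) (p r : List (Bridge n)) {i j k : Fin n}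
    (hij : i < j) (hjk : j < k) (hj : ∀ v, wire r v ≠ j) :
    EquivM2M3 (bridgeGraph J (p ++ [⟨j, k, hjk⟩, ⟨i, j, hij⟩] ++ r))
      (bridgeGraph J (p ++ [⟨i, j, hij⟩, ⟨i, k, hij.trans hjk⟩] ++ r)) := by
  have e1 := hij.ne
  have e2 := hij.ne'
  have e3 := hjk.ne
  have e4 := hjk.ne'
  have e5 := (hij.trans hjk).ne
  have e6 := (hij.trans hjk).ne'
  have hrj : first r j = none := first_eq_none.2 hj
  obtain ⟨ΘA, hA⟩ : ∃ Θ : Tangle n 2, Θ = twoTangle ⟨j, k, hjk⟩ ⟨i, j, hij⟩ := ⟨_, rfl⟩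
  obtain ⟨ΘB, hB⟩ : ∃ Θ : Tangle n 2, Θ = twoTangle ⟨i, j, hij⟩ ⟨i, k, hij.trans hjk⟩ := ⟨_, rfl⟩
  have hdA : ΘA.Describes [⟨j, k, hjk⟩, ⟨i, j, hij⟩] := hA ▸ twoTangle_describes _ _
  have hdB : ΘB.Describes [⟨i, j, hij⟩, ⟨i, k, hij.trans hjk⟩] := hB ▸ twoTangle_describes _ _
  obtain ⟨T, hT⟩ : ∃ T : Fin n → Prop, ∀ a, T a ↔ ΘA.first a ≠ none := ⟨_, fun _ => Iff.rfl⟩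
  have hT' : ∀ a, T a ↔ ΘB.first a ≠ none := by
    intro a
    rw [hT, hA, hB]
    simp only [twoTangle]
    split_ifs <;> simp_all
  have rA : ∀ d u, spliceRot p r ΘA (.inner d u) = rotDescent p r (Untouched p r T) i j k d u :=
    fun d u => by rw [hA, spliceRot_descent hij hjk hrj]
  have rB : ∀ d u, spliceRot p r ΘB (.inner d u) = rotForkLeft p r (Untouched p r T) i j k d u :=
    fun d u => by rw [hB, spliceRot_forkLeft hij hjk hrj]
  have hfirst : ∀ a, Option.Rel (fun u u' => forkLeftRename (.down, u) = (.down, u') ∧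
      u ≠ (1, true)) (ΘA.first a) (ΘB.first a) := by
    intro a
    simp only [hA, hB, twoTangle]
    split_ifs <;> first
      | exact .none
      | exact .some ⟨rfl, by decide⟩
      | (exfalso; simp_all)
  have hlast : ∀ v, (ΘA.last (wire r v) = some (0, true) ∧ ΘB.last (wire r v) = some (1, true)) ∨
      (ΘA.last (wire r v) = some (1, false) ∧ ΘB.last (wire r v) = some (1, false)) ∨
      (ΘA.last (wire r v) = none ∧ ΘB.last (wire r v) = none) := by
    intro v
    have := hj v
    simp only [hA, hB, twoTangle]
    split_ifs <;> simp_all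
  have cA : ∀ u, spliceColor p r ΘA (leafColor J)
      (.inner .down u : SpliceDart _ _ (Untouched p r T)) =
      if u = (1, true) then some .white else topColor p (ΘA.wire u) := by
    rintro ⟨t, s⟩
    rw [spliceColor_down, hA]
    fin_cases t <;> cases s <;> simp [twoTangle, e2, e6]
  have cB : ∀ u, spliceColor p r ΘB (leafColor J)
      (.inner .down u : SpliceDart _ _ (Untouched p r T)) =
      if u = (1, false) then some .white else topColor p (ΘB.wire u) := by
    rintro ⟨t, s⟩
    rw [spliceColor_down, hB]
    fin_cases t <;> cases s <;> simp [twoTangle, e3, e5]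
  refine Presentation.equivM2M3_of_removeMiddle_contract (splicePresentation hdA hT J)
    (splicePresentation hdB hT' J) (renameInner _ _ forkLeftRename)
    (m := .inner .up (1, true)) (m₂ := .inner .cross (1, true))
    (c := .inner .down (1, true)) (c₂ := .inner .cross (1, false))
    ?_ ?_ ?_ ?_ ?_ ?_ ?_ ?_ ?_
    (bdry_rename _ _ _ _ _ (fun a u hu => ?_) J) ?_
  · simp [Presentation.Middle, splicePresentation, rA, rotDescent, spliceColor_up]
  · simp [Presentation.Middle, splicePresentation, rB, rotForkLeft, spliceColor_up,
      renameInner_inner, forkLeftRename]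
  · simp
  · simp [glueEdge, splicePresentation, spliceEdge, footEdge, SpliceFoot.dart, SpliceFoot.opp]
  · simp [glueEdge, splicePresentation, spliceEdge, footEdge, SpliceFoot.dart,
      renameInner_inner, forkLeftRename]
  · simp [Presentation.Joinable, splicePresentation, rA, rotDescent, cA, spliceColor_cross]
  · simp [Presentation.Joinable, splicePresentation, rB, rotForkLeft, cB, spliceColor_up,
      renameInner_inner, forkLeftRename]
  · rintro (⟨d, v | v⟩ | ⟨d, t, s⟩ | a | a) h1 h2 h3 h4
    · cases d <;> simp [glueEdge, splicePresentation, spliceEdge, footEdge, SpliceFoot.dart,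
        SpliceFoot.opp, renameInner]
    · cases d <;> simp [glueEdge, splicePresentation, spliceEdge, footEdge, SpliceFoot.dart,
        SpliceFoot.opp, renameInner]
    · revert h1 h2 h3 h4
      fin_cases t <;> cases s <;> cases d <;>
        simp [glueEdge, splicePresentation, spliceEdge, footEdge, SpliceFoot.dart,
          SpliceFoot.opp, renameInner_inner, forkLeftRename]
    · simp [glueEdge, splicePresentation, spliceEdge, renameInner]
    · simp [glueEdge, splicePresentation, spliceEdge, renameInner]
  · rintro (⟨d, v⟩ | ⟨d, t, s⟩ | a | a) h1 h2 h3 h4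
    · refine rename_rot_outer (f := joinStep _ _ _ _) (g := joinStep _ _ _ _) forkLeftRename
        (fun _ _ => joinStep_outer _ _) (fun _ _ => joinStep_outer _ _) (fun a => ?_) (fun v => ?_)
        d v
      · refine rel_imp (fun u u' h => ?_) (hfirst a)
        obtain ⟨t, s⟩ := u
        obtain ⟨hx, hy⟩ := h
        fin_cases t <;> cases s <;> cases hx <;> first
          | exact absurd rfl hy
          | simp [joinStep, renameInner_inner, forkLeftRename]
      · simp only [splicePresentation]
        rcases hlast v with ⟨h, h'⟩ | ⟨h, h'⟩ | ⟨h, h'⟩ <;> rw [h, h'] <;> constructor <;>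
          simp [turn, joinStep, renameInner_inner, forkLeftRename, rB,
            rotForkLeft]
    · change renameInner _ _ forkLeftRename (contractRot (spliceRot p r ΘA) _ _ _) =
        contractRot (spliceRot p r ΘB) _ _ _
      revert h1 h2 h3 h4
      simp only [contractRot_eq, renameInner_inner, rA, rB]
      fin_cases t <;> cases s <;> cases d <;>
        simp [rotDescent, rotForkLeft, forkLeftRename, renameInner_topPort,
          renameInner_bottomPort, joinStep_topPort, joinStep_bottomPort] <;>
        simp [joinStep, renameInner_inner, renameInner_bottomPort]
    · simp [contractRot_eq, joinStep, splicePresentation, spliceRot, renameInner]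
    · simp [contractRot_eq, joinStep, splicePresentation, spliceRot, renameInner]
  · obtain ⟨u', h, h', -⟩ := exists_of_rel_some (hu ▸ hfirst a)
    exact ⟨u', h, h'⟩
  · rintro (⟨d, v⟩ | ⟨d, t, s⟩ | a | a) h1 h2 h3 h4
    · have hl : ∀ v : Foot r, Option.Rel (fun u u' => u.2 = u'.2)
          (ΘA.last (wire r v)) (ΘB.last (wire r v)) := by
        intro v
        rcases hlast v with ⟨h, h'⟩ | ⟨h, h'⟩ | ⟨h, h'⟩ <;> rw [h, h'] <;> constructor <;> rfl
      exact (color_outer (leafColor (p := p) (r := r) (T := T) J) fun v _ _ _ => hl v).symm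
    · revert h1 h2 h3 h4
      fin_cases t <;> cases s <;> cases d <;>
        simp [splicePresentation, renameInner_inner, forkLeftRename, spliceColor_up,
          spliceColor_cross, cA, cB] <;> simp [hA, hB, twoTangle]
    · rfl
    · rfl

end BridgePolytope

namespace BridgePolytope

open Equiv PlabicMap

variable {n : ℕ}

/-! ### Hexagons -/

open Classical in
/-- The correction to the rotation at the half-edges that precede `e`, which is moved elsewhere;
`s` takes its place. -/
noncomputable def redirect {X : Type} (e s y : X) : X := if y = e then s else y

open Classical in
theorem slideRot_eq {X : Type} (rot : X → X) (d e x : X) : slideRot rot d e x =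
    if x = d then rot (rot d) else if x = rot (rot d) then rot e else if x = rot e then d
    else if x = rot d then e else if x = e then redirect e (rot d) (rot (rot e))
    else redirect e (rot d) (rot x) := rfl

section Redirect

variable {p r : List (Bridge n)} {m : ℕ} {S : Type} {k : Kind} {u : Fin m × Bool}

theorem redirect_outer {O : Type} {s : SpliceDart O m S} (k₀ : Kind) (v : O) :
    redirect (.inner k u) s (.outer k₀ v) = .outer k₀ v := by
  simp [redirect]

theorem redirect_topPort {R : Type} {s : SpliceDart (Foot p ⊕ R) m S} (a : Fin n)
    (x : SpliceDart (Foot p ⊕ R) m S) :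
    redirect (.inner k u) s (topPort p a x) = topPort p a (redirect (.inner k u) s x) :=
  map_topPort (f := redirect _ _) (fun _ _ => redirect_outer _ _) a x

theorem redirect_bottomPort {P : Type} {s : SpliceDart (P ⊕ Foot r) m S} (a : Fin n)
    (x : SpliceDart (P ⊕ Foot r) m S) :
    redirect (.inner k u) s (bottomPort r a x) = bottomPort r a (redirect (.inner k u) s x) :=
  map_bottomPort (f := redirect _ _) (fun _ _ => redirect_outer _ _) a x

end Redirect

/-- The renaming of half-edges from the bridges `(i j), (j k), (i j)`, after sliding and switching
colors, to the bridges `(j k), (i j), (j k)`. The edge between the feet of the middle bridge, whose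
names are exceptional here, is contracted on both sides. -/
def hexagonRename : Kind × Fin 3 × Bool ≃ Kind × Fin 3 × Bool where
  toFun
    | (.up, 0, false) => (.up, 1, false)
    | (.down, 0, false) => (.down, 1, false)
    | (.cross, 0, false) => (.up, 1, true)
    | (.up, 0, true) => (.up, 0, false)
    | (.down, 0, true) => (.down, 0, false)
    | (.cross, 0, true) => (.down, 1, true)
    | (.up, 1, false) => (.cross, 0, true)
    | (.down, 1, false) => (.cross, 0, false)
    | (.cross, 1, false) => (.down, 2, true)
    | (.up, 1, true) => (.up, 0, true)
    | (.down, 1, true) => (.down, 0, true)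
    | (.cross, 1, true) => (.up, 2, true)
    | (.up, 2, false) => (.cross, 1, false)
    | (.down, 2, false) => (.cross, 1, true)
    | (.cross, 2, false) => (.down, 2, false)
    | (.up, 2, true) => (.cross, 2, false)
    | (.down, 2, true) => (.cross, 2, true)
    | (.cross, 2, true) => (.up, 2, false)
  invFun
    | (.up, 1, false) => (.up, 0, false)
    | (.down, 1, false) => (.down, 0, false)
    | (.up, 1, true) => (.cross, 0, false)
    | (.up, 0, false) => (.up, 0, true)
    | (.down, 0, false) => (.down, 0, true)
    | (.down, 1, true) => (.cross, 0, true)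
    | (.cross, 0, true) => (.up, 1, false)
    | (.cross, 0, false) => (.down, 1, false)
    | (.down, 2, true) => (.cross, 1, false)
    | (.up, 0, true) => (.up, 1, true)
    | (.down, 0, true) => (.down, 1, true)
    | (.up, 2, true) => (.cross, 1, true)
    | (.cross, 1, false) => (.up, 2, false)
    | (.cross, 1, true) => (.down, 2, false)
    | (.down, 2, false) => (.cross, 2, false)
    | (.cross, 2, false) => (.up, 2, true)
    | (.cross, 2, true) => (.down, 2, true)
    | (.up, 2, false) => (.cross, 2, true)
  left_inv := by
    rintro ⟨k, t, s⟩
    fin_cases t <;> cases s <;> cases k <;> rfl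
  right_inv := by
    rintro ⟨k, t, s⟩
    fin_cases t <;> cases s <;> cases k <;> rfl

/-- Clockwise rotation at the bridges `(i j), (j k), (i j)`, if `x` is the next foot on the wire `j`. -/
noncomputable def rotLeftHexagon (p r : List (Bridge n)) (S : Type) (i j k : Fin n) (x : Foot r) :
    Kind → Fin 3 × Bool → SpliceDart (Foot p ⊕ Foot r) 3 S
  | .up, (0, false) => .inner .cross (0, false)
  | .up, (0, true) => .inner .down (1, false)
  | .up, (1, false) => .inner .cross (1, false)
  | .up, (1, true) => bottomPort r k (.inner .cross (1, true))
  | .up, (2, false) => .inner .cross (2, false)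
  | .up, (2, true) => .outer .down (.inr x)
  | .cross, (0, false) => .inner .down (2, false)
  | .cross, (0, true) => .inner .up (0, true)
  | .cross, (1, false) => .inner .down (2, true)
  | .cross, (1, true) => .inner .up (1, true)
  | .cross, (2, false) => bottomPort r i (.inner .up (2, false))
  | .cross, (2, true) => .inner .up (2, true)
  | .down, (0, false) => topPort p i (.inner .down (0, false))
  | .down, (0, true) => topPort p j (.inner .down (0, true))
  | .down, (1, false) => .inner .cross (0, true)
  | .down, (1, true) => topPort p k (.inner .down (1, true))
  | .down, (2, false) => .inner .up (0, false)
  | .down, (2, true) => .inner .up (1, false)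

theorem spliceRot_leftHexagon {p r : List (Bridge n)} {S : Type} {i j k : Fin n} (hij : i < j)
    (hjk : j < k) {x : Foot r} (hx : first r j = some x) (d : Kind) (u : Fin 3 × Bool) :
    spliceRot p r (threeTangle ⟨i, j, hij⟩ ⟨j, k, hjk⟩ ⟨i, j, hij⟩) (.inner d u) =
      rotLeftHexagon p r S i j k x d u := by
  have hport : ∀ y : SpliceDart (Foot p ⊕ Foot r) 3 S, bottomPort r j y = .outer .down (.inr x) :=
    fun y => by rw [bottomPort, hx]
  obtain ⟨t, s⟩ := u
  fin_cases t <;> cases s <;> cases d <;>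
    simp [spliceRot_up, spliceRot_down, spliceRot_cross, threeTangle, turn, hport, rotLeftHexagon,
      hij.ne, hij.ne', hjk.ne, (hij.trans hjk).ne, (hij.trans hjk).ne']

/-- Clockwise rotation at the bridges `(i j), (j k), (i j)` after sliding along the part of the wire
`i` between the first and the last bridge: the left ends of both bridges now meet in a trivalent
vertex, and the wire `i` passes through the other vertex. -/
noncomputable def rotSlidHexagon (p r : List (Bridge n)) (S : Type) (i j k : Fin n) (x : Foot r) :
    Kind → Fin 3 × Bool → SpliceDart (Foot p ⊕ Foot r) 3 S
  | .up, (0, false) => .inner .up (2, false)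
  | .up, (0, true) => .inner .down (1, false)
  | .up, (1, false) => .inner .cross (1, false)
  | .up, (1, true) => bottomPort r k (.inner .cross (1, true))
  | .up, (2, false) => bottomPort r i (.inner .up (0, false))
  | .up, (2, true) => .outer .down (.inr x)
  | .cross, (0, false) => .inner .cross (2, false)
  | .cross, (0, true) => .inner .up (0, true)
  | .cross, (1, false) => .inner .down (2, true)
  | .cross, (1, true) => .inner .up (1, true)
  | .cross, (2, false) => .inner .down (2, false)
  | .cross, (2, true) => .inner .up (2, true)
  | .down, (0, false) => topPort p i (.inner .down (0, false))
  | .down, (0, true) => topPort p j (.inner .down (0, true))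
  | .down, (1, false) => .inner .cross (0, true)
  | .down, (1, true) => topPort p k (.inner .down (1, true))
  | .down, (2, false) => .inner .cross (0, false)
  | .down, (2, true) => .inner .up (1, false)

/-- Clockwise rotation at the bridges `(j k), (i j), (j k)`, if `x` is the next foot on the wire `j`. -/
noncomputable def rotRightHexagon (p r : List (Bridge n)) (S : Type) (i j k : Fin n) (x : Foot r) :
    Kind → Fin 3 × Bool → SpliceDart (Foot p ⊕ Foot r) 3 S
  | .up, (0, false) => .inner .cross (0, false)
  | .up, (0, true) => .inner .down (2, true)
  | .up, (1, false) => .inner .cross (1, false)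
  | .up, (1, true) => .inner .down (2, false)
  | .up, (2, false) => .inner .cross (2, false)
  | .up, (2, true) => bottomPort r k (.inner .cross (2, true))
  | .cross, (0, false) => .inner .down (1, true)
  | .cross, (0, true) => .inner .up (0, true)
  | .cross, (1, false) => bottomPort r i (.inner .up (1, false))
  | .cross, (1, true) => .inner .up (1, true)
  | .cross, (2, false) => .outer .down (.inr x)
  | .cross, (2, true) => .inner .up (2, true)
  | .down, (0, false) => topPort p j (.inner .down (0, false))
  | .down, (0, true) => topPort p k (.inner .down (0, true))
  | .down, (1, false) => topPort p i (.inner .down (1, false))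
  | .down, (1, true) => .inner .up (0, false)
  | .down, (2, false) => .inner .cross (1, true)
  | .down, (2, true) => .inner .cross (0, true)

theorem spliceRot_rightHexagon {p r : List (Bridge n)} {S : Type} {i j k : Fin n} (hij : i < j)
    (hjk : j < k) {x : Foot r} (hx : first r j = some x) (d : Kind) (u : Fin 3 × Bool) :
    spliceRot p r (threeTangle ⟨j, k, hjk⟩ ⟨i, j, hij⟩ ⟨j, k, hjk⟩) (.inner d u) =
      rotRightHexagon p r S i j k x d u := by
  have hport : ∀ y : SpliceDart (Foot p ⊕ Foot r) 3 S, bottomPort r j y = .outer .down (.inr x) :=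
    fun y => by rw [bottomPort, hx]
  obtain ⟨t, s⟩ := u
  fin_cases t <;> cases s <;> cases d <;>
    simp [spliceRot_up, spliceRot_down, spliceRot_cross, threeTangle, turn, hport, rotRightHexagon,
      hij.ne, hij.ne', hjk.ne, (hij.trans hjk).ne, (hij.trans hjk).ne']

/-- The half-edges at the corners of the square that the bridges `(i j), (j k), (i j)` form after
sliding; `x` is the next foot on the wire `j`. -/
def HexagonSquare {p r : List (Bridge n)} {S : Type} (x : Foot r)
    (y : SpliceDart (Foot p ⊕ Foot r) 3 S) : Prop :=
  (y = .inner .cross (2, false) ∨ y = .inner .down (2, false) ∨ y = .inner .cross (0, false)) ∨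
  (y = .inner .up (2, true) ∨ y = .outer .down (.inr x) ∨ y = .inner .cross (2, true)) ∨
  (y = .inner .up (1, false) ∨ y = .inner .cross (1, false) ∨ y = .inner .down (2, true)) ∨
  (y = .inner .cross (0, true) ∨ y = .inner .up (0, true) ∨ y = .inner .down (1, false))

open Classical in
/-- The bridges `(i j), (j k), (i j)` bound a face with five corners, two of which are white and
adjacent on the wire `i`. Sliding along the edge between these two leaves one of them at the face,
which is then a square with trivalent corners: the lowest corner on the wire `j` is trivalent since
`x` lies below it. -/
theorem exists_squareMove_hexagon (J : Finset (Fin n)) (p r : List (Bridge n)) {i j k : Fin n}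
    (hij : i < j) (hjk : j < k) {x : Foot r} (hx : first r j = some x) {ΘA : Tangle n 3}
    (hA : ΘA = threeTangle ⟨i, j, hij⟩ ⟨j, k, hjk⟩ ⟨i, j, hij⟩)
    (hdA : ΘA.Describes [⟨i, j, hij⟩, ⟨j, k, hjk⟩, ⟨i, j, hij⟩])
    {T : Fin n → Prop} (hT : ∀ a, T a ↔ ΘA.first a ≠ none) :
    ∃ (G H : PlabicMap n) (P : H.Presentation (SpliceDart (Foot p ⊕ Foot r) 3 (Untouched p r T))),
      EquivM2M3 (bridgeGraph J (p ++ [⟨i, j, hij⟩, ⟨j, k, hjk⟩, ⟨i, j, hij⟩] ++ r)) G ∧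
      SquareMove G H ∧
      (∀ a y, (bridgeGraph J (p ++ [⟨i, j, hij⟩, ⟨j, k, hjk⟩, ⟨i, j, hij⟩] ++ r)).bdry a =
        (splicePresentation hdA hT J).toDart y → H.bdry a = P.toDart y) ∧
      (∀ y, P.edge y = spliceEdge p r y) ∧
      (∀ d u, P.rot (.inner d u) = rotSlidHexagon p r (Untouched p r T) i j k x d u) ∧
      (∀ d v, P.rot (.outer d v) = redirect (.inner .up (2, false)) (.inner .up (0, false))
        (spliceRot p r ΘA (.outer d v))) ∧
      (∀ a, P.rot (.stub a) = .stub a) ∧ (∀ a, P.rot (.leaf a) = .leaf a) ∧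
      (∀ y, P.color y = if HexagonSquare x y
        then (spliceColor p r ΘA (leafColor J) y).map Color.flip
        else spliceColor p r ΘA (leafColor J) y) := by
  have e1 := hij.ne
  have e2 := hij.ne'
  have e3 := hjk.ne
  have e4 := hjk.ne'
  have e5 := (hij.trans hjk).ne
  have e6 := (hij.trans hjk).ne'
  obtain ⟨hxw, hxa⟩ := first_eq_some.1 hx
  have rA : ∀ d u, spliceRot p r ΘA (.inner d u) =
      rotLeftHexagon p r (Untouched p r T) i j k x d u :=
    fun d u => by rw [hA, spliceRot_leftHexagon hij hjk hx]
  have rx : spliceRot p r ΘA (.outer .down (.inr x)) =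
      (.inner .cross (2, true) : SpliceDart _ _ (Untouched p r T)) := by
    simp [spliceRot, footRot, spliceAbove, hxa, hxw, hA, threeTangle, SpliceFoot.side,
      SpliceFoot.dart, e1]
  have cA : ∀ u, spliceColor p r ΘA (leafColor J)
      (.inner .down u : SpliceDart _ _ (Untouched p r T)) =
      if u = (1, false) then some .black else if u.1 = 2 then some .white
        else topColor p (ΘA.wire u) := by
    rintro ⟨t, s⟩
    rw [spliceColor_down, hA]
    fin_cases t <;> cases s <;> simp [threeTangle, e1, e2, e3, e5, e6]
  have cx : spliceColor p r ΘA (leafColor J)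
      (.outer .down (.inr x) : SpliceDart _ _ (Untouched p r T)) = some .black := by
    simp [spliceColor, footColor, spliceAbove, hxa, hxw, hA, threeTangle, SpliceFoot.side, e1]
  have hP : (splicePresentation (p := p) (r := r) hdA hT J).Joinable (.inner .down (2, false))
      (.inner .up (2, false)) := by
    simp [Presentation.Joinable, splicePresentation, rA, rotLeftHexagon, cA, spliceColor_up]
  have hc : (splicePresentation (p := p) (r := r) hdA hT J).edge (.inner .down (2, false)) =
    .inner .up (2, false) := rfl
  have r₀ : ∀ y, ((splicePresentation (p := p) (r := r) hdA hT J).slide hP hc).rot y =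
    slideRot (spliceRot p r ΘA) (.inner .down (2, false)) (.inner .up (2, false)) y := fun _ => rfl
  have r₁ : ∀ d u, ((splicePresentation (p := p) (r := r) hdA hT J).slide hP hc).rot (.inner d u) =
      rotSlidHexagon p r (Untouched p r T) i j k x d u := by
    rintro d ⟨t, s⟩
    rw [r₀, slideRot_eq]
    fin_cases t <;> cases s <;> cases d <;>
      simp [rA, rotLeftHexagon, rotSlidHexagon, redirect_topPort, redirect_bottomPort,
        redirect_outer] <;> simp [redirect]
  have r₁' : ∀ d v, ((splicePresentation (p := p) (r := r) hdA hT J).slide hP hc).rot (.outer d v) =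
      redirect (.inner .up (2, false)) (.inner .up (0, false))
        (spliceRot p r ΘA (.outer d v)) := by
    intro d v
    rw [r₀, slideRot_eq]
    simp [rA, rotLeftHexagon]
  -- the corners, in cyclic order: the left and the right foot of the last bridge, then the left foot
  -- of the middle bridge and the right foot of the first one
  have hsq : ((splicePresentation (p := p) (r := r) hdA hT J).slide hP hc).IsSquare
      (.inner .cross (2, false)) (.inner .up (2, true)) (.inner .up (1, false))
      (.inner .cross (0, true)) .white := by
    have he : ∀ d u, ((splicePresentation (p := p) (r := r) hdA hT J).slide hP hc).edge (.inner d u)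
      = footEdge p r d (.inr u) := fun _ _ => rfl
    have hcol : ∀ y, ((splicePresentation (p := p) (r := r) hdA hT J).slide hP hc).color y =
      spliceColor p r ΘA (leafColor J) y := fun _ => rfl
    constructor <;>
      simp [he, hcol, footEdge, SpliceFoot.dart, SpliceFoot.opp, r₁, r₁', rx, redirect,
        rotSlidHexagon, spliceColor_up, spliceColor_cross, Color.flip]
  have hS : ∀ y, ((splicePresentation (p := p) (r := r) hdA hT J).slide hP hc).AtSquare
      (.inner .cross (2, false)) (.inner .up (2, true)) (.inner .up (1, false))
      (.inner .cross (0, true)) y ↔ HexagonSquare x y := by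
    intro y
    simp [Presentation.AtSquare, HexagonSquare, r₁, r₁', rx, redirect, rotSlidHexagon]
  refine ⟨_, _, ((splicePresentation hdA hT J).slide hP hc).switchColors (HexagonSquare x)
    (fun y => (hS y).symm.trans (hsq.atSquare_iff y)), equivM2M3_slide _, hsq.squareMove,
    fun _ _ h => h, fun _ => rfl, r₁, r₁', fun a => ?_, fun a => ?_, fun _ => rfl⟩
  · have h : spliceRot p r ΘA (.stub a : SpliceDart _ _ (Untouched p r T)) = .stub a := rfl
    exact (r₀ _).trans (by simp [slideRot_eq, redirect, rA, rotLeftHexagon, h])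
  · have h : spliceRot p r ΘA (.leaf a : SpliceDart _ _ (Untouched p r T)) = .leaf a := rfl
    exact (r₀ _).trans (by simp [slideRot_eq, redirect, rA, rotLeftHexagon, h])

/-- After sliding and the square move at the face that the bridges `(i j), (j k), (i j)` bound, both
feet of the middle bridge are black; contracting the edge between them gives the graph that arises
from the other sequence by contracting the edge between its two black feet on the wire `k`. -/
theorem equivWithOneM1_hexagon (J : Finset (Fin n)) (p r : List (Bridge n)) {i j k : Fin n}
    (hij : i < j) (hjk : j < k) (hj : ∃ v, wire r v = j) :
    EquivWithOneM1 (bridgeGraph J (p ++ [⟨i, j, hij⟩, ⟨j, k, hjk⟩, ⟨i, j, hij⟩] ++ r))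
      (bridgeGraph J (p ++ [⟨j, k, hjk⟩, ⟨i, j, hij⟩, ⟨j, k, hjk⟩] ++ r)) := by
  have e1 := hij.ne
  have e2 := hij.ne'
  have e3 := hjk.ne
  have e4 := hjk.ne'
  have e5 := (hij.trans hjk).ne
  have e6 := (hij.trans hjk).ne'
  obtain ⟨x, hx⟩ : ∃ x, first r j = some x := by
    obtain ⟨v, hv⟩ := hj
    rcases h : first r j with _ | x
    · exact absurd hv (first_eq_none.1 h v)
    · exact ⟨x, rfl⟩
  obtain ⟨hxw, hxa⟩ := first_eq_some.1 hx
  obtain ⟨ΘA, hA⟩ : ∃ Θ : Tangle n 3, Θ = threeTangle ⟨i, j, hij⟩ ⟨j, k, hjk⟩ ⟨i, j, hij⟩ := ⟨_, rfl⟩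
  obtain ⟨ΘB, hB⟩ : ∃ Θ : Tangle n 3, Θ = threeTangle ⟨j, k, hjk⟩ ⟨i, j, hij⟩ ⟨j, k, hjk⟩ := ⟨_, rfl⟩
  have hdA : ΘA.Describes [⟨i, j, hij⟩, ⟨j, k, hjk⟩, ⟨i, j, hij⟩] :=
    hA ▸ threeTangle_describes _ _ _
  have hdB : ΘB.Describes [⟨j, k, hjk⟩, ⟨i, j, hij⟩, ⟨j, k, hjk⟩] :=
    hB ▸ threeTangle_describes _ _ _
  obtain ⟨T, hT⟩ : ∃ T : Fin n → Prop, ∀ a, T a ↔ ΘA.first a ≠ none := ⟨_, fun _ => Iff.rfl⟩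
  have hT' : ∀ a, T a ↔ ΘB.first a ≠ none := by
    intro a
    rw [hT, hA, hB]
    simp only [threeTangle]
    split_ifs <;> simp_all
  have rB : ∀ d u, spliceRot p r ΘB (.inner d u) =
      rotRightHexagon p r (Untouched p r T) i j k x d u :=
    fun d u => by rw [hB, spliceRot_rightHexagon hij hjk hx]
  have hfirst : ∀ a, Option.Rel (fun u u' => hexagonRename (.down, u) = (.down, u') ∧
      u.1 ≠ 2) (ΘA.first a) (ΘB.first a) := by
    intro a
    simp only [hA, hB, threeTangle]
    split_ifs <;> first
      | exact .none
      | exact .some ⟨rfl, by decide⟩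
      | (exfalso; simp_all)
  have hlast : ∀ v, (ΘA.last (wire r v) = some (2, false) ∧ ΘB.last (wire r v) = some (1, false)) ∨
      (ΘA.last (wire r v) = some (2, true) ∧ ΘB.last (wire r v) = some (2, false) ∧
        wire r v = j) ∨
      (ΘA.last (wire r v) = some (1, true) ∧ ΘB.last (wire r v) = some (2, true)) ∨
      (ΘA.last (wire r v) = none ∧ ΘB.last (wire r v) = none) := by
    intro v
    simp only [hA, hB, threeTangle]
    split_ifs <;> simp_all
  have cA : ∀ u, spliceColor p r ΘA (leafColor J)
      (.inner .down u : SpliceDart _ _ (Untouched p r T)) =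
      if u = (1, false) then some .black else if u.1 = 2 then some .white
        else topColor p (ΘA.wire u) := by
    rintro ⟨t, s⟩
    rw [spliceColor_down, hA]
    fin_cases t <;> cases s <;> simp [threeTangle, e1, e2, e3, e5, e6]
  have cB : ∀ u, spliceColor p r ΘB (leafColor J)
      (.inner .down u : SpliceDart _ _ (Untouched p r T)) =
      if u = (1, true) then some .white else if u.1 = 2 then some .black
        else topColor p (ΘB.wire u) := by
    rintro ⟨t, s⟩
    rw [spliceColor_down, hB]
    fin_cases t <;> cases s <;> simp [threeTangle, e1, e2, e3, e5, e6]
  have cx : spliceColor p r ΘA (leafColor J)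
      (.outer .down (.inr x) : SpliceDart _ _ (Untouched p r T)) = some .black := by
    simp [spliceColor, footColor, spliceAbove, hxa, hxw, hA, threeTangle, SpliceFoot.side, e1]
  have cx' : spliceColor p r ΘB (leafColor J)
      (.outer .down (.inr x) : SpliceDart _ _ (Untouched p r T)) = some .white := by
    simp [spliceColor, footColor, spliceAbove, hxa, hxw, hB, threeTangle, SpliceFoot.side]
  obtain ⟨G, H, P, hG, hGH, hbdry, hedge, r₁, r₁', hstub, hleaf, hcol⟩ :=
    exists_squareMove_hexagon J p r hij hjk hx hA hdA hT
  -- in the first graph the square move has made the left foot of the middle bridge black, so that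
  -- the bridge itself is contracted
  refine ⟨G, H, hG, hGH, Presentation.equivM2M3_of_contract P
    (splicePresentation hdB hT' J) (renameInner _ _ hexagonRename)
    (c := .inner .cross (1, false)) (c₂ := .inner .cross (1, true)) ?_ rfl ?_ ?_ ?_ ?_
    (fun a => ?_) ?_⟩
  · rw [hedge]
    rfl
  · simp [Presentation.Joinable, hcol, HexagonSquare, r₁, rotSlidHexagon, spliceColor_cross,
      Color.flip]
  · simp [Presentation.Joinable, splicePresentation, rB, rotRightHexagon, cB, spliceColor_up,
      renameInner_inner, hexagonRename]
  · rintro (⟨d, v | v⟩ | ⟨d, t, s⟩ | a | a) h1 h2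
    · rw [hedge]
      cases d <;> rfl
    · rw [hedge]
      cases d <;> rfl
    · rw [hedge]
      revert h1 h2
      fin_cases t <;> cases s <;> cases d <;> intro h1 h2 <;> rfl
    · rw [hedge]
      rfl
    · rw [hedge]
      rfl
  · rintro (⟨d, v⟩ | ⟨d, t, s⟩ | a | a) h1 h2
    · rw [contractRot_eq, contractRot_eq]
      simp only [r₁']
      refine rename_rot_outer (f := fun y => joinStep _ _ _ _ (redirect _ _ y))
        (g := joinStep _ _ _ _) hexagonRename
        (fun _ _ => by rw [redirect_outer, joinStep_outer])
        (fun _ _ => joinStep_outer _ _) (fun a => ?_) (fun v => ?_) d v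
      · refine rel_imp (fun u u' h => ?_) (hfirst a)
        obtain ⟨t, s⟩ := u
        obtain ⟨hx, hy⟩ := h
        fin_cases t <;> cases s <;> cases hx <;> first
          | exact absurd rfl hy
          | simp [joinStep, redirect, renameInner_inner, hexagonRename]
      · simp only [splicePresentation, r₁, rB, renameInner_inner, rotSlidHexagon]
        rcases hlast v with ⟨h, h'⟩ | ⟨h, h', -⟩ | ⟨h, h'⟩ | ⟨h, h'⟩ <;> rw [h, h'] <;>
          constructor <;>
          simp [turn, joinStep, redirect, renameInner_inner, hexagonRename]
    · change renameInner _ _ hexagonRename (contractRot _ _ _ _) =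
        contractRot (spliceRot p r ΘB) _ _ _
      revert h1 h2
      simp only [contractRot_eq, renameInner_inner, r₁, rB]
      fin_cases t <;> cases s <;> cases d <;>
        simp [rotSlidHexagon, rotRightHexagon, hexagonRename,
          renameInner_topPort, renameInner_bottomPort, joinStep_topPort, joinStep_bottomPort,
          joinStep_outer]
      all_goals try simp [joinStep, renameInner_inner]
      all_goals rfl
    · simp [contractRot_eq, joinStep, splicePresentation, spliceRot, renameInner, hstub]
    · simp [contractRot_eq, joinStep, splicePresentation, spliceRot, renameInner, hleaf]
  · obtain ⟨y, h, h'⟩ := bdry_rename hdA hT hdB hT' hexagonRename (fun a u hu => by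
      obtain ⟨u', h, h', -⟩ := exists_of_rel_some (hu ▸ hfirst a)
      exact ⟨u', h, h'⟩) J a
    exact ⟨y, hbdry a y h, h'⟩
  · rintro (⟨d, v⟩ | ⟨d, t, s⟩ | a | a) h1 h2
    · change spliceColor p r ΘB (leafColor (p := p) (r := r) (T := T) J) (.outer d v) = _
      by_cases hv : d = .down ∧ v = .inr x
      · obtain ⟨rfl, rfl⟩ := hv
        simp [hcol, HexagonSquare, cx, cx', Color.flip]
      · rw [hcol, if_neg (by simpa [HexagonSquare] using hv)]
        refine (color_outer (leafColor (p := p) (r := r) (T := T) J) fun v' hd hv' ha => ?_).symm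
        rcases hlast v' with ⟨h, h'⟩ | ⟨h, h', hw⟩ | ⟨h, h'⟩ | ⟨h, h'⟩
        · rw [h, h']
          exact .some rfl
        · refine absurd ⟨hd, hv'.trans (congrArg _ ?_)⟩ hv
          exact Option.some.inj ((first_eq_some.2 ⟨hw, ha⟩).symm.trans hx)
        · rw [h, h']
          exact .some rfl
        · rw [h, h']
          exact .none
    · revert h1 h2
      fin_cases t <;> cases s <;> cases d <;>
        simp [splicePresentation, renameInner_inner, hexagonRename, spliceColor_up,
          spliceColor_cross, cA, cB, hcol, HexagonSquare, Color.flip]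
      all_goals simp [hA, hB, threeTangle]
    · rw [hcol, if_neg (by simp [HexagonSquare])]
      rfl
    · rw [hcol, if_neg (by simp [HexagonSquare])]
      rfl

end BridgePolytope

namespace BridgePolytope

open Equiv PlabicMap

variable {n : ℕ}

/-! ### The move at a face -/

/-- The labels around a face determine the move. The middle wire ends at the face of a trapezoid,
as the value there is a fixed point at the top vertex, and continues below a hexagon, as it is not. -/
theorem moves_of_faceLabels {J : Finset (Fin n)} {F : Set (Fin n → ℝ)} {v : Perm (Fin n)}
    {m m' w₂ : List (Bridge n)} {M : Set (Perm (Fin n))} (hw : UpPath J M v 1 w₂)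
    (h : FaceLabels F v m m') (w₁ : List (Bridge n)) :
    (IsRectangle F ∧ Homotopic (bridgeGraph J (w₁ ++ m ++ w₂)) (bridgeGraph J (w₁ ++ m' ++ w₂))) ∨
    (IsTrapezoid F ∧ EquivM2M3 (bridgeGraph J (w₁ ++ m ++ w₂)) (bridgeGraph J (w₁ ++ m' ++ w₂))) ∨
    (IsHexagon F ∧
      EquivWithOneM1 (bridgeGraph J (w₁ ++ m ++ w₂)) (bridgeGraph J (w₁ ++ m' ++ w₂))) := by
  rcases h with ⟨hF, b, b', h1, h2, h3, h4, rfl, rfl⟩ | ⟨hF, i, j, k, hij, hjk, hj, h⟩ |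
    ⟨hF, i, j, k, hij, hjk, ⟨q, hq, hqj⟩, rfl, rfl⟩
  · exact .inl ⟨hF, homotopic_of_disjoint J w₁ w₂ h1 h2 h3 h4⟩
  · have hj' : ∀ v, wire w₂ v ≠ j := by
      rintro ⟨t, s⟩ h
      have := hw.fixed hj _ (List.get_mem w₂ t)
      cases s
      · exact this.1 h.symm
      · exact this.2 h.symm
    refine .inr (.inl ⟨hF, ?_⟩)
    rcases h with ⟨rfl, rfl⟩ | ⟨rfl, rfl⟩
    · exact equivM2M3_cascade_forkRight J w₁ w₂ hij hjk hj'
    · exact (equivM2M3_descent_forkLeft J w₁ w₂ hij hjk hj').symm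
  · refine .inr (.inr ⟨hF, equivWithOneM1_hexagon J w₁ w₂ hij hjk ?_⟩)
    obtain ⟨b, hb, h⟩ := hw.exists_label (q := q) (by rw [hq]; exact hqj)
    obtain ⟨t, ht, rfl⟩ := List.getElem_of_mem hb
    rw [hq] at h
    rcases h with h | h
    · exact ⟨(⟨t, ht⟩, false), h.symm⟩
    · exact ⟨(⟨t, ht⟩, true), h.symm⟩

end BridgePolytope

open BridgePolytope in
theorem theorem5p2 {n : ℕ} (J : Finset (Fin n))
    (p p' : (skeleton J).Walk (schubertPerm J) (1 : Equiv.Perm (Fin n)))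
    (hp : p.length = (skeleton J).dist (schubertPerm J) 1)
    (F : Set (Fin n → ℝ)) (hF : IsTwoFace J F) (hpp' : IsReroute J F p p') :
    (pathGraph p).IsPlanar ∧ (pathGraph p').IsPlanar ∧
      ((IsRectangle F ∧ (pathGraph p).Homotopic (pathGraph p')) ∨
        (IsTrapezoid F ∧ (pathGraph p).EquivM2M3 (pathGraph p')) ∨
        (IsHexagon F ∧ (pathGraph p).EquivWithOneM1 (pathGraph p'))) := by
  obtain ⟨hw, hw', w₁, m, m', w₂, v, e, e', ⟨M, hM⟩, h⟩ := reroute_labels p p' hp F hF hpp'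
  have hn : 0 < n := by
    rcases n with _ | n
    · have : F.Subsingleton := fun x _ y _ => Subsingleton.elim x y
      have h2 := hF.2
      rw [vectorSpan_of_subsingleton ℝ this, finrank_bot] at h2
      omega
    · omega
  have hG : pathGraph p = bridgeGraph J (w₁ ++ m ++ w₂) := congrArg (bridgeGraph J) e
  have hG' : pathGraph p' = bridgeGraph J (w₁ ++ m' ++ w₂) := congrArg (bridgeGraph J) e'
  refine ⟨isPlanar_bridgeGraph J hw hn, isPlanar_bridgeGraph J hw' hn, ?_⟩
  rw [hG, hG']
  rcases h with h | h
  · exact moves_of_faceLabels hM h w₁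
  · rcases moves_of_faceLabels hM h w₁ with ⟨h1, h2⟩ | ⟨h1, h2⟩ | ⟨h1, h2⟩
    · exact .inl ⟨h1, h2.symm⟩
    · exact .inr (.inl ⟨h1, h2.symm⟩)
    · exact .inr (.inr ⟨h1, h2.symm⟩)
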